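/- **Setting.** Let $k$ be a field. All categories and functors are $k$-linear. Let $\mathcal C$ be a locally presentable $k$-linear monoidal category whose tensor product preserves colimits in each variable. An object $x$ is *compact projective* if $\mathrm{Hom}(x,-):\mathcal C\to\mathrm{Vect}$ preserves colimits. Assume that $\mathcal C$ is *cp-rigid*, i.e. the compact projective objects form a strong generator and each of them has a left and a right dual, and that the unit $\mathbf 1$ is compact projective. Let $\mathcal L$ be a commutative algebra in the Drinfeld center of $\mathcal C$, with central structure $\tau_x:x\otimes\mathcal L\cong\mathcal L\otimes x$. Let $\mathrm{HC}=\mathrm{LMod}_{\mathcal L}(\mathcal C)$ with the monoidal structure $\otimes_{\mathcal L}$, where a left module $M$ is viewed as a bimodule through the right action $M\otimes\mathcal L\xrightarrow{\tau_M}\mathcal L\otimes M\to M$. **Definitions.** For $\mathcal E=\mathcal C$ or $\mathrm{HC}$, let $\mathcal E\otimes\mathcal E$ be the tensor product of locally presentable $k$-linear categories, and let $\mathcal E^{\otimes\mathrm{op}}$ be $\mathcal E$ with the opposite tensor product. Let $\mathrm{ev}:\mathrm{HC}\otimes\mathrm{HC}\to\mathrm{Vect}$ be the colimit-preserving functor $\mathrm{ev}(M,N)=\mathrm{Hom}_{\mathrm{HC}}(\mathcal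 L,M\otimes_{\mathcal L}N)$. The *Takeuchi product* is the monoidal structure on $\mathrm{HC}\otimes\mathrm{HC}$ given by $$(M_1\boxtimes M_2)\times_{\mathcal L}(N_1\boxtimes N_2)=\mathrm{ev}(M_2,N_1)\otimes(M_1\boxtimes N_2);$$ it acts on $\mathrm{HC}$ by $(M_1\boxtimes M_2)\times_{\mathcal L}N=\mathrm{ev}(M_2,N)\otimes M_1$. Its unit is $\mathcal D=T_{\mathrm{HC}}^{R}(\mathcal L)$, where $T^{R}_{\mathrm{HC}}$ and $T^{R}_{\mathcal C}$ are right adjoint to the tensor product functors $T_{\mathrm{HC}}:\mathrm{HC}\otimes\mathrm{HC}\to\mathrm{HC}$ and $T_{\mathcal C}:\mathcal C\otimes\mathcal C\to\mathcal C$; the object of $\mathcal C\otimes\mathcal C$ underlying $\mathcal D$ is $T_{\mathcal C}^{R}(\mathcal L)$. Both $\mathrm{ev}$ and the unit are lax monoidal with respect to $\mathrm{HC}\otimes\mathrm{HC}^{\otimes\mathrm{op}}$; in particular $B\times_{\mathcal L}B'$ is an algebra in $\mathrm{HC}\otimes\mathrm{HC}^{\otimes\mathrm{op}}$ whenever $B$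 and $B'$ are, and $\mathcal D$ is an algebra there, hence also an algebra in $\mathcal C\otimes\mathcal C^{\otimes\mathrm{op}}$. A *quantum moment map* for an algebra $B$ in $\mathcal C\otimes\mathcal C^{\otimes\mathrm{op}}$ is an algebra map $s\otimes t:\mathcal L\boxtimes\mathcal L^{\mathrm{op}}\to B$ which is central, i.e. the multiplication of $B$ precomposed with $\mathrm{id}_B\otimes(s\otimes t)$ agrees with the multiplication precomposed with $(s\otimes t)\otimes\mathrm{id}_B$ and the central structure of $\mathcal L\boxtimes\mathcal L^{\mathrm{op}}$. Algebras in $\mathcal C\otimes\mathcal C^{\otimes\mathrm{op}}$ with a quantum moment map are the same as algebras in $\mathrm{HC}\otimes\mathrm{HC}^{\otimes\mathrm{op}}$. A *Harish-Chandra bialgebroid* is an algebra $B$ in $\mathcal C\otimes\mathcal C^{\otimes\mathrm{op}}$ with a quantum moment map, hence an algebra in $\mathrm{HC}\otimes\mathrm{HC}^{\otimes\mathrm{op}}$, together with a map $\Delta:B\to B\times_{\mathcal L}B$ of algebras in $\mathrm{HC}\otimes\mathrm{HC}^{\otimes\mathrm{op}}$ and a map $\varepsilon:B\to\mathcal D$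 of algebras in $\mathcal C\otimes\mathcal C^{\otimes\mathrm{op}}$ compatible with the quantum moment maps, such that $\Delta$ is coassociative and $\varepsilon$ is a counit for $\Delta$ with respect to the Takeuchi product. A *lax monoidal comonad* is a comonad whose underlying functor is lax monoidal and whose counit and comultiplication are monoidal natural transformations. **Theorem.** 1. For every Harish-Chandra bialgebroid $B$, the functor $\bot=B\times_{\mathcal L}(-):\mathrm{HC}\to\mathrm{HC}$ preserves colimits, and the structure maps of $B$ make it a lax monoidal comonad: its counit and comultiplication are induced by $\varepsilon$ and $\Delta$, and its lax monoidal structure is induced by the unit and the multiplication of $B$ and by the lax monoidal structure of $\mathrm{ev}$. 2. Conversely, for every colimit-preserving ($k$-linear) lax monoidal comonad $\bot$ on $\mathrm{HC}$ there are a Harish-Chandra bialgebroid $B$ and an isomorphism $\bot\cong B\times_{\mathcal L}(-)$ of lax monoidal comonads. -/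

import Mathlib

open CategoryTheory MonoidalCategory Limits MonObj Opposite

universe w u u' v v₁ v₂ v₃ v₄

set_option linter.unusedSectionVars false

namespace HarishChandra

section Modules
variable {C : Type u} [Category.{w} C] [MonoidalCategory C]

/-- The object of `C` underlying an object of the Drinfeld center of `C`. -/
def und (L : Center C) : C := L.1

/-- The algebra in `C` underlying an algebra in the Drinfeld center of `C`. -/
instance centerMonObj (L : Center C) [MonObj L] : MonObj (und L) where
  one := (η[L]).f
  mul := (μ[L]).f
  one_mul := congrArg Center.Hom.f (MonObj.one_mul L)
  mul_one := congrArg Center.Hom.f (MonObj.mul_one L)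
  mul_assoc := congrArg Center.Hom.f (MonObj.mul_assoc L)

variable (L : Center C)

/-- The isomorphism `τ_x : x ⊗ L ≅ L ⊗ x` which is part of an object of the Drinfeld center. -/
def tau (x : C) : x ⊗ (und L) ≅ (und L) ⊗ x := (L.2.β x).symm

lemma tau_tensor (x y : C) : (tau L (x ⊗ y)).hom =
    (α_ x y (und L)).hom ≫ x ◁ (tau L y).hom ≫ (α_ x (und L) y).inv ≫ (tau L x).hom ▷ y ≫
      (α_ (und L) x y).hom := by
  have aux {X : C} (b : HalfBraiding X) : (b.β (x ⊗ y)).inv = (α_ x y X).hom ≫ x ◁ (b.β y).inv ≫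
      (α_ x X y).inv ≫ (b.β x).inv ▷ y ≫ (α_ X x y).hom := by
    rw [← cancel_epi (b.β (x ⊗ y)).hom, Iso.hom_inv_id]
    simp
  exact aux L.2

lemma tau_naturality {x y : C} (f : x ⟶ y) :
    f ▷ und L ≫ (tau L y).hom = (tau L x).hom ≫ und L ◁ f := by
  have aux {X : C} (b : HalfBraiding X) : f ▷ X ≫ (b.β y).inv = (b.β x).inv ≫ X ◁ f := by
    rw [← cancel_epi (b.β x).hom]
    simp [← HalfBraiding.naturality_assoc]
  exact aux L.2

variable [MonObj L]

lemma one_tau (x : C) : x ◁ η[und L] ≫ (tau L x).hom =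
    (ρ_ x).hom ≫ (λ_ x).inv ≫ η[und L] ▷ x := by
  have aux {X : C} (b : HalfBraiding X) (e : 𝟙_ C ⟶ X)
      (h : e ▷ x ≫ (b.β x).hom = ((λ_ x).hom ≫ (ρ_ x).inv) ≫ x ◁ e) :
      x ◁ e ≫ (b.β x).inv = (ρ_ x).hom ≫ (λ_ x).inv ≫ e ▷ x := by
    rw [← cancel_mono (b.β x).hom]
    simp [h]
  exact aux L.2 _ ((η[L]).comm x)

lemma mul_tau (x : C) : x ◁ μ[und L] ≫ (tau L x).hom =
    (α_ x (und L) (und L)).inv ≫ (tau L x).hom ▷ und L ≫ (α_ (und L) x (und L)).hom ≫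
      und L ◁ (tau L x).hom ≫ (α_ (und L) (und L) x).inv ≫ μ[und L] ▷ x := by
  have aux {X : C} (b : HalfBraiding X) (e : X ⊗ X ⟶ X)
      (h : e ▷ x ≫ (b.β x).hom = (α_ X X x ≪≫ X ◁ᵢ b.β x ≪≫ (α_ X x X).symm ≪≫ b.β x ▷ᵢ X ≪≫
        α_ x X X).hom ≫ x ◁ e) :
      x ◁ e ≫ (b.β x).inv = (α_ x X X).inv ≫ (b.β x).inv ▷ X ≫ (α_ X x X).hom ≫
        X ◁ (b.β x).inv ≫ (α_ X X x).inv ≫ e ▷ x := by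
    rw [← cancel_mono (b.β x).hom]
    simp [h]
  have h := (μ[L]).comm x
  rw [Center.tensor_β] at h
  exact aux L.2 _ h

lemma tau_mul [IsCommMonObj L] : (tau L (und L)).hom ≫ μ[und L] = μ[und L] := by
  have aux {X : C} (b : HalfBraiding X) (e : X ⊗ X ⟶ X) (h : (b.β X).hom ≫ e = e) :
      (b.β X).inv ≫ e = e := by
    rw [← cancel_epi (b.β X).hom]
    simp [h]
  exact aux L.2 _ (congrArg Center.Hom.f (IsCommMonObj.mul_comm L))

/-- The category of Harish-Chandra bimodules: left `L`-modules in `C`. -/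
abbrev HC := Mod C (und L)

variable {L}

/-- The left action `L ⊗ M ⟶ M`. -/
def HC.lact (M : HC L) : (und L) ⊗ M.X ⟶ M.X := ModObj.smul (M := (und L)) (X := M.X)

/-- The right action `M ⊗ L ⟶ L ⊗ M ⟶ M`. -/
def HC.ract (M : HC L) : M.X ⊗ (und L) ⟶ M.X := (tau L M.X).hom ≫ HC.lact M

lemma HC.one_lact (M : HC L) : η[(und L)] ▷ M.X ≫ HC.lact M = (λ_ M.X).hom :=
  ModObj.one_smul_self (und L) M.X
lemma HC.mul_lact (M : HC L) : μ[(und L)] ▷ M.X ≫ HC.lact M =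
    (α_ (und L) (und L) M.X).hom ≫ (und L) ◁ HC.lact M ≫ HC.lact M := ModObj.mul_smul_self (und L) M.X
lemma HC.hom_lact {M N : HC L} (f : M ⟶ N) :
    HC.lact M ≫ f.hom = (und L) ◁ f.hom ≫ HC.lact N :=
  IsModHom.smul_hom (A := (und L)) (f := f.hom)


/-- The monoid object `L` of `C`, bundled. -/
abbrev baseMon (L : Center C) [MonObj L] : Mon C := ⟨(und L)⟩

variable [IsCommMonObj L]


lemma HC.lact_ract (M : HC L) : HC.lact M ▷ (und L) ≫ HC.ract M =
    (α_ (und L) M.X (und L)).hom ≫ (und L) ◁ HC.ract M ≫ HC.lact M := by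
  have h : (α_ (und L) (und L) M.X).hom ≫ (und L) ◁ HC.lact M ≫ HC.lact M = μ[(und L)] ▷ M.X ≫ HC.lact M :=
    (HC.mul_lact M).symm
  have hc : (tau L (und L)).hom ▷ M.X ≫ μ[(und L)] ▷ M.X = μ[(und L)] ▷ M.X := by
    rw [← comp_whiskerRight, tau_mul]
  simp only [HC.ract]
  rw [← Category.assoc, tau_naturality, tau_tensor]
  simp only [Category.assoc, whiskerLeft_comp]
  rw [h, reassoc_of% hc, HC.mul_lact M]
  simp

lemma HC.ract_mul (M : HC L) : M.X ◁ μ[(und L)] ≫ HC.ract M =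
    (α_ M.X (und L) (und L)).inv ≫ HC.ract M ▷ (und L) ≫ HC.ract M := by
  have h1 : M.X ◁ μ[(und L)] ≫ HC.ract M = (M.X ◁ μ[(und L)] ≫ (tau L M.X).hom) ≫ HC.lact M := by
    simp [HC.ract]
  have h2 : HC.ract M ▷ (und L) ≫ HC.ract M =
      (tau L M.X).hom ▷ (und L) ≫ (HC.lact M ▷ (und L) ≫ HC.ract M) := by
    rw [← comp_whiskerRight_assoc]; rfl
  rw [h1, mul_tau, h2, HC.lact_ract]
  simp only [Category.assoc, HC.mul_lact]
  simp [HC.ract]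

lemma HC.ract_one (M : HC L) : M.X ◁ η[(und L)] ≫ HC.ract M = (ρ_ M.X).hom := by
  have h1 : M.X ◁ η[(und L)] ≫ HC.ract M = (M.X ◁ η[(und L)] ≫ (tau L M.X).hom) ≫ HC.lact M := by
    simp [HC.ract]
  rw [h1, one_tau]
  simp [HC.one_lact]

lemma HC.hom_ract {M N : HC L} (f : M ⟶ N) :
    HC.ract M ≫ f.hom = f.hom ▷ (und L) ≫ HC.ract N := by
  have h : f.hom ▷ (und L) ≫ HC.ract N = (f.hom ▷ (und L) ≫ (tau L N.X).hom) ≫ HC.lact N := by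
    simp [HC.ract]
  rw [h, tau_naturality]
  simp [HC.ract, HC.hom_lact]

/-- A left `L`-module, viewed as an `L`-bimodule by means of `τ`. -/
def HC.bimod (M : HC L) : Bimod (baseMon L) (baseMon L) where
  X := M.X
  actLeft := HC.lact M
  one_actLeft := HC.one_lact M
  left_assoc := HC.mul_lact M
  actRight := HC.ract M
  actRight_one := HC.ract_one M
  right_assoc := HC.ract_mul M
  middle_assoc := HC.lact_ract M

/-- The fully faithful functor from Harish-Chandra bimodules to `L`-bimodules. -/
def HC.toBimod (L : Center C) [MonObj L] [IsCommMonObj L] :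
    HC L ⥤ Bimod (baseMon L) (baseMon L) where
  obj M := M.bimod
  map f := { hom := f.hom, left_act_hom := HC.hom_lact f, right_act_hom := HC.hom_ract f }

instance : (HC.toBimod L).Faithful where
  map_injective h := Mod.hom_ext _ _ (congrArg Bimod.Hom.hom h)

/-- A left-linear map, viewed as a morphism of Harish-Chandra bimodules. -/
def HC.mkHom {M N : HC L} (f : M.X ⟶ N.X) (h : HC.lact M ≫ f = (und L) ◁ f ≫ HC.lact N) : M ⟶ N :=
  Mod.Hom.mk' f h

/-- An isomorphism of bimodules, viewed as an isomorphism of left modules. -/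
def HC.isoOfBimod {M N : HC L} (e : M.bimod ≅ N.bimod) : M ≅ N where
  hom := HC.mkHom e.hom.hom e.hom.left_act_hom
  inv := HC.mkHom e.inv.hom e.inv.left_act_hom
  hom_inv_id := Mod.hom_ext _ _ (congrArg Bimod.Hom.hom e.hom_inv_id)
  inv_hom_id := Mod.hom_ext _ _ (congrArg Bimod.Hom.hom e.inv_hom_id)

section Tensor
variable [HasCoequalizers C] [∀ X : C, PreservesColimitsOfSize.{0, 0} (tensorLeft X)]
  [∀ X : C, PreservesColimitsOfSize.{0, 0} (tensorRight X)]

noncomputable instance bimodMonoidal (R : Mon C) : MonoidalCategory (Bimod R R) :=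
  letI := Bimod.monBicategory (C := C)
  inferInstanceAs (MonoidalCategory (EndMonoidal R))

/-- The relative tensor product `M ⊗_L N` of Harish-Chandra bimodules. -/
noncomputable def HC.tensorObj (M N : HC L) : HC L where
  X := Bimod.TensorBimod.X M.bimod N.bimod
  mod :=
    { smul := Bimod.TensorBimod.actLeft M.bimod N.bimod
      one_smul := Bimod.TensorBimod.one_act_left' M.bimod N.bimod
      mul_smul := Bimod.TensorBimod.left_assoc' M.bimod N.bimod }

/-- The projection `M ⊗ N ⟶ M ⊗_L N`. -/
noncomputable def HC.proj (M N : HC L) : M.X ⊗ N.X ⟶ (HC.tensorObj M N).X :=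
  coequalizer.π (HC.ract M ▷ N.X) ((α_ _ _ _).hom ≫ M.X ◁ HC.lact N)

instance (M N : HC L) : Epi (HC.proj M N) := coequalizer.π_epi

lemma HC.proj_condition (M N : HC L) : HC.ract M ▷ N.X ≫ HC.proj M N =
    (α_ _ _ _).hom ≫ M.X ◁ HC.lact N ≫ HC.proj M N := by
  have h := coequalizer.condition (HC.ract M ▷ N.X) ((α_ _ _ _).hom ≫ M.X ◁ HC.lact N)
  rw [Category.assoc] at h
  exact h

/-- The map `M ⊗_L N ⟶ Z` induced by a map `M ⊗ N ⟶ Z`. -/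
noncomputable def HC.desc {M N : HC L} {Z : C} (f : M.X ⊗ N.X ⟶ Z)
    (h : HC.ract M ▷ N.X ≫ f = ((α_ _ _ _).hom ≫ M.X ◁ HC.lact N) ≫ f) :
    (HC.tensorObj M N).X ⟶ Z :=
  coequalizer.desc f h

lemma HC.proj_desc {M N : HC L} {Z : C} (f : M.X ⊗ N.X ⟶ Z)
    (h : HC.ract M ▷ N.X ≫ f = ((α_ _ _ _).hom ≫ M.X ◁ HC.lact N) ≫ f) :
    HC.proj M N ≫ HC.desc f h = f :=
  coequalizer.π_desc _ _

lemma HC.proj_lact (M N : HC L) : (und L) ◁ HC.proj M N ≫ HC.lact (HC.tensorObj M N) =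
    (α_ _ _ _).inv ≫ HC.lact M ▷ N.X ≫ HC.proj M N :=
  Bimod.TensorBimod.whiskerLeft_π_actLeft M.bimod N.bimod

instance (M N : HC L) : Epi (HC.proj M N ▷ (und L)) :=
  inferInstanceAs (Epi ((tensorRight (und L)).map (HC.proj M N)))

lemma HC.proj_ract (M N : HC L) : HC.proj M N ▷ und L ≫ HC.ract (HC.tensorObj M N) =
    (α_ _ _ _).hom ≫ M.X ◁ HC.ract N ≫ HC.proj M N := by
  rw [HC.ract, ← Category.assoc, tau_naturality, tau_tensor]
  simp only [Category.assoc, HC.proj_lact, Iso.hom_inv_id_assoc]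
  have h2 : (tau L M.X).hom ▷ N.X ≫ HC.lact M ▷ N.X = HC.ract M ▷ N.X := by
    rw [← comp_whiskerRight]; rfl
  rw [reassoc_of% h2, HC.proj_condition]
  simp [HC.ract]

lemma HC.ract_tensorObj (M N : HC L) : HC.ract (HC.tensorObj M N) =
    Bimod.TensorBimod.actRight M.bimod N.bimod := by
  have h : HC.proj M N ▷ und L ≫ Bimod.TensorBimod.actRight M.bimod N.bimod =
    (α_ _ _ _).hom ≫ M.X ◁ HC.ract N ≫ HC.proj M N :=
    Bimod.TensorBimod.π_tensor_id_actRight M.bimod N.bimod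
  exact (cancel_epi (HC.proj M N ▷ und L)).1 ((HC.proj_ract M N).trans h.symm)

/-- The bimodule of a tensor product is the tensor product of bimodules. -/
noncomputable def HC.tensorIso (M N : HC L) :
    M.bimod ⊗ N.bimod ≅ (HC.tensorObj M N).bimod :=
  Bimod.isoOfIso (P := M.bimod.tensorBimod N.bimod) (Iso.refl _)
    ((Category.comp_id _).trans ((Category.id_comp _).symm.trans
      (congrArg (· ≫ _) (MonoidalCategory.whiskerLeft_id _ _).symm)))
    (((Category.comp_id _).trans (HC.ract_tensorObj M N).symm).trans ((Category.id_comp _).symm.trans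
      (congrArg (· ≫ _) (MonoidalCategory.id_whiskerRight _ _).symm)))

/-- The bimodule of the unit is the regular bimodule. -/
def HC.unitIso (L : Center C) [MonObj L] [IsCommMonObj L] :
    Bimod.regular (baseMon L) ≅ HC.bimod (Mod.regular (und L)) :=
  Bimod.isoOfIso (P := Bimod.regular (baseMon L)) (Iso.refl _)
    ((Category.comp_id _).trans ((Category.id_comp _).symm.trans
      (congrArg (· ≫ _) (MonoidalCategory.whiskerLeft_id _ _).symm)))
    (((Category.comp_id _).trans (tau_mul L).symm).trans ((Category.id_comp _).symm.trans
      (congrArg (· ≫ _) (MonoidalCategory.id_whiskerRight _ _).symm)))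

noncomputable instance HC.monoidalStruct : MonoidalCategoryStruct (HC L) where
  tensorObj := HC.tensorObj
  whiskerLeft M N₁ N₂ f :=
    let g := (HC.tensorIso M N₁).inv ≫ (M.bimod ◁ (HC.toBimod L).map f) ≫ (HC.tensorIso M N₂).hom
    HC.mkHom g.hom g.left_act_hom
  whiskerRight {M₁ M₂} f N :=
    let g := (HC.tensorIso M₁ N).inv ≫ ((HC.toBimod L).map f ▷ N.bimod) ≫ (HC.tensorIso M₂ N).hom
    HC.mkHom g.hom g.left_act_hom
  tensorHom {M₁ M₂ N₁ N₂} f g :=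
    let h := (HC.tensorIso M₁ N₁).inv ≫
      ((HC.toBimod L).map f ⊗ₘ (HC.toBimod L).map g) ≫ (HC.tensorIso M₂ N₂).hom
    HC.mkHom h.hom h.left_act_hom
  tensorUnit := Mod.regular (und L)
  associator M N P := HC.isoOfBimod
    (((HC.tensorIso (HC.tensorObj M N) P).symm ≪≫ ((HC.tensorIso M N).symm ⊗ᵢ .refl P.bimod)) ≪≫
      α_ M.bimod N.bimod P.bimod ≪≫
      ((.refl M.bimod ⊗ᵢ HC.tensorIso N P) ≪≫ HC.tensorIso M (HC.tensorObj N P)))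
  leftUnitor M := HC.isoOfBimod
    (((HC.tensorIso (Mod.regular (und L)) M).symm ≪≫ ((HC.unitIso L).symm ⊗ᵢ .refl M.bimod)) ≪≫
      λ_ M.bimod)
  rightUnitor M := HC.isoOfBimod
    (((HC.tensorIso M (Mod.regular (und L))).symm ≪≫ (.refl M.bimod ⊗ᵢ (HC.unitIso L).symm)) ≪≫
      ρ_ M.bimod)

/-- The monoidal structure on Harish-Chandra bimodules given by the relative tensor product. -/
noncomputable instance HC.monoidal : MonoidalCategory (HC L) :=
  Monoidal.induced (HC.toBimod L)
    { μIso := fun M N => HC.tensorIso M N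
      εIso := HC.unitIso L
      whiskerLeft_eq := fun _ _ _ _ => rfl
      whiskerRight_eq := fun _ _ => rfl
      tensorHom_eq := fun _ _ => rfl
      associator_eq := fun _ _ _ => rfl
      leftUnitor_eq := fun _ => rfl
      rightUnitor_eq := fun _ => rfl }

lemma HC.proj_whiskerLeft (M : HC L) {N₁ N₂ : HC L} (f : N₁ ⟶ N₂) :
    HC.proj M N₁ ≫ (M ◁ f).hom = M.X ◁ f.hom ≫ HC.proj M N₂ := by
  have h : (M ◁ f).hom = (Bimod.whiskerLeft M.bimod ((HC.toBimod L).map f)).hom :=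
    (Category.id_comp _).trans (Category.comp_id _)
  rw [h]
  exact (ι_colimMap _ _).trans rfl

lemma HC.proj_whiskerRight {M₁ M₂ : HC L} (f : M₁ ⟶ M₂) (N : HC L) :
    HC.proj M₁ N ≫ (f ▷ N).hom = f.hom ▷ N.X ≫ HC.proj M₂ N := by
  have h : (f ▷ N).hom = (Bimod.whiskerRight ((HC.toBimod L).map f) N.bimod).hom :=
    (Category.id_comp _).trans (Category.comp_id _)
  rw [h]
  exact (ι_colimMap _ _).trans rfl

lemma HC.proj_tensorHom {M₁ M₂ N₁ N₂ : HC L} (f : M₁ ⟶ M₂) (g : N₁ ⟶ N₂) :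
    HC.proj M₁ N₁ ≫ (f ⊗ₘ g).hom = (f.hom ⊗ₘ g.hom) ≫ HC.proj M₂ N₂ := by
  rw [MonoidalCategory.tensorHom_def, Mod.comp_hom', reassoc_of% HC.proj_whiskerRight,
    HC.proj_whiskerLeft, MonoidalCategory.tensorHom_def, Category.assoc]

end Tensor

section Linear
variable [Preadditive C] [MonoidalPreadditive C]

/-- The additive group of left-linear maps. -/
def HC.homAddSubgroup (M N : HC L) : AddSubgroup (M.X ⟶ N.X) where
  carrier := {f | HC.lact M ≫ f = und L ◁ f ≫ HC.lact N}
  add_mem' {f g} hf hg := by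
    simp only [Set.mem_ofPred_eq] at hf hg ⊢
    simp [hf, hg]
  zero_mem' := by simp
  neg_mem' {f} hf := by
    simp only [Set.mem_ofPred_eq] at hf ⊢
    have h : und L ◁ (-f) = -(und L ◁ f) := (tensorLeft (und L)).map_neg
    simp [hf, h]

/-- Morphisms of Harish-Chandra bimodules are the left-linear maps. -/
def HC.homEquiv (M N : HC L) : (M ⟶ N) ≃ HC.homAddSubgroup M N where
  toFun f := ⟨f.hom, HC.hom_lact f⟩
  invFun f := HC.mkHom f.1 f.2
  left_inv _ := rfl
  right_inv _ := rfl

instance HC.homAddCommGroup (M N : HC L) : AddCommGroup (M ⟶ N) := (HC.homEquiv M N).addCommGroup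

lemma HC.add_hom {M N : HC L} (f g : M ⟶ N) : (f + g).hom = f.hom + g.hom := rfl

instance HC.preadditive : Preadditive (HC L) where
  add_comp _ _ _ f f' g := Mod.hom_ext _ _ (by
    rw [HC.add_hom, Mod.comp_hom', Mod.comp_hom', Mod.comp_hom', HC.add_hom, Preadditive.add_comp])
  comp_add _ _ _ f g g' := Mod.hom_ext _ _ (by
    rw [HC.add_hom, Mod.comp_hom', Mod.comp_hom', Mod.comp_hom', HC.add_hom, Preadditive.comp_add])

variable (k : Type w) [Field k] [Linear k C] [MonoidalLinear k C]

instance HC.homSMul (M N : HC L) : SMul k (M ⟶ N) where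
  smul r f := HC.mkHom (r • f.hom) (by simp [HC.hom_lact])

lemma HC.smul_hom {M N : HC L} (r : k) (f : M ⟶ N) : (r • f).hom = r • f.hom := rfl

instance HC.homModule (M N : HC L) : Module k (M ⟶ N) where
  one_smul f := Mod.hom_ext _ _ (one_smul k f.hom)
  mul_smul r s f := Mod.hom_ext _ _ (mul_smul r s f.hom)
  smul_zero r := Mod.hom_ext _ _ (smul_zero (A := M.X ⟶ N.X) r)
  smul_add r f g := Mod.hom_ext _ _ (smul_add r f.hom g.hom)
  add_smul r s f := Mod.hom_ext _ _ (add_smul r s f.hom)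
  zero_smul f := Mod.hom_ext _ _ (zero_smul k f.hom)

instance HC.linear : Linear k (HC L) where
  smul_comp _ _ _ r f g := Mod.hom_ext _ _ (by
    rw [HC.smul_hom, Mod.comp_hom', Mod.comp_hom', HC.smul_hom, Linear.smul_comp])
  comp_smul _ _ _ f r g := Mod.hom_ext _ _ (by
    rw [HC.smul_hom, Mod.comp_hom', Mod.comp_hom', HC.smul_hom, Linear.comp_smul])

variable [HasCoequalizers C] [∀ X : C, PreservesColimitsOfSize.{0, 0} (tensorLeft X)]
  [∀ X : C, PreservesColimitsOfSize.{0, 0} (tensorRight X)]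

instance HC.monoidalPreadditive : MonoidalPreadditive (HC L) where
  whiskerLeft_zero {X Y Z} := by
    refine Mod.hom_ext _ _ ((cancel_epi (HC.proj X Y)).1 ?_)
    rw [HC.proj_whiskerLeft]
    exact ((congrArg (· ≫ _) MonoidalPreadditive.whiskerLeft_zero).trans zero_comp).trans
      comp_zero.symm
  zero_whiskerRight {X Y Z} := by
    refine Mod.hom_ext _ _ ((cancel_epi (HC.proj Y X)).1 ?_)
    rw [HC.proj_whiskerRight]
    exact ((congrArg (· ≫ _) MonoidalPreadditive.zero_whiskerRight).trans zero_comp).trans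
      comp_zero.symm
  whiskerLeft_add {X Y Z} f g := by
    refine Mod.hom_ext _ _ ((cancel_epi (HC.proj X Y)).1 ?_)
    rw [HC.proj_whiskerLeft, HC.add_hom, HC.add_hom, Preadditive.comp_add, HC.proj_whiskerLeft,
      HC.proj_whiskerLeft, MonoidalPreadditive.whiskerLeft_add, Preadditive.add_comp]
  add_whiskerRight {X Y Z} f g := by
    refine Mod.hom_ext _ _ ((cancel_epi (HC.proj Y X)).1 ?_)
    rw [HC.proj_whiskerRight, HC.add_hom, HC.add_hom, Preadditive.comp_add, HC.proj_whiskerRight,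
      HC.proj_whiskerRight, MonoidalPreadditive.add_whiskerRight, Preadditive.add_comp]

instance HC.monoidalLinear : MonoidalLinear k (HC L) where
  whiskerLeft_smul X {Y Z} r f := by
    refine Mod.hom_ext _ _ ((cancel_epi (HC.proj X Y)).1 ?_)
    rw [HC.proj_whiskerLeft, HC.smul_hom, HC.smul_hom, Linear.comp_smul, HC.proj_whiskerLeft,
      MonoidalLinear.whiskerLeft_smul, Linear.smul_comp]
  smul_whiskerRight r {Y Z} f X := by
    refine Mod.hom_ext _ _ ((cancel_epi (HC.proj Y X)).1 ?_)
    rw [HC.proj_whiskerRight, HC.smul_hom, HC.smul_hom, Linear.comp_smul, HC.proj_whiskerRight,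
      MonoidalLinear.smul_whiskerRight, Linear.smul_comp]

end Linear

end Modules

section Pairing
variable {k : Type w} [Field k] {A : Type u'} [Category.{w} A]

/-- `k`-linear presheaves on `A`. -/
abbrev Psh (k : Type w) [Field k] (A : Type u') [Category.{w} A] := Aᵒᵖ ⥤ ModuleCat.{v} k

/-- The restriction of a section of a presheaf along a morphism. -/
def Psh.res (F : Psh.{w, u', v} k A) {x y : A} (f : x ⟶ y) : F.obj (op y) →ₗ[k] F.obj (op x) :=
  (F.map f.op).hom

lemma Psh.res_id (F : Psh.{w, u', v} k A) {x : A} (a : F.obj (op x)) : F.res (𝟙 x) a = a := by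
  simp [Psh.res]

lemma Psh.res_comp (F : Psh.{w, u', v} k A) {x y z : A} (f : x ⟶ y) (g : y ⟶ z)
    (a : F.obj (op z)) : F.res (f ≫ g) a = F.res f (F.res g a) := by
  simp [Psh.res]

/-- A natural transformation between presheaves whose values may lie in different universes. -/
structure PshHom (F : Psh.{w, u', v₁} k A) (G : Psh.{w, u', v₂} k A) where
  app (x : A) : F.obj (op x) →ₗ[k] G.obj (op x)
  naturality {x y : A} (f : x ⟶ y) (a : F.obj (op y)) : app x (F.res f a) = G.res f (app y a)

/-- The identity natural transformation. -/
def PshHom.id (F : Psh.{w, u', v₁} k A) : PshHom F F where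
  app _ := LinearMap.id
  naturality _ _ := rfl

variable [MonoidalCategory A]

/-- Formal generators `[a, e, b]` of the coend
`∫^{z, w} F z ⊗ Hom (𝟙, z ⊗ w) ⊗ G w`. -/
structure EvGen (F : Psh.{w, u', v₁} k A) (G : Psh.{w, u', v₂} k A) where
  z : A
  w : A
  a : F.obj (op z)
  e : 𝟙_ A ⟶ z ⊗ w
  b : G.obj (op w)

variable [Preadditive A] [Linear k A]

/-- The relations of the coend: multilinearity, and balancing in `z` and in `w`. -/
inductive EvRel (F : Psh.{w, u', v₁} k A) (G : Psh.{w, u', v₂} k A) : (EvGen F G →₀ k) → Prop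
  | add_left {z w : A} (a a' : F.obj (op z)) (e : 𝟙_ A ⟶ z ⊗ w) (b : G.obj (op w)) :
      EvRel F G (.single ⟨z, w, a + a', e, b⟩ 1 - .single ⟨z, w, a, e, b⟩ 1 -
        .single ⟨z, w, a', e, b⟩ 1)
  | add_mid {z w : A} (a : F.obj (op z)) (e e' : 𝟙_ A ⟶ z ⊗ w) (b : G.obj (op w)) :
      EvRel F G (.single ⟨z, w, a, e + e', b⟩ 1 - .single ⟨z, w, a, e, b⟩ 1 -
        .single ⟨z, w, a, e', b⟩ 1)
  | add_right {z w : A} (a : F.obj (op z)) (e : 𝟙_ A ⟶ z ⊗ w) (b b' : G.obj (op w)) :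
      EvRel F G (.single ⟨z, w, a, e, b + b'⟩ 1 - .single ⟨z, w, a, e, b⟩ 1 -
        .single ⟨z, w, a, e, b'⟩ 1)
  | smul_left {z w : A} (r : k) (a : F.obj (op z)) (e : 𝟙_ A ⟶ z ⊗ w) (b : G.obj (op w)) :
      EvRel F G (.single ⟨z, w, r • a, e, b⟩ 1 - r • .single ⟨z, w, a, e, b⟩ 1)
  | smul_mid {z w : A} (r : k) (a : F.obj (op z)) (e : 𝟙_ A ⟶ z ⊗ w) (b : G.obj (op w)) :
      EvRel F G (.single ⟨z, w, a, r • e, b⟩ 1 - r • .single ⟨z, w, a, e, b⟩ 1)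
  | smul_right {z w : A} (r : k) (a : F.obj (op z)) (e : 𝟙_ A ⟶ z ⊗ w) (b : G.obj (op w)) :
      EvRel F G (.single ⟨z, w, a, e, r • b⟩ 1 - r • .single ⟨z, w, a, e, b⟩ 1)
  | bal_left {z z' w : A} (f : z ⟶ z') (a : F.obj (op z')) (e : 𝟙_ A ⟶ z ⊗ w)
      (b : G.obj (op w)) :
      EvRel F G (.single ⟨z, w, F.res f a, e, b⟩ 1 - .single ⟨z', w, a, e ≫ f ▷ w, b⟩ 1)
  | bal_right {z w w' : A} (g : w ⟶ w') (a : F.obj (op z)) (e : 𝟙_ A ⟶ z ⊗ w)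
      (b : G.obj (op w')) :
      EvRel F G (.single ⟨z, w, a, e, G.res g b⟩ 1 - .single ⟨z, w', a, e ≫ z ◁ g, b⟩ 1)

/-- The coend `∫^{z, w} F z ⊗ Hom (𝟙, z ⊗ w) ⊗ G w`: the colimit-preserving extension of the
pairing `ev (z, w) = Hom (𝟙, z ⊗ w)`, evaluated on the presheaves `F` and `G`. -/
abbrev Ev (F : Psh.{w, u', v₁} k A) (G : Psh.{w, u', v₂} k A) :=
  (EvGen F G →₀ k) ⧸ Submodule.span k {x | EvRel F G x}

/-- The class `[a, e, b]` in the coend. -/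
noncomputable def Ev.of {F : Psh.{w, u', v₁} k A} {G : Psh.{w, u', v₂} k A} {z w : A}
    (a : F.obj (op z)) (e : 𝟙_ A ⟶ z ⊗ w) (b : G.obj (op w)) : Ev F G :=
  Submodule.Quotient.mk (.single ⟨z, w, a, e, b⟩ 1)

namespace Ev
variable {F : Psh.{w, u', v₁} k A} {G : Psh.{w, u', v₂} k A}

lemma rel {x : EvGen F G →₀ k} (h : EvRel F G x) :
    (Submodule.Quotient.mk x : Ev F G) = 0 :=
  (Submodule.Quotient.mk_eq_zero _).2 (Submodule.subset_span h)

lemma add_left {z w : A} (a a' : F.obj (op z)) (e : 𝟙_ A ⟶ z ⊗ w) (b : G.obj (op w)) :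
    of (a + a') e b = of a e b + of a' e b := by
  have h := rel (EvRel.add_left a a' e b)
  rw [Submodule.Quotient.mk_sub, Submodule.Quotient.mk_sub, sub_sub, sub_eq_zero] at h
  exact h

lemma add_mid {z w : A} (a : F.obj (op z)) (e e' : 𝟙_ A ⟶ z ⊗ w) (b : G.obj (op w)) :
    of a (e + e') b = of a e b + of a e' b := by
  have h := rel (EvRel.add_mid a e e' b)
  rw [Submodule.Quotient.mk_sub, Submodule.Quotient.mk_sub, sub_sub, sub_eq_zero] at h
  exact h

lemma add_right {z w : A} (a : F.obj (op z)) (e : 𝟙_ A ⟶ z ⊗ w) (b b' : G.obj (op w)) :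
    of a e (b + b') = of a e b + of a e b' := by
  have h := rel (EvRel.add_right a e b b')
  rw [Submodule.Quotient.mk_sub, Submodule.Quotient.mk_sub, sub_sub, sub_eq_zero] at h
  exact h

lemma smul_left {z w : A} (r : k) (a : F.obj (op z)) (e : 𝟙_ A ⟶ z ⊗ w) (b : G.obj (op w)) :
    of (r • a) e b = r • of a e b := by
  have h := rel (EvRel.smul_left r a e b)
  rw [Submodule.Quotient.mk_sub, Submodule.Quotient.mk_smul, sub_eq_zero] at h
  exact h

lemma smul_mid {z w : A} (r : k) (a : F.obj (op z)) (e : 𝟙_ A ⟶ z ⊗ w) (b : G.obj (op w)) :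
    of a (r • e) b = r • of a e b := by
  have h := rel (EvRel.smul_mid r a e b)
  rw [Submodule.Quotient.mk_sub, Submodule.Quotient.mk_smul, sub_eq_zero] at h
  exact h

lemma smul_right {z w : A} (r : k) (a : F.obj (op z)) (e : 𝟙_ A ⟶ z ⊗ w) (b : G.obj (op w)) :
    of a e (r • b) = r • of a e b := by
  have h := rel (EvRel.smul_right r a e b)
  rw [Submodule.Quotient.mk_sub, Submodule.Quotient.mk_smul, sub_eq_zero] at h
  exact h

lemma bal_left {z z' w : A} (f : z ⟶ z') (a : F.obj (op z')) (e : 𝟙_ A ⟶ z ⊗ w)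
    (b : G.obj (op w)) : of (F.res f a) e b = of a (e ≫ f ▷ w) b := by
  have h := rel (EvRel.bal_left f a e b)
  rw [Submodule.Quotient.mk_sub, sub_eq_zero] at h
  exact h

lemma bal_right {z w w' : A} (g : w ⟶ w') (a : F.obj (op z)) (e : 𝟙_ A ⟶ z ⊗ w)
    (b : G.obj (op w')) : of a e (G.res g b) = of a (e ≫ z ◁ g) b := by
  have h := rel (EvRel.bal_right g a e b)
  rw [Submodule.Quotient.mk_sub, sub_eq_zero] at h
  exact h

/-- Data for a linear map out of the coend. -/
structure Desc (F : Psh.{w, u', v₁} k A) (G : Psh.{w, u', v₂} k A)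
    (P : Type v) [AddCommGroup P] [Module k P] where
  fn {z w : A} (a : F.obj (op z)) (e : 𝟙_ A ⟶ z ⊗ w) (b : G.obj (op w)) : P
  add_left {z w : A} (a a' : F.obj (op z)) (e : 𝟙_ A ⟶ z ⊗ w) (b : G.obj (op w)) :
    fn (a + a') e b = fn a e b + fn a' e b
  add_mid {z w : A} (a : F.obj (op z)) (e e' : 𝟙_ A ⟶ z ⊗ w) (b : G.obj (op w)) :
    fn a (e + e') b = fn a e b + fn a e' b
  add_right {z w : A} (a : F.obj (op z)) (e : 𝟙_ A ⟶ z ⊗ w) (b b' : G.obj (op w)) :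
    fn a e (b + b') = fn a e b + fn a e b'
  smul_left {z w : A} (r : k) (a : F.obj (op z)) (e : 𝟙_ A ⟶ z ⊗ w) (b : G.obj (op w)) :
    fn (r • a) e b = r • fn a e b
  smul_mid {z w : A} (r : k) (a : F.obj (op z)) (e : 𝟙_ A ⟶ z ⊗ w) (b : G.obj (op w)) :
    fn a (r • e) b = r • fn a e b
  smul_right {z w : A} (r : k) (a : F.obj (op z)) (e : 𝟙_ A ⟶ z ⊗ w) (b : G.obj (op w)) :
    fn a e (r • b) = r • fn a e b
  bal_left {z z' w : A} (f : z ⟶ z') (a : F.obj (op z')) (e : 𝟙_ A ⟶ z ⊗ w)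
    (b : G.obj (op w)) : fn (F.res f a) e b = fn a (e ≫ f ▷ w) b
  bal_right {z w w' : A} (g : w ⟶ w') (a : F.obj (op z)) (e : 𝟙_ A ⟶ z ⊗ w)
    (b : G.obj (op w')) : fn a e (G.res g b) = fn a (e ≫ z ◁ g) b

variable {P : Type v} [AddCommGroup P] [Module k P]

/-- The linear map out of the coend given by a balanced trilinear map. -/
noncomputable def lift (d : Desc F G P) : Ev F G →ₗ[k] P :=
  Submodule.liftQ _ (Finsupp.linearCombination k fun g : EvGen F G => d.fn g.a g.e g.b) (by
    rw [Submodule.span_le]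
    rintro _ h
    change _ = _
    cases h with
    | add_left a a' e b => simp [d.add_left]
    | add_mid a e e' b => simp [d.add_mid]
    | add_right a e b b' => simp [d.add_right]
    | smul_left r a e b => simp [d.smul_left]
    | smul_mid r a e b => simp [d.smul_mid]
    | smul_right r a e b => simp [d.smul_right]
    | bal_left f a e b => simp [d.bal_left]
    | bal_right g a e b => simp [d.bal_right])

@[simp]
lemma lift_of (d : Desc F G P) {z w : A} (a : F.obj (op z)) (e : 𝟙_ A ⟶ z ⊗ w)
    (b : G.obj (op w)) : lift d (of a e b) = d.fn a e b := by
  refine (Submodule.liftQ_apply _ _ _).trans ?_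
  simp

/-- Linear maps out of the coend are determined on the classes `[a, e, b]`. -/
lemma hom_ext {φ ψ : Ev F G →ₗ[k] P} (h : ∀ {z w : A} (a : F.obj (op z)) (e : 𝟙_ A ⟶ z ⊗ w)
    (b : G.obj (op w)), φ (of a e b) = ψ (of a e b)) : φ = ψ := by
  apply Submodule.linearMap_qext
  ext g
  exact h g.a g.e g.b

/-- Functoriality of the coend. -/
noncomputable def map {F' : Psh.{w, u', v₃} k A} {G' : Psh.{w, u', v₄} k A} (φ : PshHom F F')
    (ψ : PshHom G G') : Ev F G →ₗ[k] Ev F' G' :=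
  lift
    { fn := fun {z w} a e b => of (φ.app z a) e (ψ.app w b)
      add_left := fun _ _ _ _ => by rw [map_add, add_left]
      add_mid := fun _ _ _ _ => add_mid _ _ _ _
      add_right := fun _ _ _ _ => by rw [map_add, add_right]
      smul_left := fun _ _ _ _ => by rw [map_smul, smul_left]
      smul_mid := fun _ _ _ _ => smul_mid _ _ _ _
      smul_right := fun _ _ _ _ => by rw [map_smul, smul_right]
      bal_left := fun _ _ _ _ => by rw [φ.naturality, bal_left]
      bal_right := fun _ _ _ _ => by rw [ψ.naturality, bal_right] }

@[simp]
lemma map_of {F' : Psh.{w, u', v₃} k A} {G' : Psh.{w, u', v₄} k A} (φ : PshHom F F')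
    (ψ : PshHom G G') {z w : A} (a : F.obj (op z)) (e : 𝟙_ A ⟶ z ⊗ w)
    (b : G.obj (op w)) : map φ ψ (of a e b) = of (φ.app z a) e (ψ.app w b) :=
  lift_of _ _ _ _

end Ev
end Pairing

section Takeuchi
variable {k : Type w} [Field k] {A : Type u'} [Category.{w} A]

/-- Functors of two contravariant variables with values in vector spaces. Such a functor
represents the object `M` of the tensor product of two categories by
`M (x, y) = Hom (x ⊠ y, M)`. -/
abbrev BiPsh (k : Type w) [Field k] (A : Type u') [Category.{w} A] :=
  Aᵒᵖ ⥤ Aᵒᵖ ⥤ ModuleCat.{v} k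

/-- The values of a functor of two contravariant variables. -/
abbrev BiPsh.at (M : BiPsh.{w, u', v} k A) (x y : A) := (M.obj (op x)).obj (op y)

/-- The functor `M (x, -)`. -/
abbrev BiPsh.row (M : BiPsh.{w, u', v} k A) (x : A) : Psh.{w, u', v} k A := M.obj (op x)

/-- The functor `M (-, y)`. -/
abbrev BiPsh.col (M : BiPsh.{w, u', v} k A) (y : A) : Psh.{w, u', v} k A := M.flip.obj (op y)

/-- The map `M (f, g) : M (x', y') → M (x, y)`. -/
def BiPsh.act (M : BiPsh.{w, u', v} k A) {x x' y y' : A} (f : x ⟶ x') (g : y ⟶ y') :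
    M.at x' y' →ₗ[k] M.at x y :=
  (M.row x).res g ∘ₗ (M.col y').res f

lemma BiPsh.act_id (M : BiPsh.{w, u', v} k A) {x y : A} (m : M.at x y) :
    M.act (𝟙 x) (𝟙 y) m = m := by
  simp [BiPsh.act, Psh.res]

lemma BiPsh.res_row (M : BiPsh.{w, u', v} k A) {x y y' : A} (g : y ⟶ y') (m : M.at x y') :
    (M.row x).res g m = M.act (𝟙 x) g m := by
  simp [BiPsh.act, Psh.res]

lemma BiPsh.res_col (M : BiPsh.{w, u', v} k A) {x x' y : A} (f : x ⟶ x') (m : M.at x' y) :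
    (M.col y).res f m = M.act f (𝟙 y) m := by
  simp [BiPsh.act, Psh.res]

lemma BiPsh.act_comp (M : BiPsh.{w, u', v} k A) {x x' x'' y y' y'' : A} (f : x ⟶ x')
    (f' : x' ⟶ x'') (g : y ⟶ y') (g' : y' ⟶ y'') (m : M.at x'' y'') :
    M.act (f ≫ f') (g ≫ g') m = M.act f g (M.act f' g' m) := by
  simp [BiPsh.act, Psh.res]

/-- Build a functor of two contravariant variables from its values and the maps `act`. -/
def BiPsh.mk' (M : A → A → Type v) [∀ x y, AddCommGroup (M x y)] [∀ x y, Module k (M x y)]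
    (act : ∀ {x x' y y' : A} (_ : x ⟶ x') (_ : y ⟶ y'), M x' y' →ₗ[k] M x y)
    (act_id : ∀ {x y : A} (m : M x y), act (𝟙 x) (𝟙 y) m = m)
    (act_comp : ∀ {x x' x'' y y' y'' : A} (f : x ⟶ x') (f' : x' ⟶ x'') (g : y ⟶ y')
      (g' : y' ⟶ y'') (m : M x'' y''), act (f ≫ f') (g ≫ g') m = act f g (act f' g' m)) :
    BiPsh.{w, u', v} k A where
  obj x :=
    { obj := fun y => ModuleCat.of k (M x.unop y.unop)
      map := fun g => ModuleCat.ofHom (act (𝟙 x.unop) g.unop)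
      map_id := fun y => by
        ext m
        exact act_id m
      map_comp := fun g g' => by
        ext m
        have h := act_comp (𝟙 x.unop) (𝟙 x.unop) g'.unop g.unop m
        rw [Category.id_comp] at h
        exact h }
  map {x x'} f :=
    { app := fun y => ModuleCat.ofHom (act f.unop (𝟙 y.unop))
      naturality := fun y y' g => by
        ext m
        have h := act_comp f.unop (𝟙 x.unop) (𝟙 y'.unop) g.unop m
        have h' := act_comp (𝟙 x'.unop) f.unop g.unop (𝟙 y.unop) m
        rw [Category.id_comp, Category.comp_id] at h h'
        exact h.symm.trans h' }
  map_id x := by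
    ext y m
    exact act_id m
  map_comp {x x' x''} f f' := by
    ext y m
    have h := act_comp f'.unop f.unop (𝟙 y.unop) (𝟙 y.unop) m
    rw [Category.comp_id] at h
    exact h

/-- A natural transformation of functors of two contravariant variables whose values may lie in
different universes. -/
structure BiPshHom (M : BiPsh.{w, u', v₁} k A) (N : BiPsh.{w, u', v₂} k A) where
  app (x y : A) : M.at x y →ₗ[k] N.at x y
  naturality {x x' y y' : A} (f : x ⟶ x') (g : y ⟶ y') (m : M.at x' y') :
    app x y (M.act f g m) = N.act f g (app x' y' m)

/-- The restriction of a natural transformation to a row. -/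
def BiPshHom.row {M : BiPsh.{w, u', v₁} k A} {N : BiPsh.{w, u', v₂} k A} (φ : BiPshHom M N)
    (x : A) : PshHom (M.row x) (N.row x) where
  app y := φ.app x y
  naturality g m := by rw [BiPsh.res_row, φ.naturality, BiPsh.res_row]

/-- The restriction of a natural transformation to a column. -/
def BiPshHom.col {M : BiPsh.{w, u', v₁} k A} {N : BiPsh.{w, u', v₂} k A} (φ : BiPshHom M N)
    (y : A) : PshHom (M.col y) (N.col y) where
  app x := φ.app x y
  naturality g m := by rw [BiPsh.res_col, BiPsh.res_col]; exact φ.naturality g (𝟙 y) m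

/-- The natural transformation `M (x', -) → M (x, -)` given by `f : x ⟶ x'`. -/
def BiPsh.rowMap (M : BiPsh.{w, u', v} k A) {x x' : A} (f : x ⟶ x') :
    PshHom (M.row x') (M.row x) where
  app y := M.act f (𝟙 y)
  naturality g m := by
    rw [BiPsh.res_row, BiPsh.res_row, ← BiPsh.act_comp, ← BiPsh.act_comp]
    simp

/-- The natural transformation `M (-, y') → M (-, y)` given by `g : y ⟶ y'`. -/
def BiPsh.colMap (M : BiPsh.{w, u', v} k A) {y y' : A} (g : y ⟶ y') :
    PshHom (M.col y') (M.col y) where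
  app x := M.act (𝟙 x) g
  naturality f m := by
    rw [BiPsh.res_col, BiPsh.res_col, ← BiPsh.act_comp]
    refine Eq.trans ?_ (BiPsh.act_comp M _ _ _ _ _)
    simp

variable [MonoidalCategory A] [Preadditive A] [Linear k A]

lemma takeuchi_map_id (M : BiPsh.{w, u', v₁} k A) (N : BiPsh.{w, u', v₂} k A) {x y : A}
    (m : Ev (M.row x) (N.col y)) : Ev.map (M.rowMap (𝟙 x)) (N.colMap (𝟙 y)) m = m := by
  have h : Ev.map (M.rowMap (𝟙 x)) (N.colMap (𝟙 y)) = LinearMap.id :=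
    Ev.hom_ext fun a e b => by
      rw [Ev.map_of]
      exact congrArg₂ (Ev.of · e ·) (M.act_id a) (N.act_id b)
  rw [h]; rfl

lemma takeuchi_map_comp (M : BiPsh.{w, u', v₁} k A) (N : BiPsh.{w, u', v₂} k A)
    {x x' x'' y y' y'' : A} (f : x ⟶ x') (f' : x' ⟶ x'') (g : y ⟶ y') (g' : y' ⟶ y'')
    (m : Ev (M.row x'') (N.col y'')) :
    Ev.map (M.rowMap (f ≫ f')) (N.colMap (g ≫ g')) m =
      Ev.map (M.rowMap f) (N.colMap g) (Ev.map (M.rowMap f') (N.colMap g') m) := by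
  have h : Ev.map (M.rowMap (f ≫ f')) (N.colMap (g ≫ g')) =
      Ev.map (M.rowMap f) (N.colMap g) ∘ₗ Ev.map (M.rowMap f') (N.colMap g') :=
    Ev.hom_ext fun {z w} a e b => by
      rw [LinearMap.comp_apply, Ev.map_of, Ev.map_of, Ev.map_of]
      refine congrArg₂ (Ev.of · e ·) ?_ ?_
      · have := M.act_comp f f' (𝟙 z) (𝟙 z) a
        rw [Category.comp_id] at this
        exact this
      · have := N.act_comp (𝟙 w) (𝟙 w) g g' b
        rw [Category.comp_id] at this
        exact this
  rw [h]; rfl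

/-- The Takeuchi product: `(M × N) (x, y) = ∫^{z, w} M (x, z) ⊗ Hom (𝟙, z ⊗ w) ⊗ N (w, y)`, that
is, `(M₁ ⊠ M₂) × (N₁ ⊠ N₂) = Hom (𝟙, M₂ ⊗ N₁) ⊗ (M₁ ⊠ N₂)`. -/
noncomputable def takeuchi (M : BiPsh.{w, u', v₁} k A) (N : BiPsh.{w, u', v₂} k A) :
    BiPsh.{w, u', max u' w v₁ v₂} k A :=
  BiPsh.mk' (fun x y => Ev (M.row x) (N.col y)) (fun f g => Ev.map (M.rowMap f) (N.colMap g))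
    (takeuchi_map_id M N) (takeuchi_map_comp M N)

lemma takeuchi_act (M : BiPsh.{w, u', v₁} k A) (N : BiPsh.{w, u', v₂} k A) {x x' y y' : A}
    (f : x ⟶ x') (g : y ⟶ y') (m : Ev (M.row x') (N.col y')) :
    (takeuchi M N).act f g m = Ev.map (M.rowMap f) (N.colMap g) m := by
  have h := takeuchi_map_comp M N (𝟙 x) f g (𝟙 y') m
  rw [Category.id_comp, Category.comp_id] at h
  exact h.symm

lemma takeuchi_act_of (M : BiPsh.{w, u', v₁} k A) (N : BiPsh.{w, u', v₂} k A)
    {x x' y y' z w : A} (f : x ⟶ x') (g : y ⟶ y') (a : M.at x' z) (e : 𝟙_ A ⟶ z ⊗ w)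
    (b : N.at w y') :
    (takeuchi M N).act f g (Ev.of (F := M.row x') (G := N.col y') a e b) =
      Ev.of (F := M.row x) (G := N.col y) (M.act f (𝟙 z) a) e (N.act (𝟙 w) g b) :=
  (takeuchi_act M N f g _).trans (Ev.map_of _ _ _ _ _)

end Takeuchi

section TakeuchiMul
variable {k : Type w} [Field k] {A : Type u'} [Category.{w} A] [MonoidalCategory A]

/-- A natural multiplication `M (x, y) ⊗ M (x', y') → M (x ⊗ x', y' ⊗ y)` and a unit in
`M (𝟙, 𝟙)`: the order of the second variable is reversed, since the second variable ranges over
the category with the opposite tensor product. -/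
structure MulOne (M : BiPsh.{w, u', v} k A) where
  mul {x y x' y' : A} : M.at x y →ₗ[k] M.at x' y' →ₗ[k] M.at (x ⊗ x') (y' ⊗ y)
  one : M.at (𝟙_ A) (𝟙_ A)
  mul_act {x₁ x₂ y₁ y₂ x₁' x₂' y₁' y₂' : A} (f : x₁ ⟶ x₂) (g : y₁ ⟶ y₂) (f' : x₁' ⟶ x₂')
    (g' : y₁' ⟶ y₂') (m : M.at x₂ y₂) (m' : M.at x₂' y₂') :
    mul (M.act f g m) (M.act f' g' m') = M.act (f ⊗ₘ f') (g' ⊗ₘ g) (mul m m')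

/-- The composite `𝟙 ⟶ z' ⊗ w' ⟶ z' ⊗ (z ⊗ w) ⊗ w' ⟶ (z' ⊗ z) ⊗ (w ⊗ w')`. -/
def nest {z w z' w' : A} (e : 𝟙_ A ⟶ z ⊗ w) (e' : 𝟙_ A ⟶ z' ⊗ w') :
    𝟙_ A ⟶ (z' ⊗ z) ⊗ (w ⊗ w') :=
  e' ≫ z' ◁ ((λ_ w').inv ≫ e ▷ w' ≫ (α_ z w w').hom) ≫ (α_ z' z (w ⊗ w')).inv

lemma nest_comp_left {z₁ z₂ w z' w' : A} (e : 𝟙_ A ⟶ z₁ ⊗ w) (e' : 𝟙_ A ⟶ z' ⊗ w')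
    (f : z₁ ⟶ z₂) : nest (e ≫ f ▷ w) e' = nest e e' ≫ (𝟙 z' ⊗ₘ f) ▷ (w ⊗ w') := by
  simp [nest]

lemma nest_comp_right {z w₁ w₂ z' w' : A} (e : 𝟙_ A ⟶ z ⊗ w₁) (e' : 𝟙_ A ⟶ z' ⊗ w')
    (f : w₁ ⟶ w₂) : nest (e ≫ z ◁ f) e' = nest e e' ≫ (z' ⊗ z) ◁ (f ⊗ₘ 𝟙 w') := by
  simp [nest]

lemma nest_comp_left' {z w z₁ z₂ w' : A} (e : 𝟙_ A ⟶ z ⊗ w) (e' : 𝟙_ A ⟶ z₁ ⊗ w')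
    (f : z₁ ⟶ z₂) : nest e (e' ≫ f ▷ w') = nest e e' ≫ (f ⊗ₘ 𝟙 z) ▷ (w ⊗ w') := by
  simp only [nest, Category.assoc]
  rw [← whisker_exchange_assoc]
  simp

lemma nest_comp_right' {z w z' w₁ w₂ : A} (e : 𝟙_ A ⟶ z ⊗ w) (e' : 𝟙_ A ⟶ z' ⊗ w₁)
    (f : w₁ ⟶ w₂) : nest e (e' ≫ z' ◁ f) = nest e e' ≫ (z' ⊗ z) ◁ (𝟙 w ⊗ₘ f) := by
  have h : (λ_ w₂).inv ≫ e ▷ w₂ ≫ (α_ z w w₂).hom = (λ_ w₂).inv ≫ e ▷ w₂ ≫ (α_ z w w₂).hom := rfl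
  have h' : f ≫ (λ_ w₂).inv ≫ e ▷ w₂ ≫ (α_ z w w₂).hom =
      ((λ_ w₁).inv ≫ e ▷ w₁ ≫ (α_ z w w₁).hom) ≫ z ◁ w ◁ f := by
    rw [leftUnitor_inv_naturality_assoc, whisker_exchange_assoc]
    simp
  simp only [nest, Category.assoc]
  rw [← MonoidalCategory.whiskerLeft_comp_assoc, h']
  simp

variable [Preadditive A] [MonoidalPreadditive A]

lemma nest_add_left {z w z' w' : A} (e₁ e₂ : 𝟙_ A ⟶ z ⊗ w) (e' : 𝟙_ A ⟶ z' ⊗ w') :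
    nest (e₁ + e₂) e' = nest e₁ e' + nest e₂ e' := by
  simp [nest]

lemma nest_add_right {z w z' w' : A} (e : 𝟙_ A ⟶ z ⊗ w) (e₁ e₂ : 𝟙_ A ⟶ z' ⊗ w') :
    nest e (e₁ + e₂) = nest e e₁ + nest e e₂ := by
  simp [nest]

variable [Linear k A] [MonoidalLinear k A]

lemma nest_smul_left {z w z' w' : A} (r : k) (e : 𝟙_ A ⟶ z ⊗ w) (e' : 𝟙_ A ⟶ z' ⊗ w') :
    nest (r • e) e' = r • nest e e' := by
  simp [nest]

lemma nest_smul_right {z w z' w' : A} (r : k) (e : 𝟙_ A ⟶ z ⊗ w) (e' : 𝟙_ A ⟶ z' ⊗ w') :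
    nest e (r • e') = r • nest e e' := by
  simp [nest]

namespace MulOne
variable {M : BiPsh.{w, u', v₁} k A} {N : BiPsh.{w, u', v₂} k A} (S : MulOne M) (T : MulOne N)

/-- Multiplication on the Takeuchi product, with the first factor `[a, e, b]` fixed. -/
noncomputable def takeuchiMulAux {x y z w : A} (a : M.at x z) (e : 𝟙_ A ⟶ z ⊗ w) (b : N.at w y)
    (x' y' : A) : Ev (M.row x') (N.col y') →ₗ[k] Ev (M.row (x ⊗ x')) (N.col (y' ⊗ y)) :=
  Ev.lift
    { fn := fun {z' w'} a' e' b' =>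
        Ev.of (z := z' ⊗ z) (w := w ⊗ w') (S.mul a a') (nest e e') (T.mul b b')
      add_left := fun _ _ _ _ => by rw [map_add]; exact Ev.add_left _ _ _ _
      add_mid := fun _ _ _ _ => by rw [nest_add_right]; exact Ev.add_mid _ _ _ _
      add_right := fun _ _ _ _ => by rw [map_add]; exact Ev.add_right _ _ _ _
      smul_left := fun _ _ _ _ => by rw [map_smul]; exact Ev.smul_left _ _ _ _
      smul_mid := fun _ _ _ _ => by rw [nest_smul_right]; exact Ev.smul_mid _ _ _ _
      smul_right := fun _ _ _ _ => by rw [map_smul]; exact Ev.smul_right _ _ _ _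
      bal_left := fun f a' e' b' => by
        have h := S.mul_act (𝟙 x) (𝟙 z) (𝟙 x') f a a'
        rw [BiPsh.act_id, id_tensorHom_id, ← BiPsh.res_row, ← BiPsh.res_row] at h
        rw [nest_comp_left']
        refine Eq.trans ?_ (Ev.bal_left _ _ _ _)
        exact congrArg (Ev.of · _ _) h
      bal_right := fun f a' e' b' => by
        have h := T.mul_act (𝟙 w) (𝟙 y) f (𝟙 y') b b'
        rw [BiPsh.act_id, id_tensorHom_id, ← BiPsh.res_col, ← BiPsh.res_col] at h
        rw [nest_comp_right']
        refine Eq.trans ?_ (Ev.bal_right _ _ _ _)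
        exact congrArg (Ev.of _ _ ·) h }

lemma takeuchiMulAux_of {x y z w x' y' z' w' : A} (a : M.at x z) (e : 𝟙_ A ⟶ z ⊗ w)
    (b : N.at w y) (a' : M.at x' z') (e' : 𝟙_ A ⟶ z' ⊗ w') (b' : N.at w' y') :
    takeuchiMulAux S T a e b x' y' (Ev.of a' e' b') =
      Ev.of (z := z' ⊗ z) (w := w ⊗ w') (S.mul a a') (nest e e') (T.mul b b') :=
  Ev.lift_of _ _ _ _

/-- Multiplication on the Takeuchi product:
`[a, e, b] * [a', e', b'] = [a * a', nest e e', b * b']`. -/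
noncomputable def takeuchiMul (x y x' y' : A) : Ev (M.row x) (N.col y) →ₗ[k]
    Ev (M.row x') (N.col y') →ₗ[k] Ev (M.row (x ⊗ x')) (N.col (y' ⊗ y)) :=
  Ev.lift
    { fn := fun {z w} a e b => takeuchiMulAux S T a e b x' y'
      add_left := fun _ _ _ _ => Ev.hom_ext fun _ _ _ => by
        simp only [takeuchiMulAux_of, map_add, LinearMap.add_apply]; exact Ev.add_left _ _ _ _
      add_mid := fun _ _ _ _ => Ev.hom_ext fun _ _ _ => by
        simp only [takeuchiMulAux_of, nest_add_left, LinearMap.add_apply]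
        exact Ev.add_mid _ _ _ _
      add_right := fun _ _ _ _ => Ev.hom_ext fun _ _ _ => by
        simp only [takeuchiMulAux_of, map_add, LinearMap.add_apply]; exact Ev.add_right _ _ _ _
      smul_left := fun _ _ _ _ => Ev.hom_ext fun _ _ _ => by
        simp only [takeuchiMulAux_of, map_smul, LinearMap.smul_apply]
        exact Ev.smul_left _ _ _ _
      smul_mid := fun _ _ _ _ => Ev.hom_ext fun _ _ _ => by
        simp only [takeuchiMulAux_of, nest_smul_left, LinearMap.smul_apply]
        exact Ev.smul_mid _ _ _ _
      smul_right := fun _ _ _ _ => Ev.hom_ext fun _ _ _ => by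
        simp only [takeuchiMulAux_of, map_smul, LinearMap.smul_apply]
        exact Ev.smul_right _ _ _ _
      bal_left := fun {z₁ z₂ w} f a e b => Ev.hom_ext fun {z' w'} a' e' b' => by
        have h := S.mul_act (𝟙 x) f (𝟙 x') (𝟙 z') a a'
        rw [BiPsh.act_id, id_tensorHom_id, ← BiPsh.res_row, ← BiPsh.res_row] at h
        rw [takeuchiMulAux_of, takeuchiMulAux_of, nest_comp_left]
        refine Eq.trans ?_ (Ev.bal_left _ _ _ _)
        exact congrArg (Ev.of · _ _) h
      bal_right := fun {z w₁ w₂} f a e b => Ev.hom_ext fun {z' w'} a' e' b' => by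
        have h := T.mul_act f (𝟙 y) (𝟙 w') (𝟙 y') b b'
        rw [BiPsh.act_id, id_tensorHom_id, ← BiPsh.res_col, ← BiPsh.res_col] at h
        rw [takeuchiMulAux_of, takeuchiMulAux_of, nest_comp_right]
        refine Eq.trans ?_ (Ev.bal_right _ _ _ _)
        exact congrArg (Ev.of _ _ ·) h }

lemma takeuchiMul_of {x y z w x' y' z' w' : A} (a : M.at x z) (e : 𝟙_ A ⟶ z ⊗ w)
    (b : N.at w y) (a' : M.at x' z') (e' : 𝟙_ A ⟶ z' ⊗ w') (b' : N.at w' y') :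
    takeuchiMul S T x y x' y' (Ev.of a e b) (Ev.of a' e' b') =
      Ev.of (z := z' ⊗ z) (w := w ⊗ w') (S.mul a a') (nest e e') (T.mul b b') := by
  rw [takeuchiMul, Ev.lift_of]
  exact takeuchiMulAux_of _ _ _ _ _ _ _ _

/-- The multiplication and the unit on the Takeuchi product. -/
noncomputable def takeuchi : MulOne (takeuchi M N) where
  mul {x y x' y'} := takeuchiMul S T x y x' y'
  one := Ev.of S.one (λ_ (𝟙_ A)).inv T.one
  mul_act {x₁ x₂ y₁ y₂ x₁' x₂' y₁' y₂'} f g f' g' m m' := by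
    have h : (takeuchiMul S T x₁ y₁ x₁' y₁').compl₁₂ (Ev.map (M.rowMap f) (N.colMap g))
          (Ev.map (M.rowMap f') (N.colMap g')) =
        (takeuchiMul S T x₂ y₂ x₂' y₂').compr₂
          (Ev.map (M.rowMap (f ⊗ₘ f')) (N.colMap (g' ⊗ₘ g))) := by
      refine Ev.hom_ext fun {z w} a e b => Ev.hom_ext fun {z' w'} a' e' b' => ?_
      rw [LinearMap.compl₁₂_apply, LinearMap.compr₂_apply, Ev.map_of, Ev.map_of]
      refine (takeuchiMul_of _ _ _ _ _ _ _ _).trans ?_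
      rw [takeuchiMul_of, Ev.map_of]
      have h₁ := S.mul_act f (𝟙 z) f' (𝟙 z') a a'
      have h₂ := T.mul_act (𝟙 w) g (𝟙 w') g' b b'
      rw [id_tensorHom_id] at h₁ h₂
      exact congrArg₂ (Ev.of · _ ·) h₁ h₂
    have h' := congrArg (fun φ => φ m m') h
    exact (congrArg₂ (fun p q => takeuchiMul S T x₁ y₁ x₁' y₁' p q)
      (takeuchi_act M N f g m) (takeuchi_act M N f' g' m')).trans
      (h'.trans (takeuchi_act M N (f ⊗ₘ f') (g' ⊗ₘ g) _).symm)

end MulOne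

section Structure
variable {M : BiPsh.{w, u', v₁} k A} {N : BiPsh.{w, u', v₂} k A}

/-- The natural transformation `b ↦ [b, e', c]`. -/
noncomputable def trail {P : BiPsh.{w, u', v₃} k A} (y : A) {z' w' : A}
    (e' : 𝟙_ A ⟶ z' ⊗ w') (c : P.at w' y) : PshHom (N.col z') ((takeuchi N P).col y) where
  app x :=
    { toFun := fun b => Ev.of (F := N.row x) (G := P.col y) b e' c
      map_add' := fun _ _ => Ev.add_left _ _ _ _
      map_smul' := fun _ _ => Ev.smul_left _ _ _ _ }
  naturality f b := by
    rw [BiPsh.res_col, BiPsh.res_col]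
    have h := takeuchi_act_of N P f (𝟙 y) b e' c
    rw [BiPsh.act_id] at h
    exact h.symm

/-- The map `[a, e, b] ↦ [a, e, [b, e', c]]`. -/
noncomputable def takeuchiAssocAux {P : BiPsh.{w, u', v₃} k A} (x y : A) {z' w' : A}
    (e' : 𝟙_ A ⟶ z' ⊗ w') (c : P.at w' y) :
    Ev (M.row x) (N.col z') →ₗ[k] Ev (M.row x) ((takeuchi N P).col y) :=
  Ev.map (PshHom.id _) (trail y e' c)

lemma takeuchiAssocAux_of {P : BiPsh.{w, u', v₃} k A} (x y : A) {z w z' w' : A}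
    (a : M.at x z) (e : 𝟙_ A ⟶ z ⊗ w) (b : N.at w z') (e' : 𝟙_ A ⟶ z' ⊗ w') (c : P.at w' y) :
    takeuchiAssocAux x y e' c (Ev.of (F := M.row x) (G := N.col z') a e b) =
      Ev.of (F := M.row x) (G := (takeuchi N P).col y) a e
        (Ev.of (F := N.row w) (G := P.col y) b e' c) :=
  Ev.map_of _ _ _ _ _

/-- The associativity map of the Takeuchi product, `[[a, e, b], e', c] ↦ [a, e, [b, e', c]]`. -/
noncomputable def takeuchiAssoc (M : BiPsh.{w, u', v₁} k A) (N : BiPsh.{w, u', v₂} k A)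
    (P : BiPsh.{w, u', v₃} k A) (x y : A) :
    Ev ((takeuchi M N).row x) (P.col y) →ₗ[k] Ev (M.row x) ((takeuchi N P).col y) :=
  Ev.lift
    { fn := fun m e' c => takeuchiAssocAux x y e' c m
      add_left := fun _ _ _ _ => map_add _ _ _
      add_mid := fun {z' w'} m e₁ e₂ c => by
        have h : takeuchiAssocAux (M := M) (N := N) (P := P) x y (e₁ + e₂) c =
            takeuchiAssocAux x y e₁ c + takeuchiAssocAux x y e₂ c :=
          Ev.hom_ext fun a e b => by
            rw [LinearMap.add_apply, takeuchiAssocAux_of, takeuchiAssocAux_of,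
              takeuchiAssocAux_of]
            exact (congrArg (Ev.of a e ·) (Ev.add_mid _ _ _ _)).trans (Ev.add_right _ _ _ _)
        exact congrArg (· m) h
      add_right := fun {z' w'} m e' c₁ c₂ => by
        have h : takeuchiAssocAux (M := M) (N := N) (P := P) x y e' (c₁ + c₂) =
            takeuchiAssocAux x y e' c₁ + takeuchiAssocAux x y e' c₂ :=
          Ev.hom_ext fun a e b => by
            rw [LinearMap.add_apply, takeuchiAssocAux_of, takeuchiAssocAux_of,
              takeuchiAssocAux_of]
            exact (congrArg (Ev.of a e ·) (Ev.add_right _ _ _ _)).trans (Ev.add_right _ _ _ _)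
        exact congrArg (· m) h
      smul_left := fun _ _ _ _ => map_smul _ _ _
      smul_mid := fun {z' w'} r m e' c => by
        have h : takeuchiAssocAux (M := M) (N := N) (P := P) x y (r • e') c =
            r • takeuchiAssocAux x y e' c :=
          Ev.hom_ext fun a e b => by
            rw [LinearMap.smul_apply, takeuchiAssocAux_of, takeuchiAssocAux_of]
            exact (congrArg (Ev.of a e ·) (Ev.smul_mid _ _ _ _)).trans (Ev.smul_right _ _ _ _)
        exact congrArg (· m) h
      smul_right := fun {z' w'} r m e' c => by
        have h : takeuchiAssocAux (M := M) (N := N) (P := P) x y e' (r • c) =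
            r • takeuchiAssocAux x y e' c :=
          Ev.hom_ext fun a e b => by
            rw [LinearMap.smul_apply, takeuchiAssocAux_of, takeuchiAssocAux_of]
            exact (congrArg (Ev.of a e ·) (Ev.smul_right _ _ _ _)).trans (Ev.smul_right _ _ _ _)
        exact congrArg (· m) h
      bal_left := fun {z₁ z₂ w'} f m e' c => by
        have h : takeuchiAssocAux (M := M) (N := N) (P := P) x y e' c ∘ₗ
            Ev.map (M.rowMap (𝟙 x)) (N.colMap f) = takeuchiAssocAux x y (e' ≫ f ▷ w') c :=
          Ev.hom_ext fun {z w} a e b => by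
            rw [LinearMap.comp_apply, Ev.map_of, takeuchiAssocAux_of]
            rw [takeuchiAssocAux_of]
            refine congrArg₂ (Ev.of · e ·) (M.act_id a) ?_
            refine Eq.trans ?_ (Ev.bal_left _ _ _ _)
            exact congrArg (Ev.of · e' c) (BiPsh.res_row N f b).symm
        exact (congrArg (takeuchiAssocAux x y e' c) ((BiPsh.res_row _ f m).trans
          (takeuchi_act M N (𝟙 x) f m))).trans (congrArg (· m) h)
      bal_right := fun {z' w₁ w₂} f m e' c => by
        have h : takeuchiAssocAux (M := M) (N := N) (P := P) x y e' ((P.col y).res f c) =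
            takeuchiAssocAux x y (e' ≫ z' ◁ f) c :=
          Ev.hom_ext fun {z w} a e b => by
            rw [takeuchiAssocAux_of, takeuchiAssocAux_of]
            exact congrArg (Ev.of a e ·) (Ev.bal_right _ _ _ _)
        exact congrArg (· m) h }

/-- The composite `x ⟶ x ⊗ (z ⊗ w) ⟶ (x ⊗ z) ⊗ w ⟶ w`. -/
def contractLeft {x z w : A} (e : 𝟙_ A ⟶ z ⊗ w) (φ : x ⊗ z ⟶ 𝟙_ A) : x ⟶ w :=
  (ρ_ x).inv ≫ x ◁ e ≫ (α_ x z w).inv ≫ φ ▷ w ≫ (λ_ w).hom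

/-- The composite `y ⟶ (z ⊗ w) ⊗ y ⟶ z ⊗ (w ⊗ y) ⟶ z`. -/
def contractRight {y z w : A} (e : 𝟙_ A ⟶ z ⊗ w) (φ : w ⊗ y ⟶ 𝟙_ A) : y ⟶ z :=
  (λ_ y).inv ≫ e ▷ y ≫ (α_ z w y).hom ≫ z ◁ φ ≫ (ρ_ z).hom

/-- A natural transformation `M → 𝟙_×`, where `𝟙_× (x, y) = Hom (x ⊗ y, 𝟙)` is the unit of the
Takeuchi product. -/
structure Aug (M : BiPsh.{w, u', v₁} k A) where
  app (x y : A) : M.at x y →ₗ[k] (x ⊗ y ⟶ 𝟙_ A)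
  naturality {x x' y y' : A} (f : x ⟶ x') (g : y ⟶ y') (m : M.at x' y') :
    app x y (M.act f g m) = (f ⊗ₘ g) ≫ app x' y' m

end Structure
end TakeuchiMul

section Counits
variable {k : Type w} [Field k] {A : Type u'} [Category.{w} A] [Preadditive A] [Linear k A]

/-- Linearity of a functor of two contravariant variables, in each of its variables. -/
structure BiPsh.IsLinear (M : BiPsh.{w, u', v} k A) : Prop where
  act_add_left {x x' y y' : A} (f f' : x ⟶ x') (g : y ⟶ y') (m : M.at x' y') :
    M.act (f + f') g m = M.act f g m + M.act f' g m
  act_add_right {x x' y y' : A} (f : x ⟶ x') (g g' : y ⟶ y') (m : M.at x' y') :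
    M.act f (g + g') m = M.act f g m + M.act f g' m
  act_smul_left {x x' y y' : A} (r : k) (f : x ⟶ x') (g : y ⟶ y') (m : M.at x' y') :
    M.act (r • f) g m = r • M.act f g m
  act_smul_right {x x' y y' : A} (r : k) (f : x ⟶ x') (g : y ⟶ y') (m : M.at x' y') :
    M.act f (r • g) m = r • M.act f g m

variable [MonoidalCategory A]

lemma contractLeft_comp {x z w w' : A} (e : 𝟙_ A ⟶ z ⊗ w) (φ : x ⊗ z ⟶ 𝟙_ A) (g : w ⟶ w') :
    contractLeft (e ≫ z ◁ g) φ = contractLeft e φ ≫ g := by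
  simp only [contractLeft, Category.assoc, ← leftUnitor_naturality, ← whisker_exchange_assoc]
  simp

lemma contractRight_comp {y z z' w : A} (e : 𝟙_ A ⟶ z ⊗ w) (φ : w ⊗ y ⟶ 𝟙_ A) (f : z ⟶ z') :
    contractRight (e ≫ f ▷ w) φ = contractRight e φ ≫ f := by
  simp only [contractRight, Category.assoc, ← rightUnitor_naturality, whisker_exchange_assoc]
  simp

variable [MonoidalPreadditive A] [MonoidalLinear k A]
variable {M : BiPsh.{w, u', v₁} k A} {N : BiPsh.{w, u', v₂} k A}

/-- The map `M × N → 𝟙_× × N ≅ N` induced by an augmentation of `M`. -/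
noncomputable def Aug.counitLeft (ε : Aug M) (hN : N.IsLinear) (x y : A) :
    Ev (M.row x) (N.col y) →ₗ[k] N.at x y :=
  Ev.lift
    { fn := fun {z w} a e b => N.act (contractLeft e (ε.app x z a)) (𝟙 y) b
      add_left := fun a a' e b => by
        rw [← hN.act_add_left]; simp [contractLeft]
      add_mid := fun a e e' b => by
        rw [← hN.act_add_left]; simp [contractLeft]
      add_right := fun _ _ _ _ => map_add _ _ _
      smul_left := fun r a e b => by
        rw [← hN.act_smul_left]; simp [contractLeft]
      smul_mid := fun r a e b => by
        rw [← hN.act_smul_left]; simp [contractLeft]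
      smul_right := fun _ _ _ _ => map_smul _ _ _
      bal_left := fun {z z' w} f a e b => by
        have h := ε.naturality (𝟙 x) f a
        rw [BiPsh.res_row, h]
        simp [contractLeft]
      bal_right := fun {z w w'} g a e b => by
        rw [BiPsh.res_col, ← BiPsh.act_comp]
        rw [contractLeft_comp, Category.id_comp] }

/-- The map `M × N → M × 𝟙_× ≅ M` induced by an augmentation of `N`. -/
noncomputable def Aug.counitRight (ε : Aug N) (hM : M.IsLinear) (x y : A) :
    Ev (M.row x) (N.col y) →ₗ[k] M.at x y :=
  Ev.lift
    { fn := fun {z w} a e b => M.act (𝟙 x) (contractRight e (ε.app w y b)) a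
      add_left := fun _ _ _ _ => map_add _ _ _
      add_mid := fun a e e' b => by
        rw [← hM.act_add_right]; simp [contractRight]
      add_right := fun a e b b' => by
        rw [← hM.act_add_right]; simp [contractRight]
      smul_left := fun _ _ _ _ => map_smul _ _ _
      smul_mid := fun r a e b => by
        rw [← hM.act_smul_right]; simp [contractRight]
      smul_right := fun r a e b => by
        rw [← hM.act_smul_right]; simp [contractRight]
      bal_left := fun {z z' w} f a e b => by
        rw [BiPsh.res_row, ← BiPsh.act_comp]
        rw [contractRight_comp, Category.id_comp]
      bal_right := fun {z w w'} g a e b => by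
        have h := ε.naturality g (𝟙 y) b
        rw [BiPsh.res_col, h]
        simp [contractRight] }

/-- The axioms of a bialgebroid, for a comultiplication `Δ : M → M × M` and a counit `ε` on a
functor `M` with a multiplication and a unit: `Δ` is multiplicative, unital, coassociative and
counital. -/
structure IsCoring (S : MulOne M) (hM : M.IsLinear) (ε : Aug M)
    (Δ : BiPshHom M (takeuchi M M)) : Prop where
  map_mul {x y x' y' : A} (m : M.at x y) (m' : M.at x' y') :
    Δ.app _ _ (S.mul m m') = (S.takeuchi S).mul (Δ.app _ _ m) (Δ.app _ _ m')
  map_one : Δ.app _ _ S.one = (S.takeuchi S).one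
  coassoc {x y : A} (m : M.at x y) :
    takeuchiAssoc M M M x y (Ev.map (Δ.row x) (PshHom.id _) (Δ.app x y m)) =
      Ev.map (PshHom.id _) (Δ.col y) (Δ.app x y m)
  counit_left {x y : A} (m : M.at x y) : ε.counitLeft hM x y (Δ.app x y m) = m
  counit_right {x y : A} (m : M.at x y) : ε.counitRight hM x y (Δ.app x y m) = m

end Counits

section Comonads
variable (k : Type w) [Field k] {H : Type u'} [Category.{w} H] [Preadditive H] [Linear k H]

/-- A colimit-preserving `k`-linear lax monoidal comonad. -/
structure LaxMonoidalComonad (H : Type u') [Category.{w} H] [Preadditive H] [Linear k H]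
    [MonoidalCategory H] where
  toComonad : Comonad H
  [lax : toComonad.toFunctor.LaxMonoidal]
  [counit_monoidal : NatTrans.IsMonoidal toComonad.ε]
  [comul_monoidal : NatTrans.IsMonoidal toComonad.δ]
  [additive : toComonad.toFunctor.Additive]
  [linear : toComonad.toFunctor.Linear k]
  [cocontinuous : PreservesColimitsOfSize.{w, w} toComonad.toFunctor]

attribute [instance] LaxMonoidalComonad.lax

variable (P : ObjectProperty H)

/-- The presheaf `Hom (-, N)` on a full subcategory. -/
def homPsh (N : H) : Psh.{w, u', w} k P.FullSubcategory := P.ι.op ⋙ (linearYoneda k H).obj N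

variable {k P}

lemma homPsh_res (N : H) {x y : P.FullSubcategory} (f : x ⟶ y) (h : y.obj ⟶ N) :
    (homPsh k P N).res f h = (f.hom ≫ h : x.obj ⟶ N) := rfl

/-- Postcomposition with `g : N ⟶ N'`. -/
def homPshMap {N N' : H} (g : N ⟶ N') : PshHom (homPsh k P N) (homPsh k P N') where
  app x := Linear.rightComp k x.obj g
  naturality f h := Category.assoc f.hom h g

variable [MonoidalCategory H] [MonoidalPreadditive H] [MonoidalLinear k H] [P.IsMonoidal]

/-- The class `[b, e, h]` of `b : M (x, z)`, `e : 𝟙 ⟶ z ⊗ w` and `h : w ⟶ N` in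
`Hom (x, M × N)`. -/
noncomputable def actOf {M : BiPsh.{w, u', v} k P.FullSubcategory} {x z w : P.FullSubcategory}
    {N : H} (b : M.at x z) (e : 𝟙_ P.FullSubcategory ⟶ z ⊗ w) (h : w.obj ⟶ N) :
    Ev (M.row x) (homPsh k P N) :=
  Ev.of (F := M.row x) (G := homPsh k P N) b e h

/-- The natural map `b' ↦ θ [b', e, h]`, for `e : 𝟙 ⟶ z ⊗ w` and `h : w ⟶ N`. -/
noncomputable def actHom {M : BiPsh.{w, u', v} k P.FullSubcategory} {N N' : H}
    (θ : ∀ x : P.FullSubcategory, Ev (M.row x) (homPsh k P N) →ₗ[k] (x.obj ⟶ N'))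
    (hθ : ∀ {x x' : P.FullSubcategory} (f : x ⟶ x') (t : Ev (M.row x') (homPsh k P N)),
      θ x (Ev.map (M.rowMap f) (PshHom.id _) t) = f.hom ≫ θ x' t)
    {z w : P.FullSubcategory} (e : 𝟙_ P.FullSubcategory ⟶ z ⊗ w) (h : w.obj ⟶ N) :
    PshHom (M.col z) (homPsh k P N') where
  app x :=
    { toFun := fun b => θ x (actOf b e h)
      map_add' := fun _ _ => (congrArg (θ x) (Ev.add_left _ _ _ _)).trans (map_add (θ x) _ _)
      map_smul' := fun _ _ =>
        (congrArg (θ x) (Ev.smul_left _ _ _ _)).trans (map_smul (θ x) _ _) }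
  naturality {x x'} f b := by
    refine Eq.trans ?_ (hθ f _)
    refine congrArg (θ x) (Eq.trans ?_ (Ev.map_of _ _ _ _ _).symm)
    exact congrArg (fun c => actOf c e h) (BiPsh.res_col M f b)

/-- Let `M` be a functor of two contravariant variables with a multiplication, a unit, an
augmentation `ε` and a comultiplication `Δ`. A realization identifies the lax monoidal comonad `G`
with `M × (-)`: the object `M × N` is given on generators `x` by
`Hom (x, M × N) = ∫^{z, w} M (x, z) ⊗ Hom (𝟙, z ⊗ w) ⊗ Hom (w, N)`, that is,
`(M₁ ⊠ M₂) × N = Hom (𝟙, M₂ ⊗ N) ⊗ M₁`, and the structure maps of the lax monoidal comonad are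
those which are induced by the structure maps of `M`. -/
structure Realization {M : BiPsh.{w, u', v} k P.FullSubcategory} (S : MulOne M) (ε : Aug M)
    (Δ : BiPshHom M (takeuchi M M)) (G : LaxMonoidalComonad k H) where
  /-- The identification `Hom (x, M × N) ≅ Hom (x, G N)`. -/
  θ (x : P.FullSubcategory) (N : H) :
    Ev (M.row x) (homPsh k P N) ≃ₗ[k] (x.obj ⟶ G.toComonad.obj N)
  naturality_left {x x' : P.FullSubcategory} (f : x ⟶ x') (N : H)
    (t : Ev (M.row x') (homPsh k P N)) :
    θ x N (Ev.map (M.rowMap f) (PshHom.id _) t) = f.hom ≫ θ x' N t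
  naturality_right (x : P.FullSubcategory) {N N' : H} (g : N ⟶ N')
    (t : Ev (M.row x) (homPsh k P N)) :
    θ x N' (Ev.map (PshHom.id _) (homPshMap g) t) = θ x N t ≫ G.toComonad.map g
  /-- The counit of the comonad is `M × N → 𝟙_× × N ≅ N`. -/
  counit {x z w : P.FullSubcategory} {N : H} (b : M.at x z)
    (e : 𝟙_ P.FullSubcategory ⟶ z ⊗ w) (h : w.obj ⟶ N) :
    θ x N (actOf b e h) ≫ G.toComonad.ε.app N = (contractLeft e (ε.app x z b)).hom ≫ h
  /-- The comultiplication of the comonad is `M × N → (M × M) × N ≅ M × (M × N)`. -/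
  comul {x z w : P.FullSubcategory} {N : H} (b : M.at x z)
    (e : 𝟙_ P.FullSubcategory ⟶ z ⊗ w) (h : w.obj ⟶ N) :
    θ x N (actOf b e h) ≫ G.toComonad.δ.app N =
      θ x (G.toComonad.obj N)
        (Ev.map (F := M.row x) (G := M.col z) (PshHom.id _)
          (actHom (fun x => (θ x N).toLinearMap) (fun f t => naturality_left f N t) e h)
          (Δ.app x z b))
  /-- The unit of the lax monoidal structure is given by the unit of `M`. -/
  lax_unit : Functor.LaxMonoidal.ε G.toComonad.toFunctor =
    θ (𝟙_ P.FullSubcategory) (𝟙_ H)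
      (actOf S.one (λ_ (𝟙_ P.FullSubcategory)).inv (𝟙 (𝟙_ H)))
  /-- The tensorator of the lax monoidal structure is given by the multiplication of `M`:
  `[b, e, h] ⊗ [b', e', h'] ↦ [b * b', nest e e', h ⊗ h']`. -/
  lax_tensor {x z w x' z' w' : P.FullSubcategory} {N N' : H}
    (b : M.at x z) (e : 𝟙_ P.FullSubcategory ⟶ z ⊗ w) (h : w.obj ⟶ N)
    (b' : M.at x' z') (e' : 𝟙_ P.FullSubcategory ⟶ z' ⊗ w') (h' : w'.obj ⟶ N') :
    (θ x N (actOf b e h) ⊗ₘ θ x' N' (actOf b' e' h')) ≫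
        Functor.LaxMonoidal.μ G.toComonad.toFunctor N N' =
      θ (x ⊗ x') (N ⊗ N') (actOf (S.mul b b') (nest e e') (h ⊗ₘ h'))

end Comonads

section Algebras
variable {k : Type w} [Field k] {C : Type u} [Category.{w} C] [MonoidalCategory C]
  [Preadditive C] [Linear k C]

/-- An algebra in `C ⊗ C^{⊗op}`. The underlying object is represented by the functor
`A (x, y) = Hom (x ⊠ y, A)`: objects of the tensor product `C ⊗ C` of locally presentable
categories are the functors of two contravariant variables which are linear and limit-preserving
in each variable. -/
structure BiAlgebra (k : Type w) [Field k] (C : Type u) [Category.{w} C] [MonoidalCategory C]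
    [Preadditive C] [Linear k C] where
  A : BiPsh.{w, u, w} k C
  linear : A.IsLinear
  continuous_row (x : C) : PreservesLimitsOfSize.{w, w} (A.row x)
  continuous_col (y : C) : PreservesLimitsOfSize.{w, w} (A.col y)
  S : MulOne A
  mul_assoc {x₁ x₂ x₃ y₁ y₂ y₃ : C} (a₁ : A.at x₁ y₁) (a₂ : A.at x₂ y₂) (a₃ : A.at x₃ y₃) :
    S.mul (S.mul a₁ a₂) a₃ =
      A.act (α_ x₁ x₂ x₃).hom (α_ y₃ y₂ y₁).inv (S.mul a₁ (S.mul a₂ a₃))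
  one_mul {x y : C} (a : A.at x y) : S.mul S.one a = A.act (λ_ x).hom (ρ_ y).hom a
  mul_one {x y : C} (a : A.at x y) : S.mul a S.one = A.act (ρ_ x).hom (λ_ y).hom a

/-- A quantum moment map `σ : L ⊠ Lᵒᵖ ⟶ A`, where `σ` is viewed as an element of `A (L, L)`. -/
structure QuantumMomentMap (L : Center C) [MonObj L] (B : BiAlgebra k C) where
  σ : B.A.at (und L) (und L)
  map_one : B.A.act η[und L] η[und L] σ = B.S.one
  map_mul : B.A.act μ[und L] μ[und L] σ = B.S.mul σ σ
  central {x y : C} (a : B.A.at x y) :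
    B.S.mul a σ = B.A.act (tau L x).hom (tau L y).inv (B.S.mul σ a)

/-- The product on `D (x, y) = Hom (x ⊗ y, L)`:
`x ⊗ x' ⊗ y' ⊗ y ⟶ x ⊗ L ⊗ y ⟶ L ⊗ x ⊗ y ⟶ L ⊗ L ⟶ L`. -/
def heisenbergMul (L : Center C) [MonObj L] {x y x' y' : C} (φ : x ⊗ y ⟶ und L)
    (ψ : x' ⊗ y' ⟶ und L) : (x ⊗ x') ⊗ (y' ⊗ y) ⟶ und L :=
  (α_ x x' (y' ⊗ y)).hom ≫ x ◁ ((α_ x' y' y).inv ≫ ψ ▷ y) ≫ (α_ x (und L) y).inv ≫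
    (tau L x).hom ▷ y ≫ (α_ (und L) x y).hom ≫ und L ◁ φ ≫ μ[und L]

/-- A map of algebras `ε : B ⟶ D` compatible with the quantum moment maps, where `D` is the algebra
`D (x, y) = Hom (x ⊗ y, L)`, that is, `D = T^R (L)` for the tensor product functor
`T : C ⊗ C ⟶ C` and its right adjoint `T^R`. The quantum moment map of `D` corresponds to the
multiplication `L ⊗ L ⟶ L`. -/
structure HeisenbergMap (L : Center C) [MonObj L] (B : BiAlgebra k C)
    (m : QuantumMomentMap L B) where
  app (x y : C) : B.A.at x y →ₗ[k] (x ⊗ y ⟶ und L)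
  naturality {x x' y y' : C} (f : x ⟶ x') (g : y ⟶ y') (a : B.A.at x' y') :
    app x y (B.A.act f g a) = (f ⊗ₘ g) ≫ app x' y' a
  map_one : app (𝟙_ C) (𝟙_ C) B.S.one = (λ_ (𝟙_ C)).hom ≫ η[und L]
  map_mul {x y x' y' : C} (a : B.A.at x y) (a' : B.A.at x' y') :
    app _ _ (B.S.mul a a') = heisenbergMul L (app x y a) (app x' y' a')
  map_moment : app (und L) (und L) m.σ = μ[und L]

/-! ### Elements -/

variable {L : Center C} [MonObj L] {B : BiAlgebra k C}

lemma BiAlgebra.act_mul_left (B : BiAlgebra k C) {x₁ x₂ y₁ y₂ x y : C} (f : x₁ ⟶ x₂)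
    (g : y₁ ⟶ y₂) (a : B.A.at x₂ y₂) (a' : B.A.at x y) :
    B.S.mul (B.A.act f g a) a' = B.A.act (f ▷ x) (y ◁ g) (B.S.mul a a') := by
  have h := B.S.mul_act f g (𝟙 x) (𝟙 y) a a'
  rw [BiPsh.act_id, tensorHom_id, id_tensorHom] at h
  exact h

lemma BiAlgebra.act_mul_right (B : BiAlgebra k C) {x₁ x₂ y₁ y₂ x y : C} (f : x₁ ⟶ x₂)
    (g : y₁ ⟶ y₂) (a : B.A.at x y) (a' : B.A.at x₂ y₂) :
    B.S.mul a (B.A.act f g a') = B.A.act (x ◁ f) (g ▷ y) (B.S.mul a a') := by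
  have h := B.S.mul_act (𝟙 x) (𝟙 y) f g a a'
  rw [BiPsh.act_id, tensorHom_id, id_tensorHom] at h
  exact h

namespace QuantumMomentMap
variable [IsCommMonObj L] (m : QuantumMomentMap L B)

/-- The source map `s : L ⊠ 1 ⟶ A`. -/
def s : B.A.at (und L) (𝟙_ C) := B.A.act (𝟙 _) η[und L] m.σ

/-- The target map `t : 1 ⊠ L ⟶ A`. -/
def t : B.A.at (𝟙_ C) (und L) := B.A.act η[und L] (𝟙 _) m.σ

/-- The maps `P ⊠ Q ⟶ A` which are linear over `L ⊠ Lᵒᵖ`, where `L ⊠ Lᵒᵖ` acts on `A` by left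
multiplication along the quantum moment map, on `P` by the left action, and on `Q` by the right
action (which is a left action for the opposite tensor product). -/
def linearMaps (P Q : HC L) : Submodule k (B.A.at P.X Q.X) where
  carrier := {b | B.A.act (HC.lact P) (HC.ract Q) b = B.S.mul m.σ b}
  add_mem' {b b'} h h' := by
    simp only [Set.mem_ofPred_eq] at h h' ⊢
    rw [map_add, map_add, h, h']
  zero_mem' := by
    simp only [Set.mem_ofPred_eq]
    rw [map_zero, map_zero]
  smul_mem' r b h := by
    simp only [Set.mem_ofPred_eq] at h ⊢
    rw [map_smul, map_smul, h]

variable {m}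

lemma act_mem {P P' Q Q' : HC L} (f : P ⟶ P') (g : Q ⟶ Q') {b : B.A.at P'.X Q'.X}
    (hb : b ∈ m.linearMaps P' Q') : B.A.act f.hom g.hom b ∈ m.linearMaps P Q := by
  change B.A.act _ _ _ = B.S.mul _ _
  have hb' : B.A.act _ _ _ = B.S.mul _ _ := hb
  rw [← BiPsh.act_comp, HC.hom_lact, HC.hom_ract, BiPsh.act_comp, hb', B.act_mul_right]

variable (m)

/-- The object of `HC ⊗ HC^{⊗op}` underlying an algebra with a quantum moment map, as a functor
`B (P, Q) = Hom (P ⊠ Q, B)` of Harish-Chandra bimodules `P` and `Q`. -/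
def hcPsh : BiPsh.{w, max u w, w} k (HC L) :=
  BiPsh.mk' (fun P Q => m.linearMaps P Q)
    (fun {P P' Q Q'} f g => ((B.A.act f.hom g.hom).domRestrict (m.linearMaps P' Q')).codRestrict
      (m.linearMaps P Q) fun b => act_mem f g b.2)
    (fun b => Subtype.ext (B.A.act_id _))
    (fun f f' g g' b => Subtype.ext (by
      change B.A.act (f ≫ f').hom (g ≫ g').hom b.1 = _
      rw [Mod.comp_hom', Mod.comp_hom', BiPsh.act_comp]
      rfl))


/-! ### The multiplication -/

variable {m}

lemma act_lact {P Q : HC L} {b : B.A.at P.X Q.X} (hb : b ∈ m.linearMaps P Q) :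
    B.A.act (HC.lact P) (𝟙 Q.X) b = B.A.act (𝟙 _) (ρ_ Q.X).inv (B.S.mul m.s b) := by
  have hb' : B.A.act _ _ _ = B.S.mul _ _ := hb
  rw [s, B.act_mul_left, ← hb', ← BiPsh.act_comp, ← BiPsh.act_comp]
  simp [HC.ract_one]

lemma act_ract_right {P Q : HC L} {b : B.A.at P.X Q.X} (hb : b ∈ m.linearMaps P Q) :
    B.A.act (𝟙 P.X) (HC.ract Q) b = B.A.act (λ_ P.X).inv (𝟙 _) (B.S.mul m.t b) := by
  have hb' : B.A.act _ _ _ = B.S.mul _ _ := hb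
  rw [t, B.act_mul_left, ← hb', ← BiPsh.act_comp, ← BiPsh.act_comp]
  simp [HC.one_lact]

lemma act_ract {P Q : HC L} {b : B.A.at P.X Q.X} (hb : b ∈ m.linearMaps P Q) :
    B.A.act (HC.ract P) (𝟙 Q.X) b = B.A.act (𝟙 _) (λ_ Q.X).inv (B.S.mul b m.s) := by
  have hb' : B.A.act _ _ _ = B.S.mul _ _ := hb
  have h1 : (λ_ Q.X).inv ≫ η[und L] ▷ Q.X ≫ (tau L Q.X).inv = (ρ_ Q.X).inv ≫ Q.X ◁ η[und L] := by
    rw [← cancel_mono (tau L Q.X).hom]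
    simp [one_tau]
  have h2 : (ρ_ Q.X).inv ≫ Q.X ◁ η[und L] ≫ HC.ract Q = 𝟙 _ := by rw [HC.ract_one]; simp
  rw [s, B.act_mul_right, m.central, ← hb', ← BiPsh.act_comp, ← BiPsh.act_comp, ← BiPsh.act_comp]
  simp only [Category.assoc]
  rw [reassoc_of% h1, h2]
  simp [HC.ract]

lemma act_lact_right {P Q : HC L} {b : B.A.at P.X Q.X} (hb : b ∈ m.linearMaps P Q) :
    B.A.act (𝟙 P.X) (HC.lact Q) b = B.A.act (ρ_ P.X).inv (𝟙 _) (B.S.mul b m.t) := by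
  have hb' : B.A.act _ _ _ = B.S.mul _ _ := hb
  have h1 : (ρ_ P.X).inv ≫ P.X ◁ η[und L] ≫ (tau L P.X).hom = (λ_ P.X).inv ≫ η[und L] ▷ P.X := by
    simp [one_tau]
  have h2 : (λ_ P.X).inv ≫ η[und L] ▷ P.X ≫ HC.lact P = 𝟙 _ := by rw [HC.one_lact]; simp
  rw [t, B.act_mul_right, m.central, ← hb', ← BiPsh.act_comp, ← BiPsh.act_comp, ← BiPsh.act_comp]
  simp only [Category.assoc]
  rw [reassoc_of% h1, h2]
  simp [HC.ract]

/-- Compatibility of a product with the relation defining the relative tensor product in the first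
variable. -/
lemma mul_condition_left {P Q P' Q' : HC L} {b : B.A.at P.X Q.X} {b' : B.A.at P'.X Q'.X}
    (hb : b ∈ m.linearMaps P Q) (hb' : b' ∈ m.linearMaps P' Q') :
    B.A.act (HC.ract P ▷ P'.X) (𝟙 _) (B.S.mul b b') =
      B.A.act ((α_ _ _ _).hom ≫ P.X ◁ HC.lact P') (𝟙 _) (B.S.mul b b') := by
  have h1 := B.act_mul_left (HC.ract P) (𝟙 Q.X) b b'
  have h2 := B.act_mul_right (HC.lact P') (𝟙 Q'.X) b b'
  rw [act_ract hb, B.act_mul_left, B.mul_assoc, ← BiPsh.act_comp] at h1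
  rw [act_lact hb', B.act_mul_right] at h2
  simp only [MonoidalCategory.whiskerLeft_id, id_whiskerRight] at h1 h2
  rw [← h1]
  have h3 := B.A.act_comp (α_ P.X (und L) P'.X).hom (P.X ◁ HC.lact P') (𝟙 _) (𝟙 _)
    (B.S.mul b b')
  rw [Category.id_comp] at h3
  rw [h3, ← h2, ← BiPsh.act_comp]
  simp

/-- Compatibility of a product with the relation defining the relative tensor product in the second
variable. -/
lemma mul_condition_right {P Q P' Q' : HC L} {b : B.A.at P.X Q.X} {b' : B.A.at P'.X Q'.X}
    (hb : b ∈ m.linearMaps P Q) (hb' : b' ∈ m.linearMaps P' Q') :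
    B.A.act (𝟙 _) (HC.ract Q' ▷ Q.X) (B.S.mul b b') =
      B.A.act (𝟙 _) ((α_ _ _ _).hom ≫ Q'.X ◁ HC.lact Q) (B.S.mul b b') := by
  have h1 := B.act_mul_right (𝟙 P'.X) (HC.ract Q') b b'
  have h2 := B.act_mul_left (𝟙 P.X) (HC.lact Q) b b'
  rw [act_ract_right hb', B.act_mul_right] at h1
  rw [act_lact_right hb, B.act_mul_left, B.mul_assoc, ← BiPsh.act_comp] at h2
  simp only [MonoidalCategory.whiskerLeft_id, id_whiskerRight] at h1 h2
  rw [← h1]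
  have h3 := B.A.act_comp (𝟙 _) (𝟙 _) (α_ Q'.X (und L) Q.X).hom (Q'.X ◁ HC.lact Q)
    (B.S.mul b b')
  rw [Category.id_comp] at h3
  rw [h3, ← h2, ← BiPsh.act_comp]
  simp

end QuantumMomentMap
end Algebras

section Lifting
variable {k : Type w} [Field k] {C : Type u} [Category.{w} C]

/-- Limit-preserving presheaves turn epimorphisms into injections. -/
lemma Psh.res_injective (F : Psh.{w, u, w} k C) [PreservesLimitsOfSize.{w, w} F] {x y : C}
    (f : x ⟶ y) [Epi f] : Function.Injective (F.res f) := by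
  have : PreservesLimitsOfSize.{0, 0} F := preservesSmallestLimits_of_preservesLimits F
  exact (ModuleCat.mono_iff_injective _).1 (inferInstanceAs (Mono (F.map f.op)))

/-- Limit-preserving presheaves turn coequalizers into equalizers. -/
lemma Psh.exists_lift [HasCoequalizers C] (F : Psh.{w, u, w} k C) [PreservesLimitsOfSize.{w, w} F]
    {x y : C} (f g : x ⟶ y) (a : F.obj (op y)) (h : F.res f a = F.res g a) :
    ∃ c : F.obj (op (coequalizer f g)), F.res (coequalizer.π f g) c = a := by
  have : PreservesLimitsOfSize.{0, 0} F := preservesSmallestLimits_of_preservesLimits F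
  have w' : (coequalizer.π f g).op ≫ f.op = (coequalizer.π f g).op ≫ g.op := by
    rw [← op_comp, ← op_comp, coequalizer.condition]
  have l := isLimitForkMapOfIsLimit F w' (Cofork.isColimitOfπEquivIsLimitOp
    (coequalizer.π f g) (coequalizer.π f g) (coequalizer.condition f g) w' rfl
    (coequalizerIsCoequalizer f g))
  have hφ : ModuleCat.ofHom (LinearMap.toSpanSingleton k (F.obj (op y)) a) ≫ F.map f.op =
      ModuleCat.ofHom (LinearMap.toSpanSingleton k (F.obj (op y)) a) ≫ F.map g.op := by
    refine ModuleCat.hom_ext (LinearMap.ext_ring ?_)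
    change F.res f ((1 : k) • a) = F.res g ((1 : k) • a)
    rw [one_smul, h]
  obtain ⟨ψ, hψ⟩ := Fork.IsLimit.lift' l _ hφ
  refine ⟨ψ.hom (1 : k), ?_⟩
  have h1 := congrArg (fun χ => χ.hom (1 : k)) hψ
  refine Eq.trans ?_ (h1.trans (one_smul k a))
  rfl

end Lifting

section TensorCocontinuous

/-- A monoidal category in which the tensor product preserves colimits in each variable. -/
class TensorCocontinuous (C : Type u) [Category.{w} C] [MonoidalCategory C] : Prop where
  left (X : C) : PreservesColimitsOfSize.{w, w} (tensorLeft X)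
  right (X : C) : PreservesColimitsOfSize.{w, w} (tensorRight X)

variable {C : Type u} [Category.{w} C] [MonoidalCategory C] [TensorCocontinuous C]

instance (X : C) : PreservesColimitsOfSize.{0, 0} (tensorLeft X) :=
  have := TensorCocontinuous.left X
  preservesSmallestColimits_of_preservesColimits _

instance (X : C) : PreservesColimitsOfSize.{0, 0} (tensorRight X) :=
  have := TensorCocontinuous.right X
  preservesSmallestColimits_of_preservesColimits _

end TensorCocontinuous

section HCAlgebra
variable {k : Type w} [Field k] {C : Type u} [Category.{w} C] [MonoidalCategory C]
  [Preadditive C] [Linear k C] {L : Center C} [MonObj L] [IsCommMonObj L] {B : BiAlgebra k C}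

lemma BiAlgebra.act_injective (B : BiAlgebra k C) {x x' y y' : C} (f : x ⟶ x') (g : y ⟶ y')
    [Epi f] [Epi g] : Function.Injective (B.A.act f g) := by
  have := B.continuous_row x
  have := B.continuous_col y'
  exact (Psh.res_injective _ g).comp (Psh.res_injective _ f)

variable [HasCoequalizers C] [TensorCocontinuous C]

instance (M N : HC L) : Epi (und L ◁ HC.proj M N) :=
  inferInstanceAs (Epi ((tensorLeft (und L)).map (HC.proj M N)))

namespace QuantumMomentMap
variable {m : QuantumMomentMap L B}

lemma exists_lift_left (B : BiAlgebra k C) {P P' : HC L} {y : C} (a : B.A.at (P.X ⊗ P'.X) y)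
    (h : B.A.act (HC.ract P ▷ P'.X) (𝟙 y) a =
      B.A.act ((α_ _ _ _).hom ≫ P.X ◁ HC.lact P') (𝟙 y) a) :
    ∃ c : B.A.at (HC.tensorObj P P').X y, B.A.act (HC.proj P P') (𝟙 y) c = a := by
  have := B.continuous_col y
  rw [← BiPsh.res_col, ← BiPsh.res_col] at h
  obtain ⟨c, hc⟩ := Psh.exists_lift (B.A.col y) _ _ a h
  exact ⟨c, (BiPsh.res_col B.A (HC.proj P P') c).symm.trans hc⟩

lemma exists_lift_right (B : BiAlgebra k C) {Q' Q : HC L} {x : C} (a : B.A.at x (Q'.X ⊗ Q.X))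
    (h : B.A.act (𝟙 x) (HC.ract Q' ▷ Q.X) a =
      B.A.act (𝟙 x) ((α_ _ _ _).hom ≫ Q'.X ◁ HC.lact Q) a) :
    ∃ c : B.A.at x (HC.tensorObj Q' Q).X, B.A.act (𝟙 x) (HC.proj Q' Q) c = a := by
  have := B.continuous_row x
  rw [← BiPsh.res_row, ← BiPsh.res_row] at h
  obtain ⟨c, hc⟩ := Psh.exists_lift (B.A.row x) _ _ a h
  exact ⟨c, (BiPsh.res_row B.A (HC.proj Q' Q) c).symm.trans hc⟩

lemma exists_mul {P Q P' Q' : HC L} {b : B.A.at P.X Q.X} {b' : B.A.at P'.X Q'.X}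
    (hb : b ∈ m.linearMaps P Q) (hb' : b' ∈ m.linearMaps P' Q') :
    ∃ c : B.A.at (HC.tensorObj P P').X (HC.tensorObj Q' Q).X,
      B.A.act (HC.proj P P') (HC.proj Q' Q) c = B.S.mul b b' := by
  obtain ⟨c₁, hc₁⟩ := exists_lift_left B _ (mul_condition_left hb hb')
  have aux {z : C} (g : z ⟶ Q'.X ⊗ Q.X) :
      B.A.act (HC.proj P P') (𝟙 _) (B.A.act (𝟙 (HC.tensorObj P P').X) g c₁) =
        B.A.act (𝟙 _) g (B.S.mul b b') := by
    rw [← hc₁, ← BiPsh.act_comp, ← BiPsh.act_comp]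
    simp only [Category.id_comp, Category.comp_id]
  have key : B.A.act (𝟙 (HC.tensorObj P P').X) (HC.ract Q' ▷ Q.X) c₁ =
      B.A.act (𝟙 (HC.tensorObj P P').X) ((α_ _ _ _).hom ≫ Q'.X ◁ HC.lact Q) c₁ :=
    B.act_injective (HC.proj P P') (𝟙 _)
      ((aux _).trans ((mul_condition_right hb hb').trans (aux _).symm))
  obtain ⟨c, hc⟩ := exists_lift_right B _ key
  refine ⟨c, ?_⟩
  rw [← hc₁, ← hc, ← BiPsh.act_comp]
  simp only [Category.id_comp, Category.comp_id]

/-- The product `P ⊗_L P' ⊠ Q' ⊗_L Q ⟶ B` of linear maps `P ⊠ Q ⟶ B` and `P' ⊠ Q' ⟶ B`: the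
map through which `P ⊗ P' ⊠ Q' ⊗ Q ⟶ B ⊗ B ⟶ B` factors. -/
noncomputable def mulAux {P Q P' Q' : HC L} (b : m.linearMaps P Q) (b' : m.linearMaps P' Q') :
    B.A.at (P ⊗ P').X (Q' ⊗ Q).X :=
  (exists_mul b.2 b'.2).choose

lemma act_mulAux {P Q P' Q' : HC L} (b : m.linearMaps P Q) (b' : m.linearMaps P' Q') :
    B.A.act (HC.proj P P') (HC.proj Q' Q) (mulAux b b') = B.S.mul b.1 b'.1 :=
  (exists_mul b.2 b'.2).choose_spec

lemma ext_proj {P Q P' Q' : HC L} {c c' : B.A.at (P ⊗ P').X (Q' ⊗ Q).X}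
    (h : B.A.act (HC.proj P P') (HC.proj Q' Q) c = B.A.act (HC.proj P P') (HC.proj Q' Q) c') :
    c = c' :=
  B.act_injective (HC.proj P P') (HC.proj Q' Q) h

lemma mulAux_mem {P Q P' Q' : HC L} (b : m.linearMaps P Q) (b' : m.linearMaps P' Q') :
    mulAux b b' ∈ m.linearMaps (P ⊗ P') (Q' ⊗ Q) := by
  change B.A.act (HC.lact (HC.tensorObj P P')) (HC.ract (HC.tensorObj Q' Q)) _ =
    B.S.mul _ _
  refine B.act_injective (und L ◁ HC.proj P P') (HC.proj Q' Q ▷ und L) ?_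
  have hb : B.A.act _ _ _ = B.S.mul _ _ := b.2
  have h1 := B.act_mul_right (HC.proj P P') (HC.proj Q' Q) m.σ (mulAux b b')
  rw [act_mulAux] at h1
  refine Eq.trans ?_ h1
  have h2 := B.mul_assoc m.σ b.1 b'.1
  rw [← hb, B.act_mul_left] at h2
  refine (B.A.act_comp _ _ _ _ _).symm.trans ?_
  rw [HC.proj_lact, HC.proj_ract]
  have h3 := B.A.act_comp ((α_ (und L) P.X P'.X).inv ≫ HC.lact P ▷ P'.X) (HC.proj P P')
    ((α_ Q'.X Q.X (und L)).hom ≫ Q'.X ◁ HC.ract Q) (HC.proj Q' Q) (mulAux b b')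
  simp only [Category.assoc] at h3
  refine h3.trans ?_
  rw [act_mulAux, BiPsh.act_comp, h2, ← BiPsh.act_comp]
  simp [BiPsh.act_id]

/-- The product of linear maps. -/
noncomputable def hcMul (m : QuantumMomentMap L B) (P Q P' Q' : HC L) : m.linearMaps P Q →ₗ[k]
    m.linearMaps P' Q' →ₗ[k] m.linearMaps (P ⊗ P') (Q' ⊗ Q) :=
  LinearMap.mk₂ k (fun b b' => ⟨mulAux b b', mulAux_mem b b'⟩)
    (fun _ _ _ => Subtype.ext (ext_proj (by
      rw [Submodule.coe_add, map_add]
      simp only [act_mulAux, Submodule.coe_add, map_add, LinearMap.add_apply])))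
    (fun _ _ _ => Subtype.ext (ext_proj (by
      rw [Submodule.coe_smul, map_smul]
      simp only [act_mulAux, Submodule.coe_smul, map_smul, LinearMap.smul_apply])))
    (fun _ _ _ => Subtype.ext (ext_proj (by
      rw [Submodule.coe_add, map_add]
      simp only [act_mulAux, Submodule.coe_add, map_add])))
    (fun _ _ _ => Subtype.ext (ext_proj (by
      rw [Submodule.coe_smul, map_smul]
      simp only [act_mulAux, Submodule.coe_smul, map_smul])))

lemma act_hcMul {P Q P' Q' : HC L} (b : m.linearMaps P Q) (b' : m.linearMaps P' Q') :
    B.A.act (HC.proj P P') (HC.proj Q' Q) (m.hcMul P Q P' Q' b b').1 = B.S.mul b.1 b'.1 :=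
  act_mulAux b b'

lemma σ_mem (m : QuantumMomentMap L B) : m.σ ∈ m.linearMaps (𝟙_ (HC L)) (𝟙_ (HC L)) := by
  have h : HC.ract (Mod.regular (und L)) = μ[und L] := tau_mul L
  change B.A.act μ[und L] (HC.ract (Mod.regular (und L))) m.σ = _
  rw [h]
  exact m.map_mul

lemma hcPsh_act {P P' Q Q' : HC L} (f : P ⟶ P') (g : Q ⟶ Q') (b : m.linearMaps P' Q') :
    m.hcPsh.act f g b = (⟨B.A.act f.hom g.hom b.1, act_mem f g b.2⟩ : m.linearMaps P Q) := by
  refine Subtype.ext ?_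
  refine (B.A.act_comp (𝟙 P.X) f.hom g.hom (𝟙 Q'.X) b.1).symm.trans ?_
  simp

/-- The algebra structure in `HC ⊗ HC^{⊗op}` of an algebra with a quantum moment map. -/
noncomputable def hcMulOne (m : QuantumMomentMap L B) : MulOne m.hcPsh where
  mul {P Q P' Q'} := m.hcMul P Q P' Q'
  one := (⟨m.σ, m.σ_mem⟩ : m.linearMaps (𝟙_ (HC L)) (𝟙_ (HC L)))
  mul_act {P₁ P₂ Q₁ Q₂ P₁' P₂' Q₁' Q₂'} f g f' g' b b' := by
    refine (congrArg₂ (fun c c' => m.hcMul P₁ Q₁ P₁' Q₁' c c')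
      (hcPsh_act f g b) (hcPsh_act f' g' b')).trans ?_
    refine Eq.trans ?_ (hcPsh_act (f ⊗ₘ f') (g' ⊗ₘ g) (m.hcMul P₂ Q₂ P₂' Q₂' b b')).symm
    refine Subtype.ext (ext_proj ?_)
    refine (act_hcMul _ _).trans ?_
    refine (B.S.mul_act f.hom g.hom f'.hom g'.hom b.1 b'.1).trans ?_
    refine Eq.trans ?_ (B.A.act_comp _ _ _ _ _)
    rw [HC.proj_tensorHom, HC.proj_tensorHom, BiPsh.act_comp]
    exact congrArg _ (act_hcMul b b').symm

lemma hcPsh_isLinear [MonoidalPreadditive C] [MonoidalLinear k C] (m : QuantumMomentMap L B) :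
    m.hcPsh.IsLinear where
  act_add_left f f' g b := by
    refine (hcPsh_act _ _ b).trans (Eq.trans ?_
      (congrArg₂ (· + ·) (hcPsh_act f g b) (hcPsh_act f' g b)).symm)
    exact Subtype.ext (B.linear.act_add_left f.hom f'.hom g.hom b.1)
  act_add_right f g g' b := by
    refine (hcPsh_act _ _ b).trans (Eq.trans ?_
      (congrArg₂ (· + ·) (hcPsh_act f g b) (hcPsh_act f g' b)).symm)
    exact Subtype.ext (B.linear.act_add_right f.hom g.hom g'.hom b.1)
  act_smul_left r f g b := by
    refine (hcPsh_act _ _ b).trans (Eq.trans ?_ (congrArg (r • ·) (hcPsh_act f g b)).symm)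
    exact Subtype.ext (B.linear.act_smul_left r f.hom g.hom b.1)
  act_smul_right r f g b := by
    refine (hcPsh_act _ _ b).trans (Eq.trans ?_ (congrArg (r • ·) (hcPsh_act f g b)).symm)
    exact Subtype.ext (B.linear.act_smul_right r f.hom g.hom b.1)

end QuantumMomentMap

namespace HeisenbergMap
variable {m : QuantumMomentMap L B} (ε : HeisenbergMap L B m)

lemma app_s : ε.app (und L) (𝟙_ C) m.s = (ρ_ (und L)).hom := by
  rw [QuantumMomentMap.s, ε.naturality, ε.map_moment, id_tensorHom, MonObj.mul_one]

lemma app_t : ε.app (𝟙_ C) (und L) m.t = (λ_ (und L)).hom := by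
  rw [QuantumMomentMap.t, ε.naturality, ε.map_moment, tensorHom_id, MonObj.one_mul]

lemma app_condition {P Q : HC L} {b : B.A.at P.X Q.X} (hb : b ∈ m.linearMaps P Q) :
    HC.ract P ▷ Q.X ≫ ε.app P.X Q.X b =
      ((α_ _ _ _).hom ≫ P.X ◁ HC.lact Q) ≫ ε.app P.X Q.X b := by
  have h1 := ε.naturality (HC.ract P) (𝟙 Q.X) b
  have h2 := ε.naturality (𝟙 P.X) (HC.lact Q) b
  rw [QuantumMomentMap.act_ract hb, ε.naturality, ε.map_mul, app_s, tensorHom_id] at h1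
  rw [QuantumMomentMap.act_lact_right hb, ε.naturality, ε.map_mul, app_t, id_tensorHom] at h2
  rw [← h1, Category.assoc, ← h2]
  simp [heisenbergMul]

lemma app_lact {P Q : HC L} {b : B.A.at P.X Q.X} (hb : b ∈ m.linearMaps P Q) :
    (α_ _ _ _).inv ≫ HC.lact P ▷ Q.X ≫ ε.app P.X Q.X b = und L ◁ ε.app P.X Q.X b ≫ μ[und L] := by
  have h1 := ε.naturality (HC.lact P) (𝟙 Q.X) b
  rw [QuantumMomentMap.act_lact hb, ε.naturality, ε.map_mul, app_s, tensorHom_id] at h1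
  rw [← h1]
  simp [heisenbergMul, tau_mul]

/-- The underlying map `P ⊗_L Q ⟶ L` in `C` induced by `ε (b) : P ⊗ Q ⟶ L`. -/
noncomputable def hcDesc {P Q : HC L} (b : m.linearMaps P Q) :
    (HC.tensorObj P Q).X ⟶ und L :=
  HC.desc (ε.app P.X Q.X b.1) (ε.app_condition b.2)

lemma proj_hcDesc {P Q : HC L} (b : m.linearMaps P Q) :
    HC.proj P Q ≫ ε.hcDesc b = ε.app P.X Q.X b.1 :=
  HC.proj_desc _ _

lemma hcDesc_lact {P Q : HC L} (b : m.linearMaps P Q) :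
    HC.lact (HC.tensorObj P Q) ≫ ε.hcDesc b = und L ◁ ε.hcDesc b ≫ μ[und L] := by
  refine (cancel_epi (und L ◁ HC.proj P Q)).1 ?_
  rw [reassoc_of% HC.proj_lact, ε.proj_hcDesc, ε.app_lact b.2, ← whiskerLeft_comp_assoc,
    ε.proj_hcDesc]

/-- The map of Harish-Chandra bimodules `P ⊗_L Q ⟶ L` induced by `ε (b) : P ⊗ Q ⟶ L`. -/
noncomputable def hcApp {P Q : HC L} (b : m.linearMaps P Q) : P ⊗ Q ⟶ 𝟙_ (HC L) :=
  HC.mkHom (M := HC.tensorObj P Q) (N := Mod.regular (und L)) (ε.hcDesc b) (ε.hcDesc_lact b)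

lemma proj_hcApp {P Q : HC L} (b : m.linearMaps P Q) :
    HC.proj P Q ≫ (ε.hcApp b).hom = ε.app P.X Q.X b.1 :=
  ε.proj_hcDesc b

lemma hc_hom_ext {P Q : HC L} {f g : P ⊗ Q ⟶ 𝟙_ (HC L)}
    (h : HC.proj P Q ≫ f.hom = HC.proj P Q ≫ g.hom) : f = g :=
  Mod.hom_ext _ _ ((cancel_epi (HC.proj P Q)).1 h)

variable [MonoidalPreadditive C] [MonoidalLinear k C]

/-- The linear map `b ↦ ε.hcApp b`. -/
noncomputable def hcLin (P Q : HC L) : m.linearMaps P Q →ₗ[k] (P ⊗ Q ⟶ 𝟙_ (HC L)) where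
  toFun b := ε.hcApp b
  map_add' b b' := hc_hom_ext (by
    rw [proj_hcApp, HC.add_hom, Preadditive.comp_add, proj_hcApp, proj_hcApp]
    exact map_add _ _ _)
  map_smul' r b := hc_hom_ext (by
    rw [proj_hcApp, RingHom.id_apply, HC.smul_hom, Linear.comp_smul, proj_hcApp]
    exact map_smul _ _ _)

/-- The counit, as a map `B ⟶ D` in `HC ⊗ HC^{⊗op}`, where `D (P, Q) = Hom (P ⊗_L Q, L)`. -/
noncomputable def hcAug : Aug m.hcPsh where
  app P Q := ε.hcLin P Q
  naturality {P P' Q Q'} f g b := by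
    refine (congrArg (fun c => ε.hcApp (P := P) (Q := Q) c)
      (QuantumMomentMap.hcPsh_act f g b)).trans (hc_hom_ext ?_)
    refine (ε.proj_hcApp _).trans ((ε.naturality f.hom g.hom b.1).trans ?_)
    rw [Mod.comp_hom', ← Category.assoc, HC.proj_tensorHom, Category.assoc]
    exact congrArg _ (ε.proj_hcApp b).symm

end HeisenbergMap
end HCAlgebra

section Restriction
variable {k : Type w} [Field k] {H : Type u'} [Category.{w} H] (P : ObjectProperty H)

/-- Restriction of a functor of two contravariant variables to a full subcategory. -/
def BiPsh.restrict (M : BiPsh.{w, u', v} k H) : BiPsh.{w, u', v} k P.FullSubcategory :=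
  P.ι.op ⋙ M ⋙ (Functor.whiskeringLeft _ _ _).obj P.ι.op

variable {P}

lemma BiPsh.restrict_act (M : BiPsh.{w, u', v} k H) {x x' y y' : P.FullSubcategory} (f : x ⟶ x')
    (g : y ⟶ y') (m : M.at x'.obj y'.obj) :
    (M.restrict P).act f g m = M.act f.hom g.hom m := rfl

lemma BiPsh.IsLinear.restrict [Preadditive H] [Linear k H] {M : BiPsh.{w, u', v} k H}
    (h : M.IsLinear) : (M.restrict P).IsLinear where
  act_add_left f f' g m := h.act_add_left f.hom f'.hom g.hom m
  act_add_right f g g' m := h.act_add_right f.hom g.hom g'.hom m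
  act_smul_left r f g m := h.act_smul_left r f.hom g.hom m
  act_smul_right r f g m := h.act_smul_right r f.hom g.hom m

variable [MonoidalCategory H] [P.IsMonoidal]

/-- Restriction of a multiplication and a unit to a full monoidal subcategory. -/
def MulOne.restrict {M : BiPsh.{w, u', v} k H} (S : MulOne M) : MulOne (M.restrict P) where
  mul {x y x' y'} := S.mul (x := x.obj) (y := y.obj) (x' := x'.obj) (y' := y'.obj)
  one := S.one
  mul_act f g f' g' m m' := S.mul_act f.hom g.hom f'.hom g'.hom m m'

/-- Restriction of an augmentation to a full monoidal subcategory. -/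
def Aug.restrict [Preadditive H] [Linear k H] {M : BiPsh.{w, u', v} k H} (ε : Aug M) :
    Aug (M.restrict P) where
  app x y :=
    { toFun := fun m => ObjectProperty.homMk (ε.app x.obj y.obj m)
      map_add' := fun m m' => ObjectProperty.hom_ext _ (map_add (ε.app x.obj y.obj) m m')
      map_smul' := fun r m => ObjectProperty.hom_ext _ (map_smul (ε.app x.obj y.obj) r m) }
  naturality f g m := ObjectProperty.hom_ext _ (ε.naturality f.hom g.hom m)

end Restriction

section Rigidity
variable (k : Type w) [Field k] {C : Type u} [Category.{w} C] [Preadditive C] [Linear k C]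

/-- An object `x` is compact projective if `Hom (x, -)`, as a functor to vector spaces, preserves
colimits. -/
def compactProjective : ObjectProperty C :=
  fun x => PreservesColimitsOfSize.{w, w} ((linearCoyoneda k C).obj (op x))

variable (C) in
/-- A cp-rigid monoidal category: there are enough compact projective objects, and all of them are
left and right dualizable. -/
structure IsCpRigid [MonoidalCategory C] : Prop where
  enough : (compactProjective k (C := C)).IsStrongGenerator
  leftDual (x : C) (hx : compactProjective k x) : Nonempty (HasLeftDual x)
  rightDual (x : C) (hx : compactProjective k x) : Nonempty (HasRightDual x)

end Rigidity

/-- Locally presentable categories are cocomplete. -/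
instance (C : Type u) [Category.{w} C] [IsLocallyPresentable.{w} C] : HasCoequalizers C := by
  obtain ⟨κ, _, _⟩ := IsLocallyPresentable.exists_cardinal.{w} C
  have : HasColimitsOfSize.{0, 0} C := hasColimitsOfSizeShrink.{0, 0, w, w} C
  infer_instance

section Bialgebroids
variable (k : Type w) [Field k] {C : Type u} [Category.{w} C] [Preadditive C] [Linear k C]
  [MonoidalCategory C]

/-- The free left `L`-module `L ⊗ V`. -/
def HC.free (L : Center C) [MonObj L] (V : C) : HC L where
  X := und L ⊗ V
  mod :=
    { smul := (α_ (und L) (und L) V).inv ≫ μ[und L] ▷ V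
      one_smul := by
        have h : η[und L] ▷ (und L ⊗ V) ≫ (α_ (und L) (und L) V).inv ≫ μ[und L] ▷ V =
            (λ_ (und L ⊗ V)).hom := by
          rw [associator_inv_naturality_left_assoc, ← comp_whiskerRight, MonObj.one_mul]
          simp
        exact h
      mul_smul := by
        have h : μ[und L] ▷ (und L ⊗ V) ≫ (α_ (und L) (und L) V).inv ≫ μ[und L] ▷ V =
            (α_ (und L) (und L) (und L ⊗ V)).hom ≫
              und L ◁ ((α_ (und L) (und L) V).inv ≫ μ[und L] ▷ V) ≫
                (α_ (und L) (und L) V).inv ≫ μ[und L] ▷ V := by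
          rw [associator_inv_naturality_left_assoc, ← comp_whiskerRight, MonObj.mul_assoc]
          simp
        exact h }

variable [HasCoequalizers C] [TensorCocontinuous C]

/-- The closure of the free modules `L ⊗ V` on compact projective objects `V` under the monoidal
structure of `HC`. These are compact projective generators of `HC`, so that an object `M` of
`HC ⊗ HC` is determined by the linear functor `M (x, y) = Hom (x ⊠ y, M)` of these. -/
inductive generators (L : Center C) [MonObj L] [IsCommMonObj L] : ObjectProperty (HC L)
  | free (V : C) (hV : compactProjective k V) : generators L (HC.free L V)
  | unit : generators L (𝟙_ (HC L))
  | tensor (M N : HC L) (hM : generators L M) (hN : generators L N) : generators L (M ⊗ N)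

instance (L : Center C) [MonObj L] [IsCommMonObj L] : (generators k L).IsMonoidal where
  prop_unit := .unit
  prop_tensor M N hM hN := .tensor M N hM hN

variable [MonoidalPreadditive C] [MonoidalLinear k C]

/-- A Harish-Chandra bialgebroid. -/
structure HCBialgebroid (L : Center C) [MonObj L] [IsCommMonObj L] where
  /-- The algebra in `C ⊗ C^{⊗op}`. -/
  B : BiAlgebra k C
  /-- The quantum moment map `s ⊗ t : L ⊠ Lᵒᵖ ⟶ B`. -/
  moment : QuantumMomentMap L B
  /-- The counit `B ⟶ D`. -/
  ε : HeisenbergMap L B moment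
  /-- The comultiplication `B ⟶ B ×_L B`, where `B` is regarded as an object of
  `HC ⊗ HC^{⊗op}`. -/
  Δ : BiPshHom (moment.hcPsh.restrict (generators k L))
    (takeuchi (moment.hcPsh.restrict (generators k L)) (moment.hcPsh.restrict (generators k L)))
  isCoring : IsCoring (moment.hcMulOne.restrict (P := generators k L))
    (moment.hcPsh_isLinear.restrict (P := generators k L)) ε.hcAug.restrict Δ

/-- Identifications of a colimit-preserving lax monoidal comonad with `B ×_L (-)`. -/
abbrev HCBialgebroid.Realization {L : Center C} [MonObj L] [IsCommMonObj L]
    (B : HCBialgebroid k L) (G : LaxMonoidalComonad k (HC L)) :=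
  HarishChandra.Realization (B.moment.hcMulOne.restrict (P := generators k L))
    B.ε.hcAug.restrict B.Δ G

end Bialgebroids

end HarishChandra

/-! An object `M` of `HC ⊗ HC` is recorded by the functor `M (x, y) = Hom (x ⊠ y, M)`. The theorem
is a form of the equivalence between objects of `HC ⊗ HC` and colimit-preserving functors `HC ⟶ HC`,
under which the Takeuchi product becomes composition. Rigidity is what makes it true. Up to
isomorphism the generators of `HC` are the free modules `L ⊗ V` on compact projective `V`; they are
compact projective, dense, closed under `⊗_L`, and have duals on both sides. The maps from a
generator `x` to `M × N` are classes `[b, e, h]` with `b : M (x, z)`, `e : 𝟙 ⟶ z ⊗ w` and `h : w ⟶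
N`. When `e` is a coevaluation, `b ↦ [b, e, 𝟙]` identifies `M (x, z)` with `Hom (x, M × w)`. Through
this dictionary the counit, the comultiplication and the multiplication of a bialgebroid are the
counit, the comultiplication and the tensorator of a lax monoidal comonad.

From bialgebroids to comonads: a linear, essentially small presheaf on the generators is represented
by a cokernel of coproducts of generators (`Generating.exists_pres`), so `M × N` exists as an
object. All structure maps are defined on classes, and each law is checked on classes, where it is
one axiom of `IsCoring`, `MulOne.IsMonoid` or `Aug.IsMul` together with planar coherence for nested
coevaluations. Colimits are preserved because `Hom (w, -)` preserves them for every generator `w`.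
The result is `exists_realization`. It is applied to the functor `hcPsh` of a bialgebroid, whose
algebra laws follow from centrality of the moment map (`hcMulOne_isMonoid`, `hcAug_isMul`).

From comonads to bialgebroids: for dualizable `y` with dual `w` the value `B (x, y)` has to be `Hom
(x, T w)`, where `T` is the functor underlying the comonad. The algebra must however be defined, and
continuous, on all objects. The definition which makes sense for every `y` is that of an operator: a
family `x ⊗ T (y ⊗ N) ⟶ T N`, natural in `N` and linear over the lax structure of `T`, together with
a map `φ : x ⊗ y ⟶ 𝟙` compatible with it through the counit. The map `φ` belongs to the data because
the family need not determine it when `y` has no dual. Operators compose, so they form an algebra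
with an augmentation; they glue along colimits because `T` and `⊗` are cocontinuous; and evaluation
at a coevaluation is a bijection onto `Hom (x, T w)` (`evalMap_bijective`).

Pulling this algebra back along the free module functor, which is strong monoidal, gives an algebra
in `C ⊗ C^{⊗op}`. Its moment map is the pullback of the unit along `L ⊗ L ⟶ L`, viewed as a map from
the free module on `L` to the unit of `HC`. Nothing is lost, because every module `P` is a
coequalizer of free modules by its action map (`hcEquiv`). Finally the bijections `θ_bijective`,
`ev₂_bijective` and the injection `ev₃_injective` transport the comultiplication of the comonad, and
its laws, to `Δ`. -/

namespace HarishChandra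

/-! ### Density of compact projective generators -/

section Density
variable {k : Type w} [Field k] {H : Type u'} [Category.{w} H] [Preadditive H] [Linear k H]

/-- An essentially small full subcategory of compact projective objects which jointly detect
isomorphisms. -/
structure Generating (k : Type w) [Field k] {H : Type u'} [Category.{w} H] [Preadditive H]
    [Linear k H] (P : ObjectProperty H) where
  W : Type w
  obj : W → P.FullSubcategory
  exists_iso (x : P.FullSubcategory) : ∃ s, Nonempty (x ≅ obj s)
  cp (x : P.FullSubcategory) : compactProjective k x.obj
  detect {X Y : H} (f : X ⟶ Y)
    (h : ∀ x : P.FullSubcategory, Function.Bijective fun g : x.obj ⟶ X => g ≫ f) : IsIso f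

variable {P : ObjectProperty H}

lemma compactProjective.preserves {x : H} (hx : compactProjective k x) :
    PreservesColimitsOfSize.{w, w} ((linearCoyoneda k H).obj (op x)) := hx

/-- A map from a compact projective object to the point of a colimit cocone is a sum of maps
factoring through the legs. -/
lemma cp_induction {J : Type w} [Category.{w} J] {F : J ⥤ H} {c : Cocone F} (hc : IsColimit c)
    {x : H} (hx : compactProjective k x) {p : (x ⟶ c.pt) → Prop} (zero : p 0)
    (add : ∀ f g, p f → p g → p (f + g)) (legs : ∀ j (f : x ⟶ F.obj j), p (f ≫ c.ι.app j))
    (f : x ⟶ c.pt) : p f := by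
  have := hx.preserves
  have l := isColimitOfPreserves ((linearCoyoneda k H).obj (op x)) hc
  let S : Submodule k (x ⟶ c.pt) :=
    Submodule.span k {g | ∃ (j : J) (f : x ⟶ F.obj j), g = f ≫ c.ι.app j}
  -- The quotient map by `S` kills every leg, and `Hom (x, -)` preserves the colimit; hence it
  -- vanishes and `S` is everything.
  have hS : S.mkQ = 0 := by
    have h : ModuleCat.ofHom S.mkQ = ModuleCat.ofHom (0 : (x ⟶ c.pt) →ₗ[k] _) := by
      refine l.hom_ext fun j => ?_
      ext f
      exact (Submodule.Quotient.mk_eq_zero S).2 (Submodule.subset_span ⟨j, f, rfl⟩)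
    exact congrArg ModuleCat.Hom.hom h
  have hf : f ∈ S := (Submodule.Quotient.mk_eq_zero S).1 (congrArg (fun φ => φ f) hS)
  refine Submodule.span_induction ?_ zero (fun _ _ _ _ => add _ _) ?_ hf
  · rintro _ ⟨j, f, rfl⟩
    exact legs j f
  -- The predicate `p` is not assumed stable under scalars. The scalar is pushed down the span until
  -- it meets a leg, where it is absorbed into the map `f`.
  · intro r g hg _
    refine Submodule.span_induction (p := fun g _ => p (r • g)) ?_ ?_ ?_ ?_ hg
    · rintro _ ⟨j, f, rfl⟩
      rw [← Linear.smul_comp]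
      exact legs j _
    · rwa [smul_zero]
    · intro _ _ _ _ h h'
      rw [smul_add]
      exact add _ _ h h'
    · intro s g hg' _
      rw [smul_smul]
      refine Submodule.span_induction (p := fun g _ => ∀ t : k, p (t • g)) ?_ ?_ ?_ ?_ hg' (r * s)
      · rintro _ ⟨j, f, rfl⟩ t
        rw [← Linear.smul_comp]
        exact legs j _
      · intro t; rwa [smul_zero]
      · intro _ _ _ _ h h' t
        rw [smul_add]
        exact add _ _ (h t) (h' t)
      · intro s g _ h t
        rw [smul_smul]
        exact h _

/-- A linear map out of `Hom (x, c)`, for `x` compact projective and `c` a colimit. -/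
lemma cp_desc {J : Type w} [Category.{w} J] {F : J ⥤ H} {c : Cocone F} (hc : IsColimit c)
    {x : H} (hx : compactProjective k x) {V : Type v} [AddCommGroup V] [Module k V]
    [Small.{w} V] (φ : ∀ j, (x ⟶ F.obj j) →ₗ[k] V)
    (hφ : ∀ {i j} (f : i ⟶ j) (g : x ⟶ F.obj i), φ j (g ≫ F.map f) = φ i g) :
    ∃ ψ : (x ⟶ c.pt) →ₗ[k] V, ∀ j g, ψ (g ≫ c.ι.app j) = φ j g := by
  have := hx.preserves
  have l := isColimitOfPreserves ((linearCoyoneda k H).obj (op x)) hc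
  -- The colimit lives among vector spaces in the universe `w`, so `V` enters through its small
  -- model.
  let s : Cocone (F ⋙ (linearCoyoneda k H).obj (op x)) :=
    ⟨ModuleCat.of k (Shrink.{w} V),
      { app := fun j => ModuleCat.ofHom ((Shrink.linearEquiv k V).symm.toLinearMap ∘ₗ φ j)
        naturality := fun i j f => by
          ext g
          exact congrArg (Shrink.linearEquiv k V).symm (hφ f g) }⟩
  refine ⟨(Shrink.linearEquiv k V).toLinearMap ∘ₗ (l.desc s).hom, fun j g => ?_⟩
  have h := congrArg (fun φ => φ.hom g) (l.fac s j)
  refine (congrArg (Shrink.linearEquiv k V) h).trans ?_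
  exact (Shrink.linearEquiv k V).apply_symm_apply _

variable [HasColimitsOfSize.{w, w} H]

instance : HasColimitsOfSize.{0, 0} H := hasColimitsOfSizeShrink.{0, 0, w, w} H

/-- Maps out of a compact projective object are exact at a cokernel. -/
lemma cp_cokernel {x Q P' : H} (hx : compactProjective k x) (q : Q ⟶ P') :
    (∀ g : x ⟶ cokernel q, ∃ g' : x ⟶ P', g' ≫ cokernel.π q = g) ∧
    (∀ g : x ⟶ P', g ≫ cokernel.π q = 0 → ∃ g' : x ⟶ Q, g' ≫ q = g) := by
  have := hx.preserves
  let Y := (linearCoyoneda k H).obj (op x)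
  have : PreservesColimitsOfSize.{0, 0} Y := preservesSmallestColimits_of_preservesColimits Y
  have l : IsColimit (CokernelCofork.ofπ (f := Y.map q) (Y.map (cokernel.π q)) (by
      rw [← Y.map_comp, cokernel.condition, Y.map_zero])) :=
    isColimitCoforkMapOfIsColimit' Y (cokernel.condition q) (cokernelIsCokernel q)
  have he : Epi (Y.map (cokernel.π q)) := epi_of_isColimit_cofork l
  refine ⟨fun g => (ModuleCat.epi_iff_surjective _).1 he g, fun g hg => ?_⟩
  -- The universal property is applied to the explicit quotient by the range of composition with
  -- `q`, in which being zero means factoring through `q`.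
  have hc := CokernelCofork.IsColimit.desc' l (ModuleCat.ofHom
    (LinearMap.range (Y.map q).hom).mkQ) (by
      ext g
      exact (Submodule.Quotient.mk_eq_zero _).2 ⟨g, rfl⟩)
  obtain ⟨d, hd⟩ := hc
  have h1 := congrArg (fun φ => φ.hom g) hd
  have h2 : (Y.map (cokernel.π q)).hom g = 0 := hg
  have h3 : (LinearMap.range (Y.map q).hom).mkQ g = 0 := by
    refine h1.symm.trans ?_
    refine (congrArg d.hom h2).trans (map_zero _)
  exact (Submodule.Quotient.mk_eq_zero _).1 h3

namespace Generating
variable (𝒢 : Generating k P)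

section Presentation
variable {F : Psh.{w, u', v} k P.FullSubcategory} [∀ x, Small.{w} (F.obj x)]

variable (F) in
/-- The index set of the generators of a presheaf. -/
abbrev Idx := Σ s : 𝒢.W, Shrink.{w} (F.obj (op (𝒢.obj s)))

variable (F) in
/-- The free object on the elements of a presheaf. -/
noncomputable def pre : H := ∐ fun i : 𝒢.Idx F => (𝒢.obj i.1).obj

/-- The value of a presheaf at an element of its index set. -/
noncomputable def val (i : 𝒢.Idx F) : F.obj (op (𝒢.obj i.1)) := (equivShrink _).symm i.2

lemma val_mk (s : 𝒢.W) (a : F.obj (op (𝒢.obj s))) : 𝒢.val ⟨s, equivShrink _ a⟩ = a :=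
  Equiv.symm_apply_apply _ _

variable (F) in
/-- The inclusion of a generator. -/
noncomputable def incl (i : 𝒢.Idx F) : (𝒢.obj i.1).obj ⟶ 𝒢.pre F :=
  Sigma.ι (fun i : 𝒢.Idx F => (𝒢.obj i.1).obj) i

/-- The Yoneda map of the free cover: the summand indexed by an element of `F` goes to that element.
It extends to all maps `x ⟶ 𝒢.pre F` because `Hom (x, -)` preserves the coproduct, and it is linear
on each summand because `F` is linear in morphisms. -/
lemma exists_lin (hF : ∀ {x y : P.FullSubcategory} (f g : x ⟶ y) (a : F.obj (op y)),
      F.res (f + g) a = F.res f a + F.res g a)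
    (hF' : ∀ {x y : P.FullSubcategory} (r : k) (f : x ⟶ y) (a : F.obj (op y)),
      F.res (r • f) a = r • F.res f a) (x : P.FullSubcategory) :
    ∃ φ : (x.obj ⟶ 𝒢.pre F) →ₗ[k] F.obj (op x), ∀ i (g : x ⟶ 𝒢.obj i.1),
      φ (g.hom ≫ 𝒢.incl F i) = F.res g (𝒢.val i) := by
  obtain ⟨ψ, hψ⟩ := cp_desc (coproductIsCoproduct fun i : 𝒢.Idx F => (𝒢.obj i.1).obj) (𝒢.cp x)
    (V := F.obj (op x)) (fun i =>
      { toFun := fun g => F.res (ObjectProperty.homMk g) (𝒢.val i.as)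
        map_add' := fun g g' => hF _ _ _
        map_smul' := fun r g => hF' _ _ _ }) (by
      rintro ⟨i⟩ ⟨j⟩ ⟨⟨h⟩⟩ g
      obtain rfl : i = j := h
      have : (Discrete.functor fun i : 𝒢.Idx F => (𝒢.obj i.1).obj).map (𝟙 (Discrete.mk i)) =
          𝟙 _ :=
        Discrete.functor_map_id _ _
      exact congrArg _ ((congrArg (g ≫ ·) this).trans (Category.comp_id _)))
  exact ⟨ψ, fun i g => hψ ⟨i⟩ g.hom⟩

lemma pre_induction {x : P.FullSubcategory} {p : (x.obj ⟶ 𝒢.pre F) → Prop} (zero : p 0)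
    (add : ∀ f g, p f → p g → p (f + g))
    (legs : ∀ i (f : x ⟶ 𝒢.obj i.1), p (f.hom ≫ 𝒢.incl F i)) (f : x.obj ⟶ 𝒢.pre F) : p f :=
  cp_induction (coproductIsCoproduct fun i : 𝒢.Idx F => (𝒢.obj i.1).obj) (𝒢.cp x) zero add
    (fun j g => legs j.as (ObjectProperty.homMk g)) f

end Presentation

/-- A representation of a presheaf on the full subcategory by an object of `H`. -/
structure Rep (F : Psh.{w, u', v} k P.FullSubcategory) where
  X : H
  e (x : P.FullSubcategory) : F.obj (op x) ≃ₗ[k] (x.obj ⟶ X)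
  nat {x y : P.FullSubcategory} (f : x ⟶ y) (a : F.obj (op y)) : e x (F.res f a) = f.hom ≫ e y a

/-- A presentation of a presheaf, by the cokernel of a map from a coproduct of generators to the
coproduct `𝒢.pre F`. -/
structure Pres (F : Psh.{w, u', v} k P.FullSubcategory) [∀ x, Small.{w} (F.obj x)] where
  J : Type w
  t : J → 𝒢.W
  d : (∐ fun j => (𝒢.obj (t j)).obj) ⟶ 𝒢.pre F
  e (x : P.FullSubcategory) : F.obj (op x) ≃ₗ[k] (x.obj ⟶ cokernel d)
  nat {x y : P.FullSubcategory} (f : x ⟶ y) (a : F.obj (op y)) : e x (F.res f a) = f.hom ≫ e y a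
  spec (i : 𝒢.Idx F) : e (𝒢.obj i.1) (𝒢.val i) = 𝒢.incl F i ≫ cokernel.π d

/-- The representation given by a presentation. -/
noncomputable def Pres.toRep {𝒢 : Generating k P} {F : Psh.{w, u', v} k P.FullSubcategory}
    [∀ x, Small.{w} (F.obj x)] (p : 𝒢.Pres F) : Rep F where
  X := cokernel p.d
  e := p.e
  nat := p.nat

/-- The usual two-stage presentation of a presheaf: cover it by generators indexed by its elements,
then cover the kernel in the same way. Since `Hom (x, -)` is exact on coproducts of generators and
their cokernels, the cokernel formed in `H` has the same maps from `x` as the cokernel of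
presheaves, which is `F`. Smallness of the values of `F` and of the set `𝒢.W` keeps the coproducts
small. -/
theorem exists_pres (F : Psh.{w, u', v} k P.FullSubcategory) [∀ x, Small.{w} (F.obj x)]
    (hF : ∀ {x y : P.FullSubcategory} (f g : x ⟶ y) (a : F.obj (op y)),
      F.res (f + g) a = F.res f a + F.res g a)
    (hF' : ∀ {x y : P.FullSubcategory} (r : k) (f : x ⟶ y) (a : F.obj (op y)),
      F.res (r • f) a = r • F.res f a) : Nonempty (𝒢.Pres F) := by
  choose L hL using 𝒢.exists_lin hF hF'
  have hnat {x y : P.FullSubcategory} (f : x ⟶ y) (g : y.obj ⟶ 𝒢.pre F) :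
      L x (f.hom ≫ g) = F.res f (L y g) := by
    refine 𝒢.pre_induction (p := fun g => L x (f.hom ≫ g) = F.res f (L y g)) ?_ ?_ ?_ g
    · simp
    · intro g g' h h'
      rw [Preadditive.comp_add, map_add, map_add, map_add, h, h']
    · intro i g
      have := hL x i (f ≫ g)
      rw [ObjectProperty.FullSubcategory.comp_hom, Category.assoc] at this
      rw [this, hL, Psh.res_comp]
  -- Second stage of the presentation: one generator for every element of the kernel of the cover.
  let J := Σ s : 𝒢.W, {g : (𝒢.obj s).obj ⟶ 𝒢.pre F // L _ g = 0}
  let d : (∐ fun j : J => (𝒢.obj j.1).obj) ⟶ 𝒢.pre F := Sigma.desc fun j => j.2.1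
  have hd (j : J) : Sigma.ι (fun j : J => (𝒢.obj j.1).obj) j ≫ d = j.2.1 := Sigma.ι_desc _ _
  have hLd (x : P.FullSubcategory) (g : x.obj ⟶ ∐ fun j : J => (𝒢.obj j.1).obj) :
      L x (g ≫ d) = 0 := by
    refine cp_induction (coproductIsCoproduct fun j : J => (𝒢.obj j.1).obj) (𝒢.cp x)
      (p := fun g => L x (g ≫ d) = 0) ?_ ?_ ?_ g
    · simp
    · intro g g' h h'
      rw [Preadditive.add_comp, map_add, h, h', add_zero]
    · rintro ⟨j⟩ g
      refine (congrArg (L x) ((Category.assoc _ _ _).trans (congrArg (g ≫ ·) (hd j)))).trans ?_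
      exact (hnat (ObjectProperty.homMk g) _).trans ((congrArg _ j.2.2).trans (map_zero _))
  have hsurj (x : P.FullSubcategory) : Function.Surjective (L x) := by
    intro a
    obtain ⟨s, ⟨i⟩⟩ := 𝒢.exists_iso x
    refine ⟨i.hom.hom ≫ 𝒢.incl F ⟨s, equivShrink _ (F.res i.inv a)⟩,
      (hL x ⟨s, equivShrink _ (F.res i.inv a)⟩ i.hom).trans ?_⟩
    rw [val, Equiv.symm_apply_apply, ← Psh.res_comp, i.hom_inv_id, Psh.res_id]
  -- An element of the kernel is, after an isomorphism of `x` with a chosen representative, itself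
  -- an index in `J`, so it factors through `d`. The converse is exactness of `Hom (x, -)` at the
  -- cokernel.
  have hker (x : P.FullSubcategory) (g : x.obj ⟶ 𝒢.pre F) :
      L x g = 0 ↔ g ≫ cokernel.π d = 0 := by
    constructor
    · intro h
      obtain ⟨s, ⟨i⟩⟩ := 𝒢.exists_iso x
      have h1 : L _ (i.inv.hom ≫ g) = 0 := by rw [hnat, h, map_zero]
      have h2 := hd ⟨s, _, h1⟩
      have h3 : g = i.hom.hom ≫ Sigma.ι (fun j : J => (𝒢.obj j.1).obj) ⟨s, _, h1⟩ ≫ d := by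
        rw [h2, ← Category.assoc, ← ObjectProperty.FullSubcategory.comp_hom, i.hom_inv_id]
        exact (Category.id_comp g).symm
      rw [h3]
      simp
    · intro h
      obtain ⟨g', rfl⟩ := (cp_cokernel (𝒢.cp x) d).2 g h
      exact hLd x g'
  let p (x : P.FullSubcategory) : (x.obj ⟶ 𝒢.pre F) →ₗ[k] (x.obj ⟶ cokernel d) :=
    Linear.rightComp k x.obj (cokernel.π d)
  have hp (x : P.FullSubcategory) : LinearMap.ker (L x) = LinearMap.ker (p x) := by
    ext g
    exact hker x g
  let e (x : P.FullSubcategory) : F.obj (op x) ≃ₗ[k] (x.obj ⟶ cokernel d) :=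
    ((L x).quotKerEquivOfSurjective (hsurj x)).symm.trans ((Submodule.quotEquivOfEq _ _ (hp x)).trans
      ((p x).quotKerEquivOfSurjective (cp_cokernel (𝒢.cp x) d).1))
  have he (x : P.FullSubcategory) (g : x.obj ⟶ 𝒢.pre F) : e x (L x g) = g ≫ cokernel.π d := by
    have : ((L x).quotKerEquivOfSurjective (hsurj x)).symm (L x g) = Submodule.Quotient.mk g := by
      rw [LinearEquiv.symm_apply_eq]
      rfl
    simp only [e, LinearEquiv.trans_apply, this]
    rfl
  refine ⟨⟨J, fun j => j.1, d, e, ?_, ?_⟩⟩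
  · intro x y f a
    obtain ⟨g, rfl⟩ := hsurj y a
    rw [← hnat, he, he, Category.assoc]
  · intro i
    have h := hL _ i (𝟙 _)
    rw [Psh.res_id] at h
    refine (congrArg (e _) h.symm).trans ((he _ _).trans ?_)
    exact congrArg (· ≫ cokernel.π d) (Category.id_comp _)

theorem exists_rep (𝒢 : Generating k P) (F : Psh.{w, u', v} k P.FullSubcategory) [∀ x, Small.{w} (F.obj x)]
    (hF : ∀ {x y : P.FullSubcategory} (f g : x ⟶ y) (a : F.obj (op y)),
      F.res (f + g) a = F.res f a + F.res g a)
    (hF' : ∀ {x y : P.FullSubcategory} (r : k) (f : x ⟶ y) (a : F.obj (op y)),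
      F.res (r • f) a = r • F.res f a) : Nonempty (Rep F) :=
  (𝒢.exists_pres F hF hF').map Pres.toRep


section Extension
variable (P) in
/-- The presheaf represented by an object is linear. -/
lemma _root_.HarishChandra.homPsh_add (N : H) {x y : P.FullSubcategory} (f g : x ⟶ y)
    (a : (homPsh k P N).obj (op y)) :
    (homPsh k P N).res (f + g) a = (homPsh k P N).res f a + (homPsh k P N).res g a :=
  Preadditive.add_comp _ _ _ f.hom g.hom a

variable (P) in
lemma _root_.HarishChandra.homPsh_smul (N : H) {x y : P.FullSubcategory} (r : k) (f : x ⟶ y)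
    (a : (homPsh k P N).obj (op y)) :
    (homPsh k P N).res (r • f) a = r • (homPsh k P N).res f a :=
  Linear.smul_comp _ _ _ r f.hom a

variable (k P) in
instance (N : H) (x : P.FullSubcategoryᵒᵖ) : Small.{w} ((homPsh k P N).obj x) :=
  small_self _

/-- The canonical map from the free object on the generators of `N`. -/
noncomputable def can (N : H) : 𝒢.pre (homPsh k P N) ⟶ N :=
  Sigma.desc fun i => 𝒢.val i

lemma incl_can (N : H) (i : 𝒢.Idx (homPsh k P N)) : 𝒢.incl _ i ≫ 𝒢.can N = 𝒢.val i :=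
  Sigma.ι_desc _ _

lemma exists_lift_can (x : P.FullSubcategory) {N : H} (f : x.obj ⟶ N) :
    ∃ g, g ≫ 𝒢.can N = f := by
  obtain ⟨s, ⟨i⟩⟩ := 𝒢.exists_iso x
  let a : (homPsh k P N).obj (op (𝒢.obj s)) := i.inv.hom ≫ f
  refine ⟨i.hom.hom ≫ 𝒢.incl (homPsh k P N) ⟨s, equivShrink _ a⟩, ?_⟩
  rw [Category.assoc, incl_can]
  refine (congrArg (i.hom.hom ≫ ·) (𝒢.val_mk s a)).trans ?_
  refine (Category.assoc _ _ _).symm.trans ?_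
  rw [← ObjectProperty.FullSubcategory.comp_hom, i.hom_inv_id]
  exact Category.id_comp f

/-- Every object is the cokernel of a map between coproducts of generators. -/
theorem exists_cokernel (𝒢 : Generating k P) (N : H) : ∃ (J : Type w) (t : J → 𝒢.W)
    (d : (∐ fun j => (𝒢.obj (t j)).obj) ⟶ 𝒢.pre (homPsh k P N)) (h : d ≫ 𝒢.can N = 0),
    Nonempty (IsColimit (CokernelCofork.ofπ (𝒢.can N) h)) := by
  obtain ⟨p⟩ := 𝒢.exists_pres (homPsh k P N) (homPsh_add P N) (homPsh_smul P N)
  have key (x : P.FullSubcategory) (g : x.obj ⟶ 𝒢.pre (homPsh k P N)) :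
      p.e x (g ≫ 𝒢.can N : x.obj ⟶ N) = g ≫ cokernel.π p.d := by
    refine 𝒢.pre_induction
      (p := fun g => p.e x (g ≫ 𝒢.can N : x.obj ⟶ N) = g ≫ cokernel.π p.d) ?_ ?_ ?_ g
    · rw [zero_comp, zero_comp]
      exact map_zero (p.e x)
    · intro g g' h h'
      rw [Preadditive.add_comp, Preadditive.add_comp, ← h, ← h']
      exact map_add (p.e x) _ _
    · intro i g
      rw [Category.assoc, Category.assoc, incl_can, ← p.spec]
      exact p.nat g _
  have h : p.d ≫ 𝒢.can N = 0 := by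
    refine Sigma.hom_ext _ _ fun j => ?_
    rw [comp_zero, ← Category.assoc]
    refine (p.e (𝒢.obj (p.t j))).injective ?_
    refine (key _ _).trans ?_
    rw [Category.assoc, cokernel.condition, comp_zero]
    exact (map_zero (p.e _)).symm
  let c : cokernel p.d ⟶ N := cokernel.desc _ _ h
  have hc : cokernel.π p.d ≫ c = 𝒢.can N := cokernel.π_desc _ _ _
  -- Both `Hom (x, N)` and `Hom (x, cokernel p.d)` are quotients of the maps from `x` to the free
  -- cover, by `key` with the same kernel; isomorphisms are detected on generators.
  have hiso : IsIso c := by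
    refine 𝒢.detect c fun x => ⟨fun g g' (hg : g ≫ c = g' ≫ c) => ?_, fun f => ?_⟩
    · obtain ⟨g, rfl⟩ := (cp_cokernel (𝒢.cp x) p.d).1 g
      obtain ⟨g', rfl⟩ := (cp_cokernel (𝒢.cp x) p.d).1 g'
      rw [Category.assoc, Category.assoc, hc] at hg
      rw [← key, ← key, hg]
    · obtain ⟨g, hg⟩ := (cp_cokernel (𝒢.cp x) p.d).1 (p.e x f)
      refine ⟨g ≫ cokernel.π p.d, (p.e x).injective ?_⟩
      refine (congrArg (p.e x) ?_).trans ((key x g).trans hg)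
      change (g ≫ cokernel.π p.d) ≫ c = _
      rw [Category.assoc, hc]
  exact ⟨p.J, p.t, p.d, h, ⟨(cokernelIsCokernel p.d).ofIsoColimit (Cofork.ext (asIso c) hc)⟩⟩

variable {D : Type u} [Category.{v} D] [Preadditive D] (E : H ⥤ D) [E.Additive]
  [PreservesColimitsOfSize.{w, w} E]

/-- Maps out of the value of a colimit-preserving functor are determined on generators. -/
theorem map_hom_ext (𝒢 : Generating k P) {N : H} {Z : D} {f g : E.obj N ⟶ Z}
    (h : ∀ (x : P.FullSubcategory) (a : x.obj ⟶ N), E.map a ≫ f = E.map a ≫ g) : f = g := by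
  obtain ⟨J, t, d, hd, ⟨l⟩⟩ := 𝒢.exists_cokernel N
  have : PreservesColimitsOfSize.{0, 0} E := preservesSmallestColimits_of_preservesColimits E
  have l' := isColimitCoforkMapOfIsColimit' E hd l
  have he : Epi (E.map (𝒢.can N)) := epi_of_isColimit_cofork l'
  rw [← cancel_epi (E.map (𝒢.can N))]
  refine (isColimitOfPreserves E (coproductIsCoproduct
    fun i : 𝒢.Idx (homPsh k P N) => (𝒢.obj i.1).obj)).hom_ext fun j => ?_
  have h1 := h (𝒢.obj j.as.1) (𝒢.val j.as)
  rw [← incl_can, E.map_comp, Category.assoc, Category.assoc] at h1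
  exact h1

/-- Maps out of the value of a colimit-preserving functor are given by natural families of maps
out of its values on generators. -/
theorem exists_map_desc (𝒢 : Generating k P) {N : H} {Z : D} (φ : ∀ x : P.FullSubcategory, (x.obj ⟶ N) →
      (E.obj x.obj ⟶ Z))
    (add : ∀ (x : P.FullSubcategory) (f g : x.obj ⟶ N), φ x (f + g) = φ x f + φ x g)
    (nat : ∀ {x y : P.FullSubcategory} (f : x ⟶ y) (g : y.obj ⟶ N),
      φ x (f.hom ≫ g) = E.map f.hom ≫ φ y g) :
    ∃ ψ : E.obj N ⟶ Z, ∀ (x : P.FullSubcategory) (f : x.obj ⟶ N), E.map f ≫ ψ = φ x f := by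
  obtain ⟨J, t, d, hd, ⟨l⟩⟩ := 𝒢.exists_cokernel N
  have : PreservesColimitsOfSize.{0, 0} E := preservesSmallestColimits_of_preservesColimits E
  have l' := isColimitCoforkMapOfIsColimit' E hd l
  have l₀ := isColimitOfPreserves E (coproductIsCoproduct
    fun i : 𝒢.Idx (homPsh k P N) => (𝒢.obj i.1).obj)
  obtain ⟨ψ₀, hψ₀⟩ : ∃ ψ₀ : E.obj (𝒢.pre (homPsh k P N)) ⟶ Z,
      ∀ i, E.map (𝒢.incl _ i) ≫ ψ₀ = φ _ (𝒢.val i) := by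
    let s : Cocone ((Discrete.functor
        fun i : 𝒢.Idx (homPsh k P N) => (𝒢.obj i.1).obj) ⋙ E) :=
      ⟨Z, Discrete.natTrans fun i => φ _ (𝒢.val i.as)⟩
    exact ⟨l₀.desc s, fun i => l₀.fac s ⟨i⟩⟩
  have zero (x : P.FullSubcategory) : φ x 0 = 0 := by
    have := add x 0 0
    rwa [add_zero, left_eq_add] at this
  have key (x : P.FullSubcategory) (g : x.obj ⟶ 𝒢.pre (homPsh k P N)) :
      E.map g ≫ ψ₀ = φ x (g ≫ 𝒢.can N) := by
    refine 𝒢.pre_induction (p := fun g => E.map g ≫ ψ₀ = φ x (g ≫ 𝒢.can N)) ?_ ?_ ?_ g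
    · rw [E.map_zero, zero_comp, zero_comp, zero]
    · intro g g' h h'
      rw [E.map_add, Preadditive.add_comp, Preadditive.add_comp, h, h', add]
    · intro i g
      rw [E.map_comp, Category.assoc, Category.assoc, incl_can, hψ₀]
      exact (nat g _).symm
  -- By `key`, a relation `d` is sent to the value of `φ` at `d ≫ 𝒢.can N`, which is zero.
  have hdψ : E.map d ≫ ψ₀ = 0 := by
    refine (isColimitOfPreserves E (coproductIsCoproduct
      fun j => (𝒢.obj (t j)).obj)).hom_ext fun j => ?_
    rw [comp_zero]
    refine Eq.trans (b := E.map (Sigma.ι (fun j => (𝒢.obj (t j)).obj) j.as ≫ d) ≫ ψ₀) ?_ ?_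
    · rw [E.map_comp, Category.assoc]
      rfl
    · rw [key, Category.assoc, hd, comp_zero, zero]
  obtain ⟨ψ, hψ⟩ := Cofork.IsColimit.desc' l' ψ₀ (hdψ.trans (by simp))
  refine ⟨ψ, fun x f => ?_⟩
  have hψ' : E.map (𝒢.can N) ≫ ψ = ψ₀ := hψ
  obtain ⟨g, rfl⟩ : ∃ g, g ≫ 𝒢.can N = f := 𝒢.exists_lift_can x f
  rw [E.map_comp, Category.assoc, hψ', key]

end Extension

section Tensor
variable [MonoidalCategory H] [MonoidalPreadditive H] [TensorCocontinuous H]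

/-- Maps out of a tensor product are determined on generators. -/
theorem tensor_hom_ext (𝒢 : Generating k P) {X Y Z : H} {f g : X ⊗ Y ⟶ Z}
    (h : ∀ (x y : P.FullSubcategory) (a : x.obj ⟶ X) (b : y.obj ⟶ Y),
      (a ⊗ₘ b) ≫ f = (a ⊗ₘ b) ≫ g) : f = g := by
  have := TensorCocontinuous.left X
  refine 𝒢.map_hom_ext (tensorLeft X) fun y b => ?_
  have := TensorCocontinuous.right y.obj
  refine 𝒢.map_hom_ext (tensorRight y.obj) fun x a => ?_
  have h1 := h x y a b
  rwa [MonoidalCategory.tensorHom_def, Category.assoc, Category.assoc] at h1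

/-- Maps out of a tensor product are given by natural families of bilinear maps. -/
theorem exists_tensor_desc (𝒢 : Generating k P) {X Y Z : H} (φ : ∀ x y : P.FullSubcategory, (x.obj ⟶ X) →
      (y.obj ⟶ Y) → (x.obj ⊗ y.obj ⟶ Z))
    (add_left : ∀ (x y : P.FullSubcategory) (a a' : x.obj ⟶ X) (b : y.obj ⟶ Y),
      φ x y (a + a') b = φ x y a b + φ x y a' b)
    (add_right : ∀ (x y : P.FullSubcategory) (a : x.obj ⟶ X) (b b' : y.obj ⟶ Y),
      φ x y a (b + b') = φ x y a b + φ x y a b')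
    (nat : ∀ {x x' y y' : P.FullSubcategory} (f : x ⟶ x') (g : y ⟶ y') (a : x'.obj ⟶ X)
      (b : y'.obj ⟶ Y), φ x y (f.hom ≫ a) (g.hom ≫ b) = (f.hom ⊗ₘ g.hom) ≫ φ x' y' a b) :
    ∃ ψ : X ⊗ Y ⟶ Z, ∀ (x y : P.FullSubcategory) (a : x.obj ⟶ X) (b : y.obj ⟶ Y),
      (a ⊗ₘ b) ≫ ψ = φ x y a b := by
  -- One variable at a time: for a generator `y` the first variable is descended along the
  -- cocontinuous functor `- ⊗ y`, and the resulting maps `χ y b` are descended along `X ⊗ -`.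
  have h1 (y : P.FullSubcategory) (b : y.obj ⟶ Y) : ∃ ψ : X ⊗ y.obj ⟶ Z,
      ∀ (x : P.FullSubcategory) (a : x.obj ⟶ X), a ▷ y.obj ≫ ψ = φ x y a b := by
    have := TensorCocontinuous.right y.obj
    refine 𝒢.exists_map_desc (tensorRight y.obj) (fun x a => φ x y a b)
      (fun x a a' => add_left x y a a' b) fun {x x'} f a => ?_
    have := nat f (𝟙 y) a b
    rw [ObjectProperty.FullSubcategory.id_hom, Category.id_comp, tensorHom_id] at this
    exact this
  choose χ hχ using h1
  have := TensorCocontinuous.left X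
  obtain ⟨ψ, hψ⟩ := 𝒢.exists_map_desc (tensorLeft X) χ (fun y b b' => by
      have := TensorCocontinuous.right y.obj
      refine 𝒢.map_hom_ext (tensorRight y.obj) fun x a => ?_
      rw [Preadditive.comp_add]
      exact (hχ _ _ _ _).trans ((add_right x y a b b').trans
        (congrArg₂ (· + ·) (hχ _ _ _ _) (hχ _ _ _ _)).symm)) (fun {y y'} g b => by
      have := TensorCocontinuous.right y.obj
      refine 𝒢.map_hom_ext (tensorRight y.obj) fun x a => ?_
      refine (hχ _ _ _ _).trans ?_
      have h2 := nat (𝟙 x) g a b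
      rw [ObjectProperty.FullSubcategory.id_hom, Category.id_comp, id_tensorHom] at h2
      refine h2.trans ?_
      rw [← hχ, ← Category.assoc, ← Category.assoc]
      exact congrArg (· ≫ _) (whisker_exchange a g.hom))
  refine ⟨ψ, fun x y a b => ?_⟩
  rw [MonoidalCategory.tensorHom_def, Category.assoc, ← hχ]
  exact congrArg _ (hψ y b)

end Tensor

end Generating
end Density
end HarishChandra

namespace HarishChandra

/-! ### The coend: induction, size and contractions -/

section EvTools
variable {k : Type w} [Field k] {A : Type u'} [Category.{w} A] [MonoidalCategory A]
  [Preadditive A] [Linear k A]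

namespace Ev
variable {F : Psh.{w, u', v₁} k A} {G : Psh.{w, u', v₂} k A}

/-- No separate cases for zero and for scalars are needed, since a scalar multiple of a class is the
class with its first entry rescaled, and zero is a class with zero entries. -/
lemma induction {p : Ev F G → Prop} (add : ∀ t t', p t → p t' → p (t + t'))
    (of : ∀ {z w : A} (a : F.obj (op z)) (e : 𝟙_ A ⟶ z ⊗ w) (b : G.obj (op w)), p (Ev.of a e b))
    (t : Ev F G) : p t := by
  obtain ⟨t, rfl⟩ := Submodule.Quotient.mk_surjective _ t
  induction t using Finsupp.induction_linear with
  | zero =>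
    have h := Ev.smul_left (0 : k) (0 : F.obj (op (𝟙_ A))) (λ_ (𝟙_ A)).inv (0 : G.obj (op (𝟙_ A)))
    rw [zero_smul, zero_smul] at h
    have h0 : p 0 := by
      rw [← h]
      exact of _ _ _
    exact h0
  | add f g hf hg => exact add _ _ hf hg
  | single i r =>
    have h := Ev.smul_left r i.a i.e i.b
    have h' : (Submodule.Quotient.mk (Finsupp.single i r) : Ev F G) = r • Ev.of i.a i.e i.b := by
      rw [Ev.of, ← Submodule.Quotient.mk_smul, Finsupp.smul_single, smul_eq_mul,
        _root_.mul_one]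
    rw [h', ← h]
    exact of _ _ _

/-- The coend is essentially small. -/
lemma small {F : Psh.{w, u', w} k A} {G : Psh.{w, u', w} k A} {W : Type w} (obj : W → A)
    (hobj : ∀ x, ∃ s, Nonempty (x ≅ obj s)) : Small.{w} (Ev F G) := by
  let I := Σ s t : W, (F.obj (op (obj s))) × (𝟙_ A ⟶ obj s ⊗ obj t) × (G.obj (op (obj t)))
  let f : (I →₀ k) →ₗ[k] Ev F G := Finsupp.linearCombination k fun i : I =>
    Ev.of i.2.2.1 i.2.2.2.1 i.2.2.2.2
  refine small_of_surjective (f := f) fun t => ?_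
  refine Ev.induction (p := fun t => ∃ a, f a = t) ?_ ?_ t
  · rintro _ _ ⟨a, rfl⟩ ⟨b, rfl⟩
    exact ⟨a + b, map_add f a b⟩
  · intro z w a e b
    obtain ⟨s, ⟨i⟩⟩ := hobj z
    obtain ⟨t, ⟨j⟩⟩ := hobj w
    -- Balancing moves both inner variables to the chosen representatives, at the price of composing
    -- `e` with the two isomorphisms.
    refine ⟨Finsupp.single ⟨s, t, F.res i.inv a, e ≫ (i.hom ⊗ₘ j.hom), G.res j.inv b⟩ 1, ?_⟩
    rw [Finsupp.linearCombination_single, one_smul]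
    rw [Ev.bal_left, Ev.bal_right, Category.assoc, Category.assoc,
      ← MonoidalCategory.tensorHom_def, tensorHom_comp_tensorHom, i.hom_inv_id, j.hom_inv_id,
      id_tensorHom_id, Category.comp_id]

end Ev

variable [MonoidalPreadditive A] [MonoidalLinear k A]

lemma contractLeft_add_left {x z w : A} (e e' : 𝟙_ A ⟶ z ⊗ w) (φ : x ⊗ z ⟶ 𝟙_ A) :
    contractLeft (e + e') φ = contractLeft e φ + contractLeft e' φ := by
  simp [contractLeft]

lemma contractLeft_add_right {x z w : A} (e : 𝟙_ A ⟶ z ⊗ w) (φ φ' : x ⊗ z ⟶ 𝟙_ A) :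
    contractLeft e (φ + φ') = contractLeft e φ + contractLeft e φ' := by
  simp [contractLeft]

lemma contractLeft_smul_left {x z w : A} (r : k) (e : 𝟙_ A ⟶ z ⊗ w) (φ : x ⊗ z ⟶ 𝟙_ A) :
    contractLeft (r • e) φ = r • contractLeft e φ := by
  simp [contractLeft]

lemma contractLeft_smul_right {x z w : A} (r : k) (e : 𝟙_ A ⟶ z ⊗ w) (φ : x ⊗ z ⟶ 𝟙_ A) :
    contractLeft e (r • φ) = r • contractLeft e φ := by
  simp [contractLeft]

/-- Naturality of the contraction in the middle variable. -/
lemma contractLeft_whiskerLeft {x z z' w : A} (e : 𝟙_ A ⟶ z ⊗ w) (g : z ⟶ z')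
    (φ : x ⊗ z' ⟶ 𝟙_ A) : contractLeft e (x ◁ g ≫ φ) = contractLeft (e ≫ g ▷ w) φ := by
  simp [contractLeft]

/-- Naturality of the contraction in the left variable. -/
lemma contractLeft_whiskerRight {x x' z w : A} (e : 𝟙_ A ⟶ z ⊗ w) (f : x ⟶ x')
    (φ : x' ⊗ z ⟶ 𝟙_ A) : contractLeft e (f ▷ z ≫ φ) = f ≫ contractLeft e φ := by
  simp only [contractLeft, comp_whiskerRight, Category.assoc]
  rw [rightUnitor_inv_naturality_assoc, ← whisker_exchange_assoc]
  simp

end EvTools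

/-! ### Classes `[b, e, h]` and the maps they define -/

section Action
variable {k : Type w} [Field k] {H : Type u'} [Category.{w} H] [Preadditive H] [Linear k H]
  [MonoidalCategory H] [MonoidalPreadditive H] [MonoidalLinear k H] {P : ObjectProperty H}
  [P.IsMonoidal] {M : BiPsh.{w, u', v} k P.FullSubcategory}

lemma actOf_add_left {x z w : P.FullSubcategory} {N : H} (b b' : M.at x z)
    (e : 𝟙_ P.FullSubcategory ⟶ z ⊗ w) (h : w.obj ⟶ N) :
    actOf (b + b') e h = actOf b e h + actOf b' e h := Ev.add_left _ _ _ _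

lemma actOf_add_mid {x z w : P.FullSubcategory} {N : H} (b : M.at x z)
    (e e' : 𝟙_ P.FullSubcategory ⟶ z ⊗ w) (h : w.obj ⟶ N) :
    actOf b (e + e') h = actOf b e h + actOf b e' h := Ev.add_mid _ _ _ _

lemma actOf_add_right {x z w : P.FullSubcategory} {N : H} (b : M.at x z)
    (e : 𝟙_ P.FullSubcategory ⟶ z ⊗ w) (h h' : w.obj ⟶ N) :
    actOf b e (h + h') = actOf b e h + actOf b e h' := Ev.add_right (G := homPsh k P N) _ _ _ _

lemma actOf_smul_left {x z w : P.FullSubcategory} {N : H} (r : k) (b : M.at x z)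
    (e : 𝟙_ P.FullSubcategory ⟶ z ⊗ w) (h : w.obj ⟶ N) :
    actOf (r • b) e h = r • actOf b e h := Ev.smul_left _ _ _ _

lemma actOf_smul_mid {x z w : P.FullSubcategory} {N : H} (r : k) (b : M.at x z)
    (e : 𝟙_ P.FullSubcategory ⟶ z ⊗ w) (h : w.obj ⟶ N) :
    actOf b (r • e) h = r • actOf b e h := Ev.smul_mid _ _ _ _

lemma actOf_smul_right {x z w : P.FullSubcategory} {N : H} (r : k) (b : M.at x z)
    (e : 𝟙_ P.FullSubcategory ⟶ z ⊗ w) (h : w.obj ⟶ N) :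
    actOf b e (r • h) = r • actOf b e h := Ev.smul_right (G := homPsh k P N) _ _ _ _

lemma actOf_bal_left {x z z' w : P.FullSubcategory} {N : H} (g : z ⟶ z') (b : M.at x z')
    (e : 𝟙_ P.FullSubcategory ⟶ z ⊗ w) (h : w.obj ⟶ N) :
    actOf (M.act (𝟙 x) g b) e h = actOf b (e ≫ g ▷ w) h := by
  rw [← BiPsh.res_row]
  exact Ev.bal_left _ _ _ _

lemma actOf_bal_right {x z w w' : P.FullSubcategory} {N : H} (g : w ⟶ w') (b : M.at x z)
    (e : 𝟙_ P.FullSubcategory ⟶ z ⊗ w) (h : w'.obj ⟶ N) :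
    actOf b e (g.hom ≫ h) = actOf b (e ≫ z ◁ g) h :=
  Ev.bal_right (G := homPsh k P N) _ _ _ _

lemma map_actOf_left {x x' z w : P.FullSubcategory} {N : H} (f : x ⟶ x') (b : M.at x' z)
    (e : 𝟙_ P.FullSubcategory ⟶ z ⊗ w) (h : w.obj ⟶ N) :
    Ev.map (M.rowMap f) (PshHom.id _) (actOf b e h) = actOf (M.act f (𝟙 z) b) e h :=
  Ev.map_of _ _ _ _ _

lemma map_actOf_right {x z w : P.FullSubcategory} {N N' : H} (g : N ⟶ N') (b : M.at x z)
    (e : 𝟙_ P.FullSubcategory ⟶ z ⊗ w) (h : w.obj ⟶ N) :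
    Ev.map (PshHom.id _) (homPshMap g) (actOf b e h) = actOf b e (h ≫ g) :=
  Ev.map_of _ _ _ _ _

lemma act_induction {x : P.FullSubcategory} {N : H} {p : Ev (M.row x) (homPsh k P N) → Prop}
    (add : ∀ t t', p t → p t' → p (t + t'))
    (of : ∀ {z w : P.FullSubcategory} (b : M.at x z) (e : 𝟙_ P.FullSubcategory ⟶ z ⊗ w)
      (h : w.obj ⟶ N), p (actOf b e h)) (t : Ev (M.row x) (homPsh k P N)) : p t :=
  Ev.induction add (fun a e b => of a e b) t

/-- Linear maps out of `Hom (x, M × N)` agree if they agree on the classes `[b, e, h]`. -/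
lemma act_hom_ext {x : P.FullSubcategory} {N : H} {V : Type v₁} [AddCommGroup V] [Module k V]
    {φ ψ : Ev (M.row x) (homPsh k P N) →ₗ[k] V}
    (h : ∀ {z w : P.FullSubcategory} (b : M.at x z) (e : 𝟙_ P.FullSubcategory ⟶ z ⊗ w)
      (h : w.obj ⟶ N), φ (actOf b e h) = ψ (actOf b e h)) : φ = ψ :=
  Ev.hom_ext fun a e b => h a e b

lemma takeuchi_ext {M : BiPsh.{w, u', v₁} k P.FullSubcategory}
    {N : BiPsh.{w, u', v₂} k P.FullSubcategory} {x y : P.FullSubcategory} {V : Type v₃}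
    [AddCommGroup V] [Module k V] {φ ψ : Ev (M.row x) (N.col y) →ₗ[k] V}
    (h : ∀ {z w : P.FullSubcategory} (a : M.at x z) (e : 𝟙_ P.FullSubcategory ⟶ z ⊗ w)
      (b : N.at w y), φ (Ev.of (F := M.row x) (G := N.col y) a e b) =
        ψ (Ev.of (F := M.row x) (G := N.col y) a e b)) : φ = ψ :=
  Ev.hom_ext h

/-- Data for a linear map out of `Hom (x, M × N)`. -/
structure ActDesc (M : BiPsh.{w, u', v} k P.FullSubcategory) (x : P.FullSubcategory) (N : H)
    (V : Type v₁) [AddCommGroup V] [Module k V] where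
  fn {z w : P.FullSubcategory} : M.at x z →ₗ[k] (𝟙_ P.FullSubcategory ⟶ z ⊗ w) →ₗ[k]
    (w.obj ⟶ N) →ₗ[k] V
  bal_left {z z' w : P.FullSubcategory} (g : z ⟶ z') (b : M.at x z')
    (e : 𝟙_ P.FullSubcategory ⟶ z ⊗ w) (h : w.obj ⟶ N) :
    fn (M.act (𝟙 x) g b) e h = fn b (e ≫ g ▷ w) h
  bal_right {z w w' : P.FullSubcategory} (g : w ⟶ w') (b : M.at x z)
    (e : 𝟙_ P.FullSubcategory ⟶ z ⊗ w) (h : w'.obj ⟶ N) :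
    fn b e (g.hom ≫ h) = fn b (e ≫ z ◁ g) h

/-- The linear map out of `Hom (x, M × N)` given by a balanced trilinear map. -/
noncomputable def ActDesc.lift {x : P.FullSubcategory} {N : H} {V : Type v₁} [AddCommGroup V]
    [Module k V] (d : ActDesc M x N V) : Ev (M.row x) (homPsh k P N) →ₗ[k] V :=
  Ev.lift
    { fn := fun a e b => d.fn a e b
      add_left := fun a a' e b => by rw [map_add]; rfl
      add_mid := fun a e e' b => by rw [map_add]; rfl
      add_right := fun a e b b' => map_add (d.fn a e) b b'
      smul_left := fun r a e b => by rw [map_smul]; rfl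
      smul_mid := fun r a e b => by rw [map_smul]; rfl
      smul_right := fun r a e b => map_smul (d.fn a e) r b
      bal_left := fun f a e b => by
        rw [BiPsh.res_row]
        exact d.bal_left _ _ _ _
      bal_right := fun f a e b => d.bal_right f a e b }

lemma ActDesc.lift_actOf {x : P.FullSubcategory} {N : H} {V : Type v₁} [AddCommGroup V]
    [Module k V] (d : ActDesc M x N V) {z w : P.FullSubcategory} (b : M.at x z)
    (e : 𝟙_ P.FullSubcategory ⟶ z ⊗ w) (h : w.obj ⟶ N) :
    d.lift (actOf b e h) = d.fn b e h :=
  Ev.lift_of _ _ _ _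

/-- Product of classes, `[b, e, h] * [b', e', h'] = [b * b', nest e e', h ⊗ h']`, with the first
factor fixed. -/
noncomputable def actMulAux (S : MulOne M) {x z w : P.FullSubcategory} {N : H} (b : M.at x z)
    (e : 𝟙_ P.FullSubcategory ⟶ z ⊗ w) (h : w.obj ⟶ N) (x' : P.FullSubcategory) (N' : H) :
    Ev (M.row x') (homPsh k P N') →ₗ[k] Ev (M.row (x ⊗ x')) (homPsh k P (N ⊗ N')) :=
  ActDesc.lift
    { fn := fun {z' w'} => LinearMap.mk₂ k (fun b' e' =>
          { toFun := fun h' => actOf (z := z' ⊗ z) (w := w ⊗ w') (S.mul b b') (nest e e') (h ⊗ₘ h')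
            map_add' := fun _ _ => by
              rw [MonoidalPreadditive.tensor_add]
              exact actOf_add_right _ _ _ _
            map_smul' := fun r h' => by
              have : (h ⊗ₘ (r • h')) = r • (h ⊗ₘ h') := by
                simp [MonoidalCategory.tensorHom_def]
              rw [this]
              exact actOf_smul_right _ _ _ _ })
        (fun _ _ _ => by ext; simp [actOf_add_left])
        (fun _ _ _ => by ext; simp [actOf_smul_left])
        (fun _ _ _ => by ext; simp [nest_add_right, actOf_add_mid])
        (fun _ _ _ => by ext; simp [nest_smul_right, actOf_smul_mid])
      bal_left := fun {z₁ z₂ w'} g b' e' h' => by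
        have h1 := S.mul_act (𝟙 x) (𝟙 z) (𝟙 x') g b b'
        rw [BiPsh.act_id, id_tensorHom_id] at h1
        simp only [LinearMap.mk₂_apply, LinearMap.coe_mk, AddHom.coe_mk]
        rw [nest_comp_left', h1, actOf_bal_left]
      bal_right := fun {z' w₁ w₂} g b' e' h' => by
        simp only [LinearMap.mk₂_apply, LinearMap.coe_mk, AddHom.coe_mk]
        rw [nest_comp_right', ← actOf_bal_right]
        congr 1
        change _ = (𝟙 w.obj ⊗ₘ g.hom) ≫ _
        rw [tensorHom_comp_tensorHom, Category.id_comp] }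

lemma actMulAux_actOf (S : MulOne M) {x z w x' z' w' : P.FullSubcategory} {N N' : H}
    (b : M.at x z) (e : 𝟙_ P.FullSubcategory ⟶ z ⊗ w) (h : w.obj ⟶ N) (b' : M.at x' z')
    (e' : 𝟙_ P.FullSubcategory ⟶ z' ⊗ w') (h' : w'.obj ⟶ N') :
    actMulAux S b e h x' N' (actOf b' e' h') =
      actOf (z := z' ⊗ z) (w := w ⊗ w') (S.mul b b') (nest e e') (h ⊗ₘ h') :=
  ActDesc.lift_actOf _ _ _ _

/-- Product of classes, `[b, e, h] * [b', e', h'] = [b * b', nest e e', h ⊗ h']`. -/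
noncomputable def actMul (S : MulOne M) (x : P.FullSubcategory) (N : H) (x' : P.FullSubcategory)
    (N' : H) : Ev (M.row x) (homPsh k P N) →ₗ[k]
      Ev (M.row x') (homPsh k P N') →ₗ[k] Ev (M.row (x ⊗ x')) (homPsh k P (N ⊗ N')) :=
  ActDesc.lift
    { fn := fun {z w} => LinearMap.mk₂ k (fun b e =>
          { toFun := fun h => actMulAux S b e h x' N'
            map_add' := fun h₁ h₂ => act_hom_ext fun b' e' h' => by
              rw [LinearMap.add_apply, actMulAux_actOf, actMulAux_actOf, actMulAux_actOf,
                MonoidalPreadditive.add_tensor]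
              exact actOf_add_right _ _ _ _
            map_smul' := fun r h => act_hom_ext fun b' e' h' => by
              have : ((r • h) ⊗ₘ h') = r • (h ⊗ₘ h') := by
                simp [MonoidalCategory.tensorHom_def]
              rw [RingHom.id_apply, LinearMap.smul_apply, actMulAux_actOf, actMulAux_actOf, this]
              exact actOf_smul_right _ _ _ _ })
        (fun _ _ _ => LinearMap.ext fun _ => act_hom_ext fun _ _ _ => by
          simp [actMulAux_actOf, actOf_add_left])
        (fun _ _ _ => LinearMap.ext fun _ => act_hom_ext fun _ _ _ => by
          simp [actMulAux_actOf, actOf_smul_left])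
        (fun _ _ _ => LinearMap.ext fun _ => act_hom_ext fun _ _ _ => by
          simp [actMulAux_actOf, nest_add_left, actOf_add_mid])
        (fun _ _ _ => LinearMap.ext fun _ => act_hom_ext fun _ _ _ => by
          simp [actMulAux_actOf, nest_smul_left, actOf_smul_mid])
      bal_left := fun {z₁ z₂ w} g b e h => act_hom_ext fun {z' w'} b' e' h' => by
        have h1 := S.mul_act (𝟙 x) g (𝟙 x') (𝟙 z') b b'
        rw [BiPsh.act_id, id_tensorHom_id] at h1
        simp only [LinearMap.mk₂_apply, LinearMap.coe_mk, AddHom.coe_mk, actMulAux_actOf]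
        rw [nest_comp_left, h1, actOf_bal_left]
      bal_right := fun {z w₁ w₂} g b e h => act_hom_ext fun {z' w'} b' e' h' => by
        simp only [LinearMap.mk₂_apply, LinearMap.coe_mk, AddHom.coe_mk, actMulAux_actOf]
        rw [nest_comp_right, ← actOf_bal_right]
        congr 1
        change _ = (g.hom ⊗ₘ 𝟙 w'.obj) ≫ _
        rw [tensorHom_comp_tensorHom, Category.id_comp] }

lemma actMul_actOf (S : MulOne M) {x z w x' z' w' : P.FullSubcategory} {N N' : H}
    (b : M.at x z) (e : 𝟙_ P.FullSubcategory ⟶ z ⊗ w) (h : w.obj ⟶ N) (b' : M.at x' z')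
    (e' : 𝟙_ P.FullSubcategory ⟶ z' ⊗ w') (h' : w'.obj ⟶ N') :
    actMul S x N x' N' (actOf b e h) (actOf b' e' h') =
      actOf (z := z' ⊗ z) (w := w ⊗ w') (S.mul b b') (nest e e') (h ⊗ₘ h') := by
  rw [actMul, ActDesc.lift_actOf]
  exact actMulAux_actOf _ _ _ _ _ _ _

/-- The map `ε × N : M × N ⟶ N` induced by an augmentation. -/
noncomputable def actCounit (ε : Aug M) (x : P.FullSubcategory) (N : H) :
    Ev (M.row x) (homPsh k P N) →ₗ[k] (x.obj ⟶ N) :=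
  ActDesc.lift
    { fn := fun {z w} => LinearMap.mk₂ k (fun b e =>
          Linear.leftComp k N (contractLeft e (ε.app x z b)).hom)
        (fun b b' e => LinearMap.ext fun h => by
          simp only [map_add, contractLeft_add_right, LinearMap.add_apply, Linear.leftComp_apply]
          exact Preadditive.add_comp _ _ _ _ _ _)
        (fun r b e => LinearMap.ext fun h => by
          simp only [map_smul, contractLeft_smul_right, LinearMap.smul_apply,
            Linear.leftComp_apply]
          exact Linear.smul_comp _ _ _ _ _ _)
        (fun b e e' => LinearMap.ext fun h => by
          simp only [contractLeft_add_left, LinearMap.add_apply, Linear.leftComp_apply]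
          exact Preadditive.add_comp _ _ _ _ _ _)
        (fun r b e => LinearMap.ext fun h => by
          simp only [contractLeft_smul_left, LinearMap.smul_apply, Linear.leftComp_apply]
          exact Linear.smul_comp _ _ _ _ _ _)
      bal_left := fun {z₁ z₂ w} g b e h => by
        have h1 := ε.naturality (𝟙 x) g b
        rw [id_tensorHom] at h1
        simp only [LinearMap.mk₂_apply, h1, Linear.leftComp_apply, contractLeft_whiskerLeft]
      bal_right := fun {z w₁ w₂} g b e h => by
        simp only [LinearMap.mk₂_apply, Linear.leftComp_apply]
        rw [contractLeft_comp, ObjectProperty.FullSubcategory.comp_hom, Category.assoc] }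

lemma actCounit_actOf (ε : Aug M) {x z w : P.FullSubcategory} {N : H} (b : M.at x z)
    (e : 𝟙_ P.FullSubcategory ⟶ z ⊗ w) (h : w.obj ⟶ N) :
    actCounit ε x N (actOf b e h) = (contractLeft e (ε.app x z b)).hom ≫ h :=
  ActDesc.lift_actOf _ _ _ _

end Action
end HarishChandra


namespace HarishChandra

/-! ### Objects representing the action on `N` -/

section ActRep
variable {k : Type w} [Field k] {H : Type u'} [Category.{w} H] [Preadditive H] [Linear k H]
  [MonoidalCategory H] [MonoidalPreadditive H] [MonoidalLinear k H] {P : ObjectProperty H}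
  [P.IsMonoidal]

section Assoc
variable {M : BiPsh.{w, u', v} k P.FullSubcategory} {N N' : H}
    (θ : ∀ x : P.FullSubcategory, Ev (M.row x) (homPsh k P N) →ₗ[k] (x.obj ⟶ N'))
    (hθ : ∀ {x x' : P.FullSubcategory} (f : x ⟶ x') (t : Ev (M.row x') (homPsh k P N)),
      θ x (Ev.map (M.rowMap f) (PshHom.id _) t) = f.hom ≫ θ x' t)

lemma map_actHom_of {x y z w z' : P.FullSubcategory} (e : 𝟙_ P.FullSubcategory ⟶ z ⊗ w)
    (h : w.obj ⟶ N) (a : M.at x y) (e' : 𝟙_ P.FullSubcategory ⟶ y ⊗ z') (c : M.at z' z) :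
    Ev.map (F := M.row x) (G := M.col z) (PshHom.id _) (actHom θ hθ e h)
      (Ev.of (F := M.row x) (G := M.col z) a e' c) = actOf a e' (θ z' (actOf c e h)) :=
  Ev.map_of _ _ _ _ _

/-- The associativity map `(M × M) × N ⟶ M × (M × N)`. -/
noncomputable def actAssoc (x : P.FullSubcategory) :
    Ev ((takeuchi M M).row x) (homPsh k P N) →ₗ[k] Ev (M.row x) (homPsh k P N') :=
  ActDesc.lift
    { fn := fun {z w} => LinearMap.mk₂ k (fun (m : Ev (M.row x) (M.col z)) e =>
          { toFun := fun h => Ev.map (F := M.row x) (G := M.col z) (PshHom.id _)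
              (actHom θ hθ e h) m
            map_add' := fun h h' => by
              refine congrArg (· m) (takeuchi_ext (ψ := Ev.map (PshHom.id _) (actHom θ hθ e h) +
                Ev.map (PshHom.id _) (actHom θ hθ e h')) fun a e' c => ?_)
              rw [LinearMap.add_apply, map_actHom_of, map_actHom_of, map_actHom_of,
                actOf_add_right, map_add, actOf_add_right]
            map_smul' := fun r h => by
              refine congrArg (· m) (takeuchi_ext (ψ := r • Ev.map (PshHom.id _)
                (actHom θ hθ e h)) fun a e' c => ?_)
              rw [LinearMap.smul_apply, map_actHom_of, map_actHom_of,
                actOf_smul_right, map_smul, actOf_smul_right] })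
        (fun m m' e => LinearMap.ext fun h => map_add (Ev.map (F := M.row x) (G := M.col z)
          (PshHom.id _) (actHom θ hθ e h)) m m')
        (fun r m e => LinearMap.ext fun h => map_smul (Ev.map (F := M.row x) (G := M.col z)
          (PshHom.id _) (actHom θ hθ e h)) r m)
        (fun m e e₂ => LinearMap.ext fun h => by
          refine congrArg (· m) (takeuchi_ext
            (φ := Ev.map (PshHom.id _) (actHom θ hθ (e + e₂) h))
            (ψ := Ev.map (PshHom.id _) (actHom θ hθ e h) +
              Ev.map (PshHom.id _) (actHom θ hθ e₂ h)) fun a e' c => ?_)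
          rw [LinearMap.add_apply, map_actHom_of, map_actHom_of, map_actHom_of,
            actOf_add_mid, map_add, actOf_add_right])
        (fun r m e => LinearMap.ext fun h => by
          refine congrArg (· m) (takeuchi_ext
            (φ := Ev.map (PshHom.id _) (actHom θ hθ (r • e) h))
            (ψ := r • Ev.map (PshHom.id _) (actHom θ hθ e h)) fun a e' c => ?_)
          rw [LinearMap.smul_apply, map_actHom_of, map_actHom_of,
            actOf_smul_mid, map_smul, actOf_smul_right])
      bal_left := fun {z₁ z₂ w} g m e h => by
        refine (congrArg (Ev.map (F := M.row x) (G := M.col z₁) (PshHom.id _)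
          (actHom θ hθ e h)) (takeuchi_act M M (𝟙 x) g m)).trans ?_
        refine congrArg (· m) (takeuchi_ext
          (φ := Ev.map (F := M.row x) (G := M.col z₁) (PshHom.id _) (actHom θ hθ e h) ∘ₗ
            Ev.map (M.rowMap (𝟙 x)) (M.colMap g))
          (ψ := Ev.map (PshHom.id _) (actHom θ hθ (e ≫ g ▷ w) h)) fun {y z'} a e' c => ?_)
        rw [LinearMap.comp_apply, map_actHom_of, Ev.map_of]
        refine (map_actHom_of θ hθ e h (M.act (𝟙 x) (𝟙 y) a) e' (M.act (𝟙 z') g c)).trans ?_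
        rw [BiPsh.act_id, actOf_bal_left]
      bal_right := fun {z w₁ w₂} g m e h => by
        refine congrArg (· m) (takeuchi_ext
          (φ := Ev.map (PshHom.id _) (actHom θ hθ e (g.hom ≫ h)))
          (ψ := Ev.map (PshHom.id _) (actHom θ hθ (e ≫ z ◁ g) h)) fun {y z'} a e' c => ?_)
        rw [map_actHom_of, map_actHom_of, actOf_bal_right] }

lemma actAssoc_actOf {x z w : P.FullSubcategory} (m : Ev (M.row x) (M.col z))
    (e : 𝟙_ P.FullSubcategory ⟶ z ⊗ w) (h : w.obj ⟶ N) :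
    actAssoc θ hθ x (actOf (M := takeuchi M M) m e h) =
      Ev.map (F := M.row x) (G := M.col z) (PshHom.id _) (actHom θ hθ e h) m :=
  ActDesc.lift_actOf _ _ _ _

end Assoc

variable {M : BiPsh.{w, u', w} k P.FullSubcategory}

/-- Objects `G₀ N` which represent `x ↦ Hom (x, M × N)`. -/
structure ActRep (M : BiPsh.{w, u', w} k P.FullSubcategory) (G₀ : H → H) where
  θ (x : P.FullSubcategory) (N : H) : Ev (M.row x) (homPsh k P N) ≃ₗ[k] (x.obj ⟶ G₀ N)
  nat {x x' : P.FullSubcategory} (f : x ⟶ x') (N : H) (t : Ev (M.row x') (homPsh k P N)) :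
    θ x N (Ev.map (M.rowMap f) (PshHom.id _) t) = f.hom ≫ θ x' N t

/-- The presheaf `x ↦ Hom (x, M × N)`. -/
noncomputable def actPsh (M : BiPsh.{w, u', w} k P.FullSubcategory) (N : H) :
    Psh.{w, u', max u' w} k P.FullSubcategory where
  obj x := ModuleCat.of k (Ev (M.row x.unop) (homPsh k P N))
  map f := ModuleCat.ofHom (Ev.map (M.rowMap f.unop) (PshHom.id _))
  map_id x := by
    refine ModuleCat.hom_ext (act_hom_ext fun b e h => ?_)
    refine (map_actOf_left _ _ _ _).trans ?_
    exact congrArg (actOf · e h) (M.act_id b)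
  map_comp {x y z} f g := by
    refine ModuleCat.hom_ext (act_hom_ext fun {z w} b e h => ?_)
    refine (map_actOf_left _ _ _ _).trans ?_
    have h1 := M.act_comp g.unop f.unop (𝟙 z) (𝟙 z) b
    rw [Category.comp_id] at h1
    refine (congrArg (actOf · e h) h1).trans ?_
    refine (map_actOf_left g.unop _ e h).symm.trans ?_
    exact congrArg (Ev.map (M.rowMap g.unop) (PshHom.id _)) (map_actOf_left f.unop b e h).symm

variable [HasColimitsOfSize.{w, w} H]

/-- The coend is linear in `x` because `M` is, and it is small because the generators are
essentially small, so `Generating.exists_rep` applies for each `N`. Only objects are chosen here;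
functoriality is recovered from the universal property `ActRep.exists_desc`. -/
theorem Generating.exists_actRep (𝒢 : Generating k P) (hM : M.IsLinear) :
    ∃ G₀ : H → H, Nonempty (ActRep M G₀) := by
  have (N : H) : Nonempty (Generating.Rep (actPsh M N)) := by
    have (x : P.FullSubcategoryᵒᵖ) : Small.{w} ((actPsh M N).obj x) :=
      Ev.small 𝒢.obj 𝒢.exists_iso
    refine 𝒢.exists_rep (actPsh M N) (fun {x y} f g t => ?_) (fun {x y} r f t => ?_)
    · refine congrArg (· t) (act_hom_ext
        (φ := Ev.map (M.rowMap (f + g)) (PshHom.id _))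
        (ψ := Ev.map (M.rowMap f) (PshHom.id _) + Ev.map (M.rowMap g) (PshHom.id _))
        fun b e h => ?_)
      rw [LinearMap.add_apply, map_actOf_left, map_actOf_left, map_actOf_left,
        hM.act_add_left, actOf_add_left]
    · refine congrArg (· t) (act_hom_ext
        (φ := Ev.map (M.rowMap (r • f)) (PshHom.id _))
        (ψ := r • Ev.map (M.rowMap f) (PshHom.id _)) fun b e h => ?_)
      rw [LinearMap.smul_apply, map_actOf_left, map_actOf_left, hM.act_smul_left, actOf_smul_left]
  let R := fun N => (this N).some
  exact ⟨fun N => (R N).X, ⟨⟨fun x N => (R N).e x, fun f N t => (R N).nat f t⟩⟩⟩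

namespace ActRep
variable {G₀ : H → H} (R : ActRep M G₀)

/-- The morphism `x ⟶ M × N` given by a class `[b, e, h]`. -/
noncomputable def cls {x z w : P.FullSubcategory} {N : H} (b : M.at x z)
    (e : 𝟙_ P.FullSubcategory ⟶ z ⊗ w) (h : w.obj ⟶ N) : x.obj ⟶ G₀ N :=
  R.θ x N (actOf b e h)

/-- Naturality in `x` and the balancing in both inner variables, combined into one rule. It lets the
associators and unitors produced by products of elements of `M` travel into the middle entry `e`,
where coherence of `nest` cancels them. -/
lemma cls_act {x x' z z' w w' : P.FullSubcategory} {N : H} (f : x ⟶ x') (g : z ⟶ z')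
    (j : w ⟶ w') (b : M.at x' z') (e : 𝟙_ P.FullSubcategory ⟶ z ⊗ w) (h : w'.obj ⟶ N) :
    R.cls (M.act f g b) e (j.hom ≫ h) = f.hom ≫ R.cls b (e ≫ (g ⊗ₘ j)) h := by
  rw [cls, cls, ← R.nat, map_actOf_left, MonoidalCategory.tensorHom_def, ← Category.assoc,
    ← actOf_bal_right, ← actOf_bal_left]
  congr 2
  rw [← BiPsh.act_comp, Category.id_comp, Category.comp_id]

lemma cls_act' {x x' z z' w : P.FullSubcategory} {N : H} (f : x ⟶ x') (g : z ⟶ z')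
    (b : M.at x' z') (e : 𝟙_ P.FullSubcategory ⟶ z ⊗ w) (h : w.obj ⟶ N) :
    R.cls (M.act f g b) e h = f.hom ≫ R.cls b (e ≫ g ▷ w) h := by
  have h1 := R.cls_act f g (𝟙 w) b e h
  rw [ObjectProperty.FullSubcategory.id_hom, Category.id_comp, tensorHom_id] at h1
  exact h1

/-- Maps out of `M × N` agree if they agree on all classes. -/
lemma hom_ext (𝒢 : Generating k P) {N Z : H} {f g : G₀ N ⟶ Z}
    (h : ∀ {x z w : P.FullSubcategory} (b : M.at x z) (e : 𝟙_ P.FullSubcategory ⟶ z ⊗ w)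
      (h : w.obj ⟶ N), R.cls b e h ≫ f = R.cls b e h ≫ g) : f = g := by
  refine 𝒢.map_hom_ext (𝟭 H) fun x a => ?_
  obtain ⟨t, rfl⟩ := (R.θ x N).surjective a
  refine congrArg (· t) (act_hom_ext (φ := Linear.rightComp k _ f ∘ₗ (R.θ x N).toLinearMap)
    (ψ := Linear.rightComp k _ g ∘ₗ (R.θ x N).toLinearMap) fun b e j => h b e j)

/-- Maps out of `M × N` are given by natural families of maps. -/
lemma exists_desc (𝒢 : Generating k P) {N Z : H}
    (Φ : ∀ x : P.FullSubcategory, Ev (M.row x) (homPsh k P N) →ₗ[k] (x.obj ⟶ Z))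
    (hΦ : ∀ {x x' : P.FullSubcategory} (f : x ⟶ x') {z w : P.FullSubcategory} (b : M.at x' z)
      (e : 𝟙_ P.FullSubcategory ⟶ z ⊗ w) (h : w.obj ⟶ N),
      Φ x (actOf (M.act f (𝟙 z) b) e h) = f.hom ≫ Φ x' (actOf b e h)) :
    ∃ ψ : G₀ N ⟶ Z, ∀ x t, R.θ x N t ≫ ψ = Φ x t := by
  obtain ⟨ψ, hψ⟩ := 𝒢.exists_map_desc (𝟭 H) (N := G₀ N) (Z := Z)
    (fun x a => Φ x ((R.θ x N).symm a)) (fun x f g => by rw [map_add, map_add])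
    (fun {x y} f g => by
      obtain ⟨t, rfl⟩ := (R.θ y N).surjective g
      rw [← R.nat, LinearEquiv.symm_apply_apply, LinearEquiv.symm_apply_apply]
      refine congrArg (· t) (act_hom_ext (φ := Φ x ∘ₗ Ev.map (M.rowMap f) (PshHom.id _))
        (ψ := Linear.leftComp k Z f.hom ∘ₗ Φ y) fun b e h => ?_)
      rw [LinearMap.comp_apply, map_actOf_left]
      exact hΦ f b e h)
  refine ⟨ψ, fun x t => ?_⟩
  refine (hψ x (R.θ x N t)).trans ?_
  rw [LinearEquiv.symm_apply_apply]

/-- Maps out of a tensor product `(M × N) ⊗ (M × N')` agree if they agree on all classes. -/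
lemma tensor_hom_ext (𝒢 : Generating k P) [TensorCocontinuous H] {N N' Z : H}
    {f g : G₀ N ⊗ G₀ N' ⟶ Z}
    (h : ∀ {x z w x' z' w' : P.FullSubcategory} (b : M.at x z)
      (e : 𝟙_ P.FullSubcategory ⟶ z ⊗ w) (h : w.obj ⟶ N) (b' : M.at x' z')
      (e' : 𝟙_ P.FullSubcategory ⟶ z' ⊗ w') (h' : w'.obj ⟶ N'),
      (R.cls b e h ⊗ₘ R.cls b' e' h') ≫ f = (R.cls b e h ⊗ₘ R.cls b' e' h') ≫ g) : f = g := by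
  refine 𝒢.tensor_hom_ext fun x y a b => ?_
  obtain ⟨t, rfl⟩ := (R.θ x N).surjective a
  obtain ⟨t', rfl⟩ := (R.θ y N').surjective b
  refine act_induction (p := fun t => (R.θ x N t ⊗ₘ R.θ y N' t') ≫ f =
    (R.θ x N t ⊗ₘ R.θ y N' t') ≫ g) ?_ (fun {z w} b e j => ?_) t
  · intro _ _ h h'
    rw [map_add, MonoidalPreadditive.add_tensor, Preadditive.add_comp, Preadditive.add_comp, h, h']
  refine act_induction (p := fun t' => (R.θ x N (actOf b e j) ⊗ₘ R.θ y N' t') ≫ f =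
    (R.θ x N (actOf b e j) ⊗ₘ R.θ y N' t') ≫ g) ?_ (fun {z w} b' e' j' => ?_) t'
  · intro _ _ h h'
    rw [map_add, MonoidalPreadditive.tensor_add, Preadditive.add_comp, Preadditive.add_comp, h, h']
  exact h b e j b' e' j'

/-- Maps out of a triple tensor product agree if they agree on all classes. -/
lemma tensor_hom_ext₃ (𝒢 : Generating k P) [TensorCocontinuous H] {N N' N'' Z : H}
    {f g : (G₀ N ⊗ G₀ N') ⊗ G₀ N'' ⟶ Z}
    (h : ∀ {x z w x' z' w' x'' z'' w'' : P.FullSubcategory} (b : M.at x z)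
      (e : 𝟙_ P.FullSubcategory ⟶ z ⊗ w) (h : w.obj ⟶ N) (b' : M.at x' z')
      (e' : 𝟙_ P.FullSubcategory ⟶ z' ⊗ w') (h' : w'.obj ⟶ N') (b'' : M.at x'' z'')
      (e'' : 𝟙_ P.FullSubcategory ⟶ z'' ⊗ w'') (h'' : w''.obj ⟶ N''),
      ((R.cls b e h ⊗ₘ R.cls b' e' h') ⊗ₘ R.cls b'' e'' h'') ≫ f =
        ((R.cls b e h ⊗ₘ R.cls b' e' h') ⊗ₘ R.cls b'' e'' h'') ≫ g) : f = g := by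
  have := TensorCocontinuous.left (G₀ N ⊗ G₀ N')
  refine 𝒢.map_hom_ext (tensorLeft (G₀ N ⊗ G₀ N')) fun x'' c => ?_
  obtain ⟨t'', rfl⟩ := (R.θ x'' N'').surjective c
  refine act_induction (p := fun t => (tensorLeft (G₀ N ⊗ G₀ N')).map (R.θ x'' N'' t) ≫ f =
    (tensorLeft (G₀ N ⊗ G₀ N')).map (R.θ x'' N'' t) ≫ g) ?_ (fun {z'' w''} b'' e'' h'' => ?_) t''
  · intro _ _ h h'
    rw [map_add, Functor.map_add, Preadditive.add_comp, Preadditive.add_comp, h, h']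
  have := TensorCocontinuous.left (G₀ N)
  have := TensorCocontinuous.right x''.obj
  refine 𝒢.map_hom_ext (tensorLeft (G₀ N) ⋙ tensorRight x''.obj) fun x' c' => ?_
  obtain ⟨t', rfl⟩ := (R.θ x' N').surjective c'
  refine act_induction (p := fun t =>
    (tensorLeft (G₀ N) ⋙ tensorRight x''.obj).map (R.θ x' N' t) ≫ _ =
    (tensorLeft (G₀ N) ⋙ tensorRight x''.obj).map (R.θ x' N' t) ≫ _) ?_
      (fun {z' w'} b' e' h' => ?_) t'
  · intro _ _ h h'
    rw [map_add, Functor.map_add, Preadditive.add_comp, Preadditive.add_comp, h, h']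
  have := TensorCocontinuous.right x'.obj
  refine 𝒢.map_hom_ext (tensorRight x'.obj ⋙ tensorRight x''.obj) fun x c => ?_
  obtain ⟨t, rfl⟩ := (R.θ x N).surjective c
  refine act_induction (p := fun t =>
    (tensorRight x'.obj ⋙ tensorRight x''.obj).map (R.θ x N t) ≫ _ =
    (tensorRight x'.obj ⋙ tensorRight x''.obj).map (R.θ x N t) ≫ _) ?_
      (fun {z w} b e j => ?_) t
  · intro _ _ h h'
    rw [map_add, Functor.map_add, Preadditive.add_comp, Preadditive.add_comp, h, h']
  have h1 := h b e j b' e' h' b'' e'' h''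
  rw [MonoidalCategory.tensorHom_def, MonoidalCategory.tensorHom_def, comp_whiskerRight,
    Category.assoc, Category.assoc, Category.assoc, Category.assoc] at h1
  exact h1

end ActRep
end ActRep
end HarishChandra

namespace HarishChandra

/-! ### Coherence of nested coevaluations -/

section Coherence
variable {A : Type u'} [Category.{w} A] [MonoidalCategory A]

/-- Both sides draw the same three nested cups, with `e` innermost and `e''` outermost, so they
differ by coherence only. The associator on the left legs is inverted, as the left legs accumulate
in reverse order. -/
lemma nest_assoc {z w z' w' z'' w'' : A} (e : 𝟙_ A ⟶ z ⊗ w) (e' : 𝟙_ A ⟶ z' ⊗ w')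
    (e'' : 𝟙_ A ⟶ z'' ⊗ w'') :
    nest (nest e e') e'' ≫ (α_ z'' z' z).inv ▷ _ ≫ _ ◁ (α_ w w' w'').hom =
      nest e (nest e' e'') := by
  simp only [nest]
  monoidal

lemma nest_unit_left {z w : A} (e : 𝟙_ A ⟶ z ⊗ w) :
    nest (λ_ (𝟙_ A)).inv e = e ≫ ((ρ_ z).inv ⊗ₘ (λ_ w).inv) := by
  simp only [nest]
  monoidal

lemma nest_unit_right {z w : A} (e : 𝟙_ A ⟶ z ⊗ w) :
    nest e (λ_ (𝟙_ A)).inv = e ≫ ((λ_ z).inv ⊗ₘ (ρ_ w).inv) := by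
  simp only [nest]
  monoidal

/-- The nested composite `(x ⊗ x') ⊗ (y' ⊗ y) ⟶ x ⊗ y ⟶ 𝟙`. -/
def nestEval {x y x' y' : A} (φ : x ⊗ y ⟶ 𝟙_ A) (φ' : x' ⊗ y' ⟶ 𝟙_ A) :
    (x ⊗ x') ⊗ (y' ⊗ y) ⟶ 𝟙_ A :=
  (α_ x x' (y' ⊗ y)).hom ≫ x ◁ ((α_ x' y' y).inv ≫ φ' ▷ y ≫ (λ_ y).hom) ≫ φ

/-- A planar isotopy. After rebracketing, the content is the interchange law: the inner cup `e`
slides past the cap `φ'`, after which the two contractions stand side by side. It makes the counit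
of the comonad monoidal and nested coevaluations coevaluations again. -/
lemma contractLeft_nest {x z w x' z' w' : A} (e : 𝟙_ A ⟶ z ⊗ w) (e' : 𝟙_ A ⟶ z' ⊗ w')
    (φ : x ⊗ z ⟶ 𝟙_ A) (φ' : x' ⊗ z' ⟶ 𝟙_ A) :
    contractLeft (nest e e') (nestEval φ φ') = contractLeft e φ ⊗ₘ contractLeft e' φ' := by
  have h1 : contractLeft (nest e e') (nestEval φ φ') =
      (ρ_ _).inv ≫ (x ⊗ x') ◁ e' ≫ (α_ x x' (z' ⊗ w')).hom ≫ x ◁ ((α_ x' z' w').inv ≫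
        (x' ⊗ z') ◁ ((λ_ w').inv ≫ e ▷ w' ≫ (α_ z w w').hom) ≫ φ' ▷ (z ⊗ (w ⊗ w')) ≫
          (λ_ _).hom) ≫ (α_ x z (w ⊗ w')).inv ≫ φ ▷ (w ⊗ w') ≫ (λ_ _).hom := by
    simp only [contractLeft, nest, nestEval]
    monoidal
  rw [h1, whisker_exchange_assoc, MonoidalCategory.tensorHom_def']
  simp only [contractLeft]
  monoidal

/-- Both sides are the cups `e₁` and `e` side by side with their adjacent legs closed by `φ`; they
differ by the order in which the cups are created. It exchanges a contraction acting on `w` for one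
acting on `z₁`, which relates the two counit laws and produces transposes. -/
lemma whiskerLeft_contractLeft {z₁ w₁ z w : A} (e₁ : 𝟙_ A ⟶ z₁ ⊗ w₁) (e : 𝟙_ A ⟶ z ⊗ w)
    (φ : w₁ ⊗ z ⟶ 𝟙_ A) : e₁ ≫ z₁ ◁ contractLeft e φ = e ≫ contractRight e₁ φ ▷ w := by
  have h1 : e₁ ≫ z₁ ◁ contractLeft e φ = (ρ_ (𝟙_ A)).inv ≫ (e₁ ▷ 𝟙_ A ≫ (z₁ ⊗ w₁) ◁ e) ≫
      (α_ z₁ w₁ (z ⊗ w)).hom ≫ z₁ ◁ ((α_ w₁ z w).inv ≫ φ ▷ w ≫ (λ_ w).hom) := by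
    simp only [contractLeft]
    monoidal
  rw [h1, ← whisker_exchange]
  simp only [contractRight]
  monoidal

lemma contractLeft_unit {x : A} (φ : x ⊗ 𝟙_ A ⟶ 𝟙_ A) :
    contractLeft (λ_ (𝟙_ A)).inv φ = (ρ_ x).inv ≫ φ := by
  simp only [contractLeft]
  monoidal

end Coherence

/-- A multiplication and a unit which are associative and unital. -/
structure MulOne.IsMonoid {k : Type w} [Field k] {A : Type u'} [Category.{w} A]
    [MonoidalCategory A] {M : BiPsh.{w, u', v} k A} (S : MulOne M) : Prop where
  mul_assoc {x₁ x₂ x₃ y₁ y₂ y₃ : A} (a₁ : M.at x₁ y₁) (a₂ : M.at x₂ y₂) (a₃ : M.at x₃ y₃) :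
    S.mul (S.mul a₁ a₂) a₃ =
      M.act (α_ x₁ x₂ x₃).hom (α_ y₃ y₂ y₁).inv (S.mul a₁ (S.mul a₂ a₃))
  one_mul {x y : A} (a : M.at x y) : S.mul S.one a = M.act (λ_ x).hom (ρ_ y).hom a
  mul_one {x y : A} (a : M.at x y) : S.mul a S.one = M.act (ρ_ x).hom (λ_ y).hom a

/-- An augmentation which is multiplicative and unital. -/
structure Aug.IsMul {k : Type w} [Field k] {A : Type u'} [Category.{w} A]
    [MonoidalCategory A] [Preadditive A] [Linear k A] {M : BiPsh.{w, u', v} k A} (ε : Aug M)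
    (S : MulOne M) : Prop where
  map_one : ε.app (𝟙_ A) (𝟙_ A) S.one = (λ_ (𝟙_ A)).hom
  map_mul {x y x' y' : A} (a : M.at x y) (a' : M.at x' y') :
    ε.app _ _ (S.mul a a') = nestEval (ε.app x y a) (ε.app x' y' a')

end HarishChandra

namespace HarishChandra

/-! ### Reassociation of nested classes -/

section NestedAction
variable {k : Type w} [Field k] {H : Type u'} [Category.{w} H] [Preadditive H] [Linear k H]
  [MonoidalCategory H] [MonoidalPreadditive H] [MonoidalLinear k H] {P : ObjectProperty H}
  [P.IsMonoidal]
variable {M : BiPsh.{w, u', v} k P.FullSubcategory}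

lemma takeuchiAssoc_of {A : Type u'} [Category.{w} A] [MonoidalCategory A] [Preadditive A]
    [Linear k A] [MonoidalPreadditive A] [MonoidalLinear k A] {M : BiPsh.{w, u', v₁} k A}
    {N : BiPsh.{w, u', v₂} k A} {P : BiPsh.{w, u', v₃} k A} {x y z w z' w' : A}
    (a : M.at x z) (e : 𝟙_ A ⟶ z ⊗ w) (b : N.at w z') (e' : 𝟙_ A ⟶ z' ⊗ w') (c : P.at w' y) :
    takeuchiAssoc M N P x y (Ev.of (F := (takeuchi M N).row x) (G := P.col y)
      (Ev.of (F := M.row x) (G := N.col z') a e b) e' c) =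
      Ev.of (F := M.row x) (G := (takeuchi N P).col y) a e
        (Ev.of (F := N.row w) (G := P.col y) b e' c) := by
  rw [takeuchiAssoc]
  refine (Ev.lift_of _ _ _ _).trans ?_
  exact takeuchiAssocAux_of x y a e b e' c

section
variable {N N' N'' : H}
    (θ : ∀ x : P.FullSubcategory, Ev (M.row x) (homPsh k P N) →ₗ[k] (x.obj ⟶ N'))
    (hθ : ∀ {x x' : P.FullSubcategory} (f : x ⟶ x') (t : Ev (M.row x') (homPsh k P N)),
      θ x (Ev.map (M.rowMap f) (PshHom.id _) t) = f.hom ≫ θ x' t)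
    (θ' : ∀ x : P.FullSubcategory, Ev (M.row x) (homPsh k P N') →ₗ[k] (x.obj ⟶ N''))
    (hθ' : ∀ {x x' : P.FullSubcategory} (f : x ⟶ x') (t : Ev (M.row x') (homPsh k P N')),
      θ' x (Ev.map (M.rowMap f) (PshHom.id _) t) = f.hom ≫ θ' x' t)

lemma actAssoc_nat {x x' : P.FullSubcategory} (f : x ⟶ x')
    (t : Ev ((takeuchi M M).row x') (homPsh k P N)) :
    actAssoc θ hθ x (Ev.map ((takeuchi M M).rowMap f) (PshHom.id _) t) =
      Ev.map (M.rowMap f) (PshHom.id _) (actAssoc θ hθ x' t) := by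
  refine congrArg (· t) (act_hom_ext
    (φ := actAssoc θ hθ x ∘ₗ Ev.map ((takeuchi M M).rowMap f) (PshHom.id _))
    (ψ := Ev.map (M.rowMap f) (PshHom.id _) ∘ₗ actAssoc θ hθ x') fun {z w} m e h => ?_)
  rw [LinearMap.comp_apply, LinearMap.comp_apply, map_actOf_left]
  refine (actAssoc_actOf _ _ _ _ _).trans ?_
  refine Eq.trans ?_ (congrArg _ (actAssoc_actOf _ _ _ _ _)).symm
  refine (congrArg (Ev.map (F := M.row x) (G := M.col z) (PshHom.id _) (actHom θ hθ e h))
    (takeuchi_act M M f (𝟙 z) m)).trans ?_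
  refine congrArg (· m) (takeuchi_ext
    (φ := Ev.map (F := M.row x) (G := M.col z) (PshHom.id _) (actHom θ hθ e h) ∘ₗ
      Ev.map (M.rowMap f) (M.colMap (𝟙 z)))
    (ψ := Ev.map (M.rowMap f) (PshHom.id _) ∘ₗ
      Ev.map (F := M.row x') (G := M.col z) (PshHom.id _) (actHom θ hθ e h))
    fun {y z'} a e' c => ?_)
  rw [LinearMap.comp_apply, LinearMap.comp_apply, map_actHom_of, Ev.map_of, map_actOf_left]
  refine (map_actHom_of θ hθ e h (M.act f (𝟙 y) a) e' (M.act (𝟙 z') (𝟙 z) c)).trans ?_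
  rw [BiPsh.act_id]

/-- The natural map `[a, e', c] ↦ θ' [a, e', θ [c, e, h]]`. -/
noncomputable def actHom₂ {z w : P.FullSubcategory} (e : 𝟙_ P.FullSubcategory ⟶ z ⊗ w)
    (h : w.obj ⟶ N) : PshHom ((takeuchi M M).col z) (homPsh k P N'') :=
  actHom (M := takeuchi M M) (fun x => θ' x ∘ₗ actAssoc θ hθ x)
    (fun f t => (congrArg (θ' _) (actAssoc_nat θ hθ f t)).trans (hθ' f _)) e h

lemma actHom₂_app {z w x : P.FullSubcategory} (e : 𝟙_ P.FullSubcategory ⟶ z ⊗ w)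
    (h : w.obj ⟶ N) (m : Ev (M.row x) (M.col z)) : (actHom₂ θ hθ θ' hθ' e h).app x m =
      θ' x (Ev.map (F := M.row x) (G := M.col z) (PshHom.id _) (actHom θ hθ e h) m) :=
  congrArg (θ' x) (actAssoc_actOf θ hθ m e h)

/-- On `[[a, e₁, c₁], e', c]` both sides give `[a, e₁, θ' [c₁, e', θ [c, e, h]]]`. This is the
pentagon relating the associativity of the Takeuchi product to that of its action, and it turns
coassociativity of `Δ` into coassociativity of the comonad. -/
lemma map_actHom₂_takeuchiAssoc {z w x : P.FullSubcategory}
    (e : 𝟙_ P.FullSubcategory ⟶ z ⊗ w) (h : w.obj ⟶ N)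
    (t : Ev ((takeuchi M M).row x) (M.col z)) :
    Ev.map (F := M.row x) (G := (takeuchi M M).col z) (PshHom.id _) (actHom₂ θ hθ θ' hθ' e h)
      (takeuchiAssoc M M M x z t) =
    actAssoc θ' hθ' x (Ev.map (F := (takeuchi M M).row x) (G := M.col z) (PshHom.id _)
      (actHom θ hθ e h) t) := by
  refine congrArg (· t) (takeuchi_ext
    (φ := Ev.map (F := M.row x) (G := (takeuchi M M).col z) (PshHom.id _)
      (actHom₂ θ hθ θ' hθ' e h) ∘ₗ takeuchiAssoc M M M x z)
    (ψ := actAssoc θ' hθ' x ∘ₗ Ev.map (F := (takeuchi M M).row x) (G := M.col z) (PshHom.id _)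
      (actHom θ hθ e h)) fun {y z'} m e' c => ?_)
  have h1 : ∀ m : Ev (M.row x) (M.col y), actAssoc θ' hθ' x (Ev.map
      (F := (takeuchi M M).row x) (G := M.col z) (PshHom.id _) (actHom θ hθ e h)
        (Ev.of (F := (takeuchi M M).row x) (G := M.col z) m e' c)) =
      Ev.map (F := M.row x) (G := M.col y) (PshHom.id _)
        (actHom θ' hθ' e' (θ z' (actOf c e h))) m := fun m =>
    (congrArg (actAssoc θ' hθ' x) (Ev.map_of _ _ _ _ _)).trans
      (actAssoc_actOf θ' hθ' m e' (θ z' (actOf c e h)))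
  refine Eq.trans ?_ (h1 m).symm
  refine Ev.induction (F := M.row x) (G := M.col y) (p := fun m => (_ ∘ₗ takeuchiAssoc M M M x z)
    (Ev.of (F := (takeuchi M M).row x) (G := M.col z) m e' c) = Ev.map (F := M.row x)
      (G := M.col y) (PshHom.id _) (actHom θ' hθ' e' (θ z' (actOf c e h))) m) ?_ ?_ m
  · intro t t' h h'
    rw [map_add, ← h, ← h', ← map_add]
    exact congrArg _ (Ev.add_left (F := (takeuchi M M).row x) (G := M.col z) t t' e' c)
  · intro p q a e₁ c₁
    refine (congrArg _ (takeuchiAssoc_of a e₁ c₁ e' c)).trans ?_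
    refine (Ev.map_of _ _ _ _ _).trans ?_
    refine Eq.trans ?_ (map_actHom_of θ' hθ' _ _ _ _ _).symm
    exact congrArg (actOf a e₁ ·) ((actHom₂_app θ hθ θ' hθ' e h _).trans
      (congrArg (θ' q) (map_actHom_of θ hθ e h c₁ e' c)))

end
end NestedAction

/-! ### Structure maps on the representing objects -/

section Comonad
variable {k : Type w} [Field k] {H : Type u'} [Category.{w} H] [Preadditive H] [Linear k H]
  [MonoidalCategory H] [MonoidalPreadditive H] [MonoidalLinear k H] {P : ObjectProperty H}
  [P.IsMonoidal] [HasColimitsOfSize.{w, w} H]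
  {M : BiPsh.{w, u', w} k P.FullSubcategory} {G₀ : H → H}

namespace ActRep
variable (R : ActRep M G₀)

/-- The natural map `b' ↦ [b', e, h]`. -/
noncomputable abbrev clsHom {N : H} {z w : P.FullSubcategory}
    (e : 𝟙_ P.FullSubcategory ⟶ z ⊗ w) (h : w.obj ⟶ N) : PshHom (M.col z) (homPsh k P (G₀ N)) :=
  actHom (fun x => (R.θ x N).toLinearMap) (fun f t => R.nat f N t) e h

lemma map_clsHom_of {N : H} {x y z w z' : P.FullSubcategory} (e : 𝟙_ P.FullSubcategory ⟶ z ⊗ w)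
    (h : w.obj ⟶ N) (a : M.at x y) (e' : 𝟙_ P.FullSubcategory ⟶ y ⊗ z') (c : M.at z' z) :
    Ev.map (F := M.row x) (G := M.col z) (PshHom.id _) (R.clsHom e h)
      (Ev.of (F := M.row x) (G := M.col z) a e' c) = actOf a e' (R.cls c e h) :=
  Ev.map_of _ _ _ _ _

lemma exists_map (𝒢 : Generating k P) {N N' : H} (g : N ⟶ N') : ∃ ψ : G₀ N ⟶ G₀ N', ∀ x t,
    R.θ x N t ≫ ψ = R.θ x N' (Ev.map (PshHom.id _) (homPshMap g) t) :=
  R.exists_desc 𝒢 (fun x => (R.θ x N').toLinearMap ∘ₗ Ev.map (PshHom.id _) (homPshMap g))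
    fun {x x'} f {z w} b e h => by
      rw [LinearMap.comp_apply, LinearMap.comp_apply, map_actOf_right, map_actOf_right]
      refine Eq.trans ?_ (R.nat f N' (actOf b e (h ≫ g)))
      rw [map_actOf_left]
      rfl

lemma exists_counit (𝒢 : Generating k P) (ε : Aug M) (N : H) : ∃ ψ : G₀ N ⟶ N, ∀ x t,
    R.θ x N t ≫ ψ = actCounit ε x N t :=
  R.exists_desc 𝒢 (fun x => actCounit ε x N) fun {x x'} f {z w} b e h => by
    rw [actCounit_actOf, actCounit_actOf]
    have h1 := ε.naturality f (𝟙 z) b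
    rw [tensorHom_id] at h1
    rw [h1, contractLeft_whiskerRight, ObjectProperty.FullSubcategory.comp_hom, Category.assoc]

/-- The class is first expanded by `Δ` and then reassociated. Balancing is already contained in
`Ev.map` and `actAssoc`, so naturality in `x` is the only thing left to check. -/
lemma exists_comul (𝒢 : Generating k P) (Δ : BiPshHom M (takeuchi M M)) (N : H) : ∃ ψ : G₀ N ⟶ G₀ (G₀ N), ∀ x t,
    R.θ x N t ≫ ψ = R.θ x (G₀ N) (actAssoc (fun x => (R.θ x N).toLinearMap)
      (fun f t => R.nat f N t) x (Ev.map (Δ.row x) (PshHom.id _) t)) :=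
  R.exists_desc 𝒢 (fun x => (R.θ x (G₀ N)).toLinearMap ∘ₗ actAssoc
      (fun x => (R.θ x N).toLinearMap) (fun f t => R.nat f N t) x ∘ₗ
        Ev.map (Δ.row x) (PshHom.id _)) fun {x x'} f {z w} b e h => by
    have h1 (x : P.FullSubcategory) (b : M.at x z) : Ev.map (Δ.row x) (PshHom.id _)
        (actOf b e h) = actOf (M := takeuchi M M) (Δ.app x z b) e h := Ev.map_of _ _ _ _ _
    simp only [LinearMap.comp_apply, h1, Δ.naturality]
    refine Eq.trans ?_ (R.nat f (G₀ N) _)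
    refine congrArg (R.θ x (G₀ N)) (Eq.trans (congrArg _ ?_) (actAssoc_nat _ _ f _))
    exact (map_actOf_left (M := takeuchi M M) f _ e h).symm

lemma exists_mul (𝒢 : Generating k P) [TensorCocontinuous H] (S : MulOne M) (N N' : H) :
    ∃ ψ : G₀ N ⊗ G₀ N' ⟶ G₀ (N ⊗ N'), ∀ x x' t t',
      (R.θ x N t ⊗ₘ R.θ x' N' t') ≫ ψ = R.θ (x ⊗ x') (N ⊗ N') (actMul S x N x' N' t t') := by
  obtain ⟨ψ, hψ⟩ := 𝒢.exists_tensor_desc (X := G₀ N) (Y := G₀ N') (Z := G₀ (N ⊗ N'))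
    (fun x x' a b => R.θ (x ⊗ x') (N ⊗ N')
      (actMul S x N x' N' ((R.θ x N).symm a) ((R.θ x' N').symm b)))
    (fun x x' a a' b => by rw [map_add, map_add, LinearMap.add_apply, map_add])
    (fun x x' a b b' => by rw [map_add, map_add, map_add])
    (fun {x y x' y'} f g a b => by
      obtain ⟨t, rfl⟩ := (R.θ y N).surjective a
      obtain ⟨t', rfl⟩ := (R.θ y' N').surjective b
      rw [← R.nat, ← R.nat, LinearEquiv.symm_apply_apply, LinearEquiv.symm_apply_apply,
        LinearEquiv.symm_apply_apply, LinearEquiv.symm_apply_apply]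
      refine Eq.trans ?_ (R.nat (f ⊗ₘ g) _ _)
      refine congrArg (R.θ (x ⊗ x') (N ⊗ N')) ?_
      -- Both sides are bilinear in `t` and `t'`, so naturality is compared on two classes, where it
      -- is the naturality `S.mul_act` of the multiplication.
      refine congrArg (fun φ => φ t t') (act_hom_ext
        (φ := (actMul S x N x' N').compl₁₂ (Ev.map (M.rowMap f) (PshHom.id _))
          (Ev.map (M.rowMap g) (PshHom.id _)))
        (ψ := (actMul S y N y' N').compr₂ (Ev.map (M.rowMap (f ⊗ₘ g)) (PshHom.id _)))
        fun {z w} b e h => act_hom_ext fun {z' w'} b' e' h' => ?_)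
      rw [LinearMap.compl₁₂_apply, LinearMap.compr₂_apply, map_actOf_left, map_actOf_left,
        actMul_actOf, actMul_actOf, map_actOf_left, S.mul_act, id_tensorHom_id])
  refine ⟨ψ, fun x x' t t' => ?_⟩
  rw [hψ, LinearEquiv.symm_apply_apply, LinearEquiv.symm_apply_apply]

variable (𝒢 : Generating k P)

/-- Functoriality of `N ↦ M × N`. -/
noncomputable def map {N N' : H} (g : N ⟶ N') : G₀ N ⟶ G₀ N' := (R.exists_map 𝒢 g).choose

/-- The map `M × N ⟶ N` induced by the augmentation. -/
noncomputable def counit (ε : Aug M) (N : H) : G₀ N ⟶ N := (R.exists_counit 𝒢 ε N).choose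

/-- The map `M × N ⟶ M × (M × N)` induced by the comultiplication. -/
noncomputable def comul (Δ : BiPshHom M (takeuchi M M)) (N : H) : G₀ N ⟶ G₀ (G₀ N) :=
  (R.exists_comul 𝒢 Δ N).choose

/-- The map `(M × N) ⊗ (M × N') ⟶ M × (N ⊗ N')` induced by the multiplication. -/
noncomputable def mul [TensorCocontinuous H] (S : MulOne M) (N N' : H) :
    G₀ N ⊗ G₀ N' ⟶ G₀ (N ⊗ N') :=
  (R.exists_mul 𝒢 S N N').choose

/-- The map `𝟙 ⟶ M × 𝟙` induced by the unit. -/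
noncomputable def one (S : MulOne M) : 𝟙_ H ⟶ G₀ (𝟙_ H) :=
  R.cls S.one (λ_ (𝟙_ P.FullSubcategory)).inv (𝟙 (𝟙_ H))

lemma θ_map {N N' : H} (g : N ⟶ N') (x : P.FullSubcategory) (t) : R.θ x N t ≫ R.map 𝒢 g =
    R.θ x N' (Ev.map (PshHom.id _) (homPshMap g) t) :=
  (R.exists_map 𝒢 g).choose_spec x t

variable {x z w x' z' w' : P.FullSubcategory} {N N' : H} (b : M.at x z)
  (e : 𝟙_ P.FullSubcategory ⟶ z ⊗ w) (h : w.obj ⟶ N) (b' : M.at x' z')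
  (e' : 𝟙_ P.FullSubcategory ⟶ z' ⊗ w') (h' : w'.obj ⟶ N')

lemma cls_map (g : N ⟶ N') : R.cls b e h ≫ R.map 𝒢 g = R.cls b e (h ≫ g) :=
  (R.θ_map 𝒢 g x _).trans (congrArg (R.θ x N') (map_actOf_right _ _ _ _))

lemma θ_counit (ε : Aug M) (x : P.FullSubcategory) (N : H) (t) :
    R.θ x N t ≫ R.counit 𝒢 ε N = actCounit ε x N t :=
  (R.exists_counit 𝒢 ε N).choose_spec x t

lemma cls_counit (ε : Aug M) :
    R.cls b e h ≫ R.counit 𝒢 ε N = (contractLeft e (ε.app x z b)).hom ≫ h :=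
  (R.θ_counit 𝒢 ε x N _).trans (actCounit_actOf _ _ _ _)

lemma θ_comul (Δ : BiPshHom M (takeuchi M M)) (x : P.FullSubcategory) (N : H) (t) :
    R.θ x N t ≫ R.comul 𝒢 Δ N = R.θ x (G₀ N) (actAssoc (fun x => (R.θ x N).toLinearMap)
      (fun f t => R.nat f N t) x (Ev.map (Δ.row x) (PshHom.id _) t)) :=
  (R.exists_comul 𝒢 Δ N).choose_spec x t

lemma cls_comul (Δ : BiPshHom M (takeuchi M M)) : R.cls b e h ≫ R.comul 𝒢 Δ N =
    R.θ x (G₀ N) (Ev.map (F := M.row x) (G := M.col z) (PshHom.id _) (R.clsHom e h)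
      (Δ.app x z b)) := by
  refine (R.θ_comul 𝒢 Δ x N _).trans (congrArg (R.θ x (G₀ N)) ?_)
  refine Eq.trans (congrArg _ ?_) (actAssoc_actOf _ _ (Δ.app x z b) e h)
  exact Ev.map_of _ _ _ _ _

lemma cls_mul [TensorCocontinuous H] (S : MulOne M) :
    (R.cls b e h ⊗ₘ R.cls b' e' h') ≫ R.mul 𝒢 S N N' =
      R.cls (x := x ⊗ x') (z := z' ⊗ z) (w := w ⊗ w') (S.mul b b') (nest e e') (h ⊗ₘ h') :=
  ((R.exists_mul 𝒢 S N N').choose_spec x x' _ _).trans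
    (congrArg (R.θ (x ⊗ x') (N ⊗ N')) (actMul_actOf _ _ _ _ _ _ _))

lemma θ_mul [TensorCocontinuous H] (S : MulOne M) (t : Ev (M.row x) (homPsh k P N))
    (t' : Ev (M.row x') (homPsh k P N')) :
    (R.θ x N t ⊗ₘ R.θ x' N' t') ≫ R.mul 𝒢 S N N' =
      R.θ (x ⊗ x') (N ⊗ N') (actMul S x N x' N' t t') :=
  (R.exists_mul 𝒢 S N N').choose_spec x x' t t'

/-- The functor `N ↦ M × N`. -/
noncomputable def functor : H ⥤ H where
  obj := G₀
  map := R.map 𝒢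
  map_id N := R.hom_ext 𝒢 fun b e h => by
    rw [cls_map, Category.comp_id, Category.comp_id]
  map_comp f g := R.hom_ext 𝒢 fun b e h => by
    rw [← Category.assoc, cls_map, cls_map, cls_map, Category.assoc]

lemma cls_add_right (h₁ h₂ : w.obj ⟶ N) :
    R.cls b e (h₁ + h₂) = R.cls b e h₁ + R.cls b e h₂ := by
  rw [cls, actOf_add_right, map_add]; rfl

lemma cls_smul_right (r : k) : R.cls b e (r • h) = r • R.cls b e h := by
  rw [cls, actOf_smul_right, map_smul]; rfl

instance : (R.functor 𝒢).Additive where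
  map_add {N N' f g} := R.hom_ext 𝒢 fun b e h => by
    change _ ≫ R.map 𝒢 (f + g) = _ ≫ (R.map 𝒢 f + R.map 𝒢 g)
    rw [cls_map, Preadditive.comp_add, Preadditive.comp_add, cls_map, cls_map, cls_add_right]

instance : (R.functor 𝒢).Linear k where
  map_smul {N N'} f r := R.hom_ext 𝒢 fun b e h => by
    change _ ≫ R.map 𝒢 (r • f) = _ ≫ (r • R.map 𝒢 f)
    rw [cls_map, Linear.comp_smul, Linear.comp_smul, cls_map, cls_smul_right]

end ActRep
end Comonad
end HarishChandra

namespace HarishChandra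

/-! ### Comonad laws and preservation of colimits -/

section ComonadLaws
variable {k : Type w} [Field k] {H : Type u'} [Category.{w} H] [Preadditive H] [Linear k H]
  [MonoidalCategory H] [MonoidalPreadditive H] [MonoidalLinear k H] {P : ObjectProperty H}
  [P.IsMonoidal] [HasColimitsOfSize.{w, w} H]
  {M : BiPsh.{w, u', w} k P.FullSubcategory} {G₀ : H → H}

namespace ActRep
variable (R : ActRep M G₀) (𝒢 : Generating k P)

/-- To compare two linear expressions in a composite class `[m, e, h]`, it suffices to compare
them on the classes `[a, e', [c, e, h]]`. -/
lemma nested_ext {N : H} {x z w : P.FullSubcategory} (e : 𝟙_ P.FullSubcategory ⟶ z ⊗ w)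
    (h : w.obj ⟶ N) {Z : Type v} [AddCommGroup Z] [Module k Z]
    {φ : (x.obj ⟶ G₀ (G₀ N)) →ₗ[k] Z} {ψ : Ev (M.row x) (M.col z) →ₗ[k] Z}
    (hφ : ∀ {y z'} (a : M.at x y) (e' : 𝟙_ P.FullSubcategory ⟶ y ⊗ z') (c : M.at z' z),
      φ (R.cls a e' (R.cls c e h)) = ψ (Ev.of (F := M.row x) (G := M.col z) a e' c))
    (m : Ev (M.row x) (M.col z)) :
    φ (R.θ x (G₀ N) (Ev.map (F := M.row x) (G := M.col z) (PshHom.id _) (R.clsHom e h) m)) =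
      ψ m := by
  refine congrArg (· m) (takeuchi_ext (φ := φ ∘ₗ (R.θ x (G₀ N)).toLinearMap ∘ₗ
    Ev.map (F := M.row x) (G := M.col z) (PshHom.id _) (R.clsHom e h)) (ψ := ψ)
    fun a e' c => ?_)
  refine Eq.trans ?_ (hφ a e' c)
  exact congrArg (fun t => φ (R.θ x (G₀ N) t)) (R.map_clsHom_of e h a e' c)

/-- The natural transformation `M × N ⟶ N`. -/
noncomputable def counitNat (ε : Aug M) : R.functor 𝒢 ⟶ 𝟭 H where
  app N := R.counit 𝒢 ε N
  naturality N N' g := R.hom_ext 𝒢 fun b e h => by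
    change _ ≫ R.map 𝒢 g ≫ _ = _ ≫ _ ≫ g
    rw [← Category.assoc, cls_map, cls_counit, ← Category.assoc (R.cls b e h), cls_counit,
      Category.assoc]

/-- The natural transformation `M × N ⟶ M × (M × N)`. -/
noncomputable def comulNat (Δ : BiPshHom M (takeuchi M M)) :
    R.functor 𝒢 ⟶ R.functor 𝒢 ⋙ R.functor 𝒢 where
  app N := R.comul 𝒢 Δ N
  naturality N N' g := R.hom_ext 𝒢 fun {x z w} b e h => by
    change _ ≫ R.map 𝒢 g ≫ _ = _ ≫ _ ≫ R.map 𝒢 (R.map 𝒢 g)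
    rw [← Category.assoc, cls_map, cls_comul, ← Category.assoc (R.cls b e h), cls_comul]
    refine Eq.symm (R.nested_ext e h (φ := Linear.rightComp k x.obj (R.map 𝒢 (R.map 𝒢 g)))
      (ψ := (R.θ x (G₀ N')).toLinearMap ∘ₗ Ev.map (F := M.row x) (G := M.col z) (PshHom.id _)
        (R.clsHom e (h ≫ g))) (fun a e' c => ?_) (Δ.app x z b))
    refine (R.cls_map 𝒢 a e' _ _).trans ?_
    rw [cls_map]
    exact congrArg (R.θ x (G₀ N')) (R.map_clsHom_of e (h ≫ g) a e' c).symm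

variable {S : MulOne M} {hM : M.IsLinear} {ε : Aug M} {Δ : BiPshHom M (takeuchi M M)}

/-- The outer class is contracted: `[a, e', [c, e, h]]` becomes the class of `c` acted on by
`contractLeft e' ε(a)`, which is the definition of `Aug.counitLeft`. The law is thus the left counit
axiom, seen through the linear map `b ↦ [b, e, h]`. -/
lemma comul_counit (hΔ : IsCoring S hM ε Δ) (N : H) :
    R.comul 𝒢 Δ N ≫ R.counit 𝒢 ε (G₀ N) = 𝟙 (G₀ N) :=
  R.hom_ext 𝒢 fun {x z w} b e h => by
    have hl (b b' : M.at x z) : R.cls (b + b') e h = R.cls b e h + R.cls b' e h := by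
      rw [cls, actOf_add_left, map_add]; rfl
    have hs (r : k) (b : M.at x z) : R.cls (r • b) e h = r • R.cls b e h := by
      rw [cls, actOf_smul_left, map_smul]; rfl
    let l : M.at x z →ₗ[k] (x.obj ⟶ G₀ N) :=
      { toFun := fun b => R.cls b e h, map_add' := hl, map_smul' := hs }
    rw [← Category.assoc, cls_comul, Category.comp_id]
    refine (R.nested_ext e h (φ := Linear.rightComp k x.obj (R.counit 𝒢 ε (G₀ N)))
      (ψ := l ∘ₗ ε.counitLeft hM x z) (fun a e' c => ?_) (Δ.app x z b)).trans
        (congrArg l (hΔ.counit_left b))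
    refine (R.cls_counit 𝒢 a e' _ ε).trans ?_
    refine Eq.trans ?_ (congrArg l (Ev.lift_of _ _ _ _)).symm
    refine Eq.trans ?_ (R.cls_act' _ _ _ _ _).symm
    rw [id_whiskerRight, Category.comp_id]

/-- Here the inner class is contracted, which modifies the last entry of `[a, e', -]`. By
`whiskerLeft_contractLeft` this modification can be moved across `e'` onto `a`, and it is then the
one in `Aug.counitRight`. -/
lemma comul_map_counit (hΔ : IsCoring S hM ε Δ) (N : H) :
    R.comul 𝒢 Δ N ≫ R.map 𝒢 (R.counit 𝒢 ε N) = 𝟙 (G₀ N) :=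
  R.hom_ext 𝒢 fun {x z w} b e h => by
    have hl (b b' : M.at x z) : R.cls (b + b') e h = R.cls b e h + R.cls b' e h := by
      rw [cls, actOf_add_left, map_add]; rfl
    have hs (r : k) (b : M.at x z) : R.cls (r • b) e h = r • R.cls b e h := by
      rw [cls, actOf_smul_left, map_smul]; rfl
    let l : M.at x z →ₗ[k] (x.obj ⟶ G₀ N) :=
      { toFun := fun b => R.cls b e h, map_add' := hl, map_smul' := hs }
    rw [← Category.assoc, cls_comul, Category.comp_id]
    refine (R.nested_ext e h (φ := Linear.rightComp k x.obj (R.map 𝒢 (R.counit 𝒢 ε N)))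
      (ψ := l ∘ₗ ε.counitRight hM x z) (fun a e' c => ?_) (Δ.app x z b)).trans
        (congrArg l (hΔ.counit_right b))
    refine (R.cls_map 𝒢 a e' _ _).trans ?_
    rw [cls_counit]
    refine Eq.trans ?_ (congrArg l (Ev.lift_of _ _ _ _)).symm
    refine Eq.trans ?_ (R.cls_act' _ _ _ _ _).symm
    rw [← whiskerLeft_contractLeft]
    have h1 := R.cls_act (𝟙 x) (𝟙 _) (contractLeft e (ε.app _ z c)) a e' h
    rw [BiPsh.act_id, id_tensorHom] at h1
    exact h1

/-- Both sides are evaluations of a triple product at `h`; `map_actHom₂_takeuchiAssoc` brings the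
two bracketings to the same form, in which they are the two sides of the coassociativity of `Δ`. -/
lemma comul_coassoc (hΔ : IsCoring S hM ε Δ) (N : H) :
    R.comul 𝒢 Δ N ≫ R.map 𝒢 (R.comul 𝒢 Δ N) = R.comul 𝒢 Δ N ≫ R.comul 𝒢 Δ (G₀ N) :=
  R.hom_ext 𝒢 fun {x z w} b e h => by
    rw [← Category.assoc, ← Category.assoc, cls_comul, θ_comul]
    -- Applying `Δ` to the outer factor commutes with evaluating the inner factor at `h`, as the two
    -- operate on different entries of a class.
    have h2 : Ev.map (Δ.row x) (PshHom.id _) (Ev.map (F := M.row x) (G := M.col z)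
        (PshHom.id _) (R.clsHom e h) (Δ.app x z b)) =
        Ev.map (F := (takeuchi M M).row x) (G := M.col z) (PshHom.id _) (R.clsHom e h)
          (Ev.map (Δ.row x) (PshHom.id _) (Δ.app x z b)) := by
      refine congrArg (· (Δ.app x z b)) (takeuchi_ext
        (φ := Ev.map (Δ.row x) (PshHom.id _) ∘ₗ Ev.map (F := M.row x) (G := M.col z)
          (PshHom.id _) (R.clsHom e h))
        (ψ := Ev.map (F := (takeuchi M M).row x) (G := M.col z) (PshHom.id _) (R.clsHom e h) ∘ₗ
          Ev.map (Δ.row x) (PshHom.id _)) fun a e' c => ?_)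
      refine (congrArg (Ev.map (Δ.row x) (PshHom.id _)) (R.map_clsHom_of e h a e' c)).trans ?_
      refine (Ev.map_of _ _ _ _ _).trans ?_
      refine Eq.symm ((congrArg (Ev.map (F := (takeuchi M M).row x) (G := M.col z)
        (PshHom.id _) (R.clsHom e h)) (Ev.map_of _ _ _ _ _)).trans ?_)
      exact Ev.map_of _ _ _ _ _
    rw [h2]
    have h3 := map_actHom₂_takeuchiAssoc (M := M) (fun x => (R.θ x N).toLinearMap)
      (fun f t => R.nat f N t) (fun x => (R.θ x (G₀ N)).toLinearMap)
      (fun f t => R.nat f (G₀ N) t) e h (Ev.map (Δ.row x) (PshHom.id _) (Δ.app x z b))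
    refine Eq.trans ?_ (congrArg (R.θ x (G₀ (G₀ N))) h3)
    rw [hΔ.coassoc]
    refine R.nested_ext e h
      (φ := Linear.rightComp k x.obj (R.map 𝒢 (R.comul 𝒢 Δ N)))
      (ψ := (R.θ x (G₀ (G₀ N))).toLinearMap ∘ₗ Ev.map (F := M.row x) (G := (takeuchi M M).col z)
        (PshHom.id _) (actHom₂ (M := M) (fun x => (R.θ x N).toLinearMap)
          (fun f t => R.nat f N t) (fun x => (R.θ x (G₀ N)).toLinearMap)
            (fun f t => R.nat f (G₀ N) t) e h) ∘ₗ Ev.map (PshHom.id _) (Δ.col z))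
      (fun a e' c => ?_) (Δ.app x z b)
    refine (R.cls_map 𝒢 a e' _ _).trans ?_
    rw [cls_comul]
    refine congrArg (R.θ x (G₀ (G₀ N))) ?_
    refine Eq.symm ((congrArg (Ev.map (F := M.row x) (G := (takeuchi M M).col z) (PshHom.id _) _)
      (Ev.map_of _ _ _ _ _)).trans ((Ev.map_of _ _ _ _ _).trans ?_))
    exact congrArg (actOf a e' ·) (actHom₂_app _ _ _ _ e h _)

/-- The comonad `N ↦ M × N`. -/
noncomputable def comonad (hΔ : IsCoring S hM ε Δ) : Comonad H where
  toFunctor := R.functor 𝒢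
  ε := R.counitNat 𝒢 ε
  δ := R.comulNat 𝒢 Δ
  coassoc := R.comul_coassoc 𝒢 hΔ
  left_counit := R.comul_counit 𝒢 hΔ
  right_counit := R.comul_map_counit 𝒢 hΔ

/-- `M × N` preserves colimits in `N`. -/
lemma functor_cocontinuous : PreservesColimitsOfSize.{w, w} (R.functor 𝒢) := by
  refine ⟨fun {J} _ => ⟨fun {K} => ⟨fun {c} hc => ?_⟩⟩⟩
  have hl (w : P.FullSubcategory) := (𝒢.cp w).preserves
  let l (w : P.FullSubcategory) :=
    isColimitOfPreserves ((linearCoyoneda k H).obj (op w.obj)) hc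
  have ext {w : P.FullSubcategory} {V : Type w} [AddCommGroup V] [Module k V]
      {f g : (w.obj ⟶ c.pt) →ₗ[k] V}
      (hfg : ∀ j (h : w.obj ⟶ K.obj j), f (h ≫ c.ι.app j) = g (h ≫ c.ι.app j)) : f = g := by
    have h1 : ModuleCat.ofHom f = ModuleCat.ofHom g := (l w).hom_ext fun j => by
      refine ModuleCat.hom_ext (LinearMap.ext fun h => ?_)
      exact hfg j h
    exact congrArg ModuleCat.Hom.hom h1
  refine ⟨?_⟩
  have key (s : Cocone (K ⋙ R.functor 𝒢)) : ∃ d : G₀ c.pt ⟶ s.pt,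
      ∀ j, R.map 𝒢 (c.ι.app j) ≫ d = s.ι.app j := by
    -- For fixed `b` and `e` the maps `h ↦ [b, e, h] ≫ s_j` form a cocone under `Hom (w, K j)`, and
    -- `Hom (w, -)` preserves the colimit because the generator `w` is compact projective.
    have leg {x z w : P.FullSubcategory} (b : M.at x z) (e : 𝟙_ P.FullSubcategory ⟶ z ⊗ w) :
        ∃ φ : (w.obj ⟶ c.pt) →ₗ[k] (x.obj ⟶ s.pt), ∀ j (h : w.obj ⟶ K.obj j),
          φ (h ≫ c.ι.app j) = R.cls b e h ≫ s.ι.app j := by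
      let t : Cocone (K ⋙ (linearCoyoneda k H).obj (op w.obj)) :=
        ⟨ModuleCat.of k (x.obj ⟶ s.pt),
          { app := fun j => ModuleCat.ofHom
              { toFun := fun h : w.obj ⟶ K.obj j => R.cls b e h ≫ s.ι.app j
                map_add' := fun h h' => by rw [cls_add_right]; exact Preadditive.add_comp _ _ _ _ _ _
                map_smul' := fun r h => by rw [cls_smul_right]; exact Linear.smul_comp _ _ _ _ _ _ }
            naturality := fun i j f => by
              refine ModuleCat.hom_ext (LinearMap.ext fun h => ?_)
              refine Eq.trans ?_ (congrArg (R.cls b e h ≫ ·) (s.w f))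
              exact (congrArg (· ≫ s.ι.app j) (R.cls_map 𝒢 b e h (K.map f)).symm).trans
                (Category.assoc (R.cls b e h) (R.map 𝒢 (K.map f)) (s.ι.app j)) }⟩
      refine ⟨((l w).desc t).hom, fun j h => ?_⟩
      exact congrArg (fun φ => φ.hom h) ((l w).fac t j)
    choose φ hφ using @leg
    -- Linearity and balancing of `φ` in `b` and `e` hold on the legs of the colimit, and a linear
    -- map out of `Hom (w, c.pt)` is determined there by `ext`.
    let D (x : P.FullSubcategory) : ActDesc M x c.pt (x.obj ⟶ s.pt) :=
      { fn := fun {z w} => LinearMap.mk₂ k (fun b e => φ b e)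
          (fun b b' e => ext fun j h => by
            rw [LinearMap.add_apply, hφ, hφ, hφ, cls, actOf_add_left, map_add]
            exact Preadditive.add_comp _ _ _ _ _ _)
          (fun r b e => ext fun j h => by
            rw [LinearMap.smul_apply, hφ, hφ, cls, actOf_smul_left, map_smul]
            exact Linear.smul_comp _ _ _ _ _ _)
          (fun b e e' => ext fun j h => by
            rw [LinearMap.add_apply, hφ, hφ, hφ, cls, actOf_add_mid, map_add]
            exact Preadditive.add_comp _ _ _ _ _ _)
          (fun r b e => ext fun j h => by
            rw [LinearMap.smul_apply, hφ, hφ, cls, actOf_smul_mid, map_smul]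
            exact Linear.smul_comp _ _ _ _ _ _)
        bal_left := fun {z z' w} g b e h => by
          refine congrArg (· h) (ext (f := φ (M.act (𝟙 x) g b) e) (g := φ b (e ≫ g ▷ w))
            fun j h => ?_)
          rw [hφ, hφ, cls, actOf_bal_left]
          rfl
        bal_right := fun {z w w'} g b e h => by
          refine congrArg (· h) (ext (f := φ b e ∘ₗ Linear.leftComp k c.pt g.hom)
            (g := φ b (e ≫ z ◁ g)) fun j h => ?_)
          rw [LinearMap.comp_apply, Linear.leftComp_apply, ← Category.assoc, hφ, hφ, cls,
            actOf_bal_right]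
          rfl }
    obtain ⟨d, hd⟩ := R.exists_desc 𝒢 (fun x => (D x).lift) fun {x x'} f {z w} b e h => by
      rw [ActDesc.lift_actOf, ActDesc.lift_actOf]
      refine congrArg (· h) (ext (f := φ (M.act f (𝟙 z) b) e)
        (g := Linear.leftComp k _ f.hom ∘ₗ φ b e) fun j h => ?_)
      rw [LinearMap.comp_apply, Linear.leftComp_apply, hφ, hφ, cls_act', id_whiskerRight,
        Category.comp_id]
      exact Category.assoc f.hom (R.cls b e h) (s.ι.app j)
    refine ⟨d, fun j => R.hom_ext 𝒢 fun {x z w} b e h => ?_⟩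
    rw [← Category.assoc, cls_map]
    refine (hd x _).trans ((ActDesc.lift_actOf _ _ _ _).trans ?_)
    exact hφ b e j h
  choose d hd using key
  refine
    { desc := d
      fac := hd
      uniq := fun s m hm => R.hom_ext 𝒢 fun {x z w} b e h => ?_ }
  have hadd (h h' : w.obj ⟶ c.pt) : R.cls b e (h + h') = R.cls b e h + R.cls b e h' :=
    R.cls_add_right b e h h'
  have hsmul (r : k) (h : w.obj ⟶ c.pt) : R.cls b e (r • h) = r • R.cls b e h :=
    R.cls_smul_right (b := b) (e := e) (r := r) (h := h)
  let q : (w.obj ⟶ c.pt) →ₗ[k] (x.obj ⟶ G₀ c.pt) :=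
    { toFun := fun h => R.cls b e h, map_add' := hadd, map_smul' := hsmul }
  refine congrArg (· h) (ext (f := Linear.rightComp k x.obj m ∘ₗ q)
    (g := Linear.rightComp k x.obj (d s) ∘ₗ q) fun j h => ?_)
  change R.cls b e (h ≫ c.ι.app j) ≫ m = R.cls b e (h ≫ c.ι.app j) ≫ d s
  rw [← R.cls_map 𝒢]
  have h2 : R.map 𝒢 (c.ι.app j) ≫ m = R.map 𝒢 (c.ι.app j) ≫ d s := (hm j).trans (hd s j).symm
  exact (Category.assoc (R.cls b e h) (R.map 𝒢 (c.ι.app j)) m).trans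
    ((congrArg (R.cls b e h ≫ ·) h2).trans
      (Category.assoc (R.cls b e h) (R.map 𝒢 (c.ι.app j)) (d s)).symm)

end ActRep
end ComonadLaws
end HarishChandra

namespace HarishChandra

/-! ### The lax monoidal structure of the action -/

section LaxMonoidal
variable {k : Type w} [Field k] {H : Type u'} [Category.{w} H] [Preadditive H] [Linear k H]
  [MonoidalCategory H] [MonoidalPreadditive H] [MonoidalLinear k H] {P : ObjectProperty H}
  [P.IsMonoidal] [HasColimitsOfSize.{w, w} H] [TensorCocontinuous H]
  {M : BiPsh.{w, u', w} k P.FullSubcategory} {G₀ : H → H}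

namespace ActRep
variable (R : ActRep M G₀) (𝒢 : Generating k P) {S : MulOne M}

lemma mul_natural_left {N N' : H} (f : N ⟶ N') (X : H) :
    R.map 𝒢 f ▷ G₀ X ≫ R.mul 𝒢 S N' X = R.mul 𝒢 S N X ≫ R.map 𝒢 (f ▷ X) :=
  R.tensor_hom_ext 𝒢 fun b e h b' e' h' => by
    rw [← Category.assoc, ← Category.assoc, ← tensorHom_id, tensorHom_comp_tensorHom,
      Category.comp_id, cls_map, cls_mul, cls_mul, cls_map, ← tensorHom_id,
      tensorHom_comp_tensorHom, Category.comp_id]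

lemma mul_natural_right {N N' : H} (X : H) (f : N ⟶ N') :
    G₀ X ◁ R.map 𝒢 f ≫ R.mul 𝒢 S X N' = R.mul 𝒢 S X N ≫ R.map 𝒢 (X ◁ f) :=
  R.tensor_hom_ext 𝒢 fun b e h b' e' h' => by
    rw [← Category.assoc, ← Category.assoc, ← id_tensorHom, tensorHom_comp_tensorHom,
      Category.comp_id, cls_map, cls_mul, cls_mul, cls_map, ← id_tensorHom,
      tensorHom_comp_tensorHom, Category.comp_id]

/-- On three classes the two sides carry the products `(b b') b''` and `b (b' b'')` and the two
nestings of `e`, `e'`, `e''`. Associativity in `M` produces associators in both variables; `cls_act`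
moves those of the inner variables to the nested cups, where `nest_assoc` applies. -/
lemma mul_associativity (hS : S.IsMonoid) (X Y Z : H) :
    R.mul 𝒢 S X Y ▷ G₀ Z ≫ R.mul 𝒢 S (X ⊗ Y) Z ≫ R.map 𝒢 (α_ X Y Z).hom =
      (α_ (G₀ X) (G₀ Y) (G₀ Z)).hom ≫ G₀ X ◁ R.mul 𝒢 S Y Z ≫ R.mul 𝒢 S X (Y ⊗ Z) :=
  R.tensor_hom_ext₃ 𝒢 fun {x z w x' z' w' x'' z'' w''} b e h b' e' h' b'' e'' h'' => by
    have h1 : ((R.cls b e h ⊗ₘ R.cls b' e' h') ⊗ₘ R.cls b'' e'' h'') ≫ R.mul 𝒢 S X Y ▷ G₀ Z ≫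
        R.mul 𝒢 S (X ⊗ Y) Z ≫ R.map 𝒢 (α_ X Y Z).hom =
        R.cls (S.mul (S.mul b b') b'') (nest (nest e e') e'')
          (((h ⊗ₘ h') ⊗ₘ h'') ≫ (α_ X Y Z).hom) := by
      rw [← tensorHom_id, tensorHom_comp_tensorHom_assoc, Category.comp_id, cls_mul,
        ← Category.assoc, cls_mul, cls_map]
    have h2 : ((R.cls b e h ⊗ₘ R.cls b' e' h') ⊗ₘ R.cls b'' e'' h'') ≫
        (α_ (G₀ X) (G₀ Y) (G₀ Z)).hom ≫ G₀ X ◁ R.mul 𝒢 S Y Z ≫ R.mul 𝒢 S X (Y ⊗ Z) =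
        (α_ x x' x'').hom.hom ≫ R.cls (S.mul b (S.mul b' b'')) (nest e (nest e' e''))
          (h ⊗ₘ (h' ⊗ₘ h'')) := by
      rw [associator_naturality_assoc, ← id_tensorHom, tensorHom_comp_tensorHom_assoc,
        Category.comp_id, cls_mul, cls_mul]
      rfl
    refine h1.trans (Eq.trans ?_ h2.symm)
    rw [hS.mul_assoc, associator_naturality]
    refine (R.cls_act (α_ x x' x'').hom (α_ z'' z' z).inv (α_ w w' w'').hom _ _ _).trans ?_
    rw [MonoidalCategory.tensorHom_def, nest_assoc]

lemma mul_left_unitality (hS : S.IsMonoid) (X : H) :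
    (λ_ (G₀ X)).hom = R.one S ▷ G₀ X ≫ R.mul 𝒢 S (𝟙_ H) X ≫ R.map 𝒢 (λ_ X).hom := by
  rw [← cancel_epi (λ_ (G₀ X)).inv, Iso.inv_hom_id]
  refine R.hom_ext 𝒢 fun {x z w} b e h => ?_
  have h1 : R.cls b e h ≫ (λ_ (G₀ X)).inv ≫ R.one S ▷ G₀ X =
      (λ_ x.obj).inv ≫ (R.one S ⊗ₘ R.cls b e h) := by
    rw [leftUnitor_inv_naturality_assoc, MonoidalCategory.tensorHom_def']
  rw [reassoc_of% h1, one, ← Category.assoc (_ ⊗ₘ _), cls_mul, cls_map, hS.one_mul,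
    nest_unit_left, Category.comp_id]
  have h2 : (𝟙 (𝟙_ H) ⊗ₘ h) ≫ (λ_ X).hom = (λ_ w.obj).hom ≫ h := by
    rw [id_tensorHom, leftUnitor_naturality]
  refine Eq.symm ((congrArg (fun q => (λ_ x.obj).inv ≫ R.cls (M.act (λ_ x).hom (ρ_ z).hom b)
    (w := 𝟙_ P.FullSubcategory ⊗ w) (e ≫ ((ρ_ z).inv ⊗ₘ (λ_ w).inv)) q) h2).trans ?_)
  refine (congrArg ((λ_ x.obj).inv ≫ ·) (R.cls_act (λ_ x).hom (ρ_ z).hom (λ_ w).hom b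
    (e ≫ ((ρ_ z).inv ⊗ₘ (λ_ w).inv)) h)).trans ?_
  rw [Category.assoc, tensorHom_comp_tensorHom, Iso.inv_hom_id, Iso.inv_hom_id, id_tensorHom_id,
    Category.comp_id]
  exact Iso.inv_hom_id_assoc (λ_ x.obj) _

lemma mul_right_unitality (hS : S.IsMonoid) (X : H) :
    (ρ_ (G₀ X)).hom = G₀ X ◁ R.one S ≫ R.mul 𝒢 S X (𝟙_ H) ≫ R.map 𝒢 (ρ_ X).hom := by
  rw [← cancel_epi (ρ_ (G₀ X)).inv, Iso.inv_hom_id]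
  refine R.hom_ext 𝒢 fun {x z w} b e h => ?_
  have h1 : R.cls b e h ≫ (ρ_ (G₀ X)).inv ≫ G₀ X ◁ R.one S =
      (ρ_ x.obj).inv ≫ (R.cls b e h ⊗ₘ R.one S) := by
    rw [rightUnitor_inv_naturality_assoc, MonoidalCategory.tensorHom_def]
  rw [reassoc_of% h1, one, ← Category.assoc (_ ⊗ₘ _), cls_mul, cls_map, hS.mul_one,
    nest_unit_right, Category.comp_id]
  have h2 : (h ⊗ₘ 𝟙 (𝟙_ H)) ≫ (ρ_ X).hom = (ρ_ w.obj).hom ≫ h := by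
    rw [tensorHom_id, rightUnitor_naturality]
  refine Eq.symm ((congrArg (fun q => (ρ_ x.obj).inv ≫ R.cls (M.act (ρ_ x).hom (λ_ z).hom b)
    (w := w ⊗ 𝟙_ P.FullSubcategory) (e ≫ ((λ_ z).inv ⊗ₘ (ρ_ w).inv)) q) h2).trans ?_)
  refine (congrArg ((ρ_ x.obj).inv ≫ ·) (R.cls_act (ρ_ x).hom (λ_ z).hom (ρ_ w).hom b
    (e ≫ ((λ_ z).inv ⊗ₘ (ρ_ w).inv)) h)).trans ?_
  rw [Category.assoc, tensorHom_comp_tensorHom, Iso.inv_hom_id, Iso.inv_hom_id, id_tensorHom_id,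
    Category.comp_id]
  exact Iso.inv_hom_id_assoc (ρ_ x.obj) _

/-- The lax monoidal structure on `N ↦ M × N`. -/
@[reducible]
noncomputable def laxMonoidal (hS : S.IsMonoid) : (R.functor 𝒢).LaxMonoidal :=
  ⟨R.one S, R.mul 𝒢 S, R.mul_natural_left 𝒢, R.mul_natural_right 𝒢, R.mul_associativity 𝒢 hS,
    R.mul_left_unitality 𝒢 hS, R.mul_right_unitality 𝒢 hS⟩

variable {ε : Aug M} {Δ : BiPshHom M (takeuchi M M)} {hM : M.IsLinear}

lemma one_counit (hε : ε.IsMul S) : R.one S ≫ R.counit 𝒢 ε (𝟙_ H) = 𝟙 (𝟙_ H) := by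
  rw [one, cls_counit, hε.map_one, contractLeft_unit, unitors_equal]
  exact (Category.comp_id _).trans (Iso.inv_hom_id (ρ_ (𝟙_ H)))

/-- Multiplicativity of `ε` gives nested caps against nested cups, and `contractLeft_nest` separates
them into a tensor product of contractions. -/
lemma mul_counit (hε : ε.IsMul S) (X Y : H) : R.mul 𝒢 S X Y ≫ R.counit 𝒢 ε (X ⊗ Y) =
    R.counit 𝒢 ε X ⊗ₘ R.counit 𝒢 ε Y :=
  R.tensor_hom_ext 𝒢 fun b e h b' e' h' => by
    rw [← Category.assoc, cls_mul, cls_counit, hε.map_mul, contractLeft_nest,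
      tensorHom_comp_tensorHom, cls_counit, cls_counit, ← tensorHom_comp_tensorHom]
    rfl

lemma one_comul (hΔ : IsCoring S hM ε Δ) :
    R.one S ≫ R.comul 𝒢 Δ (𝟙_ H) = R.one S ≫ R.map 𝒢 (R.one S) := by
  rw [one, cls_comul, cls_map, hΔ.map_one]
  refine (congrArg (R.θ _ _) (R.map_clsHom_of _ _ _ _ _)).trans ?_
  exact congrArg (R.cls S.one (λ_ (𝟙_ P.FullSubcategory)).inv) (Category.id_comp _).symm

lemma mul_comul (hΔ : IsCoring S hM ε Δ) (X Y : H) :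
    R.mul 𝒢 S X Y ≫ R.comul 𝒢 Δ (X ⊗ Y) =
      (R.comul 𝒢 Δ X ⊗ₘ R.comul 𝒢 Δ Y) ≫ R.mul 𝒢 S (G₀ X) (G₀ Y) ≫ R.map 𝒢 (R.mul 𝒢 S X Y) :=
  R.tensor_hom_ext 𝒢 fun {x z w x' z' w'} b e h b' e' h' => by
    rw [← Category.assoc, cls_mul, cls_comul, hΔ.map_mul, tensorHom_comp_tensorHom_assoc,
      cls_comul, cls_comul, ← Category.assoc, θ_mul, θ_map]
    refine congrArg (R.θ _ _) ?_
    -- The remaining identity is bilinear in the two comultiplied elements and holds for arbitrary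
    -- elements of `M × M`, so it is checked on classes.
    generalize Δ.app x z b = m
    generalize Δ.app x' z' b' = m'
    have key : ((S.takeuchi S).mul (x := x) (y := z) (x' := x') (y' := z')).compr₂
        (Ev.map (F := M.row (x ⊗ x')) (G := M.col (z' ⊗ z)) (PshHom.id _)
          (R.clsHom (nest e e') (h ⊗ₘ h'))) =
        (((actMul S x (G₀ X) x' (G₀ Y)).compr₂
          (Ev.map (PshHom.id _) (homPshMap (R.mul 𝒢 S X Y)))).compl₁₂
          (Ev.map (F := M.row x) (G := M.col z) (PshHom.id _) (R.clsHom e h))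
          (Ev.map (F := M.row x') (G := M.col z') (PshHom.id _) (R.clsHom e' h'))) := by
      refine takeuchi_ext fun {y z₁} a e₁ c => takeuchi_ext fun {y' z₁'} a' e₁' c' => ?_
      refine (congrArg (Ev.map (F := M.row (x ⊗ x')) (G := M.col (z' ⊗ z)) (PshHom.id _)
          (R.clsHom (nest e e') (h ⊗ₘ h')))
          (MulOne.takeuchiMul_of S S a e₁ c a' e₁' c')).trans ?_
      refine (R.map_clsHom_of _ _ _ _ _).trans ?_
      refine Eq.symm ((congrArg₂ (fun t t' => Ev.map (PshHom.id _) (homPshMap (R.mul 𝒢 S X Y))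
        (actMul S x (G₀ X) x' (G₀ Y) t t')) (R.map_clsHom_of e h a e₁ c)
          (R.map_clsHom_of e' h' a' e₁' c')).trans ?_)
      rw [actMul_actOf, map_actOf_right, cls_mul]
    exact congrArg (fun φ => φ m m') key

end ActRep

/-- A linear functor of two variables on generators with the structure of a bialgebroid acts by a
colimit-preserving lax monoidal comonad. -/
theorem exists_realization (𝒢 : Generating k P) (hM : M.IsLinear) {S : MulOne M}
    (hS : S.IsMonoid) {ε : Aug M} (hε : ε.IsMul S) {Δ : BiPshHom M (takeuchi M M)}
    (hΔ : IsCoring S hM ε Δ) :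
    ∃ G : LaxMonoidalComonad k H, Nonempty (Realization S ε Δ G) := by
  obtain ⟨G₀, ⟨R⟩⟩ := 𝒢.exists_actRep hM
  let : (R.comonad 𝒢 hΔ).toFunctor.LaxMonoidal := R.laxMonoidal 𝒢 hS
  have hc : NatTrans.IsMonoidal (R.comonad 𝒢 hΔ).ε :=
    { unit := R.one_counit 𝒢 hε
      tensor := fun X Y => (R.mul_counit 𝒢 hε X Y).trans (Category.comp_id _).symm }
  have hd : NatTrans.IsMonoidal (R.comonad 𝒢 hΔ).δ :=
    { unit := R.one_comul 𝒢 hΔ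
      tensor := R.mul_comul 𝒢 hΔ }
  refine ⟨{ toComonad := R.comonad 𝒢 hΔ
            lax := R.laxMonoidal 𝒢 hS
            counit_monoidal := hc
            comul_monoidal := hd
            additive := inferInstanceAs (R.functor 𝒢).Additive
            linear := inferInstanceAs ((R.functor 𝒢).Linear k)
            cocontinuous := R.functor_cocontinuous 𝒢 }, ⟨?_⟩⟩
  exact
    { θ := R.θ
      naturality_left := R.nat
      naturality_right := fun x N N' g t => (R.θ_map 𝒢 g x t).symm
      counit := fun b e h => R.cls_counit 𝒢 b e h ε
      comul := fun b e h => R.cls_comul 𝒢 b e h Δ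
      lax_unit := rfl
      lax_tensor := fun b e h b' e' h' => R.cls_mul 𝒢 b e h b' e' h' S }

end LaxMonoidal
end HarishChandra

namespace HarishChandra

/-! ### Coevaluations and transposes -/

section Coevaluations
variable {A : Type u'} [Category.{w} A] [MonoidalCategory A]

lemma contractRight_nest {y z w y' z' w' : A} (e : 𝟙_ A ⟶ z ⊗ w) (e' : 𝟙_ A ⟶ z' ⊗ w')
    (φ : w ⊗ y ⟶ 𝟙_ A) (φ' : w' ⊗ y' ⟶ 𝟙_ A) :
    contractRight (nest e e') (nestEval φ φ') = contractRight e' φ' ⊗ₘ contractRight e φ := by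
  have h1 : contractRight (nest e e') (nestEval φ φ') =
      (λ_ _).inv ≫ e' ▷ (y' ⊗ y) ≫ (α_ z' w' (y' ⊗ y)).hom ≫ z' ◁ ((λ_ _).inv ≫
        e ▷ (w' ⊗ y' ⊗ y) ≫ (z ⊗ w) ◁ ((α_ w' y' y).inv ≫ φ' ▷ y ≫ (λ_ y).hom) ≫
          (α_ z w y).hom ≫ z ◁ φ ≫ (ρ_ z).hom) := by
    simp only [contractRight, nest, nestEval]
    monoidal
  rw [h1, ← whisker_exchange_assoc, MonoidalCategory.tensorHom_def]
  simp only [contractRight]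
  monoidal

/-- Coevaluations: morphisms which are part of a duality. -/
def IsCoev {z w : A} (e : 𝟙_ A ⟶ z ⊗ w) : Prop :=
  ∃ φ : w ⊗ z ⟶ 𝟙_ A, contractLeft e φ = 𝟙 w ∧ contractRight e φ = 𝟙 z

/-- Allows multiplicativity of a comultiplication to be tested at a nested coevaluation, where
evaluation is injective. -/
lemma IsCoev.nest {z w z' w' : A} {e : 𝟙_ A ⟶ z ⊗ w} {e' : 𝟙_ A ⟶ z' ⊗ w'} (h : IsCoev e)
    (h' : IsCoev e') : IsCoev (nest e e') := by
  obtain ⟨φ, h₁, h₂⟩ := h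
  obtain ⟨φ', h₁', h₂'⟩ := h'
  refine ⟨nestEval φ φ', ?_, ?_⟩
  · rw [contractLeft_nest, h₁, h₁', id_tensorHom_id]
  · rw [contractRight_nest, h₂, h₂', id_tensorHom_id]

lemma isCoev_unit : IsCoev (λ_ (𝟙_ A)).inv := by
  refine ⟨(λ_ (𝟙_ A)).hom, ?_, ?_⟩
  · simp only [contractLeft]; monoidal
  · simp only [contractRight]; monoidal

lemma isCoev_coevaluation (z w : A) [ExactPairing z w] : IsCoev (η_ z w) := by
  refine ⟨ε_ z w, ?_, ?_⟩
  · simp [contractLeft]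
  · simp [contractRight]

/-- A coevaluation is a universal element: contracting `e` with the evaluation gives the
factorization, and one triangle identity verifies it. In the coend this brings every class to a form
whose middle entry is a fixed coevaluation. -/
lemma IsCoev.exists_left {z z₀ w : A} {e₀ : 𝟙_ A ⟶ z ⊗ w} (h : IsCoev e₀) (e : 𝟙_ A ⟶ z₀ ⊗ w) :
    ∃ f : z ⟶ z₀, e₀ ≫ f ▷ w = e := by
  obtain ⟨φ, h₁, -⟩ := h
  refine ⟨contractRight e φ, ?_⟩
  rw [← whiskerLeft_contractLeft, h₁, MonoidalCategory.whiskerLeft_id, Category.comp_id]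

lemma IsCoev.exists_right {z w w₀ : A} {e₀ : 𝟙_ A ⟶ z ⊗ w} (h : IsCoev e₀)
    (e : 𝟙_ A ⟶ z ⊗ w₀) : ∃ f : w ⟶ w₀, e₀ ≫ z ◁ f = e := by
  obtain ⟨φ, -, h₂⟩ := h
  refine ⟨contractLeft e φ, ?_⟩
  rw [whiskerLeft_contractLeft, h₂, id_whiskerRight, Category.comp_id]

end Coevaluations

section EvBijective
variable {k : Type w} [Field k] {A : Type u'} [Category.{w} A] [MonoidalCategory A]
  [Preadditive A] [Linear k A]

/-- The pointwise inverse is again natural, and the coend is functorial. It is stated for presheaves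
in different universes because it is applied to presheaves of classes, which lie in a larger
universe than `M`. -/
lemma Ev.map_bijective {F : Psh.{w, u', v₁} k A} {G : Psh.{w, u', v₂} k A}
    {G' : Psh.{w, u', v₃} k A} (ψ : PshHom G G') (h : ∀ x, Function.Bijective (ψ.app x)) :
    Function.Bijective (Ev.map (PshHom.id F) ψ) := by
  let ψ' : PshHom G' G :=
    { app := fun x => (LinearEquiv.ofBijective (ψ.app x) (h x)).symm.toLinearMap
      naturality := fun {x y} f a => by
        obtain ⟨a, rfl⟩ := (h y).2 a
        refine (h x).1 ?_
        rw [ψ.naturality]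
        refine (LinearEquiv.apply_symm_apply (LinearEquiv.ofBijective (ψ.app x) (h x)) _).trans ?_
        refine congrArg (G'.res f) (congrArg (ψ.app y) ?_).symm
        exact LinearEquiv.symm_apply_apply (LinearEquiv.ofBijective (ψ.app y) (h y)) a }
  have h1 : Ev.map (PshHom.id F) ψ' ∘ₗ Ev.map (PshHom.id F) ψ = LinearMap.id :=
    Ev.hom_ext fun {z w} a e b => by
      rw [LinearMap.comp_apply, Ev.map_of, Ev.map_of]
      exact congrArg (Ev.of a e)
        (LinearEquiv.symm_apply_apply (LinearEquiv.ofBijective (ψ.app w) (h w)) b)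
  have h2 : Ev.map (PshHom.id F) ψ ∘ₗ Ev.map (PshHom.id F) ψ' = LinearMap.id :=
    Ev.hom_ext fun {z w} a e b => by
      rw [LinearMap.comp_apply, Ev.map_of, Ev.map_of]
      exact congrArg (Ev.of a e)
        (LinearEquiv.apply_symm_apply (LinearEquiv.ofBijective (ψ.app w) (h w)) b)
  exact Function.bijective_iff_has_inverse.2
    ⟨_, fun t => congrArg (· t) h1, fun t => congrArg (· t) h2⟩

end EvBijective

/-! ### Pairings and the density formula for `Hom (x, F N)` -/

section Pairing
variable {k : Type w} [Field k] {H : Type u'} [Category.{w} H] [Preadditive H] [Linear k H]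
  [MonoidalCategory H] [MonoidalPreadditive H] [MonoidalLinear k H] {P : ObjectProperty H}
  [P.IsMonoidal]

/-- An identification of `M (x, z)` with `Hom (x, F w)` for dual objects `z` and `w`. -/
structure Pairing (M : BiPsh.{w, u', v} k P.FullSubcategory) (F : H ⥤ H) where
  ev {x z w : P.FullSubcategory} :
    M.at x z →ₗ[k] (𝟙_ P.FullSubcategory ⟶ z ⊗ w) →ₗ[k] (x.obj ⟶ F.obj w.obj)
  ev_act {x x' z z' w : P.FullSubcategory} (f : x ⟶ x') (g : z ⟶ z') (b : M.at x' z')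
    (e : 𝟙_ P.FullSubcategory ⟶ z ⊗ w) : ev (M.act f g b) e = f.hom ≫ ev b (e ≫ g ▷ w)
  ev_comp {x z w w' : P.FullSubcategory} (b : M.at x z) (e : 𝟙_ P.FullSubcategory ⟶ z ⊗ w)
    (h : w ⟶ w') : ev b (e ≫ z ◁ h) = ev b e ≫ F.map h.hom
  bijective {x z w : P.FullSubcategory} {e : 𝟙_ P.FullSubcategory ⟶ z ⊗ w} (he : IsCoev e) :
    Function.Bijective fun b : M.at x z => ev b e

namespace Pairing
variable {M : BiPsh.{w, u', w} k P.FullSubcategory} {F : H ⥤ H} [F.Additive] [F.Linear k]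
  (π : Pairing M F)

/-- The map `[b, e, h] ↦ π.ev b e ≫ F.map h`. -/
noncomputable def θ (x : P.FullSubcategory) (N : H) :
    Ev (M.row x) (homPsh k P N) →ₗ[k] (x.obj ⟶ F.obj N) :=
  ActDesc.lift
    { fn := fun {z w} => LinearMap.mk₂ k (fun b e =>
          Linear.leftComp k (F.obj N) (π.ev b e) ∘ₗ F.mapLinearMap k)
        (fun b b' e => LinearMap.ext fun h => by simp)
        (fun r b e => LinearMap.ext fun h => by simp)
        (fun b e e' => LinearMap.ext fun h => by simp)
        (fun r b e => LinearMap.ext fun h => by simp)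
      bal_left := fun g b e h => by
        simp only [LinearMap.mk₂_apply, π.ev_act, ObjectProperty.FullSubcategory.id_hom,
          Category.id_comp]
      bal_right := fun g b e h => by
        simp only [LinearMap.mk₂_apply, LinearMap.comp_apply, Linear.leftComp_apply,
          Functor.coe_mapLinearMap]
        rw [π.ev_comp, F.map_comp, Category.assoc] }

lemma θ_actOf {x z w : P.FullSubcategory} {N : H} (b : M.at x z)
    (e : 𝟙_ P.FullSubcategory ⟶ z ⊗ w) (h : w.obj ⟶ N) :
    π.θ x N (actOf b e h) = π.ev b e ≫ F.map h :=
  ActDesc.lift_actOf _ _ _ _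

lemma θ_nat {x x' : P.FullSubcategory} (f : x ⟶ x') (N : H)
    (t : Ev (M.row x') (homPsh k P N)) :
    π.θ x N (Ev.map (M.rowMap f) (PshHom.id _) t) = f.hom ≫ π.θ x' N t := by
  refine congrArg (· t) (act_hom_ext (φ := π.θ x N ∘ₗ Ev.map (M.rowMap f) (PshHom.id _))
    (ψ := Linear.leftComp k _ f.hom ∘ₗ π.θ x' N) fun b e h => ?_)
  rw [LinearMap.comp_apply, LinearMap.comp_apply, map_actOf_left, θ_actOf, θ_actOf, ev_act,
    id_whiskerRight, Category.comp_id, Linear.leftComp_apply, Category.assoc]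

lemma θ_map (x : P.FullSubcategory) {N N' : H} (g : N ⟶ N')
    (t : Ev (M.row x) (homPsh k P N)) :
    π.θ x N' (Ev.map (PshHom.id _) (homPshMap g) t) = π.θ x N t ≫ F.map g := by
  refine congrArg (· t) (act_hom_ext (φ := π.θ x N' ∘ₗ Ev.map (PshHom.id _) (homPshMap g))
    (ψ := Linear.rightComp k _ (F.map g) ∘ₗ π.θ x N) fun b e h => ?_)
  rw [LinearMap.comp_apply, LinearMap.comp_apply, map_actOf_right, θ_actOf, θ_actOf,
    Linear.rightComp_apply, F.map_comp, Category.assoc]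

/-- With a coevaluation `c w : 𝟙 ⟶ z w ⊗ w` for each generator `w`, every class has the form `[b, c
w, h]`, and `M (x, z w)` is `Hom (x, F w)`. The coend thus becomes `∫^w Hom (x, F w) ⊗ Hom (w, N)`,
which is `Hom (x, F N)` by density of the generators and cocontinuity of `Hom (x, F -)`. The inverse
is constructed from the universal property of this density formula. -/
theorem θ_bijective [HasColimitsOfSize.{w, w} H] [PreservesColimitsOfSize.{w, w} F] (𝒢 : Generating k P)
    (dual : ∀ w : P.FullSubcategory, ∃ (z : P.FullSubcategory)
      (e : 𝟙_ P.FullSubcategory ⟶ z ⊗ w), IsCoev e) (x : P.FullSubcategory) (N : H) :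
    Function.Bijective (π.θ x N) := by
  choose z c hc using dual
  have hsmall : Small.{w} (Ev (M.row x) (homPsh k P N)) := Ev.small 𝒢.obj 𝒢.exists_iso
  have := (𝒢.cp x).preserves
  let E : H ⥤ ModuleCat.{w} k := F ⋙ (linearCoyoneda k H).obj (op x.obj)
  let V := Ev (M.row x) (homPsh k P N)
  let I (w : P.FullSubcategory) : M.at x (z w) ≃ₗ[k] (x.obj ⟶ F.obj w.obj) :=
    LinearEquiv.ofBijective (π.ev.flip (c w)) (π.bijective (hc w))
  have hI (w : P.FullSubcategory) (b) : I w b = π.ev b (c w) := rfl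
  let φ (w : P.FullSubcategory) (h : w.obj ⟶ N) : (x.obj ⟶ F.obj w.obj) →ₗ[k] V :=
    { toFun := fun g => actOf ((I w).symm g) (c w) h
      map_add' := fun g g' => by rw [map_add, actOf_add_left]
      map_smul' := fun r g => by rw [map_smul, actOf_smul_left]; rfl }
  have hφ (w : P.FullSubcategory) (h : w.obj ⟶ N) (b) : φ w h (π.ev b (c w)) = actOf b (c w) h :=
    congrArg (actOf · (c w) h) ((I w).symm_apply_apply b)
  have key {w w' : P.FullSubcategory} (f : w ⟶ w') (h : w'.obj ⟶ N) (g : x.obj ⟶ F.obj w.obj) :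
      φ w (f.hom ≫ h) g = φ w' h (g ≫ F.map f.hom) := by
    obtain ⟨b, rfl⟩ := (I w).surjective g
    -- `f'` is the transpose of `f` under the two dualities; it lets the class change its generator
    -- from `w` to `w'`.
    obtain ⟨f', hf'⟩ := (hc w').exists_left (c w ≫ z w ◁ f)
    rw [hI, hφ, ← π.ev_comp, actOf_bal_right, ← hf', ← actOf_bal_left, ← hφ, π.ev_act,
      ObjectProperty.FullSubcategory.id_hom, Category.id_comp]
  -- `key` is the dinaturality needed to glue the maps `φ w h` to a map out of `Hom (x, F N)`. Its
  -- target has to be shrunk to lie in the universe of `E`.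
  obtain ⟨Ψ, hΨ⟩ := 𝒢.exists_map_desc E (N := N) (Z := ModuleCat.of k (Shrink.{w} V))
    (fun w h => ModuleCat.ofHom ((Shrink.linearEquiv k V).symm.toLinearMap ∘ₗ φ w h))
    (fun w h h' => by
      refine ModuleCat.hom_ext (LinearMap.ext fun g => ?_)
      refine (congrArg (Shrink.linearEquiv k V).symm
        (actOf_add_right ((I w).symm g) (c w) h h')).trans ?_
      exact map_add _ _ _)
    (fun {w w'} f h => by
      refine ModuleCat.hom_ext (LinearMap.ext fun g => ?_)
      exact congrArg (Shrink.linearEquiv k V).symm (key f h g))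
  let Φ : (x.obj ⟶ F.obj N) →ₗ[k] V := (Shrink.linearEquiv k V).toLinearMap ∘ₗ Ψ.hom
  have hΦ (w : P.FullSubcategory) (h : w.obj ⟶ N) (g : x.obj ⟶ F.obj w.obj) :
      Φ (g ≫ F.map h) = φ w h g :=
    (congrArg (fun q => Shrink.linearEquiv k V (q.hom g)) (hΨ w h)).trans
      (LinearEquiv.apply_symm_apply (Shrink.linearEquiv k V) _)
  have h1 (t) : Φ (π.θ x N t) = t := by
    refine congrArg (· t) (act_hom_ext (φ := Φ ∘ₗ π.θ x N) (ψ := LinearMap.id)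
      fun {z' w} b e h => ?_)
    obtain ⟨f, rfl⟩ := (hc w).exists_left e
    rw [LinearMap.comp_apply, θ_actOf, hΦ, LinearMap.id_apply, ← actOf_bal_left, ← hφ, ev_act,
      ObjectProperty.FullSubcategory.id_hom, Category.id_comp]
  have h2 (g) : π.θ x N (Φ g) = g := by
    -- An endomorphism of the value of the cocontinuous functor `E` at `N` is determined by maps `w
    -- ⟶ N` from generators.
    have h3 : ModuleCat.ofHom (π.θ x N ∘ₗ Φ) = 𝟙 (E.obj N) := by
      refine 𝒢.map_hom_ext E fun w h => ?_
      refine ModuleCat.hom_ext (LinearMap.ext fun g => ?_)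
      obtain ⟨b, rfl⟩ := (I w).surjective g
      refine (congrArg (π.θ x N) (hΦ w h (I w b))).trans ?_
      rw [hI, hφ, θ_actOf]
      rfl
    exact congrArg (fun q => q.hom g) h3
  exact Function.bijective_iff_has_inverse.2 ⟨Φ, h1, h2⟩

/-- The natural map `b ↦ π.ev b e`. -/
noncomputable def evHom {z w : P.FullSubcategory} (e : 𝟙_ P.FullSubcategory ⟶ z ⊗ w) :
    PshHom (M.col z) (homPsh k P (F.obj w.obj)) where
  app x := π.ev.flip e
  naturality f b := by
    rw [BiPsh.res_col]
    refine (π.ev_act f (𝟙 z) b e).trans ?_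
    rw [id_whiskerRight, Category.comp_id]
    rfl

/-- The map `[a, e', c] ↦ π.ev a e' ≫ F.map (π.ev c e)`. -/
noncomputable def ev₂ {x z w : P.FullSubcategory} (e : 𝟙_ P.FullSubcategory ⟶ z ⊗ w) :
    Ev (M.row x) (M.col z) →ₗ[k] (x.obj ⟶ F.obj (F.obj w.obj)) :=
  π.θ x _ ∘ₗ Ev.map (PshHom.id _) (π.evHom e)

lemma ev₂_of {x y z w z' : P.FullSubcategory} (e : 𝟙_ P.FullSubcategory ⟶ z ⊗ w) (a : M.at x y)
    (e' : 𝟙_ P.FullSubcategory ⟶ y ⊗ z') (c : M.at z' z) :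
    π.ev₂ e (Ev.of (F := M.row x) (G := M.col z) a e' c) = π.ev a e' ≫ F.map (π.ev c e) :=
  (congrArg (π.θ x _) (Ev.map_of _ _ _ _ _)).trans (π.θ_actOf a e' (π.ev c e))

end Pairing
end Pairing
end HarishChandra

namespace HarishChandra

/-! ### From a lax monoidal comonad to a coring -/

section Pairing
variable {k : Type w} [Field k] {H : Type u'} [Category.{w} H] [Preadditive H] [Linear k H]
  [MonoidalCategory H] [MonoidalPreadditive H] [MonoidalLinear k H] {P : ObjectProperty H}
  [P.IsMonoidal]

namespace Pairing
variable {M : BiPsh.{w, u', w} k P.FullSubcategory} {F : H ⥤ H} [F.Additive] [F.Linear k]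
  (π : Pairing M F)

lemma ev₂_act {x x' z z' w : P.FullSubcategory} (e : 𝟙_ P.FullSubcategory ⟶ z ⊗ w) (f : x ⟶ x')
    (g : z ⟶ z') (m : Ev (M.row x') (M.col z')) :
    π.ev₂ e ((takeuchi M M).act f g m) = f.hom ≫ π.ev₂ (e ≫ g ▷ w) m := by
  refine (congrArg (π.ev₂ e) (takeuchi_act M M f g m)).trans ?_
  refine congrArg (· m) (takeuchi_ext (φ := π.ev₂ e ∘ₗ Ev.map (M.rowMap f) (M.colMap g))
    (ψ := Linear.leftComp k _ f.hom ∘ₗ π.ev₂ (e ≫ g ▷ w)) fun {y z₁} a e' c => ?_)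
  refine (congrArg (π.ev₂ e) (Ev.map_of _ _ _ _ _)).trans ?_
  refine (π.ev₂_of e (M.act f (𝟙 y) a) e' (M.act (𝟙 z₁) g c)).trans ?_
  rw [LinearMap.comp_apply, ev₂_of, π.ev_act, π.ev_act, id_whiskerRight, Category.comp_id,
    ObjectProperty.FullSubcategory.id_hom, Category.id_comp, Linear.leftComp_apply, Category.assoc]

lemma ev₂_comp {x z w w' : P.FullSubcategory} (e : 𝟙_ P.FullSubcategory ⟶ z ⊗ w) (h : w ⟶ w')
    (m : Ev (M.row x) (M.col z)) :
    π.ev₂ (e ≫ z ◁ h) m = π.ev₂ e m ≫ F.map (F.map h.hom) := by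
  refine congrArg (· m) (takeuchi_ext (φ := π.ev₂ (e ≫ z ◁ h))
    (ψ := Linear.rightComp k _ (F.map (F.map h.hom)) ∘ₗ π.ev₂ e) fun {y z₁} a e' c => ?_)
  rw [LinearMap.comp_apply, ev₂_of, ev₂_of, π.ev_comp, F.map_comp, Linear.rightComp_apply,
    Category.assoc]

/-- The Takeuchi square corresponds to `F ⋙ F`: the inner factor is replaced by maps into `F w`
through the pairing, and then the outer factor is `θ` for the object `F w`. -/
lemma ev₂_bijective (hθ : ∀ x N, Function.Bijective (π.θ x N)) {x z w : P.FullSubcategory}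
    {e : 𝟙_ P.FullSubcategory ⟶ z ⊗ w} (he : IsCoev e) :
    Function.Bijective (π.ev₂ (x := x) e) :=
  (hθ x _).comp (Ev.map_bijective (π.evHom e) fun _ => π.bijective he)

/-- The natural map `m ↦ π.ev₂ e m`. -/
noncomputable def ev₂Hom {z w : P.FullSubcategory} (e : 𝟙_ P.FullSubcategory ⟶ z ⊗ w) :
    PshHom ((takeuchi M M).col z) (homPsh k P (F.obj (F.obj w.obj))) where
  app x := π.ev₂ e
  naturality f m := by
    rw [BiPsh.res_col]
    refine (π.ev₂_act e f (𝟙 z) m).trans ?_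
    rw [id_whiskerRight, Category.comp_id]
    rfl

/-- The map `[a, e', m] ↦ π.ev a e' ≫ F.map (π.ev₂ e m)`. -/
noncomputable def ev₃ {x z w : P.FullSubcategory} (e : 𝟙_ P.FullSubcategory ⟶ z ⊗ w) :
    Ev (M.row x) ((takeuchi M M).col z) →ₗ[k] (x.obj ⟶ F.obj (F.obj (F.obj w.obj))) :=
  π.θ x _ ∘ₗ Ev.map (PshHom.id _) (π.ev₂Hom e)

lemma ev₃_of {x y z w z' : P.FullSubcategory} (e : 𝟙_ P.FullSubcategory ⟶ z ⊗ w) (a : M.at x y)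
    (e' : 𝟙_ P.FullSubcategory ⟶ y ⊗ z') (m : Ev (M.row z') (M.col z)) :
    π.ev₃ e (Ev.of (F := M.row x) (G := (takeuchi M M).col z) a e' m) =
      π.ev a e' ≫ F.map (π.ev₂ e m) :=
  (congrArg (π.θ x _) (Ev.map_of _ _ _ _ _)).trans (π.θ_actOf a e' (π.ev₂ e m))

/-- The same reduction once more, for the triple product bracketed to the right. Coassociativity is
an equality of elements there, so injectivity is what is used. -/
lemma ev₃_injective (hθ : ∀ x N, Function.Bijective (π.θ x N)) {x z w : P.FullSubcategory}
    {e : 𝟙_ P.FullSubcategory ⟶ z ⊗ w} (he : IsCoev e) :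
    Function.Injective (π.ev₃ (x := x) e) :=
  ((hθ x _).comp (Ev.map_bijective (π.ev₂Hom e) fun _ => π.ev₂_bijective hθ he)).1

/-- A natural transformation `δ : F ⟶ F ⋙ F` induces a comultiplication. -/
lemma exists_comul (hθ : ∀ x N, Function.Bijective (π.θ x N)) (δ : F ⟶ F ⋙ F)
    (dual : ∀ z : P.FullSubcategory, ∃ (w : P.FullSubcategory)
      (e : 𝟙_ P.FullSubcategory ⟶ z ⊗ w), IsCoev e) :
    ∃ Δ : BiPshHom M (takeuchi M M), ∀ {x z w : P.FullSubcategory} (b : M.at x z)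
      (e : 𝟙_ P.FullSubcategory ⟶ z ⊗ w),
      π.ev₂ e (Δ.app x z b) = π.ev b e ≫ δ.app w.obj := by
  choose w c hc using dual
  let J (x z : P.FullSubcategory) : Ev (M.row x) (M.col z) ≃ₗ[k] _ :=
    LinearEquiv.ofBijective (π.ev₂ (x := x) (c z)) (π.ev₂_bijective hθ (hc z))
  -- The comultiplication is `δ` read through the bijections at one chosen coevaluation for each
  -- `z`.
  let D (x z : P.FullSubcategory) : M.at x z →ₗ[k] Ev (M.row x) (M.col z) :=
    (J x z).symm.toLinearMap ∘ₗ Linear.rightComp k x.obj (δ.app (w z).obj) ∘ₗ π.ev.flip (c z)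
  have hD {x z v : P.FullSubcategory} (b : M.at x z) (e : 𝟙_ P.FullSubcategory ⟶ z ⊗ v) :
      π.ev₂ e (D x z b) = π.ev b e ≫ δ.app v.obj := by
    have h1 : π.ev₂ (c z) (D x z b) = π.ev b (c z) ≫ δ.app (w z).obj :=
      (J x z).apply_symm_apply _
    -- An arbitrary `e` is the chosen coevaluation followed by a map of the right leg, so naturality
    -- of `δ` removes the dependence on the choice.
    obtain ⟨f, rfl⟩ := (hc z).exists_right e
    rw [ev₂_comp, h1, ev_comp, Category.assoc, Category.assoc]
    exact congrArg _ (δ.naturality f.hom).symm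
  refine ⟨⟨D, fun {x x' z z'} f g b => ?_⟩, hD⟩
  refine (π.ev₂_bijective hθ (hc z)).1 ?_
  refine (hD _ _).trans (Eq.trans ?_ (π.ev₂_act (c z) f g (D x' z' b)).symm)
  rw [hD, π.ev_act, Category.assoc]

/-- Compatibility of a pairing with the structure of a lax monoidal comonad. -/
structure Compatible {G : LaxMonoidalComonad k H} (π : Pairing M G.toComonad.toFunctor)
    (S : MulOne M) (ε : Aug M) : Prop where
  counit {x z w : P.FullSubcategory} (b : M.at x z) (e : 𝟙_ P.FullSubcategory ⟶ z ⊗ w) :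
    π.ev b e ≫ G.toComonad.ε.app w.obj = (contractLeft e (ε.app x z b)).hom
  one : π.ev S.one (λ_ (𝟙_ P.FullSubcategory)).inv =
    Functor.LaxMonoidal.ε G.toComonad.toFunctor
  mul {x z w x' z' w' : P.FullSubcategory} (b : M.at x z) (e : 𝟙_ P.FullSubcategory ⟶ z ⊗ w)
    (b' : M.at x' z') (e' : 𝟙_ P.FullSubcategory ⟶ z' ⊗ w') :
    (π.ev b e ⊗ₘ π.ev b' e') ≫ Functor.LaxMonoidal.μ G.toComonad.toFunctor w.obj w'.obj =
      π.ev (x := x ⊗ x') (z := z' ⊗ z) (w := w ⊗ w') (S.mul b b') (nest e e')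

end Pairing

/-- A lax monoidal comonad with a compatible pairing is realized by a bialgebroid structure. -/
theorem Pairing.Compatible.exists_realization {M : BiPsh.{w, u', w} k P.FullSubcategory}
    [HasColimitsOfSize.{w, w} H] {G : LaxMonoidalComonad k H}
    {π : Pairing M G.toComonad.toFunctor} {S : MulOne M} {ε : Aug M} (hπ : π.Compatible S ε)
    (𝒢 : Generating k P) (hM : M.IsLinear)
    (dual : ∀ w : P.FullSubcategory, ∃ (z : P.FullSubcategory)
      (e : 𝟙_ P.FullSubcategory ⟶ z ⊗ w), IsCoev e)
    (dual' : ∀ z : P.FullSubcategory, ∃ (w : P.FullSubcategory)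
      (e : 𝟙_ P.FullSubcategory ⟶ z ⊗ w), IsCoev e) :
    ∃ Δ : BiPshHom M (takeuchi M M), IsCoring S hM ε Δ ∧ Nonempty (Realization S ε Δ G) := by
  have := G.additive
  have := G.linear
  have := G.cocontinuous
  have hθ := π.θ_bijective 𝒢 dual
  obtain ⟨Δ, hΔ⟩ := π.exists_comul hθ G.toComonad.δ dual'
  choose v c hc using dual'
  -- Under evaluation, the product on the Takeuchi square is the tensorator of the composite
  -- functor. The identity is bilinear in `m` and `m'` and is therefore proved on classes.
  have hmul {x z w x' z' w' : P.FullSubcategory} (e : 𝟙_ P.FullSubcategory ⟶ z ⊗ w)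
      (e' : 𝟙_ P.FullSubcategory ⟶ z' ⊗ w') (m : Ev (M.row x) (M.col z))
      (m' : Ev (M.row x') (M.col z')) :
      π.ev₂ (x := x ⊗ x') (z := z' ⊗ z) (w := w ⊗ w') (nest e e') ((S.takeuchi S).mul m m') =
        (π.ev₂ e m ⊗ₘ π.ev₂ e' m') ≫ Functor.LaxMonoidal.μ G.toComonad.toFunctor _ _ ≫
          G.toComonad.map (Functor.LaxMonoidal.μ G.toComonad.toFunctor _ _) := by
    refine Ev.induction (p := fun m => π.ev₂ (x := x ⊗ x') (z := z' ⊗ z) (w := w ⊗ w')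
      (nest e e') ((S.takeuchi S).mul m m') = (π.ev₂ e m ⊗ₘ π.ev₂ e' m') ≫ _) ?_ ?_ m
    · intro t t' h h'
      rw [map_add, MonoidalPreadditive.add_tensor, Preadditive.add_comp, ← h, ← h']
      refine Eq.trans (congrArg _ ?_) (map_add (π.ev₂ _) _ _)
      exact congrArg (· m') (map_add ((S.takeuchi S).mul (x := x) (y := z)) t t')
    intro y z₁ a e₁ d
    refine Ev.induction (p := fun m' => π.ev₂ (x := x ⊗ x') (z := z' ⊗ z) (w := w ⊗ w')
      (nest e e') ((S.takeuchi S).mul (Ev.of (F := M.row x) (G := M.col z) a e₁ d) m') =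
      (π.ev₂ e (Ev.of (F := M.row x) (G := M.col z) a e₁ d) ⊗ₘ π.ev₂ e' m') ≫ _) ?_ ?_ m'
    · intro t t' h h'
      rw [map_add, MonoidalPreadditive.tensor_add, Preadditive.add_comp, ← h, ← h']
      refine Eq.trans (congrArg _ ?_) (map_add (π.ev₂ _) _ _)
      exact map_add ((S.takeuchi S).mul (x := x) (y := z) _) t t'
    intro y' z₁' a' e₁' d'
    refine (congrArg (π.ev₂ _) (MulOne.takeuchiMul_of S S a e₁ d a' e₁' d')).trans ?_
    refine (π.ev₂_of _ _ _ _).trans ?_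
    rw [← hπ.mul, ← hπ.mul, ev₂_of, ev₂_of, Functor.map_comp, Category.assoc,
      ← tensorHom_comp_tensorHom, Category.assoc, Functor.LaxMonoidal.μ_natural_assoc]
  -- Each coring axiom is tested under an evaluation which is injective at a coevaluation, and there
  -- it becomes an axiom of the lax monoidal comonad.
  refine ⟨Δ, ⟨fun {x y x' y'} m m' => ?_, ?_, fun {x z} b => ?_, fun {x z} b => ?_,
    fun {x z} b => ?_⟩, ⟨?_⟩⟩
  · refine (π.ev₂_bijective hθ ((hc y).nest (hc y'))).1 ?_
    refine (hΔ _ _).trans (Eq.trans ?_ (hmul _ _ _ _).symm)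
    rw [hΔ, hΔ, ← hπ.mul, ← tensorHom_comp_tensorHom, Category.assoc, Category.assoc]
    exact congrArg _ (G.comul_monoidal.tensor _ _)
  · refine (π.ev₂_bijective hθ isCoev_unit).1 ?_
    refine (hΔ _ _).trans (Eq.trans ?_ (π.ev₂_of _ _ _ _).symm)
    rw [hπ.one]
    exact G.comul_monoidal.unit
  · refine π.ev₃_injective hθ (hc z) ?_
    -- Comultiplying the outer factor corresponds to `δ` at the object `G w`; naturality of `δ`
    -- moves it past the inner evaluation.
    have h1 (m : Ev (M.row x) (M.col z)) : π.ev₃ (c z) (takeuchiAssoc M M M x z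
        (Ev.map (Δ.row x) (PshHom.id _) m)) = π.ev₂ (c z) m ≫ G.toComonad.δ.app _ := by
      refine congrArg (· m) (takeuchi_ext (φ := π.ev₃ (c z) ∘ₗ takeuchiAssoc M M M x z ∘ₗ
        Ev.map (Δ.row x) (PshHom.id _)) (ψ := Linear.rightComp k _ (G.toComonad.δ.app _) ∘ₗ
          π.ev₂ (c z)) fun {y z₁} a e' d => ?_)
      have h2 (m : Ev (M.row x) (M.col y)) : π.ev₃ (c z) (takeuchiAssoc M M M x z
          (Ev.of (F := (takeuchi M M).row x) (G := M.col z) m e' d)) =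
          π.ev₂ e' m ≫ G.toComonad.map (G.toComonad.map (π.ev d (c z))) := by
        refine Ev.induction (F := M.row x) (G := M.col y) (p := fun m => π.ev₃ (c z)
          (takeuchiAssoc M M M x z (Ev.of (F := (takeuchi M M).row x) (G := M.col z) m e' d)) =
          π.ev₂ e' m ≫ G.toComonad.map (G.toComonad.map (π.ev d (c z)))) ?_ ?_ m
        · intro t t' h h'
          rw [map_add, Preadditive.add_comp, ← h, ← h', ← map_add, ← map_add]
          exact congrArg (fun q => π.ev₃ (c z) (takeuchiAssoc M M M x z q))
            (Ev.add_left (F := (takeuchi M M).row x) (G := M.col z) t t' e' d)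
        · intro p q a e₁ c₁
          refine (congrArg (π.ev₃ (c z)) (takeuchiAssoc_of a e₁ c₁ e' d)).trans ?_
          refine (π.ev₃_of _ _ _ _).trans ?_
          rw [ev₂_of, ev₂_of, Functor.map_comp, Category.assoc]
      refine (congrArg (fun q => π.ev₃ (c z) (takeuchiAssoc M M M x z q))
        (Ev.map_of _ _ _ _ _)).trans ((h2 _).trans ?_)
      refine (congrArg (· ≫ _) (hΔ a e')).trans ?_
      rw [LinearMap.comp_apply, ev₂_of, Linear.rightComp_apply, Category.assoc, Category.assoc]
      exact congrArg _ (G.toComonad.δ.naturality (π.ev d (c z))).symm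
    -- Comultiplying the inner factor corresponds to the image of `δ` under the functor.
    have h3 (m : Ev (M.row x) (M.col z)) : π.ev₃ (c z) (Ev.map (PshHom.id _) (Δ.col z) m) =
        π.ev₂ (c z) m ≫ G.toComonad.map (G.toComonad.δ.app _) := by
      refine congrArg (· m) (takeuchi_ext (φ := π.ev₃ (c z) ∘ₗ
        Ev.map (PshHom.id _) (Δ.col z)) (ψ := Linear.rightComp k _
          (G.toComonad.map (G.toComonad.δ.app _)) ∘ₗ π.ev₂ (c z)) fun {y z₁} a e' d => ?_)
      refine (congrArg (π.ev₃ (c z)) (Ev.map_of _ _ _ _ _)).trans ((π.ev₃_of _ _ _ _).trans ?_)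
      refine (congrArg (fun q => π.ev a e' ≫ G.toComonad.map q) (hΔ d (c z))).trans ?_
      rw [LinearMap.comp_apply, ev₂_of, Linear.rightComp_apply, Functor.map_comp, Category.assoc]
    refine (h1 _).trans (Eq.trans ?_ (h3 _).symm)
    rw [hΔ, Category.assoc, Category.assoc, Comonad.coassoc]
  · refine (π.bijective (hc z)).1 ?_
    have h1 (m : Ev (M.row x) (M.col z)) : π.ev (ε.counitLeft hM x z m) (c z) =
        π.ev₂ (c z) m ≫ G.toComonad.ε.app _ := by
      refine congrArg (· m) (takeuchi_ext (φ := π.ev.flip (c z) ∘ₗ ε.counitLeft hM x z)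
        (ψ := Linear.rightComp k _ (G.toComonad.ε.app _) ∘ₗ π.ev₂ (c z))
          fun {y z₁} a e' d => ?_)
      refine (congrArg (π.ev.flip (c z)) (Ev.lift_of _ _ _ _)).trans ?_
      refine (π.ev_act _ _ _ _).trans ?_
      rw [LinearMap.comp_apply, ev₂_of, Linear.rightComp_apply, Category.assoc,
        Comonad.counit_naturality, reassoc_of% hπ.counit a e', id_whiskerRight, Category.comp_id]
    refine (h1 _).trans ?_
    rw [hΔ, Category.assoc, Comonad.left_counit, Category.comp_id]
  · refine (π.bijective (hc z)).1 ?_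
    -- The contraction in `counitRight` acts on the outer element `a`, the counit of the comonad on
    -- the inner one; `whiskerLeft_contractLeft` exchanges the two.
    have h1 (m : Ev (M.row x) (M.col z)) : π.ev (ε.counitRight hM x z m) (c z) =
        π.ev₂ (c z) m ≫ G.toComonad.map (G.toComonad.ε.app _) := by
      refine congrArg (· m) (takeuchi_ext (φ := π.ev.flip (c z) ∘ₗ ε.counitRight hM x z)
        (ψ := Linear.rightComp k _ (G.toComonad.map (G.toComonad.ε.app _)) ∘ₗ π.ev₂ (c z))
          fun {y z₁} a e' d => ?_)
      refine (congrArg (π.ev.flip (c z)) (Ev.lift_of _ _ _ _)).trans ?_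
      refine (π.ev_act _ _ _ _).trans ?_
      rw [LinearMap.comp_apply, ev₂_of, Linear.rightComp_apply, Category.assoc,
        ← Functor.map_comp, hπ.counit, ← whiskerLeft_contractLeft, π.ev_comp,
        ObjectProperty.FullSubcategory.id_hom, Category.id_comp]
    refine (h1 _).trans ?_
    rw [hΔ, Category.assoc, Comonad.right_counit, Category.comp_id]
  · let θ (x : P.FullSubcategory) (N : H) := LinearEquiv.ofBijective (π.θ x N) (hθ x N)
    have hcls {x z w : P.FullSubcategory} {N : H} (b : M.at x z)
        (e : 𝟙_ P.FullSubcategory ⟶ z ⊗ w) (h : w.obj ⟶ N) :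
        θ x N (actOf b e h) = π.ev b e ≫ G.toComonad.map h := π.θ_actOf b e h
    exact
      { θ := θ
        naturality_left := π.θ_nat
        naturality_right := fun x N N' g t => π.θ_map x g t
        counit := fun b e h => by
          rw [hcls, Category.assoc, Comonad.counit_naturality, reassoc_of% hπ.counit b e]
        comul := fun {x z w N} b e h => by
          have h1 (m : Ev (M.row x) (M.col z)) : θ x (G.toComonad.obj N)
              (Ev.map (F := M.row x) (G := M.col z) (PshHom.id _)
                (actHom (fun x => (θ x N).toLinearMap) (fun f t => π.θ_nat f N t) e h) m) =
              π.ev₂ e m ≫ G.toComonad.map (G.toComonad.map h) := by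
            refine congrArg (· m) (takeuchi_ext (φ := (θ x (G.toComonad.obj N)).toLinearMap ∘ₗ
              Ev.map (F := M.row x) (G := M.col z) (PshHom.id _)
                (actHom (fun x => (θ x N).toLinearMap) (fun f t => π.θ_nat f N t) e h))
              (ψ := Linear.rightComp k _ (G.toComonad.map (G.toComonad.map h)) ∘ₗ π.ev₂ e)
                fun {y z₁} a e' d => ?_)
            refine (congrArg (θ x (G.toComonad.obj N)) (Ev.map_of _ _ _ _ _)).trans ?_
            refine (hcls _ _ _).trans ?_
            refine (congrArg (fun q => π.ev a e' ≫ G.toComonad.map q) (hcls d e h)).trans ?_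
            rw [LinearMap.comp_apply, ev₂_of, Linear.rightComp_apply, Functor.map_comp,
              Category.assoc]
          refine Eq.trans ?_ (h1 _).symm
          rw [hΔ, hcls, Category.assoc, Category.assoc]
          exact congrArg _ (G.toComonad.δ.naturality h)
        lax_unit := by
          rw [hcls, hπ.one]
          refine ((congrArg _ (CategoryTheory.Functor.map_id _ _)).trans (Category.comp_id _)).symm
        lax_tensor := fun b e h b' e' h' => by
          rw [hcls, hcls, ← tensorHom_comp_tensorHom, Category.assoc,
            Functor.LaxMonoidal.μ_natural, reassoc_of% hπ.mul b e b' e']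
          exact (hcls _ _ _).symm }

end Pairing
end HarishChandra

namespace HarishChandra

/-- Used for composites of module maps and their underlying maps, whose intermediate objects agree
only after unfolding definitions. -/
lemma comp_comp_eq {C : Type*} [Category* C] {X Y Z W : C} {f : X ⟶ Y} {g : Y ⟶ Z} {h : Z ⟶ W} {p : X ⟶ Z} {q : X ⟶ W}
    (hp : f ≫ g = p) (hq : p ≫ h = q) : f ≫ g ≫ h = q := by
  rw [← hq, ← hp, Category.assoc]

/-! ### Constraints of the relative tensor product on representatives -/

section Coherence
variable {C : Type u} [Category.{w} C] [MonoidalCategory C] {L : Center C} [MonObj L]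
  [IsCommMonObj L] [HasCoequalizers C] [∀ X : C, PreservesColimitsOfSize.{0, 0} (tensorLeft X)]
  [∀ X : C, PreservesColimitsOfSize.{0, 0} (tensorRight X)]

namespace HC

instance (M N : HC L) (X : C) : Epi (X ◁ proj M N) :=
  inferInstanceAs (Epi ((tensorLeft X).map (proj M N)))

instance (M N : HC L) (X : C) : Epi (proj M N ▷ X) :=
  inferInstanceAs (Epi ((tensorRight X).map (proj M N)))

/-- The constraints of `HC` are transported from bimodules along isomorphisms whose underlying maps
are identities. Hence on representatives they are those of bimodules: the actions for the unitors,
and the associator of `C` for the associator. -/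
lemma proj_leftUnitor (M : HC L) : proj (𝟙_ (HC L)) M ≫ (λ_ M).hom.hom = lact M := by
  have h0 : ((tensorIso (Mod.regular (und L)) M).inv ≫ ((unitIso L).inv ⊗ₘ 𝟙 M.bimod)).hom =
      (Bimod.whiskerRight (unitIso L).inv M.bimod).hom :=
    (Category.id_comp _).trans (congrArg Bimod.Hom.hom (tensorHom_id (unitIso L).inv M.bimod))
  have h1 : (λ_ M).hom.hom = (Bimod.whiskerRight (unitIso L).inv M.bimod).hom ≫
      (Bimod.leftUnitorBimod M.bimod).hom.hom := congrArg (· ≫ _) h0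
  have h2 : proj (𝟙_ (HC L)) M ≫ (Bimod.whiskerRight (unitIso L).inv M.bimod).hom =
      coequalizer.π _ _ :=
    (ι_colimMap _ _).trans ((congrArg (· ≫ _) (id_whiskerRight _ _)).trans (Category.id_comp _))
  exact (congrArg (_ ≫ ·) h1).trans (comp_comp_eq h2 (coequalizer.π_desc _ _))

lemma proj_rightUnitor (M : HC L) : proj M (𝟙_ (HC L)) ≫ (ρ_ M).hom.hom = ract M := by
  have h0 : ((tensorIso M (Mod.regular (und L))).inv ≫ (𝟙 M.bimod ⊗ₘ (unitIso L).inv)).hom =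
      (Bimod.whiskerLeft M.bimod (unitIso L).inv).hom :=
    (Category.id_comp _).trans (congrArg Bimod.Hom.hom (id_tensorHom M.bimod (unitIso L).inv))
  have h1 : (ρ_ M).hom.hom = (Bimod.whiskerLeft M.bimod (unitIso L).inv).hom ≫
      (Bimod.rightUnitorBimod M.bimod).hom.hom := congrArg (· ≫ _) h0
  have h2 : proj M (𝟙_ (HC L)) ≫ (Bimod.whiskerLeft M.bimod (unitIso L).inv).hom =
      coequalizer.π _ _ :=
    (ι_colimMap _ _).trans ((congrArg (· ≫ _) (MonoidalCategory.whiskerLeft_id _ _)).trans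
      (Category.id_comp _))
  exact (congrArg (_ ≫ ·) h1).trans (comp_comp_eq h2 (coequalizer.π_desc _ _))

lemma proj_associator (M N P : HC L) :
    proj M N ▷ P.X ≫ proj (M ⊗ N) P ≫ (α_ M N P).hom.hom =
      (α_ M.X N.X P.X).hom ≫ M.X ◁ proj N P ≫ proj M (N ⊗ P) := by
  have h0 : ((tensorIso (tensorObj M N) P).inv ≫ ((tensorIso M N).inv ⊗ₘ 𝟙 P.bimod)).hom =
      (Bimod.whiskerRight (tensorIso M N).inv P.bimod).hom :=
    (Category.id_comp _).trans (congrArg Bimod.Hom.hom (tensorHom_id (tensorIso M N).inv P.bimod))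
  have h0' : ((𝟙 M.bimod ⊗ₘ (tensorIso N P).hom) ≫ (tensorIso M (tensorObj N P)).hom).hom =
      (Bimod.whiskerLeft M.bimod (tensorIso N P).hom).hom :=
    (Category.comp_id _).trans (congrArg Bimod.Hom.hom (id_tensorHom M.bimod (tensorIso N P).hom))
  have h1 : (α_ M N P).hom.hom = (Bimod.whiskerRight (tensorIso M N).inv P.bimod).hom ≫
      (Bimod.associatorBimod M.bimod N.bimod P.bimod).hom.hom ≫
        (Bimod.whiskerLeft M.bimod (tensorIso N P).hom).hom :=
    congrArg₂ (fun f g => f ≫ _ ≫ g) h0 h0'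
  have h2 : proj (M ⊗ N) P ≫ (Bimod.whiskerRight (tensorIso M N).inv P.bimod).hom =
      coequalizer.π _ _ :=
    (ι_colimMap _ _).trans ((congrArg (· ≫ _) (id_whiskerRight _ _)).trans (Category.id_comp _))
  have h3 : coequalizer.π _ _ ≫ (Bimod.associatorBimod M.bimod N.bimod P.bimod).hom.hom =
      Bimod.AssociatorBimod.homAux M.bimod N.bimod P.bimod := coequalizer.π_desc _ _
  have h4 : proj M N ▷ P.X ≫ Bimod.AssociatorBimod.homAux M.bimod N.bimod P.bimod =
      (α_ _ _ _).hom ≫ (M.X ◁ coequalizer.π _ _) ≫ coequalizer.π _ _ :=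
    π_tensor_id_preserves_coequalizer_inv_desc _ _ _ _
  have h5 : coequalizer.π _ _ ≫ (Bimod.whiskerLeft M.bimod (tensorIso N P).hom).hom =
      proj M (N ⊗ P) :=
    (ι_colimMap _ _).trans ((congrArg (· ≫ _) (MonoidalCategory.whiskerLeft_id _ _)).trans
      (Category.id_comp _))
  refine (congrArg (fun q => proj M N ▷ P.X ≫ proj (M ⊗ N) P ≫ q) h1).trans ?_
  refine (congrArg (proj M N ▷ P.X ≫ ·) (comp_comp_eq h2 (comp_comp_eq h3 rfl))).trans ?_
  refine comp_comp_eq h4 ?_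
  refine (Category.assoc _ _ _).trans (congrArg _ ((Category.assoc _ _ _).trans ?_))
  exact congrArg (M.X ◁ proj N P ≫ ·) h5

end HC
end Coherence
end HarishChandra

namespace HarishChandra

/-! ### The algebra and the augmentation over `HC` given by a bialgebroid -/

section BialgebroidStructure
variable {C : Type u} [Category.{w} C] [MonoidalCategory C] {L : Center C} [MonObj L]
  [IsCommMonObj L] [HasCoequalizers C]

section
variable [∀ X : C, PreservesColimitsOfSize.{0, 0} (tensorLeft X)]
  [∀ X : C, PreservesColimitsOfSize.{0, 0} (tensorRight X)]

lemma HC.proj_associator_inv (M N P : HC L) :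
    M.X ◁ proj N P ≫ proj M (N ⊗ P) ≫ (α_ M N P).inv.hom =
      (α_ M.X N.X P.X).inv ≫ proj M N ▷ P.X ≫ proj (M ⊗ N) P := by
  have h := proj_associator M N P
  have h2 : (α_ M N P).hom.hom ≫ (α_ M N P).inv.hom = 𝟙 _ :=
    congrArg Mod.Hom.hom (α_ M N P).hom_inv_id
  rw [← cancel_epi (α_ M.X N.X P.X).hom, Iso.hom_inv_id_assoc, ← reassoc_of% h, h2]
  exact congrArg (fun t => proj M N ▷ P.X ≫ t) (Category.comp_id (proj (M ⊗ N) P))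

/-- The diagram chase of `HC.proj_nestEval` with abstract objects: the `pᵢ` stand for projections to
relative tensor products, `s` for the associator, `t` for the inner evaluation and `v` for its
whiskering. -/
lemma nested_comp_eq {a b q q' l X Y Z Z' T U : C} {p₁ : a ⊗ b ⟶ X} {p₂ : q' ⊗ q ⟶ Y}
    {p₃ : X ⊗ Y ⟶ Z} {s : Z ⟶ Z'} {p₄ : b ⊗ Y ⟶ T} {p₅ : a ⊗ T ⟶ Z'} {t : T ⟶ q}
    {p₆ : a ⊗ q ⟶ U} {v : Z' ⟶ U} {r : b ⊗ q' ⊗ q ⟶ q} (f : U ⟶ l)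
    (h₁ : p₁ ▷ Y ≫ p₃ ≫ s = (α_ a b Y).hom ≫ a ◁ p₄ ≫ p₅) (h₂ : p₅ ≫ v = a ◁ t ≫ p₆)
    (h₃ : b ◁ p₂ ≫ p₄ ≫ t = r) :
    (p₁ ⊗ₘ p₂) ≫ p₃ ≫ s ≫ v ≫ f = (α_ a b (q' ⊗ q)).hom ≫ a ◁ r ≫ p₆ ≫ f := by
  rw [MonoidalCategory.tensorHom_def', Category.assoc, reassoc_of% h₁, reassoc_of% h₂,
    associator_naturality_right_assoc, ← h₃]
  simp

/-- The value of `ψ'` is a factor `L` standing between `P` and `Q`. Because `ψ` is balanced and left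
linear, letting it act on `Q` is the same as carrying it across `P` by `τ` and multiplying it into
the value of `ψ`. -/
lemma heisenbergMul_eq {P Q : HC L} {p' q' : C} (ψ : P.X ⊗ Q.X ⟶ und L) (ψ' : p' ⊗ q' ⟶ und L)
    (h₁ : HC.ract P ▷ Q.X ≫ ψ = (α_ _ _ _).hom ≫ P.X ◁ HC.lact Q ≫ ψ)
    (h₂ : (α_ _ _ _).inv ≫ HC.lact P ▷ Q.X ≫ ψ = und L ◁ ψ ≫ μ[und L]) :
    (α_ P.X p' (q' ⊗ Q.X)).hom ≫ P.X ◁ ((α_ p' q' Q.X).inv ≫ ψ' ▷ Q.X ≫ HC.lact Q) ≫ ψ =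
      heisenbergMul L ψ ψ' := by
  have h₃ : P.X ◁ HC.lact Q ≫ ψ = (α_ P.X (und L) Q.X).inv ≫
      (tau L P.X).hom ▷ Q.X ≫ (α_ (und L) P.X Q.X).hom ≫ und L ◁ ψ ≫ μ[und L] := by
    rw [← h₂, Iso.hom_inv_id_assoc, ← comp_whiskerRight_assoc]
    exact (Iso.eq_inv_comp _).2 h₁.symm
  rw [heisenbergMul]
  simp only [whiskerLeft_comp, Category.assoc]
  rw [h₃]

lemma HC.proj_hom_condition {P Q : HC L} {Z : C} (f : (P ⊗ Q).X ⟶ Z) :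
    ract P ▷ Q.X ≫ proj P Q ≫ f = (α_ _ _ _).hom ≫ P.X ◁ lact Q ≫ proj P Q ≫ f := by
  have h := congrArg (· ≫ f) (proj_condition P Q)
  simp only [Category.assoc] at h
  exact h

lemma HC.proj_hom_lact {P Q N : HC L} (φ : P ⊗ Q ⟶ N) :
    (α_ _ _ _).inv ≫ lact P ▷ Q.X ≫ proj P Q ≫ φ.hom =
      und L ◁ (proj P Q ≫ φ.hom) ≫ lact N := by
  have h := congrArg (· ≫ φ.hom) (proj_lact P Q)
  simp only [Category.assoc] at h
  refine h.symm.trans ((congrArg (_ ≫ ·) (hom_lact φ)).trans ?_)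
  exact (Category.assoc _ _ _).symm.trans
    (congrArg (· ≫ _) (MonoidalCategory.whiskerLeft_comp _ _ _).symm)

/-- The nested composite of two maps of Harish-Chandra bimodules to the unit is described by the
product on `D`. -/
lemma HC.proj_nestEval {P Q P' Q' : HC L} (φ : P ⊗ Q ⟶ 𝟙_ (HC L)) (φ' : P' ⊗ Q' ⟶ 𝟙_ (HC L)) :
    (proj P P' ⊗ₘ proj Q' Q) ≫ proj (P ⊗ P') (Q' ⊗ Q) ≫ (nestEval φ φ').hom =
      heisenbergMul L (proj P Q ≫ φ.hom) (proj P' Q' ≫ φ'.hom) := by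
  have h1 : (P'.X ◁ proj Q' Q) ≫ proj P' (Q' ⊗ Q) ≫
      ((α_ P' Q' Q).inv ≫ φ' ▷ Q ≫ (λ_ Q).hom).hom =
      (α_ P'.X Q'.X Q.X).inv ≫ (proj P' Q' ≫ φ'.hom) ▷ Q.X ≫ lact Q := by
    have h2 := proj_associator_inv P' Q' Q
    have h3 : proj (P' ⊗ Q') Q ≫ (φ' ▷ Q).hom ≫ (λ_ Q).hom.hom = φ'.hom ▷ Q.X ≫ lact Q := by
      rw [reassoc_of% (proj_whiskerRight φ' Q), proj_leftUnitor]
    have h4 : (proj P' Q' ≫ φ'.hom) ▷ Q.X ≫ lact Q =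
        proj P' Q' ▷ Q.X ≫ proj (P' ⊗ Q') Q ≫ (φ' ▷ Q).hom ≫ (λ_ Q).hom.hom := by
      refine Eq.trans ?_ (congrArg (_ ≫ ·) h3).symm
      exact (congrArg (· ≫ _) (comp_whiskerRight _ _ _)).trans (Category.assoc _ _ _)
    have h5 := congrArg (· ≫ (φ' ▷ Q).hom ≫ (λ_ Q).hom.hom) h2
    simp only [Category.assoc] at h5
    exact h5.trans (congrArg (_ ≫ ·) h4.symm)
  refine Eq.trans ?_ (heisenbergMul_eq _ _ (proj_hom_condition φ.hom) (proj_hom_lact φ))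
  exact nested_comp_eq φ.hom (proj_associator P P' (Q' ⊗ Q))
    (proj_whiskerLeft P ((α_ P' Q' Q).inv ≫ φ' ▷ Q ≫ (λ_ Q).hom)) h1

end

variable {k : Type w} [Field k] [Preadditive C] [Linear k C] [TensorCocontinuous C]
  {B : BiAlgebra k C} (m : QuantumMomentMap L B)

namespace QuantumMomentMap
variable {m}

/-- A continuous functor turns the epimorphisms from the triple tensor products over `C` into
injections. After restriction along them the associator of `HC` is that of `C`, and the identity is
associativity of `B`. -/
lemma hcMul_assoc {P₁ P₂ P₃ Q₁ Q₂ Q₃ : HC L} (b₁ : m.linearMaps P₁ Q₁) (b₂ : m.linearMaps P₂ Q₂)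
    (b₃ : m.linearMaps P₃ Q₃) :
    (m.hcMul _ _ _ _ (m.hcMul _ _ _ _ b₁ b₂) b₃).1 =
      B.A.act (α_ P₁ P₂ P₃).hom.hom (α_ Q₃ Q₂ Q₁).inv.hom
        (m.hcMul _ _ _ _ b₁ (m.hcMul _ _ _ _ b₂ b₃)).1 := by
  have : Epi (HC.proj P₁ P₂ ▷ P₃.X ≫ HC.proj (P₁ ⊗ P₂) P₃) := epi_comp _ _
  have : Epi (Q₃.X ◁ HC.proj Q₂ Q₁ ≫ HC.proj Q₃ (Q₂ ⊗ Q₁)) := epi_comp _ _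
  refine B.act_injective (HC.proj P₁ P₂ ▷ P₃.X ≫ HC.proj (P₁ ⊗ P₂) P₃)
    (Q₃.X ◁ HC.proj Q₂ Q₁ ≫ HC.proj Q₃ (Q₂ ⊗ Q₁)) ?_
  rw [← BiPsh.act_comp, Category.assoc, Category.assoc, HC.proj_associator,
    HC.proj_associator_inv, BiPsh.act_comp, BiPsh.act_comp, BiPsh.act_comp]
  refine (congrArg (B.A.act _ _) (act_hcMul (m.hcMul _ _ _ _ b₁ b₂) b₃)).trans ?_
  refine Eq.trans ?_ (congrArg (fun t => B.A.act _ _ (B.A.act _ _ t))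
    (act_hcMul b₁ (m.hcMul _ _ _ _ b₂ b₃))).symm
  refine (B.act_mul_left _ _ _ _).symm.trans ?_
  refine Eq.trans ?_ (congrArg (B.A.act _ _) (B.act_mul_right _ _ _ _))
  refine (congrArg (fun t => B.S.mul t b₃.1) (act_hcMul b₁ b₂)).trans ?_
  refine Eq.trans ?_ (congrArg (fun t => B.A.act _ _ (B.S.mul b₁.1 t)) (act_hcMul b₂ b₃)).symm
  exact B.mul_assoc _ _ _

/-- The unit is `σ`, so the left unit law is the linearity condition defining `linearMaps`. The
right unit law is that condition combined with centrality of `σ`: the two braidings `τ` exchange the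
left and right actions in each variable. -/
theorem hcMulOne_isMonoid : m.hcMulOne.IsMonoid where
  mul_assoc b₁ b₂ b₃ :=
    (Subtype.ext (hcMul_assoc b₁ b₂ b₃)).trans (hcPsh_act (α_ _ _ _).hom (α_ _ _ _).inv _).symm
  one_mul {P Q} b := by
    refine Eq.trans ?_ (hcPsh_act (λ_ P).hom (ρ_ Q).hom b).symm
    refine Subtype.ext (ext_proj ?_)
    refine (act_hcMul (⟨m.σ, m.σ_mem⟩ : m.linearMaps (𝟙_ (HC L)) (𝟙_ (HC L))) b).trans ?_
    refine Eq.trans ?_ (B.A.act_comp _ _ _ _ _)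
    rw [HC.proj_leftUnitor, HC.proj_rightUnitor]
    exact b.2.symm
  mul_one {P Q} b := by
    refine Eq.trans ?_ (hcPsh_act (ρ_ P).hom (λ_ Q).hom b).symm
    refine Subtype.ext (ext_proj ?_)
    refine (act_hcMul b (⟨m.σ, m.σ_mem⟩ : m.linearMaps (𝟙_ (HC L)) (𝟙_ (HC L)))).trans ?_
    refine Eq.trans ?_ (B.A.act_comp _ _ _ _ _)
    rw [HC.proj_leftUnitor, HC.proj_rightUnitor]
    refine (m.central b.1).trans ?_
    have hb : B.A.act (HC.lact P) (HC.ract Q) b.1 = B.S.mul m.σ b.1 := b.2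
    refine (congrArg (B.A.act _ _) hb.symm).trans ((B.A.act_comp _ _ _ _ _).symm.trans ?_)
    exact congrArg (B.A.act (HC.ract P) · b.1) (Iso.inv_hom_id_assoc (tau L Q.X) (HC.lact Q))

end QuantumMomentMap

variable [MonoidalPreadditive C] [MonoidalLinear k C]

/-- Compatibility of `ε` with the moment maps is preservation of the unit. For products,
`HC.proj_nestEval` describes nested evaluations over `L` by the product of `D`, for which `ε` is
multiplicative. -/
theorem HeisenbergMap.hcAug_isMul {m : QuantumMomentMap L B} (ε : HeisenbergMap L B m) :
    ε.hcAug.IsMul m.hcMulOne where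
  map_one := hc_hom_ext ((ε.proj_hcApp _).trans (ε.map_moment.trans
    (HC.proj_leftUnitor (𝟙_ (HC L))).symm))
  map_mul {P Q P' Q'} b b' := by
    refine hc_hom_ext ?_
    have : Epi (HC.proj P P' ⊗ₘ HC.proj Q' Q) := by
      rw [MonoidalCategory.tensorHom_def]
      exact epi_comp _ _
    refine (cancel_epi (HC.proj P P' ⊗ₘ HC.proj Q' Q)).1 ?_
    refine Eq.trans ?_ (HC.proj_nestEval (ε.hcApp b) (ε.hcApp b')).symm
    refine Eq.trans ?_ (congrArg₂ (heisenbergMul L) (ε.proj_hcApp b) (ε.proj_hcApp b')).symm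
    refine (congrArg (_ ≫ ·) (ε.proj_hcApp (m.hcMul P Q P' Q' b b'))).trans ?_
    refine (ε.naturality _ _ _).symm.trans ?_
    refine (congrArg (ε.app _ _) (QuantumMomentMap.act_hcMul b b')).trans ?_
    exact ε.map_mul _ _

end BialgebroidStructure
end HarishChandra

namespace HarishChandra

/-! ### Free modules and colimits of modules -/

section ModuleColimits
variable {C : Type u} [Category.{w} C] [MonoidalCategory C] {L : Center C} [MonObj L]

namespace HC

variable (L) in
/-- The forgetful functor from left modules. -/
abbrev forget : HC L ⥤ C := Mod.forget (und L)

lemma free_lact_comp {V : C} {N : HC L} (f : V ⟶ N.X) :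
    ((α_ (und L) (und L) V).inv ≫ μ[und L] ▷ V) ≫ und L ◁ f ≫ lact N =
      und L ◁ (und L ◁ f ≫ lact N) ≫ lact N := by
  simp only [Category.assoc, whiskerLeft_comp]
  rw [← whisker_exchange_assoc, mul_lact]
  simp

/-- The map out of a free module determined by its restriction to generators. -/
def freeHom {V : C} {N : HC L} (f : V ⟶ N.X) : free L V ⟶ N :=
  mkHom (M := free L V) (und L ◁ f ≫ lact N) (free_lact_comp f)

/-- The inclusion of the generators of a free module. -/
def freeUnit (L : Center C) [MonObj L] (V : C) : V ⟶ (free L V).X :=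
  (λ_ V).inv ≫ η[und L] ▷ V

lemma freeUnit_freeHom {V : C} {N : HC L} (f : V ⟶ N.X) :
    freeUnit L V ≫ (freeHom f).hom = f := by
  have h : ((λ_ V).inv ≫ η[und L] ▷ V) ≫ und L ◁ f ≫ lact N = f := by
    rw [Category.assoc, ← whisker_exchange_assoc, one_lact]
    simp
  exact h

lemma freeUnit_lact (V : C) : und L ◁ freeUnit L V ≫ lact (free L V) = 𝟙 _ := by
  have h : und L ◁ ((λ_ V).inv ≫ η[und L] ▷ V) ≫ (α_ (und L) (und L) V).inv ≫ μ[und L] ▷ V =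
      𝟙 _ := by
    rw [whiskerLeft_comp, Category.assoc, associator_inv_naturality_middle_assoc,
      ← comp_whiskerRight, MonObj.mul_one]
    simp
  exact h

lemma free_hom_ext {V : C} {N : HC L} {f g : free L V ⟶ N}
    (h : freeUnit L V ≫ f.hom = freeUnit L V ≫ g.hom) : f = g := by
  have key (f : free L V ⟶ N) : f.hom = und L ◁ (freeUnit L V ≫ f.hom) ≫ lact N := by
    rw [whiskerLeft_comp, Category.assoc, ← hom_lact f]
    exact (Category.id_comp _).symm.trans ((congrArg (· ≫ f.hom) (freeUnit_lact V).symm).trans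
      (Category.assoc _ _ _))
  exact Mod.hom_ext _ _ ((key f).trans ((congrArg (und L ◁ · ≫ lact N) h).trans (key g).symm))

/-- Maps out of a free module. -/
def freeHomEquiv (V : C) (N : HC L) : (free L V ⟶ N) ≃ (V ⟶ N.X) where
  toFun f := freeUnit L V ≫ f.hom
  invFun := freeHom
  left_inv _ := free_hom_ext (freeUnit_freeHom _)
  right_inv := freeUnit_freeHom

instance : (forget L).ReflectsIsomorphisms where
  reflects {M N} f _ := by
    have : IsIso f.hom := ‹_›
    refine ⟨mkHom (inv f.hom) ?_, Mod.hom_ext _ _ (IsIso.hom_inv_id f.hom),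
      Mod.hom_ext _ _ (IsIso.inv_hom_id f.hom)⟩
    rw [← cancel_mono f.hom, Category.assoc, Category.assoc, IsIso.inv_hom_id, hom_lact,
      ← whiskerLeft_comp_assoc, IsIso.inv_hom_id, whiskerLeft_id, Category.id_comp,
      Category.comp_id]

section Colimits
variable {J : Type*} [Category* J] {K : J ⥤ HC L} (c : Cocone (K ⋙ forget L))

/-- The maps of a cocone of underlying objects. -/
def leg (j : J) : (K.obj j).X ⟶ c.pt := c.ι.app j

lemma map_leg {i j : J} (f : i ⟶ j) : (K.map f).hom ≫ leg c j = leg c i := c.w f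

variable {c} (hc : IsColimit c)

variable [∀ X : C, PreservesColimitsOfShape J (tensorLeft X)]

lemma tensorLeft_leg_hom_ext {X Z : C} {f g : X ⊗ c.pt ⟶ Z} (hc : IsColimit c)
    (h : ∀ j, X ◁ leg c j ≫ f = X ◁ leg c j ≫ g) : f = g :=
  (isColimitOfPreserves (tensorLeft X) hc).hom_ext h

/-- Maps out of the tensor product with a colimit. -/
lemma exists_tensorLeft_desc {X Z : C} (hc : IsColimit c) (φ : ∀ j, X ⊗ (K.obj j).X ⟶ Z)
    (hφ : ∀ {i j : J} (f : i ⟶ j), X ◁ (K.map f).hom ≫ φ j = φ i) :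
    ∃ ψ : X ⊗ c.pt ⟶ Z, ∀ j, X ◁ leg c j ≫ ψ = φ j :=
  ⟨(isColimitOfPreserves (tensorLeft X) hc).desc
    ⟨Z, { app := φ
          naturality := fun _ _ f => (hφ f).trans (Category.comp_id _).symm }⟩,
    fun j => (isColimitOfPreserves (tensorLeft X) hc).fac _ j⟩

lemma exists_colimitAct (hc : IsColimit c) : ∃ a : und L ⊗ c.pt ⟶ c.pt,
    ∀ j, und L ◁ leg c j ≫ a = lact (K.obj j) ≫ leg c j :=
  exists_tensorLeft_desc hc _ fun {i j} f => by
    rw [← reassoc_of% hom_lact (K.map f), map_leg]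

/-- The action on a colimit of modules. -/
noncomputable def colimitAct : und L ⊗ c.pt ⟶ c.pt := (exists_colimitAct hc).choose

lemma whisker_colimitAct (j : J) :
    und L ◁ leg c j ≫ colimitAct hc = lact (K.obj j) ≫ leg c j :=
  (exists_colimitAct hc).choose_spec j

lemma one_colimitAct : η[und L] ▷ c.pt ≫ colimitAct hc = (λ_ c.pt).hom :=
  tensorLeft_leg_hom_ext hc fun j => by
    rw [whisker_exchange_assoc, whisker_colimitAct, ← Category.assoc, one_lact,
      leftUnitor_naturality]

lemma mul_colimitAct : μ[und L] ▷ c.pt ≫ colimitAct hc =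
    (α_ (und L) (und L) c.pt).hom ≫ und L ◁ colimitAct hc ≫ colimitAct hc :=
  tensorLeft_leg_hom_ext hc fun j => by
    rw [whisker_exchange_assoc, whisker_colimitAct, ← Category.assoc, mul_lact,
      associator_naturality_right_assoc, ← whiskerLeft_comp_assoc, whisker_colimitAct]
    simp only [Category.assoc, whiskerLeft_comp]
    rw [whisker_colimitAct]

/-- The colimit of modules. -/
noncomputable def colimitMod : HC L where
  X := c.pt
  mod :=
    { smul := colimitAct hc
      one_smul := one_colimitAct hc
      mul_smul := mul_colimitAct hc }

/-- The cocone of modules over a colimit cocone of underlying objects. -/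
noncomputable def colimitCocone : Cocone K :=
  ⟨colimitMod hc,
    { app := fun j => mkHom (N := colimitMod hc) (leg c j) (whisker_colimitAct hc j).symm
      naturality := fun _ _ f =>
        Mod.hom_ext _ _ ((map_leg c f).trans (Category.comp_id (leg c _)).symm) }⟩

/-- Maps of modules out of the colimit. -/
noncomputable def colimitDesc (s : Cocone K) : colimitMod hc ⟶ s.pt :=
  mkHom (M := colimitMod hc) (hc.desc ((forget L).mapCocone s))
    (tensorLeft_leg_hom_ext hc fun j => by
      have hj : leg c j ≫ hc.desc ((forget L).mapCocone s) = (s.ι.app j).hom := hc.fac _ j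
      refine (comp_comp_eq (whisker_colimitAct hc j) ((Category.assoc _ _ _).trans
        ((congrArg (_ ≫ ·) hj).trans (hom_lact (s.ι.app j))))).trans ?_
      refine Eq.trans ?_ (whiskerLeft_comp_assoc (und L) (leg c j)
        (hc.desc ((forget L).mapCocone s)) (lact s.pt))
      exact congrArg (und L ◁ · ≫ lact s.pt) hj.symm)

/-- Since `L ⊗ -` preserves the colimit, the actions glue to a unique action on it, and the module
axioms and linearity of induced maps can be checked on the legs. -/
noncomputable instance : CreatesColimitsOfShape J (forget L) where
  CreatesColimit := createsColimitOfReflectsIso fun _ hc =>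
    { liftedCocone := colimitCocone hc
      validLift := Iso.refl _
      makesColimit :=
        { desc := colimitDesc hc
          fac := fun _ j => Mod.hom_ext _ _ (hc.fac _ j)
          uniq := fun s f h => Mod.hom_ext _ _ (hc.uniq ((forget L).mapCocone s) f.hom
            fun j => congrArg Mod.Hom.hom (h j)) } }

end Colimits

end HC
end ModuleColimits

/-! ### Cocontinuity of the relative tensor product -/

section TensorColimits
variable {C : Type u} [Category.{w} C] [MonoidalCategory C] {L : Center C} [MonObj L]
  [TensorCocontinuous C]

namespace HC

noncomputable instance : CreatesColimitsOfSize.{w, w} (forget L) where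
  CreatesColimitsOfShape {J} _ := by
    have (X : C) : PreservesColimitsOfShape J (tensorLeft X) :=
      (TensorCocontinuous.left X).preservesColimitsOfShape
    infer_instance

instance [HasColimitsOfSize.{w, w} C] : HasColimitsOfSize.{w, w} (HC L) :=
  hasColimits_of_hasColimits_createsColimits (forget L)

variable [IsCommMonObj L] [HasCoequalizers C]

lemma tensor_hom_ext {M N : HC L} {Z : C} {f g : (M ⊗ N).X ⟶ Z}
    (h : proj M N ≫ f = proj M N ≫ g) : f = g :=
  (cancel_epi (proj M N)).1 h

section
variable {J : Type w} [SmallCategory J] {K : J ⥤ HC L} {c : Cocone K}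

/-- The maps of a cocone of modules. -/
def hleg (c : Cocone K) (j : J) : K.obj j ⟶ c.pt := c.ι.app j

/-- A map out of `M ⊗_L c` is a balanced map out of `M ⊗ c`. It is glued from the legs, and balance
holds because the legs stay jointly epimorphic after tensoring with `M ⊗ L`. -/
lemma exists_left_desc (M : HC L) (hc : IsColimit ((forget L).mapCocone c)) {Z : C}
    (t : ∀ j, (M ⊗ K.obj j).X ⟶ Z)
    (ht : ∀ {i j : J} (f : i ⟶ j), (M ◁ K.map f).hom ≫ t j = t i) :
    ∃ ψ : (M ⊗ c.pt).X ⟶ Z, ∀ j, (M ◁ hleg c j).hom ≫ ψ = t j := by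
  have (X : C) : PreservesColimitsOfShape J (tensorLeft X) :=
    (TensorCocontinuous.left X).preservesColimitsOfShape
  obtain ⟨ψ, hψ⟩ : ∃ ψ : M.X ⊗ c.pt.X ⟶ Z, ∀ j, M.X ◁ (hleg c j).hom ≫ ψ =
      proj M (K.obj j) ≫ t j :=
    exists_tensorLeft_desc (X := M.X) (Z := Z) hc (fun j => proj M (K.obj j) ≫ t j)
      (fun {i j} f => by rw [← reassoc_of% (proj_whiskerLeft M (K.map f)), ht])
  have hψ' : ract M ▷ c.pt.X ≫ ψ = ((α_ _ _ _).hom ≫ M.X ◁ lact c.pt) ≫ ψ := by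
    refine tensorLeft_leg_hom_ext hc fun j => ?_
    change (M.X ⊗ und L) ◁ (hleg c j).hom ≫ ract M ▷ c.pt.X ≫ ψ =
      (M.X ⊗ und L) ◁ (hleg c j).hom ≫ ((α_ _ _ _).hom ≫ M.X ◁ lact c.pt) ≫ ψ
    rw [whisker_exchange_assoc, hψ, reassoc_of% (proj_condition M (K.obj j)), Category.assoc,
      associator_naturality_right_assoc, ← whiskerLeft_comp_assoc, ← hom_lact,
      whiskerLeft_comp_assoc, hψ]
  refine ⟨desc ψ hψ', fun j => tensor_hom_ext (Eq.trans ?_ (hψ j))⟩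
  exact comp_comp_eq (proj_whiskerLeft M (hleg c j)) ((Category.assoc _ _ _).trans
    (congrArg (_ ≫ ·) (proj_desc ψ hψ')))

lemma left_hom_ext (M : HC L) (hc : IsColimit ((forget L).mapCocone c)) {Z : C}
    {f g : (M ⊗ c.pt).X ⟶ Z} (h : ∀ j, (M ◁ hleg c j).hom ≫ f = (M ◁ hleg c j).hom ≫ g) :
    f = g := by
  have (X : C) : PreservesColimitsOfShape J (tensorLeft X) :=
    (TensorCocontinuous.left X).preservesColimitsOfShape
  refine tensor_hom_ext (tensorLeft_leg_hom_ext hc fun j => ?_)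
  change M.X ◁ (hleg c j).hom ≫ proj M c.pt ≫ f = M.X ◁ (hleg c j).hom ≫ proj M c.pt ≫ g
  rw [← reassoc_of% (proj_whiskerLeft M (hleg c j)), h,
    reassoc_of% (proj_whiskerLeft M (hleg c j))]

lemma exists_right_desc (N : HC L) (hc : IsColimit ((forget L).mapCocone c)) {Z : C}
    (t : ∀ j, (K.obj j ⊗ N).X ⟶ Z)
    (ht : ∀ {i j : J} (f : i ⟶ j), (K.map f ▷ N).hom ≫ t j = t i) :
    ∃ ψ : (c.pt ⊗ N).X ⟶ Z, ∀ j, (hleg c j ▷ N).hom ≫ ψ = t j := by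
  have (X : C) : PreservesColimitsOfShape J (tensorRight X) :=
    (TensorCocontinuous.right X).preservesColimitsOfShape
  let hN := isColimitOfPreserves (tensorRight N.X) hc
  have ht' {i j : J} (f : i ⟶ j) : (K.map f).hom ▷ N.X ≫ proj (K.obj j) N ≫ t j =
      proj (K.obj i) N ≫ t i := by
    rw [← reassoc_of% (proj_whiskerRight (K.map f) N), ht]
  obtain ⟨ψ, hψ⟩ : ∃ ψ : c.pt.X ⊗ N.X ⟶ Z, ∀ j, (hleg c j).hom ▷ N.X ≫ ψ =
      proj (K.obj j) N ≫ t j :=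
    ⟨hN.desc ⟨Z, { app := fun j => proj (K.obj j) N ≫ t j
                   naturality := fun _ _ f => (ht' f).trans (Category.comp_id _).symm }⟩,
      fun j => hN.fac _ j⟩
  have hψ' : ract c.pt ▷ N.X ≫ ψ = ((α_ _ _ _).hom ≫ c.pt.X ◁ lact N) ≫ ψ := by
    refine (isColimitOfPreserves (tensorRight N.X)
      (isColimitOfPreserves (tensorRight (und L)) hc)).hom_ext fun j => ?_
    change (hleg c j).hom ▷ und L ▷ N.X ≫ ract c.pt ▷ N.X ≫ ψ =
      (hleg c j).hom ▷ und L ▷ N.X ≫ ((α_ _ _ _).hom ≫ c.pt.X ◁ lact N) ≫ ψ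
    rw [← comp_whiskerRight_assoc, ← hom_ract, comp_whiskerRight_assoc, hψ,
      reassoc_of% (proj_condition (K.obj j) N), Category.assoc,
      associator_naturality_left_assoc, ← whisker_exchange_assoc, hψ]
  refine ⟨desc ψ hψ', fun j => tensor_hom_ext (Eq.trans ?_ (hψ j))⟩
  exact comp_comp_eq (proj_whiskerRight (hleg c j) N) ((Category.assoc _ _ _).trans
    (congrArg (_ ≫ ·) (proj_desc ψ hψ')))

lemma right_hom_ext (N : HC L) (hc : IsColimit ((forget L).mapCocone c)) {Z : C}
    {f g : (c.pt ⊗ N).X ⟶ Z} (h : ∀ j, (hleg c j ▷ N).hom ≫ f = (hleg c j ▷ N).hom ≫ g) :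
    f = g := by
  have (X : C) : PreservesColimitsOfShape J (tensorRight X) :=
    (TensorCocontinuous.right X).preservesColimitsOfShape
  refine tensor_hom_ext ((isColimitOfPreserves (tensorRight N.X) hc).hom_ext fun j => ?_)
  change (hleg c j).hom ▷ N.X ≫ proj c.pt N ≫ f = (hleg c j).hom ▷ N.X ≫ proj c.pt N ≫ g
  rw [← reassoc_of% (proj_whiskerRight (hleg c j) N), h,
    reassoc_of% (proj_whiskerRight (hleg c j) N)]

end

variable [HasColimitsOfSize.{w, w} C]

/-- Colimits of modules are reflected by the forgetful functor, so preservation is checked on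
underlying objects. -/
instance : TensorCocontinuous (HC L) where
  left M := ⟨⟨fun {K} => by
    have : PreservesColimit K (tensorLeft M ⋙ forget L) := ⟨fun {c} hc => by
      have hc' := isColimitOfPreserves (forget L) hc
      have hd (s : Cocone (K ⋙ tensorLeft M ⋙ forget L)) :=
        exists_left_desc M hc' (Z := s.pt) s.ι.app (fun f => s.w f)
      exact ⟨{ desc := fun s => (hd s).choose
               fac := fun s j => (hd s).choose_spec j
               uniq := fun s m hm => left_hom_ext M hc' fun j =>
                (hm j).trans ((hd s).choose_spec j).symm }⟩⟩
    exact preservesColimit_of_reflects_of_preserves (tensorLeft M) (forget L)⟩⟩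
  right N := ⟨⟨fun {K} => by
    have : PreservesColimit K (tensorRight N ⋙ forget L) := ⟨fun {c} hc => by
      have hc' := isColimitOfPreserves (forget L) hc
      have hd (s : Cocone (K ⋙ tensorRight N ⋙ forget L)) :=
        exists_right_desc N hc' (Z := s.pt) s.ι.app (fun f => s.w f)
      exact ⟨{ desc := fun s => (hd s).choose
               fac := fun s j => (hd s).choose_spec j
               uniq := fun s m hm => right_hom_ext N hc' fun j =>
                (hm j).trans ((hd s).choose_spec j).symm }⟩⟩
    exact preservesColimit_of_reflects_of_preserves (tensorRight N) (forget L)⟩⟩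

end HC
end TensorColimits
end HarishChandra

namespace HarishChandra

/-! ### The free module functor is strong monoidal -/

section FreeMonoidal
variable {C : Type u} [Category.{w} C] [MonoidalCategory C] {L : Center C} [MonObj L]

namespace HC

variable (L) in
/-- The free module functor. -/
def freeFunctor : C ⥤ HC L where
  obj := free L
  map {V W} f := freeHom (f ≫ freeUnit L W)
  map_id V := free_hom_ext ((freeUnit_freeHom _).trans
    ((Category.id_comp _).trans (Category.comp_id _).symm))
  map_comp {V W X} f g := free_hom_ext (by
    refine (freeUnit_freeHom _).trans ?_
    refine Eq.trans ?_ (comp_comp_eq (freeUnit_freeHom (f ≫ freeUnit L W)) rfl).symm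
    rw [Category.assoc, Category.assoc]
    exact congrArg (f ≫ ·) (freeUnit_freeHom (g ≫ freeUnit L X)).symm)

lemma freeUnit_map {V W : C} (f : V ⟶ W) :
    freeUnit L V ≫ ((freeFunctor L).map f).hom = f ≫ freeUnit L W :=
  freeUnit_freeHom _

variable (L) in
/-- The adjunction between free modules and underlying objects. -/
def freeAdj : freeFunctor L ⊣ forget L :=
  Adjunction.mkOfHomEquiv
    { homEquiv := freeHomEquiv
      homEquiv_naturality_left_symm := fun {V V' N} f g => free_hom_ext (by
        refine (freeUnit_freeHom _).trans ?_
        refine Eq.trans ?_ (comp_comp_eq (freeUnit_map f) rfl).symm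
        exact (congrArg (f ≫ ·) (freeUnit_freeHom g).symm).trans (Category.assoc _ _ _).symm)
      homEquiv_naturality_right := fun {V N N'} f g => (Category.assoc _ _ _).symm }

lemma freeAdj_unit (V : C) : (freeAdj L).unit.app V = freeUnit L V :=
  Category.comp_id _

lemma freeAdj_counit (N : HC L) : ((freeAdj L).counit.app N).hom = lact N :=
  (congrArg (· ≫ lact N) (MonoidalCategory.whiskerLeft_id _ _)).trans (Category.id_comp _)

variable [IsCommMonObj L]

/-- The central structure, as an isomorphism onto the object underlying a free module. -/
def freeTau (V : C) : V ⊗ und L ≅ (free L V).X := tau L V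

lemma freeUnit_ract (V : C) : freeUnit L V ▷ und L ≫ ract (free L V) = (freeTau V).hom := by
  rw [ract, ← Category.assoc, tau_naturality, Category.assoc, freeUnit_lact]
  exact Category.comp_id _

/-- As a right module, `L ⊗ V` is by `τ` the free right module `V ⊗ L`; this is the property behind
`(L ⊗ V) ⊗_L N ≅ V ⊗ N`. -/
lemma freeTau_ract (V : C) : (freeTau V).hom ▷ und L ≫ ract (free L V) =
    (α_ _ _ _).hom ≫ V ◁ μ[und L] ≫ (freeTau V).hom := by
  have h : ract (free L V) ▷ und L ≫ ract (free L V) =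
      (α_ _ _ _).hom ≫ (free L V).X ◁ μ[und L] ≫ ract (free L V) := by
    rw [ract_mul, Iso.hom_inv_id_assoc]
  rw [← freeUnit_ract, comp_whiskerRight, Category.assoc, h, associator_naturality_left_assoc,
    ← whisker_exchange_assoc]

lemma freeTau_inv_ract (V : C) :
    (freeTau V).inv ▷ und L ≫ (α_ _ _ _).hom ≫ V ◁ μ[und L] =
      ract (free L V) ≫ (freeTau V).inv := by
  rw [Iso.eq_comp_inv, Category.assoc, Category.assoc, ← freeTau_ract,
    ← comp_whiskerRight_assoc, Iso.inv_hom_id, id_whiskerRight, Category.id_comp]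

lemma freeUnit_freeTau_inv (V : C) : freeUnit L V ≫ (freeTau V).inv = (ρ_ V).inv ≫ V ◁ η := by
  have h : ((λ_ V).inv ≫ η[und L] ▷ V) ≫ (tau L V).inv = (ρ_ V).inv ≫ V ◁ η[und L] := by
    rw [Iso.comp_inv_eq, Category.assoc, one_tau]
    simp
  exact h

variable [HasCoequalizers C] [TensorCocontinuous C]

/-- The canonical map `V ⊗ N ⟶ (L ⊗ V) ⊗_L N`. -/
noncomputable def freeTensor (V : C) (N : HC L) : V ⊗ N.X ⟶ (free L V ⊗ N).X :=
  freeUnit L V ▷ N.X ≫ proj (free L V) N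

/-- The map `(L ⊗ V) ⊗ N ⟶ V ⊗ N`, which is balanced over `L`. -/
def freeAct (V : C) (N : HC L) : (free L V).X ⊗ N.X ⟶ V ⊗ N.X :=
  (freeTau V).inv ▷ N.X ≫ (α_ _ _ _).hom ≫ V ◁ lact N

/-- After the identification of `L ⊗ V` with `V ⊗ L`, balance is associativity of the action on `N`.
-/
lemma freeAct_condition (V : C) (N : HC L) : ract (free L V) ▷ N.X ≫ freeAct V N =
    ((α_ _ _ _).hom ≫ (free L V).X ◁ lact N) ≫ freeAct V N := by
  have h2 : (V ◁ μ[und L]) ▷ N.X ≫ (α_ _ _ _).hom ≫ V ◁ lact N =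
      (α_ _ _ _).hom ≫ V ◁ ((α_ _ _ _).hom ≫ und L ◁ lact N ≫ lact N) := by
    rw [← mul_lact]
    simp
  rw [freeAct, ← comp_whiskerRight_assoc, ← freeTau_inv_ract, Category.assoc,
    whisker_exchange_assoc, comp_whiskerRight_assoc, comp_whiskerRight_assoc, h2]
  simp

lemma freeTensor_desc (V : C) (N : HC L) :
    freeTensor V N ≫ desc (freeAct V N) (freeAct_condition V N) = 𝟙 _ := by
  have h : freeUnit L V ▷ N.X ≫ freeAct V N = 𝟙 _ := by
    rw [freeAct, ← comp_whiskerRight_assoc, freeUnit_freeTau_inv, comp_whiskerRight,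
      Category.assoc, associator_naturality_middle_assoc, ← MonoidalCategory.whiskerLeft_comp,
      one_lact]
    simp
  exact (Category.assoc _ _ _).trans ((congrArg (_ ≫ ·) (proj_desc _ _)).trans h)

lemma freeTau_freeTensor (V : C) (N : HC L) : (α_ V (und L) N.X).hom ≫ V ◁ lact N ≫
    freeTensor V N = (freeTau V).hom ▷ N.X ≫ proj (free L V) N := by
  refine Eq.trans (b := (α_ V (und L) N.X).hom ≫ V ◁ lact N ≫ freeUnit L V ▷ N.X ≫
    proj (free L V) N) rfl ?_
  rw [whisker_exchange_assoc, ← associator_naturality_left_assoc, ← proj_condition,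
    ← comp_whiskerRight_assoc, freeUnit_ract]

lemma desc_freeTensor (V : C) (N : HC L) :
    desc (freeAct V N) (freeAct_condition V N) ≫ freeTensor V N = 𝟙 _ := by
  refine tensor_hom_ext ?_
  have h : freeAct V N ≫ freeTensor V N = proj (free L V) N := by
    rw [freeAct, Category.assoc, Category.assoc, freeTau_freeTensor,
      ← comp_whiskerRight_assoc, Iso.inv_hom_id, id_whiskerRight, Category.id_comp]
  exact (comp_comp_eq (proj_desc _ _) h).trans (Category.comp_id _).symm

instance (V : C) (N : HC L) : IsIso (freeTensor V N) :=
  ⟨desc (freeAct V N) (freeAct_condition V N), freeTensor_desc V N, desc_freeTensor V N⟩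

noncomputable instance : (forget L).LaxMonoidal :=
  Functor.LaxMonoidal.mk η[und L] proj
    (fun f X' => (proj_whiskerRight f X').symm)
    (fun X' f => (proj_whiskerLeft X' f).symm)
    (fun X Y Z => proj_associator X Y Z)
    (fun X => (one_lact X).symm.trans (congrArg (_ ≫ ·) (proj_leftUnitor X).symm))
    (fun X => (ract_one X).symm.trans (congrArg (_ ≫ ·) (proj_rightUnitor X).symm))

/-- A left adjoint of a lax monoidal functor is oplax monoidal. All coherence comes from the
adjunction in this way, and only the invertibility of `δ` and `η` remains to be shown. -/
noncomputable instance : (freeFunctor L).OplaxMonoidal := (freeAdj L).leftAdjointOplaxMonoidal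

instance : (freeAdj L).IsMonoidal := by
  unfold instOplaxMonoidalFreeFunctor
  infer_instance

open Functor.OplaxMonoidal in
lemma freeUnit_δ (V W : C) : freeUnit L (V ⊗ W) ≫ (δ (freeFunctor L) V W).hom =
    (freeUnit L V ⊗ₘ freeUnit L W) ≫ proj (free L V) (free L W) := by
  have h := (freeAdj L).unit_app_tensor_comp_map_δ V W
  rw [freeAdj_unit, freeAdj_unit, freeAdj_unit] at h
  exact h

open Functor.OplaxMonoidal in
lemma freeUnit_η : freeUnit L (𝟙_ C) ≫ (Functor.OplaxMonoidal.η (freeFunctor L)).hom = η[und L] := by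
  have h := (freeAdj L).unit_app_unit_comp_map_η
  rw [freeAdj_unit] at h
  exact h

/-- Exhibits `δ` as a composite of isomorphisms: `L` is moved behind `V` by the inverse of `τ`, and
then `V ⊗ (L ⊗ W)` is identified with `(L ⊗ V) ⊗_L (L ⊗ W)`. -/
lemma δ_hom (V W : C) : (Functor.OplaxMonoidal.δ (freeFunctor L) V W).hom =
    (α_ (und L) V W).inv ≫ (freeTau V).inv ▷ W ≫ (α_ V (und L) W).hom ≫
      freeTensor V (free L W) := by
  have h1 : V ◁ (und L ◁ freeUnit L W) ≫ V ◁ lact (free L W) = 𝟙 _ := by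
    rw [← MonoidalCategory.whiskerLeft_comp, freeUnit_lact]
    exact MonoidalCategory.whiskerLeft_id _ _
  have h2 : (freeTau V).hom ▷ W ≫ (free L V).X ◁ freeUnit L W ≫ proj (free L V) (free L W) =
      (α_ V (und L) W).hom ≫ freeTensor V (free L W) := by
    rw [← whisker_exchange_assoc, ← freeTau_freeTensor, associator_naturality_right_assoc]
    exact congrArg (_ ≫ ·) ((Category.assoc _ _ _).symm.trans
      ((congrArg (· ≫ _) h1).trans (Category.id_comp _)))
  have h3 : (freeUnit L V ⊗ₘ freeUnit L W) ≫ proj (free L V) (free L W) =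
      freeUnit L V ▷ W ≫ (free L V).X ◁ freeUnit L W ≫ proj (free L V) (free L W) := by
    rw [MonoidalCategory.tensorHom_def, Category.assoc]
  have h4 : (freeTau V).inv ▷ W ≫ (α_ V (und L) W).hom ≫ freeTensor V (free L W) =
      (free L V).X ◁ freeUnit L W ≫ proj (free L V) (free L W) := by
    rw [← h2, ← comp_whiskerRight_assoc, Iso.inv_hom_id, id_whiskerRight, Category.id_comp]
  have h5 : (Functor.OplaxMonoidal.δ (freeFunctor L) V W) =
      freeHom ((freeUnit L V ⊗ₘ freeUnit L W) ≫ proj (free L V) (free L W)) :=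
    free_hom_ext ((freeUnit_δ V W).trans (freeUnit_freeHom _).symm)
  refine (congrArg Mod.Hom.hom h5).trans ?_
  refine (congrArg (und L ◁ · ≫ lact (tensorObj (free L V) (free L W))) h3).trans ?_
  refine Eq.trans ?_ (congrArg ((α_ (und L) V W).inv ≫ ·) h4).symm
  have h6 : und L ◁ (freeUnit L V ▷ W ≫ (free L V).X ◁ freeUnit L W ≫
      proj (free L V) (free L W)) ≫ lact (tensorObj (free L V) (free L W)) =
      (α_ (und L) V W).inv ≫ (und L ◁ freeUnit L V ≫ lact (free L V)) ▷ W ≫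
        (free L V).X ◁ freeUnit L W ≫ proj (free L V) (free L W) := by
    simp only [MonoidalCategory.whiskerLeft_comp, Category.assoc]
    rw [proj_lact]
    rw [comp_whiskerRight, Category.assoc, ← whisker_exchange_assoc]
    simp
  refine h6.trans ?_
  rw [freeUnit_lact]
  exact congrArg (_ ≫ ·) ((congrArg (· ≫ _) (id_whiskerRight _ _)).trans (Category.id_comp _))

lemma isIso_of_hom {M N : HC L} {f : M ⟶ N} {g : M.X ⟶ N.X} (h : f.hom = g) (hg : IsIso g) :
    IsIso f := by
  have : IsIso ((forget L).map f) := by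
    subst h
    exact hg
  exact isIso_of_reflects_iso f (forget L)

instance (V W : C) : IsIso (Functor.OplaxMonoidal.δ (freeFunctor L) V W) :=
  isIso_of_hom (δ_hom V W) (IsIso.comp_isIso'
    (inferInstanceAs (IsIso (α_ (und L) V W).inv))
    (IsIso.comp_isIso' (inferInstanceAs (IsIso ((tau L V).inv ▷ W))) (IsIso.comp_isIso' inferInstance
      (inferInstanceAs (IsIso (freeTensor V (free L W)))))))

instance : IsIso (Functor.OplaxMonoidal.η (freeFunctor L)) := by
  have h : Functor.OplaxMonoidal.η (freeFunctor L) =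
      freeHom (N := Mod.regular (und L)) η[und L] :=
    free_hom_ext (freeUnit_η.trans (freeUnit_freeHom (N := Mod.regular (und L)) η[und L]).symm)
  exact isIso_of_hom ((congrArg Mod.Hom.hom h).trans (MonObj.mul_one (und L)))
    (inferInstanceAs (IsIso (ρ_ (und L)).hom))

noncomputable instance : (freeFunctor L).Monoidal := .ofOplaxMonoidal _

end HC
end FreeMonoidal
end HarishChandra

namespace HarishChandra

/-! ### Transport of coevaluations -/

section Duals
variable {A : Type*} [Category* A] [MonoidalCategory A]

lemma IsCoev.map {A' : Type*} [Category* A'] [MonoidalCategory A'] (F : A ⥤ A') [F.Monoidal]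
    {z w : A} {e : 𝟙_ A ⟶ z ⊗ w} (he : IsCoev e) :
    IsCoev (Functor.LaxMonoidal.ε F ≫ F.map e ≫ Functor.OplaxMonoidal.δ F z w) := by
  obtain ⟨φ, h₁, h₂⟩ := he
  refine ⟨Functor.LaxMonoidal.μ F w z ≫ F.map φ ≫ Functor.OplaxMonoidal.η F, ?_, ?_⟩
  · rw [← F.map_id, ← h₁]
    simp only [contractLeft, F.map_comp, Functor.Monoidal.map_whiskerLeft,
      Functor.Monoidal.map_whiskerRight, Functor.Monoidal.map_associator_inv,
      Functor.Monoidal.map_leftUnitor, Functor.Monoidal.map_rightUnitor_inv,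
      MonoidalCategory.whiskerLeft_comp, comp_whiskerRight, Category.assoc,
      Functor.Monoidal.μ_δ_assoc]
  · rw [← F.map_id, ← h₂]
    simp only [contractRight, F.map_comp, Functor.Monoidal.map_whiskerLeft,
      Functor.Monoidal.map_whiskerRight, Functor.Monoidal.map_associator,
      Functor.Monoidal.map_rightUnitor, Functor.Monoidal.map_leftUnitor_inv,
      MonoidalCategory.whiskerLeft_comp, comp_whiskerRight, Category.assoc,
      Functor.Monoidal.μ_δ_assoc]

lemma IsCoev.comp_left_iso {z z' w : A} {e : 𝟙_ A ⟶ z ⊗ w} (he : IsCoev e) (i : z ≅ z') :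
    IsCoev (e ≫ i.hom ▷ w) := by
  obtain ⟨φ, h₁, h₂⟩ := he
  refine ⟨w ◁ i.inv ≫ φ, ?_, ?_⟩
  · rw [← h₁]
    simp [contractLeft]
  · have h : contractRight (e ≫ i.hom ▷ w) (w ◁ i.inv ≫ φ) =
        contractRight e (w ◁ i.inv ≫ φ) ≫ i.hom := by
      simp only [contractRight, Category.assoc, ← rightUnitor_naturality, whisker_exchange_assoc]
      simp
    have h' : contractRight e (w ◁ i.inv ≫ φ) = i.inv ≫ contractRight e φ := by
      simp only [contractRight, MonoidalCategory.whiskerLeft_comp, Category.assoc]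
      rw [leftUnitor_inv_naturality_assoc, whisker_exchange_assoc]
      simp
    rw [h, h', h₂, Category.comp_id, Iso.inv_hom_id]

lemma IsCoev.comp_right_iso {z w w' : A} {e : 𝟙_ A ⟶ z ⊗ w} (he : IsCoev e) (i : w ≅ w') :
    IsCoev (e ≫ z ◁ i.hom) := by
  obtain ⟨φ, h₁, h₂⟩ := he
  refine ⟨i.inv ▷ z ≫ φ, ?_, ?_⟩
  · have h : contractLeft (e ≫ z ◁ i.hom) (i.inv ▷ z ≫ φ) =
        contractLeft e (i.inv ▷ z ≫ φ) ≫ i.hom := by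
      simp only [contractLeft, Category.assoc, ← leftUnitor_naturality, ← whisker_exchange_assoc]
      simp
    have h' : contractLeft e (i.inv ▷ z ≫ φ) = i.inv ≫ contractLeft e φ := by
      simp only [contractLeft, comp_whiskerRight, Category.assoc]
      rw [rightUnitor_inv_naturality_assoc, ← whisker_exchange_assoc]
      simp
    rw [h, h', h₁, Category.comp_id, Iso.inv_hom_id]
  · rw [← h₂]
    simp [contractRight]

end Duals

section FullSubcategories
variable {H : Type u'} [Category.{w} H] [MonoidalCategory H] {P : ObjectProperty H}
  [P.IsMonoidal]

lemma IsCoev.fullSubcategory {z w : P.FullSubcategory} {e : 𝟙_ P.FullSubcategory ⟶ z ⊗ w}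
    (he : IsCoev (z := z.obj) (w := w.obj) e.hom) : IsCoev e := by
  obtain ⟨φ, h₁, h₂⟩ := he
  exact ⟨ObjectProperty.homMk φ, ObjectProperty.hom_ext _ h₁, ObjectProperty.hom_ext _ h₂⟩

end FullSubcategories

/-! ### Closure properties of compact projective objects -/

section CompactProjective
variable {k : Type w} [Field k] {H : Type u} [Category.{w} H] [Preadditive H] [Linear k H]

/-- If `Hom (x, -)` is `Hom (y, F -)` with `F` cocontinuous, it is cocontinuous. Free modules,
tensor products and duals are all instances. -/
lemma compactProjective.of_equiv {H' : Type u'} [Category.{w} H'] [Preadditive H'] [Linear k H']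
    {x : H} {y : H'} (hy : compactProjective k y) (F : H ⥤ H') [PreservesColimitsOfSize.{w, w} F]
    (e : ∀ N, (x ⟶ N) ≃ (y ⟶ F.obj N)) (map_add : ∀ N f g, e N (f + g) = e N f + e N g)
    (map_smul : ∀ N (r : k) f, e N (r • f) = r • e N f)
    (map_comp : ∀ {N N'} (f : x ⟶ N) (g : N ⟶ N'), e N' (f ≫ g) = e N f ≫ F.map g) :
    compactProjective k x := by
  have : PreservesColimitsOfSize.{w, w} ((linearCoyoneda k H').obj (op y)) := hy
  let i : F ⋙ (linearCoyoneda k H').obj (op y) ≅ (linearCoyoneda k H).obj (op x) :=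
    (NatIso.ofComponents (fun N => LinearEquiv.toModuleIso
      { e N with
        map_add' := map_add N
        map_smul' := map_smul N }) (fun {N N'} g => by
          ext f
          exact map_comp f g)).symm
  exact preservesColimits_of_natIso i

variable [MonoidalCategory H] [MonoidalPreadditive H] [MonoidalLinear k H] [TensorCocontinuous H]

lemma compactProjective.tensor {x y : H} [HasLeftDual x] (hy : compactProjective k y) :
    compactProjective k (x ⊗ y) := by
  have := TensorCocontinuous.left (ᘁx)
  exact hy.of_equiv (tensorLeft (ᘁx)) (fun N => tensorLeftHomEquiv y (ᘁx) x N)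
    (fun N f g => by simp [tensorLeftHomEquiv])
    (fun N r f => by simp [tensorLeftHomEquiv])
    (fun f g => tensorLeftHomEquiv_naturality f g)

/-- Since `Hom (x, N)` is `Hom (𝟙, N ⊗ y)`, compact projectivity of the unit passes to every object
having a dual. -/
lemma compactProjective.leftDual (h1 : compactProjective k (𝟙_ H)) (x y : H) [ExactPairing x y] :
    compactProjective k x := by
  have := TensorCocontinuous.right y
  exact h1.of_equiv (tensorRight y)
    (fun N => (Iso.homCongr (λ_ x).symm (Iso.refl N)).trans (tensorRightHomEquiv (𝟙_ H) x y N))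
    (fun N f g => by simp [tensorRightHomEquiv])
    (fun N r f => by simp [tensorRightHomEquiv])
    (fun f g => by simp [tensorRightHomEquiv])

lemma compactProjective.rightDual (h1 : compactProjective k (𝟙_ H)) (x y : H) [ExactPairing x y] :
    compactProjective k y := by
  have := TensorCocontinuous.left x
  exact h1.of_equiv (tensorLeft x)
    (fun N => (Iso.homCongr (ρ_ y).symm (Iso.refl N)).trans (tensorLeftHomEquiv (𝟙_ H) x y N))
    (fun N f g => by simp [tensorLeftHomEquiv])
    (fun N r f => by simp [tensorLeftHomEquiv])
    (fun f g => by simp [tensorLeftHomEquiv])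

end CompactProjective

section EssentiallySmall
variable (k : Type w) [Field k] (C : Type u) [Category.{w} C] [Preadditive C] [Linear k C]
  [IsLocallyPresentable.{w} C]

/-- The underlying set functor on vector spaces preserves filtered colimits, so compact projective
objects are `κ`-presentable, and these form an essentially small class in a locally `κ`-presentable
category. -/
lemma compactProjective_essentiallySmall :
    ObjectProperty.EssentiallySmall.{w} (compactProjective k (C := C)) := by
  obtain ⟨κ, _, _⟩ := IsLocallyPresentable.exists_cardinal.{w} C
  have h : compactProjective k (C := C) ≤ isCardinalPresentable C κ := fun x hx => by
    have : PreservesColimitsOfSize.{w, w} ((linearCoyoneda k C).obj (op x)) := hx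
    refine ⟨fun J _ _ => ?_⟩
    have : IsFiltered J := isFiltered_of_isCardinalFiltered J κ
    exact inferInstanceAs (PreservesColimitsOfShape J
      ((linearCoyoneda k C).obj (op x) ⋙ CategoryTheory.forget (ModuleCat.{w} k)))
  exact ObjectProperty.EssentiallySmall.of_le h

end EssentiallySmall

lemma isIso_of_bijective {C : Type*} [Category* C] {P : ObjectProperty C}
    (hP : P.IsStrongGenerator) {X Y : C} (f : X ⟶ Y)
    (h : ∀ V, P V → Function.Bijective fun g : V ⟶ X => g ≫ f) : IsIso f := by
  have : Mono f := ⟨fun g g' hg => hP.isSeparating _ _ fun V hV a => (h V hV).1 (by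
    simp only [Category.assoc, hg])⟩
  exact hP.isIso_of_mono f fun V hV => (h V hV).2

/-! ### The generators of `HC` -/

section Generators
variable (k : Type w) [Field k] {C : Type u} [Category.{w} C] [Preadditive C] [Linear k C]
  [MonoidalCategory C] [MonoidalPreadditive C] [MonoidalLinear k C] [TensorCocontinuous C]
  {L : Center C} [MonObj L]

variable [IsCommMonObj L]

lemma compactProjective.free {V : C} (hV : compactProjective k V)
    [PreservesColimitsOfSize.{w, w} (HC.forget L)] : compactProjective k (HC.free L V) :=
  hV.of_equiv (HC.forget L) (HC.freeHomEquiv V)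
    (fun _ _ _ => Preadditive.comp_add _ _ _ _ _ _)
    (fun _ _ _ => Linear.comp_smul _ _ _ _ _ _) (fun _ _ => (Category.assoc _ _ _).symm)

variable [HasCoequalizers C] {k}

/-- The free functor is strong monoidal, and compact projective objects of `C` contain the unit and
are closed under `⊗` by rigidity. Closing the free modules under `⊗_L` therefore adds nothing up to
isomorphism. -/
lemma generators.exists_iso_free (hC : IsCpRigid k C) (h1 : compactProjective k (𝟙_ C))
    {M : HC L} (hM : generators k L M) :
    ∃ V, compactProjective k V ∧ Nonempty (M ≅ HC.free L V) := by
  induction hM with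
  | free V hV => exact ⟨V, hV, ⟨Iso.refl _⟩⟩
  | unit => exact ⟨𝟙_ C, h1, ⟨(asIso (Functor.OplaxMonoidal.η (HC.freeFunctor L))).symm⟩⟩
  | tensor M N _ _ hM hN =>
    obtain ⟨V, hV, ⟨i⟩⟩ := hM
    obtain ⟨W, hW, ⟨j⟩⟩ := hN
    obtain ⟨_⟩ := hC.leftDual V hV
    exact ⟨V ⊗ W, hW.tensor, ⟨(i ⊗ᵢ j) ≪≫
      (asIso (Functor.OplaxMonoidal.δ (HC.freeFunctor L) V W)).symm⟩⟩

/-- Smallness, compact projectivity and detection of isomorphisms are inherited from `C` through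
`Hom (L ⊗ V, N) = Hom (V, N)`. -/
theorem nonempty_generating [IsLocallyPresentable.{w} C] (hC : IsCpRigid k C)
    (h1 : compactProjective k (𝟙_ C)) : Nonempty (Generating k (generators k L)) := by
  have := compactProjective_essentiallySmall k C
  have : HasColimitsOfSize.{w, w} C := by
    obtain ⟨κ, _, _⟩ := IsLocallyPresentable.exists_cardinal.{w} C
    infer_instance
  obtain ⟨Q, _, hQ, hQ'⟩ :=
    ObjectProperty.EssentiallySmall.exists_small_le.{w} (compactProjective k (C := C))
  have h (x : (generators k L).FullSubcategory) : ∃ V, Q V ∧ Nonempty (x.obj ≅ HC.free L V) := by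
    obtain ⟨V, hV, ⟨i⟩⟩ := x.property.exists_iso_free hC h1
    obtain ⟨V', hV', ⟨j⟩⟩ := hQ' V hV
    exact ⟨V', hV', ⟨i ≪≫ (HC.freeFunctor L).mapIso j⟩⟩
  exact ⟨{
    W := Shrink.{w} (Subtype Q)
    obj := fun s => ⟨HC.free L ((equivShrink _).symm s).1,
      .free _ (hQ _ ((equivShrink _).symm s).2)⟩
    exists_iso := fun x => by
      obtain ⟨V, hV, ⟨i⟩⟩ := h x
      refine ⟨equivShrink _ ⟨V, hV⟩, ⟨(generators k L).isoMk ?_⟩⟩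
      exact i ≪≫ eqToIso (by simp)
    cp := fun x => by
      obtain ⟨V, hV, ⟨i⟩⟩ := h x
      exact ((hQ V hV).free k).of_equiv (𝟭 _) (fun N => Iso.homCongr i (Iso.refl N))
        (fun N f g => by simp) (fun N r f => by simp) (fun f g => by simp)
    detect := fun {X Y} f hf => by
      refine HC.isIso_of_hom rfl (isIso_of_bijective hC.enough f.hom fun V hV => ?_)
      have h := hf ⟨HC.free L V, .free V hV⟩
      have h' := (HC.freeHomEquiv V Y).bijective.comp (h.comp
        (HC.freeHomEquiv V X).symm.bijective)
      refine (congrArg Function.Bijective (funext fun g => ?_)).mp h'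
      exact (Category.assoc _ _ _).symm.trans (congrArg (· ≫ f.hom) (HC.freeUnit_freeHom g)) }⟩

/-- A dual of a compact projective object of `C` is compact projective, so the free module on it is
again a generator, and the free functor carries the duality over. -/
lemma generators.exists_dual (hC : IsCpRigid k C) (h1 : compactProjective k (𝟙_ C))
    (w : (generators k L).FullSubcategory) :
    ∃ (z : (generators k L).FullSubcategory)
      (e : 𝟙_ (generators k L).FullSubcategory ⟶ z ⊗ w), IsCoev e := by
  obtain ⟨V, hV, ⟨i⟩⟩ := w.property.exists_iso_free hC h1
  obtain ⟨⟨V', _⟩⟩ := hC.leftDual V hV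
  refine ⟨⟨HC.free L V', .free V' (h1.leftDual V' V)⟩, ObjectProperty.homMk _,
    IsCoev.fullSubcategory
      (((isCoev_coevaluation V' V).map (HC.freeFunctor L)).comp_right_iso i.symm)⟩

lemma generators.exists_dual' (hC : IsCpRigid k C) (h1 : compactProjective k (𝟙_ C))
    (z : (generators k L).FullSubcategory) :
    ∃ (w : (generators k L).FullSubcategory)
      (e : 𝟙_ (generators k L).FullSubcategory ⟶ z ⊗ w), IsCoev e := by
  obtain ⟨V, hV, ⟨i⟩⟩ := z.property.exists_iso_free hC h1
  obtain ⟨⟨V', _⟩⟩ := hC.rightDual V hV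
  refine ⟨⟨HC.free L V', .free V' (h1.rightDual V V')⟩, ObjectProperty.homMk _,
    IsCoev.fullSubcategory
      (((isCoev_coevaluation V V').map (HC.freeFunctor L)).comp_left_iso i.symm)⟩

end Generators

section Restrict
variable {k : Type w} [Field k] {H : Type u'} [Category.{w} H] [MonoidalCategory H]
  {M : BiPsh.{w, u', v} k H} {S : MulOne M} {P : ObjectProperty H} [P.IsMonoidal]

lemma MulOne.IsMonoid.restrict (hS : S.IsMonoid) : (S.restrict (P := P)).IsMonoid where
  mul_assoc a₁ a₂ a₃ := hS.mul_assoc a₁ a₂ a₃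
  one_mul a := hS.one_mul a
  mul_one a := hS.mul_one a

lemma Aug.IsMul.restrict [Preadditive H] [Linear k H] {ε : Aug M} (hε : ε.IsMul S) :
    (ε.restrict (P := P)).IsMul S.restrict where
  map_one := ObjectProperty.hom_ext _ hε.map_one
  map_mul a a' := ObjectProperty.hom_ext _ (hε.map_mul a a')

end Restrict

/-! ### The comonad of a bialgebroid -/

section Realization
variable {k : Type w} [Field k] {C : Type u} [Category.{w} C] [Preadditive C] [Linear k C]
  [MonoidalCategory C] [MonoidalPreadditive C] [MonoidalLinear k C] [TensorCocontinuous C]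
  [IsLocallyPresentable.{w} C] {L : Center C} [MonObj L] [IsCommMonObj L]

theorem HCBialgebroid.exists_realization (hC : IsCpRigid k C) (h1 : compactProjective k (𝟙_ C))
    (B : HCBialgebroid k L) :
    ∃ G : LaxMonoidalComonad k (HC L), Nonempty (B.Realization k G) := by
  obtain ⟨𝒢⟩ := nonempty_generating (L := L) hC h1
  have : HasColimitsOfSize.{w, w} C := by
    obtain ⟨κ, _, _⟩ := IsLocallyPresentable.exists_cardinal.{w} C
    infer_instance
  exact HarishChandra.exists_realization 𝒢 _ B.moment.hcMulOne_isMonoid.restrict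
    B.ε.hcAug_isMul.restrict B.isCoring

end Realization
end HarishChandra

namespace HarishChandra

/-! ### Operators: families `x ⊗ T (y ⊗ N) ⟶ T N` -/

section Operators
variable {H : Type u'} [Category.{w} H] [MonoidalCategory H]

open Functor.LaxMonoidal (μ_natural_left μ_natural_right)

/-- A monoidal natural transformation from a lax monoidal functor to the identity. -/
structure MonoidalCounit (T : H ⥤ H) [T.LaxMonoidal] where
  app (N : H) : T.obj N ⟶ N
  naturality {N N' : H} (f : N ⟶ N') : T.map f ≫ app N' = app N ≫ f
  unit : Functor.LaxMonoidal.ε T ≫ app (𝟙_ H) = 𝟙 _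
  tensor (N N' : H) : Functor.LaxMonoidal.μ T N N' ≫ app (N ⊗ N') = app N ⊗ₘ app N'

variable {T : H ⥤ H} [T.LaxMonoidal] (c : MonoidalCounit T)

/-- The compatible families of maps `x ⊗ T (y ⊗ N) ⟶ T N`, over a map `x ⊗ y ⟶ 𝟙`. -/
structure IsOperator {x y : H} (φ : x ⊗ y ⟶ 𝟙_ H)
    (β : ∀ N, x ⊗ T.obj (y ⊗ N) ⟶ T.obj N) : Prop where
  naturality {N N' : H} (h : N ⟶ N') : x ◁ T.map (y ◁ h) ≫ β N' = β N ≫ T.map h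
  tensor (N N' : H) : (α_ x (T.obj (y ⊗ N)) (T.obj N')).inv ≫ β N ▷ T.obj N' ≫
    Functor.LaxMonoidal.μ T N N' =
      x ◁ (Functor.LaxMonoidal.μ T (y ⊗ N) N' ≫ T.map (α_ y N N').hom) ≫ β (N ⊗ N')
  counit (N : H) : β N ≫ c.app N =
    x ◁ c.app (y ⊗ N) ≫ (α_ x y N).inv ≫ φ ▷ N ≫ (λ_ N).hom

namespace IsOperator
variable {c}

lemma act {x x' y y' : H} {φ : x' ⊗ y' ⟶ 𝟙_ H} {β : ∀ N, x' ⊗ T.obj (y' ⊗ N) ⟶ T.obj N}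
    (hβ : IsOperator c φ β) (f : x ⟶ x') (g : y ⟶ y') :
    IsOperator c ((f ⊗ₘ g) ≫ φ)
      (fun N => f ▷ T.obj (y ⊗ N) ≫ x' ◁ T.map (g ▷ N) ≫ β N) where
  naturality {N N'} h := by
    rw [Category.assoc, Category.assoc, ← hβ.naturality, whisker_exchange_assoc,
      ← whiskerLeft_comp_assoc, ← T.map_comp, whisker_exchange, T.map_comp,
      whiskerLeft_comp_assoc]
  tensor N N' := by
    have h := hβ.tensor N N'
    have h2 : T.map (g ▷ N) ▷ T.obj N' ≫ Functor.LaxMonoidal.μ T (y' ⊗ N) N' ≫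
        T.map (α_ y' N N').hom = Functor.LaxMonoidal.μ T (y ⊗ N) N' ≫ T.map (α_ y N N').hom ≫
          T.map (g ▷ (N ⊗ N')) := by
      rw [Functor.LaxMonoidal.μ_natural_left_assoc, ← T.map_comp, ← T.map_comp,
        associator_naturality_left]
    rw [comp_whiskerRight, comp_whiskerRight, Category.assoc, Category.assoc,
      ← associator_inv_naturality_left_assoc, ← associator_inv_naturality_middle_assoc, h,
      ← whiskerLeft_comp_assoc, h2, whisker_exchange_assoc, ← whiskerLeft_comp_assoc,
      Category.assoc]
  counit N := by
    rw [Category.assoc, Category.assoc, hβ.counit, ← whiskerLeft_comp_assoc, c.naturality,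
      ← whisker_exchange_assoc]
    simp [MonoidalCategory.tensorHom_def']

variable (c) in
lemma one : IsOperator c (λ_ (𝟙_ H)).hom
    (fun N => (λ_ (T.obj (𝟙_ H ⊗ N))).hom ≫ T.map (λ_ N).hom) where
  naturality {N N'} h := by
    have h1 : T.map (λ_ N).hom ≫ T.map h = T.map (𝟙_ H ◁ h) ≫ T.map (λ_ N').hom := by
      rw [← T.map_comp, ← T.map_comp, leftUnitor_naturality]
    rw [Category.assoc, h1, leftUnitor_naturality_assoc]
  tensor N N' := by
    have h : Functor.LaxMonoidal.μ T (𝟙_ H ⊗ N) N' ≫ T.map ((λ_ N).hom ▷ N') =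
        (Functor.LaxMonoidal.μ T (𝟙_ H ⊗ N) N' ≫ T.map (α_ _ N N').hom) ≫
          T.map (λ_ (N ⊗ N')).hom := by
      rw [Category.assoc, ← T.map_comp, leftUnitor_tensor_hom, Iso.hom_inv_id_assoc]
    rw [leftUnitor_naturality_assoc, ← h, ← μ_natural_left, leftUnitor_tensor_hom,
      comp_whiskerRight, Category.assoc, Category.assoc]
  counit N := by
    rw [Category.assoc, c.naturality, ← leftUnitor_naturality_assoc, leftUnitor_tensor_hom,
      Category.assoc]

/-- The operator nearer to `T` is applied first, at the object `y ⊗ N`, and the outer one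
afterwards. This is why the second variables appear in the order `y' ⊗ y` and why the maps to `𝟙`
are nested. -/
lemma mul {x y x' y' : H} {φ : x ⊗ y ⟶ 𝟙_ H} {β : ∀ N, x ⊗ T.obj (y ⊗ N) ⟶ T.obj N}
    {φ' : x' ⊗ y' ⟶ 𝟙_ H} {β' : ∀ N, x' ⊗ T.obj (y' ⊗ N) ⟶ T.obj N}
    (hβ : IsOperator c φ β) (hβ' : IsOperator c φ' β') :
    IsOperator c (nestEval φ φ') (fun N => (α_ x x' _).hom ≫
      x ◁ (x' ◁ T.map (α_ y' y N).hom ≫ β' (y ⊗ N)) ≫ β N) where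
  naturality {N N'} h := by
    have h1 : x' ◁ T.map ((y' ⊗ y) ◁ h) ≫ x' ◁ T.map (α_ y' y N').hom ≫ β' (y ⊗ N') =
        (x' ◁ T.map (α_ y' y N).hom ≫ β' (y ⊗ N)) ≫ T.map (y ◁ h) := by
      rw [Category.assoc, ← hβ'.naturality, ← whiskerLeft_comp_assoc, ← whiskerLeft_comp_assoc,
        ← T.map_comp, ← T.map_comp, associator_naturality_right]
    rw [associator_naturality_right_assoc, ← whiskerLeft_comp_assoc, h1, whiskerLeft_comp_assoc,
      hβ.naturality]
    simp only [Category.assoc]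
  tensor N N' := by
    have h1 : (x' ◁ T.map (α_ y' y N).hom ≫ β' (y ⊗ N)) ▷ T.obj N' ≫
        Functor.LaxMonoidal.μ T (y ⊗ N) N' ≫ T.map (α_ y N N').hom =
        (α_ _ _ _).hom ≫ x' ◁ (Functor.LaxMonoidal.μ T ((y' ⊗ y) ⊗ N) N' ≫
          T.map (α_ (y' ⊗ y) N N').hom) ≫ x' ◁ T.map (α_ y' y (N ⊗ N')).hom ≫
            β' (y ⊗ N ⊗ N') := by
      have h2 := hβ'.tensor (y ⊗ N) N'
      have h3 : T.map (α_ y' y N).hom ▷ T.obj N' ≫ Functor.LaxMonoidal.μ T (y' ⊗ y ⊗ N) N' ≫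
          T.map (α_ y' (y ⊗ N) N').hom ≫ T.map (y' ◁ (α_ y N N').hom) =
          Functor.LaxMonoidal.μ T ((y' ⊗ y) ⊗ N) N' ≫ T.map (α_ (y' ⊗ y) N N').hom ≫
            T.map (α_ y' y (N ⊗ N')).hom := by
        rw [Functor.LaxMonoidal.μ_natural_left_assoc, ← T.map_comp, ← T.map_comp, ← T.map_comp,
          pentagon]
      rw [Iso.inv_comp_eq] at h2
      rw [comp_whiskerRight, Category.assoc, reassoc_of% h2, ← hβ'.naturality,
        associator_naturality_middle_assoc, ← whiskerLeft_comp_assoc, ← whiskerLeft_comp_assoc,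
        Category.assoc, Category.assoc, h3, ← whiskerLeft_comp_assoc, Category.assoc]
    have h4 := hβ.tensor N N'
    rw [Iso.inv_comp_eq] at h4
    rw [comp_whiskerRight, comp_whiskerRight, Category.assoc, Category.assoc, h4,
      associator_naturality_middle_assoc, ← whiskerLeft_comp_assoc, h1]
    simp
  counit N := by
    rw [Category.assoc, Category.assoc, hβ.counit, ← whiskerLeft_comp_assoc, Category.assoc,
      hβ'.counit, ← whiskerLeft_comp_assoc, c.naturality, nestEval]
    simp only [whiskerLeft_comp, Category.assoc, comp_whiskerRight]
    rw [← associator_naturality_right_assoc]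
    monoidal

end IsOperator
end Operators
end HarishChandra

namespace HarishChandra

section NestEval
variable {A : Type u} [Category.{v} A] [MonoidalCategory A]

lemma nestEval_comp {x₁ x₂ y₁ y₂ x₁' x₂' y₁' y₂' : A} (f : x₁ ⟶ x₂) (g : y₁ ⟶ y₂) (f' : x₁' ⟶ x₂')
    (g' : y₁' ⟶ y₂') (φ : x₂ ⊗ y₂ ⟶ 𝟙_ A) (φ' : x₂' ⊗ y₂' ⟶ 𝟙_ A) :
    nestEval ((f ⊗ₘ g) ≫ φ) ((f' ⊗ₘ g') ≫ φ') =
      ((f ⊗ₘ f') ⊗ₘ (g' ⊗ₘ g)) ≫ nestEval φ φ' := by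
  have h : (α_ x₁' y₁' y₁).inv ≫ ((f' ⊗ₘ g') ≫ φ') ▷ y₁ ≫ (λ_ y₁).hom ≫ g =
      f' ▷ (y₁' ⊗ y₁) ≫ x₂' ◁ (g' ▷ y₁ ≫ y₂' ◁ g) ≫
        (α_ x₂' y₂' y₂).inv ≫ φ' ▷ y₂ ≫ (λ_ y₂).hom := by
    rw [← leftUnitor_naturality, comp_whiskerRight, Category.assoc, ← whisker_exchange_assoc,
      MonoidalCategory.tensorHom_def]
    monoidal
  rw [nestEval, nestEval, MonoidalCategory.tensorHom_def' f g, Category.assoc,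
    ← whiskerLeft_comp_assoc, Category.assoc, Category.assoc, h, whisker_exchange_assoc,
    MonoidalCategory.tensorHom_def (f ⊗ₘ f'), MonoidalCategory.tensorHom_def g' g,
    MonoidalCategory.tensorHom_def f f']
  monoidal

lemma nestEval_assoc {x₁ x₂ x₃ y₁ y₂ y₃ : A} (φ₁ : x₁ ⊗ y₁ ⟶ 𝟙_ A) (φ₂ : x₂ ⊗ y₂ ⟶ 𝟙_ A)
    (φ₃ : x₃ ⊗ y₃ ⟶ 𝟙_ A) : nestEval (nestEval φ₁ φ₂) φ₃ =
      ((α_ x₁ x₂ x₃).hom ⊗ₘ (α_ y₃ y₂ y₁).inv) ≫ nestEval φ₁ (nestEval φ₂ φ₃) := by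
  simp only [nestEval]
  monoidal

lemma nestEval_one_left {x y : A} (φ : x ⊗ y ⟶ 𝟙_ A) :
    nestEval (λ_ (𝟙_ A)).hom φ = ((λ_ x).hom ⊗ₘ (ρ_ y).hom) ≫ φ := by
  simp only [nestEval]
  monoidal

lemma nestEval_one_right {x y : A} (φ : x ⊗ y ⟶ 𝟙_ A) :
    nestEval φ (λ_ (𝟙_ A)).hom = ((ρ_ x).hom ⊗ₘ (λ_ y).hom) ≫ φ := by
  simp only [nestEval]
  monoidal

end NestEval

/-! ### Composition of operators is an algebra structure -/

section OperatorPresheaf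
variable (k : Type w) [Field k] {H : Type u'} [Category.{w} H] [Preadditive H] [Linear k H]
  [MonoidalCategory H] [MonoidalPreadditive H] [MonoidalLinear k H]
  {T : H ⥤ H} [T.LaxMonoidal] (c : MonoidalCounit T)

/-- The vector space of compatible families of maps `x ⊗ T (y ⊗ N) ⟶ T N`. -/
def operators (x y : H) :
    Submodule k ((x ⊗ y ⟶ 𝟙_ H) × ∀ N, x ⊗ T.obj (y ⊗ N) ⟶ T.obj N) where
  carrier := {p | IsOperator c p.1 p.2}
  add_mem' {p q} hp hq :=
    { naturality := fun h => by simp [hp.naturality h, hq.naturality h]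
      tensor := fun N N' => by
        have h₁ := hp.tensor N N'
        have h₂ := hq.tensor N N'
        simp only [Prod.snd_add, Pi.add_apply, Preadditive.comp_add, Preadditive.add_comp,
          MonoidalPreadditive.add_whiskerRight, h₁, h₂]
      counit := fun N => by simp [hp.counit N, hq.counit N] }
  zero_mem' :=
    { naturality := fun h => by simp
      tensor := fun N N' => by simp
      counit := fun N => by simp }
  smul_mem' r p hp :=
    { naturality := fun h => by simp [hp.naturality h]
      tensor := fun N N' => by
        have h₁ := hp.tensor N N'
        simp only [Prod.smul_snd, Pi.smul_apply, Linear.comp_smul, Linear.smul_comp,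
          MonoidalLinear.smul_whiskerRight, h₁]
      counit := fun N => by simp [hp.counit N] }

variable {k c}

namespace operators

/-- The map `x ⊗ y ⟶ 𝟙` of an operator. -/
def φ {x y : H} (b : operators k c x y) : x ⊗ y ⟶ 𝟙_ H := b.1.1

/-- The maps `x ⊗ T (y ⊗ N) ⟶ T N` of an operator. -/
def β {x y : H} (b : operators k c x y) (N : H) : x ⊗ T.obj (y ⊗ N) ⟶ T.obj N := b.1.2 N

lemma isOperator {x y : H} (b : operators k c x y) : IsOperator c (φ b) (β b) := b.2

lemma ext {x y : H} {b b' : operators k c x y} (h : φ b = φ b') (h' : ∀ N, β b N = β b' N) :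
    b = b' :=
  Subtype.ext (Prod.ext h (funext h'))

/-- Precomposition of operators. -/
def act {x x' y y' : H} (f : x ⟶ x') (g : y ⟶ y') : operators k c x' y' →ₗ[k] operators k c x y where
  toFun b := ⟨((f ⊗ₘ g) ≫ φ b, fun N => f ▷ T.obj (y ⊗ N) ≫ x' ◁ T.map (g ▷ N) ≫ β b N),
    (isOperator b).act f g⟩
  map_add' b b' := ext (by simp [φ]) (fun N => by simp [β])
  map_smul' r b := ext (by simp [φ]) (fun N => by simp [β])

/-- The composition of operators. -/
def mul {x y x' y' : H} : operators k c x y →ₗ[k] operators k c x' y' →ₗ[k]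
    operators k c (x ⊗ x') (y' ⊗ y) :=
  LinearMap.mk₂ k (fun b b' => ⟨(nestEval (φ b) (φ b'), fun N => (α_ x x' _).hom ≫
      x ◁ (x' ◁ T.map (α_ y' y N).hom ≫ β b' (y ⊗ N)) ≫ β b N),
      (isOperator b).mul (isOperator b')⟩)
    (fun b₁ b₂ b => ext (by simp [φ, nestEval]) (fun N => by simp [β]))
    (fun r b₁ b => ext (by simp [φ, nestEval]) (fun N => by simp [β]))
    (fun b₁ b₂ b => ext (by simp [φ, nestEval]) (fun N => by simp [β]))
    (fun r b₁ b => ext (by simp [φ, nestEval]) (fun N => by simp [β]))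

variable (k c) in
/-- The identity operator. -/
def one : operators k c (𝟙_ H) (𝟙_ H) := 
  ⟨((λ_ (𝟙_ H)).hom, fun N => (λ_ (T.obj (𝟙_ H ⊗ N))).hom ≫ T.map (λ_ N).hom), IsOperator.one c⟩

section
variable {x x' x'' y y' y'' : H}

lemma φ_act (f : x ⟶ x') (g : y ⟶ y') (b : operators k c x' y') :
    φ (act f g b) = (f ⊗ₘ g) ≫ φ b := rfl

lemma β_act (f : x ⟶ x') (g : y ⟶ y') (b : operators k c x' y') (N : H) :
    β (act f g b) N = f ▷ T.obj (y ⊗ N) ≫ x' ◁ T.map (g ▷ N) ≫ β b N := rfl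

lemma β_mul (b : operators k c x y) (b' : operators k c x' y') (N : H) :
    β (mul b b') N = (α_ x x' _).hom ≫
      x ◁ (x' ◁ T.map (α_ y' y N).hom ≫ β b' (y ⊗ N)) ≫ β b N := rfl

lemma β_one (N : H) :
    β (one k c) N = (λ_ (T.obj (𝟙_ H ⊗ N))).hom ≫ T.map (λ_ N).hom := rfl

lemma act_id (b : operators k c x y) : act (𝟙 x) (𝟙 y) b = b :=
  ext (by simp [φ_act]) (fun N => by simp [β_act])

lemma act_comp (f : x ⟶ x') (f' : x' ⟶ x'') (g : y ⟶ y') (g' : y' ⟶ y'')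
    (b : operators k c x'' y'') : act (f ≫ f') (g ≫ g') b = act f g (act f' g' b) :=
  ext (by simp [φ_act]) (fun N => by
    simp only [β_act, comp_whiskerRight, T.map_comp, MonoidalCategory.whiskerLeft_comp,
      Category.assoc, whisker_exchange_assoc])

end

/-- Besides interchange, this uses the naturality in `N` of the operator applied first: the map `g`
of the outer operator acts on its parameter object. -/
lemma mul_act {x₁ x₂ y₁ y₂ x₁' x₂' y₁' y₂' : H} (f : x₁ ⟶ x₂) (g : y₁ ⟶ y₂) (f' : x₁' ⟶ x₂')
    (g' : y₁' ⟶ y₂') (b : operators k c x₂ y₂) (b' : operators k c x₂' y₂') :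
    mul (act f g b) (act f' g' b') = act (f ⊗ₘ f') (g' ⊗ₘ g) (mul b b') := by
  refine ext (nestEval_comp _ _ _ _ _ _) (fun N => ?_)
  have h : T.map (α_ y₁' y₁ N).hom ≫ T.map (g' ▷ (y₁ ⊗ N)) ≫ T.map (y₂' ◁ g ▷ N) =
      T.map ((g' ⊗ₘ g) ▷ N) ≫ T.map (α_ y₂' y₂ N).hom := by
    rw [← T.map_comp, ← T.map_comp, ← T.map_comp, MonoidalCategory.tensorHom_def]
    simp
  have h' := (isOperator b').naturality (g ▷ N)
  rw [β_act, β_mul, β_mul, β_act, β_act]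
  have h₁ : (x₁' ◁ T.map (α_ y₁' y₁ N).hom ≫ f' ▷ T.obj (y₁' ⊗ y₁ ⊗ N) ≫
      x₂' ◁ T.map (g' ▷ (y₁ ⊗ N)) ≫ β b' (y₁ ⊗ N)) ≫ T.map (g ▷ N) =
      f' ▷ T.obj ((y₁' ⊗ y₁) ⊗ N) ≫ x₂' ◁ T.map ((g' ⊗ₘ g) ▷ N) ≫
        x₂' ◁ T.map (α_ y₂' y₂ N).hom ≫ β b' (y₂ ⊗ N) := by
    rw [Category.assoc, Category.assoc, Category.assoc, ← h', whisker_exchange_assoc,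
      ← whiskerLeft_comp_assoc, ← whiskerLeft_comp_assoc, ← whiskerLeft_comp_assoc]
    simp only [Category.assoc, h]
  rw [← whisker_exchange_assoc f, ← whiskerLeft_comp_assoc, h₁, whisker_exchange_assoc,
    MonoidalCategory.tensorHom_def f f']
  simp only [MonoidalCategory.whiskerLeft_comp, comp_whiskerRight, Category.assoc]
  rw [← associator_naturality_left_assoc, ← associator_naturality_middle_assoc,
    associator_naturality_right_assoc]

/-- The two composites apply the same three operators, but the innermost one at parameter objects
which are bracketed differently; its naturality along an associator reconciles them. -/
lemma mul_assoc {x₁ x₂ x₃ y₁ y₂ y₃ : H} (b₁ : operators k c x₁ y₁) (b₂ : operators k c x₂ y₂)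
    (b₃ : operators k c x₃ y₃) : mul (mul b₁ b₂) b₃ =
      act (α_ x₁ x₂ x₃).hom (α_ y₃ y₂ y₁).inv (mul b₁ (mul b₂ b₃)) := by
  refine ext (nestEval_assoc _ _ _) (fun N => ?_)
  have h : T.map (α_ y₃ (y₂ ⊗ y₁) N).hom ≫ T.map (y₃ ◁ (α_ y₂ y₁ N).hom) =
      T.map ((α_ y₃ y₂ y₁).inv ▷ N) ≫ T.map (α_ (y₃ ⊗ y₂) y₁ N).hom ≫
        T.map (α_ y₃ y₂ (y₁ ⊗ N)).hom := by
    rw [← T.map_comp, ← T.map_comp, ← T.map_comp, ]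
    exact congrArg _ (by monoidal)
  have h' := (isOperator b₃).naturality (α_ y₂ y₁ N).hom
  rw [β_act, β_mul, β_mul, β_mul, β_mul]
  have h₁ : (x₃ ◁ T.map (α_ y₃ (y₂ ⊗ y₁) N).hom ≫ β b₃ ((y₂ ⊗ y₁) ⊗ N)) ≫
      T.map (α_ y₂ y₁ N).hom = x₃ ◁ T.map ((α_ y₃ y₂ y₁).inv ▷ N) ≫
        x₃ ◁ T.map (α_ (y₃ ⊗ y₂) y₁ N).hom ≫ x₃ ◁ T.map (α_ y₃ y₂ (y₁ ⊗ N)).hom ≫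
          β b₃ (y₂ ⊗ y₁ ⊗ N) := by
    rw [Category.assoc, ← h']
    simp only [← whiskerLeft_comp_assoc, h]
  have h₂ : (x₁ ⊗ x₂) ◁ (x₃ ◁ T.map (α_ y₃ (y₂ ⊗ y₁) N).hom ≫ β b₃ ((y₂ ⊗ y₁) ⊗ N)) ≫
      (α_ x₁ x₂ _).hom ≫ x₁ ◁ x₂ ◁ T.map (α_ y₂ y₁ N).hom =
      (x₁ ⊗ x₂) ◁ (x₃ ◁ T.map ((α_ y₃ y₂ y₁).inv ▷ N) ≫
        x₃ ◁ T.map (α_ (y₃ ⊗ y₂) y₁ N).hom ≫ x₃ ◁ T.map (α_ y₃ y₂ (y₁ ⊗ N)).hom ≫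
          β b₃ (y₂ ⊗ y₁ ⊗ N)) ≫ (α_ x₁ x₂ _).hom := by
    rw [← h₁, ← associator_naturality_right, ← whiskerLeft_comp_assoc]
  simp only [MonoidalCategory.whiskerLeft_comp, Category.assoc] at h₂ ⊢
  rw [reassoc_of% h₂]
  monoidal

lemma one_mul {x y : H} (b : operators k c x y) :
    mul (one k c) b = act (λ_ x).hom (ρ_ y).hom b := by
  refine ext (nestEval_one_left _) (fun N => ?_)
  have h' := (isOperator b).naturality (λ_ N).hom
  rw [β_act, β_mul, β_one]
  have h : T.map (α_ y (𝟙_ H) N).hom ≫ T.map (y ◁ (λ_ N).hom) = T.map ((ρ_ y).hom ▷ N) := by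
    rw [← T.map_comp, triangle]
  rw [leftUnitor_naturality_assoc, Category.assoc, ← h', ← whiskerLeft_comp_assoc, h,
    leftUnitor_tensor_hom]
  simp only [Iso.hom_inv_id_assoc, Category.assoc]

lemma mul_one {x y : H} (b : operators k c x y) :
    mul b (one k c) = act (ρ_ x).hom (λ_ y).hom b := by
  refine ext (nestEval_one_right _) (fun N => ?_)
  rw [β_act, β_mul, β_one]
  have h : T.map (α_ (𝟙_ H) y N).hom ≫ T.map (λ_ (y ⊗ N)).hom = T.map ((λ_ y).hom ▷ N) := by
    rw [← T.map_comp, leftUnitor_tensor_hom, Iso.hom_inv_id_assoc]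
  rw [leftUnitor_naturality_assoc, h]
  simp only [MonoidalCategory.whiskerLeft_comp, Category.assoc]
  rw [triangle_assoc]

end operators
end OperatorPresheaf
end HarishChandra

namespace HarishChandra

/-! ### Small models and gluing conditions -/

section Gluing
variable {k : Type w} [Field k] {A : Type u'} [Category.{w} A]

lemma BiPsh.mk'_act {M : A → A → Type v} [∀ x y, AddCommGroup (M x y)] [∀ x y, Module k (M x y)]
    (act : ∀ {x x' y y' : A} (_ : x ⟶ x') (_ : y ⟶ y'), M x' y' →ₗ[k] M x y)
    (act_id : ∀ {x y : A} (m : M x y), act (𝟙 x) (𝟙 y) m = m)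
    (act_comp : ∀ {x x' x'' y y' y'' : A} (f : x ⟶ x') (f' : x' ⟶ x'') (g : y ⟶ y')
      (g' : y' ⟶ y'') (m : M x'' y''), act (f ≫ f') (g ≫ g') m = act f g (act f' g' m))
    {x x' y y' : A} (f : x ⟶ x') (g : y ⟶ y') (m : M x' y') :
    (BiPsh.mk' M act act_id act_comp).act f g m = act f g m := by
  refine (act_comp (𝟙 x) f g (𝟙 y') m).symm.trans ?_
  rw [Category.id_comp, Category.comp_id]

/-- A presheaf preserves limits if compatible families glue uniquely along colimit cocones. -/
lemma Psh.preservesLimitsOfSize (F : Psh.{w, u', w} k A)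
    (h : ∀ {J : Type w} [Category.{w} J] (K : J ⥤ A) (d : Cocone K) (_ : IsColimit d)
      (b : ∀ j, F.obj (op (K.obj j))), (∀ {j j'} (f : j ⟶ j'), F.res (K.map f) (b j') = b j) →
        ∃! m : F.obj (op d.pt), ∀ j, F.res (d.ι.app j) m = b j) :
    PreservesLimitsOfSize.{w, w} F where
  preservesLimitsOfShape {J} _ :=
    { preservesLimit := fun {K} =>
        { preserves := fun {c} hc => by
            refine ⟨isLimitOfReflects (CategoryTheory.forget (ModuleCat k)) ?_⟩
            refine Nonempty.some ((Types.isLimit_iff _).2 fun s hs => ?_)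
            obtain ⟨m, hm, hm'⟩ := h K.leftOp (coconeLeftOpOfCone c)
              (isColimitCoconeLeftOpOfCone K hc) (fun j => s j.unop) (fun f => hs f.unop)
            exact ⟨m, fun j => hm (op j), fun m' h' => hm' m' fun j => h' j.unop⟩ } }

variable {D : Type u} [Category.{v} D] (E : A ⥤ D) [PreservesColimitsOfSize.{w, w} E]
  {J : Type w} [Category.{w} J] {K : J ⥤ A} {d : Cocone K}

lemma map_cocone_hom_ext (hd : IsColimit d) {Z : D} {f g : E.obj d.pt ⟶ Z}
    (h : ∀ j, E.map (d.ι.app j) ≫ f = E.map (d.ι.app j) ≫ g) : f = g :=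
  (isColimitOfPreserves E hd).hom_ext h

lemma exists_map_cocone_desc (hd : IsColimit d) {Z : D} (φ : ∀ j, E.obj (K.obj j) ⟶ Z)
    (h : ∀ {j j'} (f : j ⟶ j'), E.map (K.map f) ≫ φ j' = φ j) :
    ∃ ψ : E.obj d.pt ⟶ Z, ∀ j, E.map (d.ι.app j) ≫ ψ = φ j :=
  ⟨(isColimitOfPreserves E hd).desc
    ⟨Z, { app := φ, naturality := fun _ _ f => (h f).trans (Category.comp_id _).symm }⟩,
    fun j => (isColimitOfPreserves E hd).fac _ j⟩

end Gluing

section Operators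
variable {H : Type u'} [Category.{w} H] [MonoidalCategory H] {T : H ⥤ H} [T.LaxMonoidal]
  {c : MonoidalCounit T}

/-- The conditions on an operator can be checked after restriction to a jointly epimorphic
family. -/
lemma IsOperator.of_act {ι' : Type v} {x y : H} {x' y' : ι' → H} (f : ∀ i, x' i ⟶ x)
    (g : ∀ i, y' i ⟶ y) (hfg : ∀ (N Z : H) {W : H} (p q : (x ⊗ T.obj (y ⊗ N)) ⊗ Z ⟶ W),
      (∀ i, (f i ▷ T.obj (y' i ⊗ N) ≫ x ◁ T.map (g i ▷ N)) ▷ Z ≫ p =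
        (f i ▷ T.obj (y' i ⊗ N) ≫ x ◁ T.map (g i ▷ N)) ▷ Z ≫ q) → p = q)
    {φ : x ⊗ y ⟶ 𝟙_ H} {β : ∀ N, x ⊗ T.obj (y ⊗ N) ⟶ T.obj N}
    (h : ∀ i, IsOperator c ((f i ⊗ₘ g i) ≫ φ)
      (fun N => f i ▷ T.obj (y' i ⊗ N) ≫ x ◁ T.map (g i ▷ N) ≫ β N)) :
    IsOperator c φ β := by
  have hfg' (N : H) {W : H} (p q : x ⊗ T.obj (y ⊗ N) ⟶ W)
      (hpq : ∀ i, f i ▷ T.obj (y' i ⊗ N) ≫ x ◁ T.map (g i ▷ N) ≫ p =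
        f i ▷ T.obj (y' i ⊗ N) ≫ x ◁ T.map (g i ▷ N) ≫ q) : p = q := by
    -- Taking `Z = 𝟙` recovers joint epimorphy of the unwhiskered family. General `Z` is needed for
    -- the condition involving the tensorator.
    have h1 := hfg N (𝟙_ H) ((ρ_ _).hom ≫ p) ((ρ_ _).hom ≫ q) fun i => by
      rw [rightUnitor_naturality_assoc, rightUnitor_naturality_assoc, Category.assoc,
        Category.assoc, hpq]
    exact (cancel_epi _).1 h1
  refine ⟨fun {N N'} n => hfg' _ _ _ fun i => ?_, fun N N' => ?_, fun N => hfg' _ _ _ fun i => ?_⟩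
  · have h1 := (h i).naturality n
    rw [Category.assoc, Category.assoc] at h1
    rw [← h1, whisker_exchange_assoc, ← whiskerLeft_comp_assoc, ← whiskerLeft_comp_assoc,
      ← T.map_comp, ← T.map_comp, whisker_exchange]
  · rw [Iso.inv_comp_eq]
    refine hfg _ _ _ _ fun i => ?_
    have h1 := (h i).tensor N N'
    rw [Iso.inv_comp_eq, comp_whiskerRight, comp_whiskerRight, Category.assoc,
      Category.assoc] at h1
    have h2 : T.map (g i ▷ N) ▷ T.obj N' ≫ Functor.LaxMonoidal.μ T (y ⊗ N) N' ≫
        T.map (α_ y N N').hom = Functor.LaxMonoidal.μ T (y' i ⊗ N) N' ≫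
          T.map (α_ (y' i) N N').hom ≫ T.map (g i ▷ (N ⊗ N')) := by
      rw [Functor.LaxMonoidal.μ_natural_left_assoc, ← T.map_comp, ← T.map_comp,
        associator_naturality_left]
    rw [comp_whiskerRight, Category.assoc, h1, Category.assoc, associator_naturality_middle_assoc,
      associator_naturality_left_assoc, ← whiskerLeft_comp_assoc, h2, ← whisker_exchange_assoc,
      ← whiskerLeft_comp_assoc, Category.assoc, whisker_exchange_assoc]
  · have h1 := (h i).counit N
    rw [Category.assoc, Category.assoc] at h1
    rw [h1, ← whiskerLeft_comp_assoc, c.naturality, ← whisker_exchange_assoc]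
    simp [MonoidalCategory.tensorHom_def']

end Operators

section OperatorPresheaf
variable (k : Type w) [Field k] {H : Type u'} [Category.{w} H] [Preadditive H] [Linear k H]
  [MonoidalCategory H] [MonoidalPreadditive H] [MonoidalLinear k H]
  {T : H ⥤ H} [T.LaxMonoidal] (c : MonoidalCounit T)

/-- There is only a set of operators. -/
lemma operators.small {k : Type w} [Field k] [Linear k H] [MonoidalLinear k H]
    {P : ObjectProperty H} (𝒢 : Generating k P) [HasColimitsOfSize.{w, w} H] [TensorCocontinuous H]
    [T.Additive] [PreservesColimitsOfSize.{w, w} T] (x y : H) : Small.{w} (operators k c x y) := by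
  -- An operator is natural in `N`, and `x ⊗ T (y ⊗ -)` is cocontinuous, so its values at a small
  -- set of generators determine the whole family; `φ` is recorded separately.
  refine small_of_injective (β := (x ⊗ y ⟶ 𝟙_ H) × ∀ s : 𝒢.W,
    x ⊗ T.obj (y ⊗ (𝒢.obj s).obj) ⟶ T.obj (𝒢.obj s).obj)
    (f := fun b => (φ b, fun s => β b (𝒢.obj s).obj)) fun b b' h => ?_
  refine ext (Prod.ext_iff.1 h).1 fun N => ?_
  have := TensorCocontinuous.left x
  have := TensorCocontinuous.left y
  refine 𝒢.map_hom_ext (tensorLeft y ⋙ T ⋙ tensorLeft x) fun z a => ?_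
  obtain ⟨s, ⟨i⟩⟩ := 𝒢.exists_iso z
  have h1 : β b (𝒢.obj s).obj = β b' (𝒢.obj s).obj := congrFun (Prod.ext_iff.1 h).2 s
  have h2 (b : operators k c x y) : x ◁ T.map (y ◁ a) ≫ β b N =
      x ◁ T.map (y ◁ i.hom.hom) ≫ β b (𝒢.obj s).obj ≫ T.map (i.inv.hom ≫ a) := by
    rw [← (isOperator b).naturality, ← whiskerLeft_comp_assoc, ← T.map_comp,
      ← MonoidalCategory.whiskerLeft_comp, ← ObjectProperty.FullSubcategory.comp_hom_assoc,
      i.hom_inv_id, ObjectProperty.FullSubcategory.id_hom, Category.id_comp]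
  exact (h2 b).trans ((congrArg (fun t => _ ≫ t ≫ _) h1).trans (h2 b').symm)

variable [∀ x y : H, Small.{w} (operators k c x y)]

/-- A small model of the vector space of operators. -/
def OpSpace (x y : H) : Type w := Shrink.{w} (operators k c x y)

noncomputable instance (x y : H) : AddCommGroup (OpSpace k c x y) :=
  inferInstanceAs (AddCommGroup (Shrink.{w} (operators k c x y)))

noncomputable instance (x y : H) : Module k (OpSpace k c x y) :=
  inferInstanceAs (Module k (Shrink.{w} (operators k c x y)))

/-- The elements of the small model are the operators. -/
noncomputable def OpSpace.equiv (x y : H) : OpSpace k c x y ≃ₗ[k] operators k c x y :=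
  Shrink.linearEquiv k (operators k c x y)

variable {k c} in
/-- Precomposition of operators. -/
noncomputable def OpSpace.act {x x' y y' : H} (f : x ⟶ x') (g : y ⟶ y') :
    OpSpace k c x' y' →ₗ[k] OpSpace k c x y :=
  (OpSpace.equiv k c x y).symm.toLinearMap ∘ₗ operators.act f g ∘ₗ
    (OpSpace.equiv k c x' y').toLinearMap

variable {k c} in
lemma OpSpace.equiv_act {x x' y y' : H} (f : x ⟶ x') (g : y ⟶ y') (b : OpSpace k c x' y') :
    OpSpace.equiv k c x y (OpSpace.act f g b) = operators.act f g (OpSpace.equiv k c x' y' b) :=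
  (OpSpace.equiv k c x y).apply_symm_apply _

variable {k c} in
lemma OpSpace.act_id {x y : H} (b : OpSpace k c x y) : OpSpace.act (𝟙 x) (𝟙 y) b = b :=
  (OpSpace.equiv k c _ _).injective ((OpSpace.equiv_act _ _ b).trans (operators.act_id _))

variable {k c} in
lemma OpSpace.act_comp {x x' x'' y y' y'' : H} (f : x ⟶ x') (f' : x' ⟶ x'') (g : y ⟶ y')
    (g' : y' ⟶ y'') (b : OpSpace k c x'' y'') :
    OpSpace.act (f ≫ f') (g ≫ g') b = OpSpace.act f g (OpSpace.act f' g' b) :=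
  (OpSpace.equiv k c _ _).injective (by
    rw [OpSpace.equiv_act, OpSpace.equiv_act, OpSpace.equiv_act, operators.act_comp])

/-- The presheaf of operators. -/
noncomputable def opPsh : BiPsh.{w, u', w} k H :=
  BiPsh.mk' (OpSpace k c) OpSpace.act OpSpace.act_id OpSpace.act_comp

/-- The elements of the presheaf of operators are the operators. -/
noncomputable def opEquiv (x y : H) : (opPsh k c).at x y ≃ₗ[k] operators k c x y :=
  OpSpace.equiv k c x y

variable {k c}

lemma opEquiv_act {x x' y y' : H} (f : x ⟶ x') (g : y ⟶ y') (b : (opPsh k c).at x' y') :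
    opEquiv k c x y ((opPsh k c).act f g b) = operators.act f g (opEquiv k c x' y' b) :=
  (congrArg (opEquiv k c x y) (BiPsh.mk'_act OpSpace.act OpSpace.act_id OpSpace.act_comp f g b)).trans
    (OpSpace.equiv_act f g b)

variable (k c)

/-- The composition of operators. -/
noncomputable def opMul : MulOne (opPsh k c) where
  mul {x y x' y'} := ((operators.mul (k := k) (c := c) (x := x) (y := y) (x' := x') (y' := y')).compl₁₂
    (opEquiv k c x y).toLinearMap (opEquiv k c x' y').toLinearMap).compr₂
      (opEquiv k c (x ⊗ x') (y' ⊗ y)).symm.toLinearMap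
  one := (opEquiv k c _ _).symm (operators.one k c)
  mul_act f g f' g' b b' := (opEquiv k c _ _).injective (by
    refine ((opEquiv k c _ _).apply_symm_apply _).trans (Eq.trans ?_
      ((opEquiv_act _ _ _).trans (congrArg _ ((opEquiv k c _ _).apply_symm_apply _))).symm)
    refine (congrArg₂ (fun t t' => operators.mul t t') (opEquiv_act f g b)
      (opEquiv_act f' g' b')).trans ?_
    exact operators.mul_act f g f' g' _ _)

variable {k c}

lemma opEquiv_mul {x y x' y' : H} (b : (opPsh k c).at x y) (b' : (opPsh k c).at x' y') :
    opEquiv k c (x ⊗ x') (y' ⊗ y) ((opMul k c).mul b b') =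
      operators.mul (opEquiv k c x y b) (opEquiv k c x' y' b') :=
  (opEquiv k c _ _).apply_symm_apply _

lemma opEquiv_one : opEquiv k c (𝟙_ H) (𝟙_ H) (opMul k c).one = operators.one k c :=
  (opEquiv k c _ _).apply_symm_apply _

lemma opMul_isMonoid : (opMul k c).IsMonoid where
  mul_assoc b₁ b₂ b₃ := (opEquiv k c _ _).injective (by
    rw [opEquiv_act, opEquiv_mul, opEquiv_mul, opEquiv_mul, opEquiv_mul]
    exact operators.mul_assoc _ _ _)
  one_mul b := (opEquiv k c _ _).injective (by
    rw [opEquiv_act, opEquiv_mul, opEquiv_one]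
    exact operators.one_mul _)
  mul_one b := (opEquiv k c _ _).injective (by
    rw [opEquiv_act, opEquiv_mul, opEquiv_one]
    exact operators.mul_one _)

lemma opPsh_isLinear [T.Additive] [T.Linear k] : (opPsh k c).IsLinear where
  act_add_left f f' g b := (opEquiv k c _ _).injective (by
    rw [map_add, opEquiv_act, opEquiv_act, opEquiv_act]
    exact operators.ext (by simp [operators.φ, operators.act, MonoidalCategory.tensorHom_def]) fun N => by simp [operators.β, operators.act])
  act_add_right f g g' b := (opEquiv k c _ _).injective (by
    rw [map_add, opEquiv_act, opEquiv_act, opEquiv_act]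
    exact operators.ext (by simp [operators.φ, operators.act, MonoidalCategory.tensorHom_def]) fun N => by simp [operators.β, operators.act])
  act_smul_left r f g b := (opEquiv k c _ _).injective (by
    rw [map_smul, opEquiv_act, opEquiv_act]
    exact operators.ext (by simp [operators.φ, operators.act, MonoidalCategory.tensorHom_def]) fun N => by simp [operators.β, operators.act])
  act_smul_right r f g b := (opEquiv k c _ _).injective (by
    rw [map_smul, opEquiv_act, opEquiv_act]
    exact operators.ext (by simp [operators.φ, operators.act, MonoidalCategory.tensorHom_def]) fun N => by simp [operators.β, operators.act])

variable (k c)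

/-- The underlying map `x ⊗ y ⟶ 𝟙` of an operator. -/
noncomputable def opAug : Aug (opPsh k c) where
  app x y := LinearMap.fst k _ _ ∘ₗ (operators k c x y).subtype ∘ₗ (opEquiv k c x y).toLinearMap
  naturality f g b := congrArg operators.φ (opEquiv_act f g b)

variable {k c}

lemma opAug_isMul : (opAug k c).IsMul (opMul k c) where
  map_one := congrArg operators.φ opEquiv_one
  map_mul b b' := congrArg operators.φ (opEquiv_mul b b')

end OperatorPresheaf
end HarishChandra

namespace HarishChandra

/-! ### Operators glue along colimits in each variable -/

section OperatorContinuity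
variable {k : Type w} [Field k] {H : Type u'} [Category.{w} H] [Preadditive H] [Linear k H]
  [MonoidalCategory H] [MonoidalPreadditive H] [MonoidalLinear k H] [TensorCocontinuous H]
  {T : H ⥤ H} [T.LaxMonoidal] [PreservesColimitsOfSize.{w, w} T] {c : MonoidalCounit T}
  {J : Type w} [Category.{w} J] {K : J ⥤ H} {d : Cocone K}

namespace operators

/-- Operators glue along colimits in the second variable. -/
lemma existsUnique_right (hd : IsColimit d) (x : H) (b : ∀ j, operators k c x (K.obj j))
    (hb : ∀ {j j'} (f : j ⟶ j'), act (𝟙 x) (K.map f) (b j') = b j) :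
    ∃! m : operators k c x d.pt, ∀ j, act (𝟙 x) (d.ι.app j) m = b j := by
  have (X : H) := TensorCocontinuous.left X
  have (X : H) := TensorCocontinuous.right X
  have hφ {j j'} (f : j ⟶ j') : x ◁ K.map f ≫ φ (b j') = φ (b j) := by
    have h := congrArg φ (hb f)
    rwa [φ_act, id_tensorHom] at h
  have hβ {j j'} (f : j ⟶ j') (N : H) : x ◁ T.map (K.map f ▷ N) ≫ β (b j') N = β (b j) N := by
    have h := congrArg (β · N) (hb f)
    simpa only [β_act, id_whiskerRight, Category.id_comp] using h
  obtain ⟨ψ, hψ⟩ := exists_map_cocone_desc (tensorLeft x) hd (fun j => φ (b j)) hφ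
  -- For each `N` separately, `x ⊗ T (- ⊗ N)` preserves the colimit, so the components glue; that
  -- the glued family is an operator is checked on the legs by `IsOperator.of_act`.
  choose χ hχ using fun N => exists_map_cocone_desc (tensorRight N ⋙ T ⋙ tensorLeft x) hd
    (fun j => β (b j) N) (fun f => hβ f N)
  have hψ' (j : J) : (𝟙 x ⊗ₘ d.ι.app j) ≫ ψ = φ (b j) := by
    rw [id_tensorHom]
    exact hψ j
  have hχ' (j : J) : (fun N => 𝟙 x ▷ T.obj (K.obj j ⊗ N) ≫ x ◁ T.map (d.ι.app j ▷ N) ≫ χ N) =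
      β (b j) := by
    refine funext fun N => ?_
    rw [id_whiskerRight, Category.id_comp]
    exact hχ N j
  have h : IsOperator c ψ χ := by
    refine IsOperator.of_act (fun _ => 𝟙 x) d.ι.app (fun N Z _ p q hpq => ?_) fun j => ?_
    · refine map_cocone_hom_ext (tensorRight N ⋙ T ⋙ tensorLeft x ⋙ tensorRight Z) hd
        fun j => ?_
      have h1 := hpq j
      rwa [id_whiskerRight, Category.id_comp] at h1
    · rw [hψ', hχ']
      exact isOperator (b j)
  refine ⟨⟨(ψ, χ), h⟩, fun j => ext (hψ' j) (congrFun (hχ' j)), fun m hm => ext ?_ fun N => ?_⟩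
  · refine map_cocone_hom_ext (tensorLeft x) hd fun j => Eq.trans ?_ (hψ j).symm
    have h1 := congrArg φ (hm j)
    rwa [φ_act, id_tensorHom] at h1
  · refine map_cocone_hom_ext (tensorRight N ⋙ T ⋙ tensorLeft x) hd
      fun j => Eq.trans ?_ (hχ N j).symm
    have h1 := congrArg (β · N) (hm j)
    simp only [β_act, id_whiskerRight, Category.id_comp] at h1
    exact h1

/-- Operators glue along colimits in the first variable. -/
lemma existsUnique_left (hd : IsColimit d) (y : H) (b : ∀ j, operators k c (K.obj j) y)
    (hb : ∀ {j j'} (f : j ⟶ j'), act (K.map f) (𝟙 y) (b j') = b j) :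
    ∃! m : operators k c d.pt y, ∀ j, act (d.ι.app j) (𝟙 y) m = b j := by
  have (X : H) := TensorCocontinuous.left X
  have (X : H) := TensorCocontinuous.right X
  have key {x x' : H} (f : x ⟶ x') (N : H) {W : H} (u : x' ⊗ T.obj (y ⊗ N) ⟶ W) :
      f ▷ T.obj (y ⊗ N) ≫ x' ◁ T.map (𝟙 y ▷ N) ≫ u = f ▷ T.obj (y ⊗ N) ≫ u := by
    rw [id_whiskerRight, T.map_id, MonoidalCategory.whiskerLeft_id, Category.id_comp]
  have hφ {j j'} (f : j ⟶ j') : K.map f ▷ y ≫ φ (b j') = φ (b j) := by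
    have h := congrArg φ (hb f)
    rwa [φ_act, tensorHom_id] at h
  have hβ {j j'} (f : j ⟶ j') (N : H) : K.map f ▷ _ ≫ β (b j') N = β (b j) N :=
    (key _ _ _).symm.trans (congrArg (β · N) (hb f))
  obtain ⟨ψ, hψ⟩ := exists_map_cocone_desc (tensorRight y) hd (fun j => φ (b j)) hφ
  choose χ hχ using fun N => exists_map_cocone_desc (tensorRight (T.obj (y ⊗ N))) hd
    (fun j => β (b j) N) (fun f => hβ f N)
  have hψ' (j : J) : (d.ι.app j ⊗ₘ 𝟙 y) ≫ ψ = φ (b j) := by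
    rw [tensorHom_id]
    exact hψ j
  have hχ' (j : J) : (fun N => d.ι.app j ▷ T.obj (y ⊗ N) ≫ d.pt ◁ T.map (𝟙 y ▷ N) ≫ χ N) =
      β (b j) :=
    funext fun N => (key _ _ _).trans (hχ N j)
  have h : IsOperator c ψ χ := by
    refine IsOperator.of_act d.ι.app (fun _ => 𝟙 y) (fun N Z _ p q hpq => ?_) fun j => ?_
    · refine map_cocone_hom_ext (tensorRight (T.obj (y ⊗ N)) ⋙ tensorRight Z) hd fun j => ?_
      have h1 := hpq j
      rwa [id_whiskerRight, T.map_id, MonoidalCategory.whiskerLeft_id, Category.comp_id] at h1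
    · rw [hψ']
      exact (hχ' j).symm ▸ isOperator (b j)
  refine ⟨⟨(ψ, χ), h⟩, fun j => ext (hψ' j) (congrFun (hχ' j)), fun m hm => ext ?_ fun N => ?_⟩
  · refine map_cocone_hom_ext (tensorRight y) hd fun j => Eq.trans ?_ (hψ j).symm
    have h1 := congrArg φ (hm j)
    rwa [φ_act, tensorHom_id] at h1
  · refine map_cocone_hom_ext (tensorRight (T.obj (y ⊗ N))) hd
      fun j => Eq.trans ?_ (hχ N j).symm
    exact (key _ _ _).symm.trans (congrArg (β · N) (hm j))

end operators

variable [∀ x y : H, Small.{w} (operators k c x y)]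

instance opPsh_continuous_row (x : H) : PreservesLimitsOfSize.{w, w} ((opPsh k c).row x) := by
  refine Psh.preservesLimitsOfSize _ fun {J} _ K d hd b hb => ?_
  have key {y y' : H} (g : y ⟶ y') (m : (opPsh k c).at x y') :
      opEquiv k c x y (((opPsh k c).row x).res g m) =
        operators.act (𝟙 x) g (opEquiv k c x y' m) := by
    rw [BiPsh.res_row, opEquiv_act]
  obtain ⟨m, hm, hm'⟩ := operators.existsUnique_right hd x (fun j => opEquiv k c x _ (b j))
    fun f => (key _ _).symm.trans (congrArg _ (hb f))
  refine ⟨(opEquiv k c x d.pt).symm m, fun j => (opEquiv k c _ _).injective ?_, fun m' h => ?_⟩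
  · exact ((key _ _).trans (congrArg _ ((opEquiv k c x d.pt).apply_symm_apply m))).trans (hm j)
  · exact ((opEquiv k c _ _).symm_apply_eq.2
      (hm' _ fun j => (key _ _).symm.trans (congrArg _ (h j))).symm).symm

instance opPsh_continuous_col (y : H) : PreservesLimitsOfSize.{w, w} ((opPsh k c).col y) := by
  refine Psh.preservesLimitsOfSize _ fun {J} _ K d hd b hb => ?_
  have key {x x' : H} (f : x ⟶ x') (m : (opPsh k c).at x' y) :
      opEquiv k c x y (((opPsh k c).col y).res f m) =
        operators.act f (𝟙 y) (opEquiv k c x' y m) := by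
    rw [BiPsh.res_col, opEquiv_act]
  obtain ⟨m, hm, hm'⟩ := operators.existsUnique_left hd y (fun j => opEquiv k c _ y (b j))
    fun f => (key _ _).symm.trans (congrArg _ (hb f))
  refine ⟨(opEquiv k c d.pt y).symm m, fun j => (opEquiv k c _ _).injective ?_, fun m' h => ?_⟩
  · exact ((key _ _).trans (congrArg _ ((opEquiv k c d.pt y).apply_symm_apply m))).trans (hm j)
  · exact ((opEquiv k c _ _).symm_apply_eq.2
      (hm' _ fun j => (key _ _).symm.trans (congrArg _ (h j))).symm).symm

end OperatorContinuity
end HarishChandra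

namespace HarishChandra

/-! ### Pullback of algebras along an oplax monoidal functor -/

section Comap
variable {k : Type w} [Field k] {A : Type u} [Category.{w} A] {A' : Type u'} [Category.{w} A']

/-- Precomposition of a functor of two contravariant variables with a functor. -/
def BiPsh.comap (F : A ⥤ A') (M : BiPsh.{w, u', v} k A') : BiPsh.{w, u, v} k A :=
  F.op ⋙ M ⋙ (Functor.whiskeringLeft _ _ _).obj F.op

variable {F : A ⥤ A'} {M : BiPsh.{w, u', v} k A'}

lemma BiPsh.IsLinear.comap [Preadditive A] [Linear k A] [Preadditive A'] [Linear k A']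
    (h : M.IsLinear) (F : A ⥤ A') [F.Additive] [F.Linear k] : (M.comap F).IsLinear where
  act_add_left {x x' y y'} f f' g m := by
    have h1 := h.act_add_left (F.map f) (F.map f') (F.map g) m
    rw [← F.map_add] at h1
    exact h1
  act_add_right {x x' y y'} f g g' m := by
    have h1 := h.act_add_right (F.map f) (F.map g) (F.map g') m
    rw [← F.map_add] at h1
    exact h1
  act_smul_left {x x' y y'} r f g m := by
    have h1 := h.act_smul_left r (F.map f) (F.map g) m
    rw [← F.map_smul] at h1
    exact h1
  act_smul_right {x x' y y'} r f g m := by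
    have h1 := h.act_smul_right r (F.map f) (F.map g) m
    rw [← F.map_smul] at h1
    exact h1

lemma BiPsh.act_act (M : BiPsh.{w, u', v} k A') {x x' x'' y y' y'' : A'} (f : x ⟶ x') (f' : x' ⟶ x'') (g : y ⟶ y')
    (g' : y' ⟶ y'') (m : M.at x'' y'') : M.act f g (M.act f' g' m) = M.act (f ≫ f') (g ≫ g') m :=
  (M.act_comp _ _ _ _ _).symm

variable [MonoidalCategory A] [MonoidalCategory A'] [F.OplaxMonoidal]

open Functor.OplaxMonoidal (δ δ_natural)

/-- Precomposition of an algebra structure with an oplax monoidal functor. -/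
def MulOne.comap (S : MulOne M) (F : A ⥤ A') [F.OplaxMonoidal] : MulOne (M.comap F) where
  mul {x y x' y'} := (S.mul (x := F.obj x) (y := F.obj y) (x' := F.obj x') (y' := F.obj y')).compr₂
    (M.act (δ F x x') (δ F y' y))
  one := M.act (Functor.OplaxMonoidal.η F) (Functor.OplaxMonoidal.η F) S.one
  mul_act {x₁ x₂ y₁ y₂ x₁' x₂' y₁' y₂'} f g f' g' m m' := by
    refine (congrArg (M.act (δ F x₁ x₁') (δ F y₁' y₁))
      (S.mul_act (F.map f) (F.map g) (F.map f') (F.map g') m m')).trans ?_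
    refine (M.act_act _ _ _ _ _).trans (Eq.trans ?_ (M.act_act _ _ _ _ _).symm)
    exact congrArg₂ (fun p q => M.act p q (S.mul m m')) (δ_natural F f f') (δ_natural F g' g)

lemma MulOne.mul_act_left (S : MulOne M) {x x' y y' z w : A'} (f : x ⟶ x') (g : y ⟶ y')
    (m : M.at x' y') (m' : M.at z w) :
    S.mul (M.act f g m) m' = M.act (f ▷ z) (w ◁ g) (S.mul m m') := by
  have h := S.mul_act f g (𝟙 z) (𝟙 w) m m'
  rwa [M.act_id, tensorHom_id, id_tensorHom] at h

lemma MulOne.mul_act_right (S : MulOne M) {x x' y y' z w : A'} (f : x ⟶ x') (g : y ⟶ y')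
    (m : M.at z w) (m' : M.at x' y') :
    S.mul m (M.act f g m') = M.act (z ◁ f) (g ▷ w) (S.mul m m') := by
  have h := S.mul_act (𝟙 z) (𝟙 w) f g m m'
  rwa [M.act_id, tensorHom_id, id_tensorHom] at h

/-- Because `M` is contravariant, products are pulled back along the maps `δ : F (x ⊗ x') ⟶ F x ⊗ F
x'`, so an oplax structure on `F` suffices; coassociativity of `δ` gives the law, in inverse form in
the second variable. -/
lemma MulOne.IsMonoid.act_mul_assoc {S : MulOne M} (hS : S.IsMonoid) {x₁ x₂ x₃ y₁ y₂ y₃ : A}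
    (a₁ : M.at (F.obj x₁) (F.obj y₁)) (a₂ : M.at (F.obj x₂) (F.obj y₂))
    (a₃ : M.at (F.obj x₃) (F.obj y₃)) :
    M.act (δ F (x₁ ⊗ x₂) x₃) (δ F y₃ (y₂ ⊗ y₁))
      (S.mul (M.act (δ F x₁ x₂) (δ F y₂ y₁) (S.mul a₁ a₂)) a₃) =
      M.act (F.map (α_ x₁ x₂ x₃).hom) (F.map (α_ y₃ y₂ y₁).inv)
        (M.act (δ F x₁ (x₂ ⊗ x₃)) (δ F (y₃ ⊗ y₂) y₁)
          (S.mul a₁ (M.act (δ F x₂ x₃) (δ F y₃ y₂) (S.mul a₂ a₃)))) := by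
  rw [S.mul_act_left, S.mul_act_right, hS.mul_assoc, M.act_act, M.act_act, M.act_act, M.act_act,
    Category.assoc, Category.assoc, Functor.OplaxMonoidal.associativity,
    Functor.OplaxMonoidal.associativity_inv]
  simp only [Category.assoc]

lemma MulOne.IsMonoid.act_one_mul {S : MulOne M} (hS : S.IsMonoid) {x y : A}
    (a : M.at (F.obj x) (F.obj y)) :
    M.act (δ F (𝟙_ A) x) (δ F y (𝟙_ A)) (S.mul (M.act (Functor.OplaxMonoidal.η F)
      (Functor.OplaxMonoidal.η F) S.one) a) = M.act (F.map (λ_ x).hom) (F.map (ρ_ y).hom) a := by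
  rw [S.mul_act_left, hS.one_mul, M.act_act, M.act_act, Category.assoc, Category.assoc,
    Functor.OplaxMonoidal.left_unitality_hom, Functor.OplaxMonoidal.right_unitality_hom]

lemma MulOne.IsMonoid.act_mul_one {S : MulOne M} (hS : S.IsMonoid) {x y : A}
    (a : M.at (F.obj x) (F.obj y)) :
    M.act (δ F x (𝟙_ A)) (δ F (𝟙_ A) y) (S.mul a (M.act (Functor.OplaxMonoidal.η F)
      (Functor.OplaxMonoidal.η F) S.one)) = M.act (F.map (ρ_ x).hom) (F.map (λ_ y).hom) a := by
  rw [S.mul_act_right, hS.mul_one, M.act_act, M.act_act, Category.assoc, Category.assoc,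
    Functor.OplaxMonoidal.left_unitality_hom, Functor.OplaxMonoidal.right_unitality_hom]

lemma MulOne.IsMonoid.comap {S : MulOne M} (hS : S.IsMonoid) (F : A ⥤ A') [F.OplaxMonoidal] :
    (S.comap F).IsMonoid where
  mul_assoc a₁ a₂ a₃ := hS.act_mul_assoc a₁ a₂ a₃
  one_mul a := hS.act_one_mul a
  mul_one a := hS.act_mul_one a

end Comap

/-! ### The action map from the free module -/

section Counit
variable {C : Type u} [Category.{w} C] [MonoidalCategory C] {L : Center C} [MonObj L]

namespace HC

/-- The action map `L ⊗ P ⟶ P` from a free module. -/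
def cu (P : HC L) : (freeFunctor L).obj P.X ⟶ P := (freeAdj L).counit.app P

lemma cu_hom (P : HC L) : (cu P).hom = lact P := freeAdj_counit P

lemma freeUnit_cu (P : HC L) : freeUnit L P.X ≫ (cu P).hom = 𝟙 P.X := by
  refine (congrArg (freeUnit L P.X ≫ ·) (cu_hom P)).trans ?_
  refine (Category.assoc (λ_ P.X).inv _ _).trans ?_
  exact (congrArg ((λ_ P.X).inv ≫ ·) (one_lact P)).trans (λ_ P.X).inv_hom_id

lemma cu_naturality {P Q : HC L} (f : P ⟶ Q) : (freeFunctor L).map f.hom ≫ cu Q = cu P ≫ f :=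
  (freeAdj L).counit.naturality f

/-- Maps out of a free module are determined by their restriction along the unit. -/
lemma freeFunctor_hom_ext {V : C} {N : HC L} {f g : (freeFunctor L).obj V ⟶ N}
    (h : freeUnit L V ≫ f.hom = freeUnit L V ≫ g.hom) : f = g :=
  free_hom_ext h

lemma freeUnit_map_comp {V W : C} {N : HC L} (f : V ⟶ W) (g : (freeFunctor L).obj W ⟶ N) :
    freeUnit L V ≫ ((freeFunctor L).map f ≫ g).hom = f ≫ freeUnit L W ≫ g.hom :=
  (comp_comp_eq (freeUnit_map f) rfl).trans (Category.assoc _ _ _)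

variable [IsCommMonObj L] [HasCoequalizers C] [TensorCocontinuous C]

open Functor.OplaxMonoidal (δ)

/-- The map `L ⟶ 1` from the free module on `L`. -/
noncomputable def cu₁ : (freeFunctor L).obj (und L) ⟶ 𝟙_ (HC L) := cu (𝟙_ (HC L))

lemma freeUnit_cu₁ : freeUnit L (und L) ≫ (cu₁ (L := L)).hom = 𝟙 (und L) :=
  freeUnit_cu (𝟙_ (HC L))

lemma freeUnit_δ_comp {V W : C} {P Q N : HC L} (f : (freeFunctor L).obj V ⟶ P)
    (g : (freeFunctor L).obj W ⟶ Q) (h : P ⊗ Q ⟶ N) :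
    freeUnit L (V ⊗ W) ≫ (δ (freeFunctor L) V W ≫ (f ⊗ₘ g) ≫ h).hom =
      ((freeUnit L V ≫ f.hom) ⊗ₘ (freeUnit L W ≫ g.hom)) ≫ proj P Q ≫ h.hom := by
  refine (comp_comp_eq (freeUnit_δ V W) rfl).trans ?_
  refine (Category.assoc _ _ _).trans ?_
  refine (congrArg ((freeUnit L V ⊗ₘ freeUnit L W) ≫ ·)
    (comp_comp_eq (proj_tensorHom f g) rfl)).trans ?_
  refine (congrArg ((freeUnit L V ⊗ₘ freeUnit L W) ≫ ·) (Category.assoc _ _ _)).trans ?_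
  exact comp_comp_eq (tensorHom_comp_tensorHom _ _ _ _) rfl

lemma map_η_cu : (freeFunctor L).map η[und L] ≫ cu₁ = Functor.OplaxMonoidal.η (freeFunctor L) := by
  refine freeFunctor_hom_ext ((freeUnit_map_comp _ _).trans ?_)
  refine (congrArg (_ ≫ ·) freeUnit_cu₁).trans ?_
  exact (Category.comp_id _).trans freeUnit_η.symm

/-- Restricted to the generating object `L ⊗ L`, both sides are the multiplication, because the left
unitor of the regular module is induced by it. This yields multiplicativity of the moment map. -/
lemma map_μ_cu : (freeFunctor L).map μ[und L] ≫ cu₁ =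
    δ (freeFunctor L) (und L) (und L) ≫ (cu₁ ⊗ₘ cu₁) ≫ (λ_ (𝟙_ (HC L))).hom := by
  refine freeFunctor_hom_ext ((freeUnit_map_comp _ _).trans ?_)
  refine (congrArg (_ ≫ ·) freeUnit_cu₁).trans ?_
  refine Eq.trans ?_ (freeUnit_δ_comp _ _ _).symm
  refine Eq.trans ?_ (congrArg (fun t => (t ⊗ₘ t) ≫ _) freeUnit_cu₁).symm
  refine (Category.comp_id _).trans (Eq.trans ?_ (congrArg (· ≫ _) (id_tensorHom_id _ _)).symm)
  exact (proj_leftUnitor (𝟙_ (HC L))).symm.trans (Category.id_comp _).symm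

/-- The counit of the adjunction is monoidal; both sides restrict to the projection on generators.
This is what makes `hcEquiv` multiplicative. -/
lemma map_proj_cu (P Q : HC L) : (freeFunctor L).map (proj P Q) ≫ cu (P ⊗ Q) =
    δ (freeFunctor L) P.X Q.X ≫ (cu P ⊗ₘ cu Q) := by
  refine freeFunctor_hom_ext ((freeUnit_map_comp _ _).trans ?_)
  refine (congrArg (_ ≫ ·) (freeUnit_cu (P ⊗ Q))).trans ((Category.comp_id _).trans ?_)
  rw [← Category.comp_id (cu P ⊗ₘ cu Q)]
  refine Eq.trans ?_ (freeUnit_δ_comp _ _ _).symm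
  rw [freeUnit_cu, freeUnit_cu, id_tensorHom_id, Category.id_comp]
  exact (Category.comp_id _).symm

variable (L) in
/-- The left action of `L` on a free module, as a map out of a free module. -/
noncomputable def freeLeft (V : C) : (freeFunctor L).obj (und L ⊗ V) ⟶ (freeFunctor L).obj V :=
  δ (freeFunctor L) (und L) V ≫ cu₁ ▷ _ ≫ (λ_ _).hom

variable (L) in
/-- The right action of `L` on a free module, as a map out of a free module. -/
noncomputable def freeRight (V : C) : (freeFunctor L).obj (V ⊗ und L) ⟶ (freeFunctor L).obj V :=
  δ (freeFunctor L) V (und L) ≫ _ ◁ cu₁ ≫ (ρ_ _).hom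

lemma freeUnit_freeLeft (V : C) : freeUnit L (und L ⊗ V) ≫ (freeLeft L V).hom = 𝟙 _ := by
  rw [freeLeft, ← tensorHom_id]
  refine (freeUnit_δ_comp _ _ _).trans ?_
  refine (congrArg (fun t => (t ⊗ₘ _) ≫ _) freeUnit_cu₁).trans ?_
  refine (congrArg₂ (· ≫ ·) ((id_tensorHom _ _).trans (congrArg (und L ◁ ·)
    (Category.comp_id (freeUnit L V)))) (proj_leftUnitor (free L V))).trans ?_
  exact freeUnit_lact V

lemma freeUnit_freeRight (V : C) :
    freeUnit L (V ⊗ und L) ≫ (freeRight L V).hom = (freeTau V).hom := by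
  rw [freeRight, ← id_tensorHom]
  refine (freeUnit_δ_comp _ _ _).trans ?_
  refine (congrArg (fun t => (_ ⊗ₘ t) ≫ _) freeUnit_cu₁).trans ?_
  refine (congrArg₂ (· ≫ ·) ((tensorHom_id _ _).trans (congrArg (· ▷ und L)
    (Category.comp_id (freeUnit L V)))) (proj_rightUnitor (free L V))).trans ?_
  exact freeUnit_ract V

/-- The right action on a free module is, as on any object of `HC`, the left action after `τ`.
Centrality of the moment map reduces to this. -/
lemma freeRight_eq (V : C) :
    freeRight L V = (freeFunctor L).map (tau L V).hom ≫ freeLeft L V := by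
  refine freeFunctor_hom_ext ((freeUnit_freeRight V).trans ?_)
  refine Eq.trans ?_ (freeUnit_map_comp _ _).symm
  exact (Category.comp_id _).symm.trans (congrArg (_ ≫ ·) (freeUnit_freeLeft V).symm)

lemma map_lact_cu (P : HC L) :
    (freeFunctor L).map (lact P) ≫ cu P = freeLeft L P.X ≫ cu P := by
  refine freeFunctor_hom_ext ((freeUnit_map_comp _ _).trans ?_)
  refine (congrArg (_ ≫ ·) (freeUnit_cu P)).trans ((Category.comp_id _).trans ?_)
  refine Eq.trans ?_ (comp_comp_eq (freeUnit_freeLeft P.X) rfl).symm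
  exact (cu_hom P).symm.trans (Category.id_comp _).symm

lemma map_ract_cu (P : HC L) :
    (freeFunctor L).map (ract P) ≫ cu P = freeRight L P.X ≫ cu P := by
  rw [freeRight_eq, Category.assoc, ← map_lact_cu, ← Category.assoc, ← Functor.map_comp, ract]

lemma map_freeUnit_freeLeft (V : C) :
    (freeFunctor L).map (freeUnit L V) ≫ freeLeft L V = 𝟙 _ := by
  refine freeFunctor_hom_ext ((freeUnit_map_comp _ _).trans ?_)
  exact congrArg (_ ≫ ·) (freeUnit_freeLeft V)

instance (P : HC L) : Epi (cu P) where
  left_cancellation f g h := Mod.hom_ext _ _ (by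
    have h1 : (cu P).hom ≫ f.hom = (cu P).hom ≫ g.hom := congrArg Mod.Hom.hom h
    have h2 {N : HC L} (f : P ⟶ N) : freeUnit L P.X ≫ (cu P).hom ≫ f.hom = f.hom :=
      comp_comp_eq (freeUnit_cu P) (Category.id_comp _)
    exact (h2 f).symm.trans ((congrArg (freeUnit L P.X ≫ ·) h1).trans (h2 g)))

/-- The map `L ⊗ P ⟶ P` is a coequalizer. -/
lemma exists_cu_desc {P N : HC L} (q : (freeFunctor L).obj P.X ⟶ N)
    (h : (freeFunctor L).map (lact P) ≫ q = freeLeft L P.X ≫ q) : ∃ d : P ⟶ N, cu P ≫ d = q := by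
  have h1 : lact P ≫ freeUnit L P.X ≫ q.hom = q.hom := by
    refine (freeUnit_map_comp (lact P) q).symm.trans ((congrArg (fun t => _ ≫ t.hom) h).trans ?_)
    exact comp_comp_eq (freeUnit_freeLeft P.X) (Category.id_comp _)
  -- The unit of the free module splits the fork in `C`, so the descended map can only be `q`
  -- restricted along it; what needs proof is that it is linear.
  refine ⟨mkHom (freeUnit L P.X ≫ q.hom) ?_, freeFunctor_hom_ext ?_⟩
  · refine h1.trans ((comp_comp_eq (freeUnit_lact P.X) (Category.id_comp _)).symm.trans ?_)
    refine (congrArg (und L ◁ freeUnit L P.X ≫ ·) (hom_lact q)).trans ?_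
    exact (whiskerLeft_comp_assoc _ _ _ _).symm
  · exact comp_comp_eq (freeUnit_cu P) (Category.id_comp _)

end HC
end Counit
end HarishChandra

namespace HarishChandra

section HeisenbergNaturality
variable {C : Type u} [Category.{w} C] [MonoidalCategory C] (L : Center C) [MonObj L]

lemma heisenbergMul_comp {x₁ x₂ y₁ y₂ x₁' x₂' y₁' y₂' : C} (f : x₁ ⟶ x₂) (g : y₁ ⟶ y₂)
    (f' : x₁' ⟶ x₂') (g' : y₁' ⟶ y₂') (φ : x₂ ⊗ y₂ ⟶ und L) (φ' : x₂' ⊗ y₂' ⟶ und L) :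
    heisenbergMul L ((f ⊗ₘ g) ≫ φ) ((f' ⊗ₘ g') ≫ φ') =
      ((f ⊗ₘ f') ⊗ₘ (g' ⊗ₘ g)) ≫ heisenbergMul L φ φ' := by
  have h₁ : (tau L x₁).hom ▷ y₁ ≫ (α_ (und L) x₁ y₁).hom ≫ und L ◁ ((f ⊗ₘ g) ≫ φ) =
      f ▷ und L ▷ y₁ ≫ (x₂ ⊗ und L) ◁ g ≫ (tau L x₂).hom ▷ y₂ ≫ (α_ (und L) x₂ y₂).hom ≫
        und L ◁ φ := by
    rw [whisker_exchange_assoc, ← comp_whiskerRight_assoc, tau_naturality,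
      MonoidalCategory.tensorHom_def]
    simp
  have h₂ : (α_ x₁' y₁' y₁).inv ≫ ((f' ⊗ₘ g') ≫ φ') ▷ y₁ ≫ und L ◁ g =
      f' ▷ (y₁' ⊗ y₁) ≫ x₂' ◁ (g' ▷ y₁ ≫ y₂' ◁ g) ≫ (α_ x₂' y₂' y₂).inv ≫ φ' ▷ y₂ := by
    rw [comp_whiskerRight, Category.assoc, ← whisker_exchange, MonoidalCategory.tensorHom_def]
    monoidal
  have h₃ : x₁ ◁ ((α_ x₁' y₁' y₁).inv ≫ ((f' ⊗ₘ g') ≫ φ') ▷ y₁) ≫ (α_ x₁ (und L) y₁).inv ≫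
      f ▷ und L ▷ y₁ ≫ (x₂ ⊗ und L) ◁ g =
      f ▷ (x₁' ⊗ y₁' ⊗ y₁) ≫ x₂ ◁ (f' ▷ (y₁' ⊗ y₁) ≫ x₂' ◁ (g' ▷ y₁ ≫ y₂' ◁ g) ≫
        (α_ x₂' y₂' y₂).inv ≫ φ' ▷ y₂) ≫ (α_ x₂ (und L) y₂).inv := by
    rw [← h₂, ← whisker_exchange_assoc, ← whisker_exchange]
    simp
  rw [heisenbergMul, heisenbergMul, reassoc_of% h₁, reassoc_of% h₃,
    MonoidalCategory.tensorHom_def (f ⊗ₘ f'), MonoidalCategory.tensorHom_def g' g,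
    MonoidalCategory.tensorHom_def f f']
  monoidal

end HeisenbergNaturality

/-! ### The algebra in `C ⊗ C^{⊗op}` underlying an algebra over `HC` -/

section FreeAlgebra
variable {k : Type w} [Field k] {C : Type u} [Category.{w} C] [Preadditive C] [Linear k C]
  [MonoidalCategory C] [MonoidalPreadditive C] [MonoidalLinear k C] [HasCoequalizers C]
  [TensorCocontinuous C] {L : Center C} [MonObj L] [IsCommMonObj L]

open HC
open Functor.OplaxMonoidal (δ)

instance : (freeFunctor L).Additive where
  map_add {_ _ f g} := freeFunctor_hom_ext ((freeUnit_map _).trans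
    ((Preadditive.add_comp _ _ _ f g _).trans
      ((congrArg₂ (· + ·) (freeUnit_map f).symm (freeUnit_map g).symm).trans
        (Preadditive.comp_add _ _ _ (freeUnit L _) _ _).symm)))

instance : (freeFunctor L).Linear k where
  map_smul f r := freeFunctor_hom_ext ((freeUnit_map _).trans
    ((Linear.smul_comp _ _ _ r f _).trans ((congrArg (r • ·) (freeUnit_map f).symm).trans
      (Linear.comp_smul _ _ _ (freeUnit L _) r _).symm)))

instance : PreservesColimitsOfSize.{w, w} (freeFunctor L) :=
  (freeAdj L).leftAdjoint_preservesColimits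

variable {M : BiPsh.{w, max u w, w} k (HC L)} (hM : M.IsLinear)
  [∀ P, PreservesLimitsOfSize.{w, w} (M.row P)] [∀ Q, PreservesLimitsOfSize.{w, w} (M.col Q)]
  {S : MulOne M} (hS : S.IsMonoid) {ε : Aug M} (hε : ε.IsMul S)

instance (F : C ⥤ HC L) [PreservesColimitsOfSize.{w, w} F] (x : C) :
    PreservesLimitsOfSize.{w, w} ((M.comap F).row x) :=
  have := preservesLimitsOfSize_op.{w, w} F
  inferInstanceAs (PreservesLimitsOfSize.{w, w} (F.op ⋙ M.row (F.obj x)))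

instance (F : C ⥤ HC L) [PreservesColimitsOfSize.{w, w} F] (y : C) :
    PreservesLimitsOfSize.{w, w} ((M.comap F).col y) :=
  have := preservesLimitsOfSize_op.{w, w} F
  inferInstanceAs (PreservesLimitsOfSize.{w, w} (F.op ⋙ M.col (F.obj y)))

/-- The algebra in `C ⊗ C^{⊗op}` underlying an algebra in `HC ⊗ HC^{⊗op}`. -/
noncomputable def freeBiAlgebra : BiAlgebra k C where
  A := M.comap (freeFunctor L)
  linear := hM.comap (freeFunctor L)
  continuous_row _ := inferInstance
  continuous_col _ := inferInstance
  S := S.comap (freeFunctor L)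
  mul_assoc := (hS.comap (freeFunctor L)).mul_assoc
  one_mul := (hS.comap (freeFunctor L)).one_mul
  mul_one := (hS.comap (freeFunctor L)).mul_one

variable (S) in
/-- The image of the unit under `L ⊠ L ⟶ 1 ⊠ 1`. -/
noncomputable def freeσ : M.at ((freeFunctor L).obj (und L)) ((freeFunctor L).obj (und L)) :=
  M.act cu₁ cu₁ S.one

/-- The element `freeσ` is pulled back from the unit of `M`. By the unit law, multiplication by it
is precomposition with the actions of `L` on free modules, so linearity over the moment map becomes
a condition on restrictions of `a`. -/
lemma act_mul_freeσ_left (hS : S.IsMonoid) {x y : C} (a : M.at ((freeFunctor L).obj x) ((freeFunctor L).obj y)) :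
    M.act (δ (freeFunctor L) (und L) x) (δ (freeFunctor L) y (und L)) (S.mul (freeσ S) a) =
      M.act (freeLeft L x) (freeRight L y) a := by
  rw [freeσ, S.mul_act_left, hS.one_mul, M.act_act, M.act_act, Category.assoc, Category.assoc]
  rfl

lemma act_mul_freeσ_right (hS : S.IsMonoid) {x y : C} (a : M.at ((freeFunctor L).obj x) ((freeFunctor L).obj y)) :
    M.act (δ (freeFunctor L) x (und L)) (δ (freeFunctor L) (und L) y) (S.mul a (freeσ S)) =
      M.act (freeRight L x) (freeLeft L y) a := by
  rw [freeσ, S.mul_act_right, hS.mul_one, M.act_act, M.act_act, Category.assoc, Category.assoc]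
  rfl

lemma act_mul_freeσ_freeσ (hS : S.IsMonoid) :
    M.act ((freeFunctor L).map μ[und L]) ((freeFunctor L).map μ[und L]) (freeσ S) =
      M.act (δ (freeFunctor L) (und L) (und L)) (δ (freeFunctor L) (und L) (und L))
        (S.mul (freeσ S) (freeσ S)) := by
  rw [freeσ, M.act_act, map_μ_cu, S.mul_act, hS.one_mul, M.act_act, M.act_act]
  simp only [Category.assoc, unitors_equal]

lemma act_freeσ_central (hS : S.IsMonoid) {x y : C} (a : M.at ((freeFunctor L).obj x) ((freeFunctor L).obj y)) :
    M.act (δ (freeFunctor L) x (und L)) (δ (freeFunctor L) (und L) y) (S.mul a (freeσ S)) =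
      M.act ((freeFunctor L).map (tau L x).hom) ((freeFunctor L).map (tau L y).inv)
        (M.act (δ (freeFunctor L) (und L) x) (δ (freeFunctor L) y (und L)) (S.mul (freeσ S) a)) := by
  rw [act_mul_freeσ_left hS, act_mul_freeσ_right hS, M.act_act, ← freeRight_eq, freeRight_eq y,
    ← Category.assoc, ← Functor.map_comp, Iso.inv_hom_id, CategoryTheory.Functor.map_id, Category.id_comp]

/-- The quantum moment map of the algebra underlying an algebra in `HC ⊗ HC^{⊗op}`. -/
noncomputable def freeMoment : QuantumMomentMap L (freeBiAlgebra hM hS) where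
  σ := freeσ S
  map_one := by
    refine (M.act_act ((freeFunctor L).map η[und L]) cu₁ ((freeFunctor L).map η[und L]) cu₁
      S.one).trans ?_
    rw [map_η_cu]
    rfl
  map_mul := act_mul_freeσ_freeσ hS
  central a := act_freeσ_central hS a

variable (ε) in
/-- The map `x ⊗ y ⟶ L` given by an augmentation. -/
noncomputable def freeAug (x y : C) :
    M.at ((freeFunctor L).obj x) ((freeFunctor L).obj y) →ₗ[k] (x ⊗ y ⟶ und L) where
  toFun a := (freeUnit L x ⊗ₘ freeUnit L y) ≫ proj (free L x) (free L y) ≫ (ε.app _ _ a).hom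
  map_add' a b := by
    refine (congrArg (fun t => (freeUnit L x ⊗ₘ freeUnit L y) ≫ proj _ _ ≫ Mod.Hom.hom t)
      (map_add (ε.app _ _) a b)).trans ?_
    exact (congrArg ((freeUnit L x ⊗ₘ freeUnit L y) ≫ ·) (Preadditive.comp_add _ _ _
      (proj (free L x) (free L y)) _ _)).trans (Preadditive.comp_add _ _ _ _ _ _)
  map_smul' r a := by
    refine (congrArg (fun t => (freeUnit L x ⊗ₘ freeUnit L y) ≫ proj _ _ ≫ Mod.Hom.hom t)
      (map_smul (ε.app _ _) r a)).trans ?_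
    exact (congrArg ((freeUnit L x ⊗ₘ freeUnit L y) ≫ ·) (Linear.comp_smul _ _ _
      (proj (free L x) (free L y)) r _)).trans (Linear.comp_smul _ _ _ _ r _)

variable (ε) in
lemma freeAug_act {x y : C} {P Q : HC L} (f : (freeFunctor L).obj x ⟶ P)
    (g : (freeFunctor L).obj y ⟶ Q) (b : M.at P Q) :
    freeAug ε x y (M.act f g b) = ((freeUnit L x ≫ f.hom) ⊗ₘ (freeUnit L y ≫ g.hom)) ≫
      proj P Q ≫ (ε.app P Q b).hom := by
  refine (congrArg (fun t => (freeUnit L x ⊗ₘ freeUnit L y) ≫ proj _ _ ≫ Mod.Hom.hom t)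
    (ε.naturality f g b)).trans ?_
  refine (congrArg ((freeUnit L x ⊗ₘ freeUnit L y) ≫ ·)
    ((comp_comp_eq (proj_tensorHom f g) rfl).trans (Category.assoc _ _ _))).trans ?_
  exact comp_comp_eq (tensorHom_comp_tensorHom _ _ _ _) rfl

lemma freeAug_one (hε : ε.IsMul S) : freeAug ε (𝟙_ C) (𝟙_ C) (M.act (Functor.OplaxMonoidal.η (freeFunctor L))
    (Functor.OplaxMonoidal.η (freeFunctor L)) S.one) = (λ_ (𝟙_ C)).hom ≫ η[und L] := by
  refine (freeAug_act ε _ _ _).trans ?_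
  refine (congrArg₂ (fun t t' => (t ⊗ₘ t) ≫ _ ≫ Mod.Hom.hom t') freeUnit_η hε.map_one).trans ?_
  refine (congrArg (_ ≫ ·) (proj_leftUnitor (𝟙_ (HC L)))).trans ?_
  have h : (η[und L] ⊗ₘ η[und L]) ≫ μ[und L] = (λ_ (𝟙_ C)).hom ≫ η[und L] := by
    rw [MonoidalCategory.tensorHom_def', Category.assoc, MonObj.one_mul, leftUnitor_naturality]
  exact h

lemma freeAug_freeσ (hε : ε.IsMul S) : freeAug ε (und L) (und L) (freeσ S) = μ[und L] := by
  refine (freeAug_act ε _ _ _).trans ?_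
  refine (congrArg₂ (fun t t' => (t ⊗ₘ t) ≫ _ ≫ Mod.Hom.hom t') freeUnit_cu₁ hε.map_one).trans ?_
  refine (congrArg (· ≫ _) (id_tensorHom_id _ _)).trans ((Category.id_comp _).trans ?_)
  exact proj_leftUnitor (𝟙_ (HC L))

/-- Multiplicativity of `ε` gives nested evaluations over `L`; on representatives these are the
product of `D` by `HC.proj_nestEval`, and naturality of that product restricts them to generators.
-/
lemma freeAug_mul (hε : ε.IsMul S) {x y x' y' : C} (a : M.at ((freeFunctor L).obj x) ((freeFunctor L).obj y))
    (a' : M.at ((freeFunctor L).obj x') ((freeFunctor L).obj y')) :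
    freeAug ε (x ⊗ x') (y' ⊗ y) (M.act (δ (freeFunctor L) x x') (δ (freeFunctor L) y' y)
      (S.mul a a')) = heisenbergMul L (freeAug ε x y a) (freeAug ε x' y' a') := by
  refine (freeAug_act ε _ _ _).trans ?_
  refine (congrArg (_ ≫ _ ≫ Mod.Hom.hom ·) (hε.map_mul a a')).trans ?_
  refine (congrArg₂ (fun t t' => (t ⊗ₘ t') ≫ _) (freeUnit_δ x x') (freeUnit_δ y' y)).trans ?_
  refine Eq.trans ?_ (heisenbergMul_comp L _ _ _ _ _ _).symm
  refine (congrArg (· ≫ _) (tensorHom_comp_tensorHom _ _ _ _).symm).trans ?_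
  exact (Category.assoc _ _ _).trans (congrArg (_ ≫ ·) (HC.proj_nestEval _ _))

/-- The map to the Heisenberg algebra given by an augmentation. -/
noncomputable def freeHeisenberg : HeisenbergMap L (freeBiAlgebra hM hS) (freeMoment hM hS) where
  app := freeAug ε
  naturality f g a := by
    refine (freeAug_act ε _ _ _).trans ?_
    refine (congrArg₂ (fun t t' => (t ⊗ₘ t') ≫ _) (freeUnit_map f) (freeUnit_map g)).trans ?_
    exact (congrArg (· ≫ _) (tensorHom_comp_tensorHom _ _ _ _).symm).trans (Category.assoc _ _ _)
  map_one := freeAug_one hε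
  map_mul a a' := freeAug_mul hε a a'
  map_moment := freeAug_freeσ hε

end FreeAlgebra
end HarishChandra

namespace HarishChandra

/-! ### Recovering an algebra over `HC` from its values on free modules -/

section FreeAlgebra
variable {k : Type w} [Field k] {C : Type u} [Category.{w} C] [Preadditive C] [Linear k C]
  [MonoidalCategory C] [MonoidalPreadditive C] [MonoidalLinear k C] [HasCoequalizers C]
  [TensorCocontinuous C] {L : Center C} [MonObj L] [IsCommMonObj L]

open HC
open Functor.OplaxMonoidal (δ)

variable {M : BiPsh.{w, max u w, w} k (HC L)} (hM : M.IsLinear)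
  [∀ P, PreservesLimitsOfSize.{w, w} (M.row P)] [∀ Q, PreservesLimitsOfSize.{w, w} (M.col Q)]
  {S : MulOne M} (hS : S.IsMonoid) {ε : Aug M} (hε : ε.IsMul S)

variable (M) in
lemma act_cu_injective (P Q : HC L) : Function.Injective (M.act (cu P) (cu Q)) :=
  (Psh.res_injective (M.row ((freeFunctor L).obj P.X)) (cu Q)).comp
    (Psh.res_injective (M.col Q) (cu P))

lemma exists_act_cu_left [HasCoequalizers (HC L)] {P Q : HC L}
    {b : M.at ((freeFunctor L).obj P.X) Q}
    (h : M.act ((freeFunctor L).map (lact P)) (𝟙 _) b = M.act (freeLeft L P.X) (𝟙 _) b) :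
    ∃ a : M.at P Q, M.act (cu P) (𝟙 _) a = b := by
  rw [← BiPsh.res_col, ← BiPsh.res_col] at h
  obtain ⟨c, hc⟩ := Psh.exists_lift (M.col Q) _ _ b h
  obtain ⟨d, hd⟩ := exists_cu_desc _ (coequalizer.condition ((freeFunctor L).map (lact P))
    (freeLeft L P.X))
  refine ⟨(M.col Q).res d c, ?_⟩
  refine (BiPsh.res_col M (cu P) _).symm.trans ?_
  rw [← Psh.res_comp, hd]
  exact hc

lemma exists_act_cu_right [HasCoequalizers (HC L)] {P Q : HC L}
    {b : M.at P ((freeFunctor L).obj Q.X)}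
    (h : M.act (𝟙 _) ((freeFunctor L).map (lact Q)) b = M.act (𝟙 _) (freeLeft L Q.X) b) :
    ∃ a : M.at P Q, M.act (𝟙 _) (cu Q) a = b := by
  rw [← BiPsh.res_row, ← BiPsh.res_row] at h
  obtain ⟨c, hc⟩ := Psh.exists_lift (M.row P) _ _ b h
  obtain ⟨d, hd⟩ := exists_cu_desc _ (coequalizer.condition ((freeFunctor L).map (lact Q))
    (freeLeft L Q.X))
  refine ⟨(M.row P).res d c, ?_⟩
  refine (BiPsh.res_row M (cu Q) _).symm.trans ?_
  rw [← Psh.res_comp, hd]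
  exact hc

variable (L) in
/-- The map `V ⟶ L ⊗ V` given by the unit of `L`. -/
def HC.insertUnit (V : C) : V ⟶ und L ⊗ V := (λ_ V).inv ≫ η[und L] ▷ V

lemma HC.map_insertUnit_freeLeft (V : C) :
    (freeFunctor L).map (insertUnit L V) ≫ freeLeft L V = 𝟙 _ :=
  map_freeUnit_freeLeft V

lemma HC.map_insertUnit_lact (P : HC L) :
    (freeFunctor L).map (insertUnit L P.X) ≫ (freeFunctor L).map (lact P) = 𝟙 _ := by
  rw [← Functor.map_comp, insertUnit, Category.assoc, one_lact, Iso.inv_hom_id,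
    CategoryTheory.Functor.map_id]

lemma act_cu_condition (P Q : HC L) (a : M.at P Q) :
    M.act ((freeFunctor L).map (lact P)) ((freeFunctor L).map (ract Q)) (M.act (cu P) (cu Q) a) =
      M.act (freeLeft L P.X) (freeRight L Q.X) (M.act (cu P) (cu Q) a) := by
  rw [M.act_act, M.act_act, map_lact_cu, map_ract_cu]

/-- In each variable `cu` is a coequalizer of the two maps `L ⊗ (L ⊗ P) ⟶ L ⊗ P`, and `M` turns it
into an equalizer. The hypothesis is the fork condition in both variables at once; inserting the
unit of `L` in one variable isolates the condition in the other. -/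
lemma exists_act_cu [HasCoequalizers (HC L)] {P Q : HC L}
    {b : M.at ((freeFunctor L).obj P.X) ((freeFunctor L).obj Q.X)}
    (h : M.act ((freeFunctor L).map (lact P)) ((freeFunctor L).map (ract Q)) b =
      M.act (freeLeft L P.X) (freeRight L Q.X) b) :
    ∃ a : M.at P Q, M.act (cu P) (cu Q) a = b := by
  -- The inverse of `τ` exchanges the right actions in the second variable for left actions.
  have h' : M.act ((freeFunctor L).map (lact P)) ((freeFunctor L).map (lact Q)) b =
      M.act (freeLeft L P.X) (freeLeft L Q.X) b := by
    have h1 := congrArg (M.act (𝟙 _) ((freeFunctor L).map (tau L Q.X).inv)) h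
    rw [M.act_act, M.act_act, freeRight_eq, ← Category.assoc, ← Functor.map_comp,
      ← Functor.map_comp, Iso.inv_hom_id, CategoryTheory.Functor.map_id, Category.id_comp,
      Category.id_comp, Category.id_comp, ract, Iso.inv_hom_id_assoc] at h1
    exact h1
  have h₁ : M.act ((freeFunctor L).map (lact P)) (𝟙 _) b = M.act (freeLeft L P.X) (𝟙 _) b := by
    have h1 := congrArg (M.act (𝟙 _) ((freeFunctor L).map (insertUnit L Q.X))) h'
    rw [M.act_act, M.act_act, map_insertUnit_freeLeft, map_insertUnit_lact, Category.id_comp,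
      Category.id_comp] at h1
    exact h1
  have h₂ : M.act (𝟙 _) ((freeFunctor L).map (lact Q)) b = M.act (𝟙 _) (freeLeft L Q.X) b := by
    have h1 := congrArg (M.act ((freeFunctor L).map (insertUnit L P.X)) (𝟙 _)) h'
    rw [M.act_act, M.act_act, map_insertUnit_freeLeft, map_insertUnit_lact, Category.id_comp,
      Category.id_comp] at h1
    exact h1
  obtain ⟨a, rfl⟩ := exists_act_cu_left h₁
  have h₃ : M.act (𝟙 _) ((freeFunctor L).map (lact Q)) a = M.act (𝟙 _) (freeLeft L Q.X) a := by
    refine Psh.res_injective (M.col _) (cu P) ?_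
    refine (BiPsh.res_col M (cu P) _).trans (Eq.trans ?_ (BiPsh.res_col M (cu P) _).symm)
    rw [M.act_act, M.act_act] at h₂ ⊢
    simpa only [Category.id_comp, Category.comp_id] using h₂
  obtain ⟨a, rfl⟩ := exists_act_cu_right h₃
  refine ⟨a, ?_⟩
  rw [M.act_act, Category.comp_id, Category.id_comp]

lemma act_cu_mem {P Q : HC L} (a : M.at P Q) :
    M.act (cu P) (cu Q) a ∈ (freeMoment hM hS).linearMaps P Q :=
  (act_cu_condition P Q a).trans (act_mul_freeσ_left hS _).symm

/-- An algebra in `HC ⊗ HC^{⊗op}` is recovered from the underlying algebra with a quantum moment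
map. -/
noncomputable def hcEquiv [HasCoequalizers (HC L)] (P Q : HC L) :
    M.at P Q ≃ₗ[k] (freeMoment hM hS).hcPsh.at P Q :=
  LinearEquiv.ofBijective ((M.act (cu P) (cu Q)).codRestrict ((freeMoment hM hS).linearMaps P Q)
    (act_cu_mem hM hS)) ⟨fun _ _ h => act_cu_injective M P Q (congrArg Subtype.val h), fun b => by
      obtain ⟨a, ha⟩ := exists_act_cu (b.2.trans (act_mul_freeσ_left hS b.1))
      exact ⟨a, Subtype.ext ha⟩⟩

variable [HasCoequalizers (HC L)]

lemma hcEquiv_act {P P' Q Q' : HC L} (f : P ⟶ P') (g : Q ⟶ Q') (a : M.at P' Q') :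
    hcEquiv hM hS P Q (M.act f g a) =
      (freeMoment hM hS).hcPsh.act f g (hcEquiv hM hS P' Q' a) := by
  refine Eq.trans (Subtype.ext ?_) (QuantumMomentMap.hcPsh_act f g _).symm
  refine (M.act_act _ _ _ _ _).trans (Eq.trans ?_ (M.act_act _ _ _ _ _).symm)
  exact congrArg₂ (fun p q => M.act p q a) (cu_naturality f).symm (cu_naturality g).symm

lemma hcEquiv_one : hcEquiv hM hS (𝟙_ (HC L)) (𝟙_ (HC L)) S.one =
    (freeMoment hM hS).hcMulOne.one :=
  Subtype.ext rfl

/-- The product in `hcMulOne` is characterized by its restriction along the projections, where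
`map_proj_cu` turns it into the product pulled back along `δ`. -/
lemma hcEquiv_mul {P P' Q Q' : HC L} (a : M.at P Q) (a' : M.at P' Q') :
    hcEquiv hM hS (P ⊗ P') (Q' ⊗ Q) (S.mul a a') =
      (freeMoment hM hS).hcMulOne.mul (hcEquiv hM hS P Q a) (hcEquiv hM hS P' Q' a') := by
  refine Subtype.ext (QuantumMomentMap.ext_proj ?_)
  refine Eq.trans ?_ (QuantumMomentMap.act_hcMul (m := freeMoment hM hS) _ _).symm
  have h := congrArg (M.act (δ (freeFunctor L) P.X P'.X) (δ (freeFunctor L) Q'.X Q.X))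
    (S.mul_act (cu P) (cu Q) (cu P') (cu Q') a a')
  rw [M.act_act, ← map_proj_cu, ← map_proj_cu] at h
  exact (M.act_act _ _ _ _ _).trans h.symm

lemma hcAug_hcEquiv {P Q : HC L} (a : M.at P Q) :
    (freeHeisenberg hM hS hε).hcAug.app P Q (hcEquiv hM hS P Q a) = ε.app P Q a := by
  refine HeisenbergMap.hc_hom_ext ?_
  refine (HeisenbergMap.proj_hcApp _ _).trans ?_
  refine (freeAug_act ε _ _ _).trans ?_
  rw [freeUnit_cu, freeUnit_cu, id_tensorHom_id, Category.id_comp]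

end FreeAlgebra
end HarishChandra

namespace HarishChandra

/-! ### Evaluating operators at coevaluations -/

section OperatorEvaluation
variable {k : Type w} [Field k] {H : Type u'} [Category.{w} H] [Preadditive H] [Linear k H]
  [MonoidalCategory H] [MonoidalPreadditive H] [MonoidalLinear k H]
  {T : H ⥤ H} [T.LaxMonoidal] {c : MonoidalCounit T}

namespace operators

/-- The map `x ⟶ T w` given by an operator `x ⊗ T (z ⊗ N) ⟶ T N` and a map `𝟙 ⟶ z ⊗ w`. -/
def evalMap {x z w : H} (b : operators k c x z) (e : 𝟙_ H ⟶ z ⊗ w) : x ⟶ T.obj w :=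
  (ρ_ x).inv ≫ x ◁ (Functor.LaxMonoidal.ε T ≫ T.map e) ≫ β b w

lemma evalMap_act {x x' z z' w : H} (f : x ⟶ x') (g : z ⟶ z') (b : operators k c x' z')
    (e : 𝟙_ H ⟶ z ⊗ w) : evalMap (act f g b) e = f ≫ evalMap b (e ≫ g ▷ w) := by
  rw [evalMap, evalMap, β_act, whisker_exchange_assoc, ← rightUnitor_inv_naturality_assoc,
    ← whiskerLeft_comp_assoc, T.map_comp, Category.assoc]

lemma evalMap_comp {x z w w' : H} (b : operators k c x z) (e : 𝟙_ H ⟶ z ⊗ w) (h : w ⟶ w') :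
    evalMap b (e ≫ z ◁ h) = evalMap b e ≫ T.map h := by
  rw [evalMap, evalMap, T.map_comp, Category.assoc, Category.assoc, ← (isOperator b).naturality,
    ← whiskerLeft_comp_assoc, Category.assoc]

lemma evalMap_counit {x z w : H} (b : operators k c x z) (e : 𝟙_ H ⟶ z ⊗ w) :
    evalMap b e ≫ c.app w = contractLeft e (φ b) := by
  have h : (Functor.LaxMonoidal.ε T ≫ T.map e) ≫ c.app (z ⊗ w) = e := by
    rw [Category.assoc, c.naturality, ← Category.assoc, c.unit, Category.id_comp]
  rw [evalMap, Category.assoc, Category.assoc, (isOperator b).counit, ← whiskerLeft_comp_assoc, h,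
    contractLeft]

lemma evalMap_one : evalMap (one k c) (λ_ (𝟙_ H)).inv = Functor.LaxMonoidal.ε T := by
  rw [evalMap, β_one, leftUnitor_naturality_assoc, Category.assoc, ← T.map_comp, Iso.inv_hom_id,
    T.map_id, Category.comp_id, unitors_equal, Iso.inv_hom_id_assoc]

/-- The operator is linear over `T`, so multiplying its value at `e` by `T N` is applying it at `w ⊗
N`. Thus the single map `evalMap b e` knows the operator on everything created by `e`. -/
lemma evalMap_whiskerRight_μ {x z w : H} (b : operators k c x z) (e : 𝟙_ H ⟶ z ⊗ w) (N : H) :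
    evalMap b e ▷ T.obj N ≫ Functor.LaxMonoidal.μ T w N =
      x ◁ T.map ((λ_ N).inv ≫ e ▷ N ≫ (α_ z w N).hom) ≫ β b (w ⊗ N) := by
  have h1 := (isOperator b).tensor w N
  rw [Iso.inv_comp_eq] at h1
  have h2 : (λ_ (T.obj N)).inv ≫ (Functor.LaxMonoidal.ε T ≫ T.map e) ▷ T.obj N ≫
      Functor.LaxMonoidal.μ T (z ⊗ w) N ≫ T.map (α_ z w N).hom =
      T.map ((λ_ N).inv ≫ e ▷ N ≫ (α_ z w N).hom) := by
    rw [comp_whiskerRight, Category.assoc, Functor.LaxMonoidal.μ_natural_left_assoc, T.map_comp,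
      T.map_comp, Functor.LaxMonoidal.left_unitality_inv_assoc]
  rw [← h2, evalMap, comp_whiskerRight, comp_whiskerRight, Category.assoc, Category.assoc, h1,
    associator_naturality_middle_assoc, ← whiskerLeft_comp_assoc,
    MonoidalCategory.whiskerLeft_comp x (λ_ _).inv, Category.assoc,
    ← triangle_assoc_comp_right_inv_assoc]

lemma evalMap_mul {x z w x' z' w' : H} (b : operators k c x z) (e : 𝟙_ H ⟶ z ⊗ w)
    (b' : operators k c x' z') (e' : 𝟙_ H ⟶ z' ⊗ w') :
    (evalMap b e ⊗ₘ evalMap b' e') ≫ Functor.LaxMonoidal.μ T w w' =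
      evalMap (mul b b') (nest e e') := by
  have h : x' ◁ (Functor.LaxMonoidal.ε T ≫ T.map (nest e e')) ≫
      x' ◁ T.map (α_ z' z (w ⊗ w')).hom ≫ β b' (z ⊗ w ⊗ w') =
      x' ◁ (Functor.LaxMonoidal.ε T ≫ T.map e') ≫ β b' w' ≫
        T.map ((λ_ w').inv ≫ e ▷ w' ≫ (α_ z w w').hom) := by
    rw [← (isOperator b').naturality, ← whiskerLeft_comp_assoc, ← whiskerLeft_comp_assoc,
      Category.assoc, Category.assoc, ← T.map_comp, ← T.map_comp, nest]
    simp
  rw [MonoidalCategory.tensorHom_def', Category.assoc, evalMap_whiskerRight_μ,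
    ← whiskerLeft_comp_assoc, evalMap, Category.assoc, Category.assoc, ← h, evalMap, β_mul,
    associator_naturality_right_assoc, ← whiskerLeft_comp_assoc]
  simp

/-- The operator attached to `g` multiplies by `g` in `T` and then closes `w` against `z` by `χ`; it
is the inverse of evaluation when `χ` is the evaluation of a duality. -/
lemma isOperator_of_hom (c : MonoidalCounit T) {x z w : H} (χ : w ⊗ z ⟶ 𝟙_ H) (g : x ⟶ T.obj w) :
    IsOperator c ((g ≫ c.app w) ▷ z ≫ χ) (fun N => g ▷ T.obj (z ⊗ N) ≫
      Functor.LaxMonoidal.μ T w (z ⊗ N) ≫ T.map ((α_ w z N).inv ≫ χ ▷ N ≫ (λ_ N).hom)) where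
  naturality {N N'} h := by
    have h1 : w ◁ z ◁ h ≫ (α_ w z N').inv ≫ χ ▷ N' ≫ (λ_ N').hom =
        ((α_ w z N).inv ≫ χ ▷ N ≫ (λ_ N).hom) ≫ h := by
      rw [associator_inv_naturality_right_assoc, whisker_exchange_assoc]
      simp
    rw [whisker_exchange_assoc, Functor.LaxMonoidal.μ_natural_right_assoc, ← T.map_comp, h1]
    simp only [Category.assoc, T.map_comp]
  tensor N N' := by
    have h1 : ((α_ w z N).inv ≫ χ ▷ N ≫ (λ_ N).hom) ▷ N' = (α_ w (z ⊗ N) N').hom ≫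
        w ◁ (α_ z N N').hom ≫ (α_ w z (N ⊗ N')).inv ≫ χ ▷ (N ⊗ N') ≫ (λ_ (N ⊗ N')).hom := by
      monoidal
    rw [Iso.inv_comp_eq, whisker_exchange_assoc, ← associator_naturality_left_assoc,
      comp_whiskerRight, comp_whiskerRight, Category.assoc, Category.assoc,
      Functor.LaxMonoidal.μ_natural_left, h1, T.map_comp, T.map_comp,
      Functor.LaxMonoidal.associativity_assoc, MonoidalCategory.whiskerLeft_comp, Category.assoc,
      Functor.LaxMonoidal.μ_natural_right_assoc]
  counit N := by
    rw [Category.assoc, Category.assoc, c.naturality, reassoc_of% c.tensor, 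
      MonoidalCategory.tensorHom_def', Category.assoc, ← whisker_exchange_assoc]
    simp

lemma contractLeft_whiskerRight {x z w : H} (e : 𝟙_ H ⟶ z ⊗ w) (φ : x ⊗ z ⟶ 𝟙_ H)
    (χ : w ⊗ z ⟶ 𝟙_ H) : contractLeft e φ ▷ z ≫ χ = x ◁ contractRight e χ ≫ φ := by
  have h : contractLeft e φ ▷ z ≫ χ = (ρ_ x).inv ▷ z ≫ (x ◁ e) ▷ z ≫ (α_ x z w).inv ▷ z ≫
      (α_ (x ⊗ z) w z).hom ≫ (φ ▷ (w ⊗ z) ≫ 𝟙_ H ◁ χ) ≫ (λ_ _).hom := by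
    rw [contractLeft]
    monoidal
  rw [h, ← whisker_exchange, contractRight]
  monoidal

/-- The inverse is `isOperator_of_hom`. One triangle identity, with `evalMap_whiskerRight_μ` and
naturality in `N`, recovers an operator from its value; the other recovers `g`. In particular `φ` is
determined by the family when `z` has a dual. -/
lemma evalMap_bijective {x z w : H} {e : 𝟙_ H ⟶ z ⊗ w} (he : IsCoev e) :
    Function.Bijective fun b : operators k c x z => evalMap b e := by
  obtain ⟨χ, h₁, h₂⟩ := he
  let inv (g : x ⟶ T.obj w) : operators k c x z := ⟨((g ≫ c.app w) ▷ z ≫ χ,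
    fun N => g ▷ T.obj (z ⊗ N) ≫ Functor.LaxMonoidal.μ T w (z ⊗ N) ≫
      T.map ((α_ w z N).inv ≫ χ ▷ N ≫ (λ_ N).hom)), isOperator_of_hom c χ g⟩
  have key (b : operators k c x z) : b = inv (evalMap b e) := by
    refine ext ?_ fun N => ?_
    · refine Eq.trans ?_ (congrArg (· ▷ z ≫ χ) (evalMap_counit b e)).symm
      rw [contractLeft_whiskerRight, h₂]
      simp
    · refine Eq.trans ?_ ((Category.assoc _ _ _).symm.trans
        (congrArg (· ≫ _) (evalMap_whiskerRight_μ b e (z ⊗ N)))).symm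
      rw [Category.assoc, ← (isOperator b).naturality, ← whiskerLeft_comp_assoc, ← T.map_comp]
      have h : ((λ_ (z ⊗ N)).inv ≫ e ▷ (z ⊗ N) ≫ (α_ z w (z ⊗ N)).hom) ≫
          z ◁ ((α_ w z N).inv ≫ χ ▷ N ≫ (λ_ N).hom) = contractRight e χ ▷ N := by
        rw [contractRight]
        monoidal
      rw [h, h₂]
      simp
  refine ⟨fun b b' h => (key b).trans ((congrArg inv h).trans (key b').symm),
    fun g => ⟨inv g, ?_⟩⟩
  change (ρ_ x).inv ≫ x ◁ (Functor.LaxMonoidal.ε T ≫ T.map e) ≫ g ▷ T.obj (z ⊗ w) ≫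
    Functor.LaxMonoidal.μ T w (z ⊗ w) ≫ T.map ((α_ w z w).inv ≫ χ ▷ w ≫ (λ_ w).hom) = g
  rw [whisker_exchange_assoc, ← rightUnitor_inv_naturality_assoc, 
    MonoidalCategory.whiskerLeft_comp, Category.assoc,
    Functor.LaxMonoidal.μ_natural_right_assoc, Functor.LaxMonoidal.right_unitality_inv_assoc, 
    ← T.map_comp, ← T.map_comp]
  refine (congrArg (g ≫ T.map ·) h₁).trans ?_
  rw [T.map_id, Category.comp_id]

end operators
end OperatorEvaluation
end HarishChandra

namespace HarishChandra

/-! ### The pairing given by operators -/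

section OperatorPairing
variable {k : Type w} [Field k] {H : Type u'} [Category.{w} H] [Preadditive H] [Linear k H]
  [MonoidalCategory H] [MonoidalPreadditive H] [MonoidalLinear k H] {P : ObjectProperty H}
  [P.IsMonoidal]

/-- The counit of a lax monoidal comonad. -/
def LaxMonoidalComonad.monoidalCounit (G : LaxMonoidalComonad k H) :
    MonoidalCounit G.toComonad.toFunctor where
  app := G.toComonad.ε.app
  naturality f := G.toComonad.ε.naturality f
  unit := G.counit_monoidal.unit
  tensor N N' := (G.counit_monoidal.tensor N N').trans (Category.comp_id _)

lemma IsCoev.hom {z w : P.FullSubcategory} {e : 𝟙_ P.FullSubcategory ⟶ z ⊗ w} (he : IsCoev e) :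
    IsCoev (A := H) (z := z.obj) (w := w.obj) e.hom := by
  obtain ⟨χ, h₁, h₂⟩ := he
  exact ⟨χ.hom, congrArg InducedCategory.Hom.hom h₁, congrArg InducedCategory.Hom.hom h₂⟩

variable {T : H ⥤ H} [T.LaxMonoidal] [T.Additive] [T.Linear k] {c : MonoidalCounit T}
  {M : BiPsh.{w, u', w} k H}

namespace operators

lemma evalMap_add {x z w : H} (b b' : operators k c x z) (e : 𝟙_ H ⟶ z ⊗ w) :
    evalMap (b + b') e = evalMap b e + evalMap b' e := by
  simp [evalMap, β]

lemma evalMap_smul {x z w : H} (r : k) (b : operators k c x z) (e : 𝟙_ H ⟶ z ⊗ w) :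
    evalMap (r • b) e = r • evalMap b e := by
  simp [evalMap, β]

lemma evalMap_add_right {x z w : H} (b : operators k c x z) (e e' : 𝟙_ H ⟶ z ⊗ w) :
    evalMap b (e + e') = evalMap b e + evalMap b e' := by
  simp [evalMap]

lemma evalMap_smul_right {x z w : H} (r : k) (b : operators k c x z) (e : 𝟙_ H ⟶ z ⊗ w) :
    evalMap b (r • e) = r • evalMap b e := by
  simp [evalMap]

end operators

/-- The pairing given by an identification with operators. -/
def Pairing.ofOperators (i : ∀ x y, M.at x y ≃ₗ[k] operators k c x y)
    (hi : ∀ {x x' y y' : H} (f : x ⟶ x') (g : y ⟶ y') (b : M.at x' y'),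
      i x y (M.act f g b) = operators.act f g (i x' y' b)) : Pairing (M.restrict P) T where
  ev {x z w} := LinearMap.mk₂ k (fun b e => operators.evalMap (i x.obj z.obj b) (w := w.obj) e.hom)
    (fun b b' e => (congrArg (operators.evalMap · _) (map_add (i _ _) b b')).trans
      (operators.evalMap_add _ _ _))
    (fun r b e => (congrArg (operators.evalMap · _) (map_smul (i _ _) r b)).trans
      (operators.evalMap_smul r _ _))
    (fun _ e e' => operators.evalMap_add_right _ e.hom e'.hom)
    (fun r _ e => operators.evalMap_smul_right r _ e.hom)
  ev_act f g b _ := (congrArg (operators.evalMap · _) (hi f.hom g.hom b)).trans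
    (operators.evalMap_act _ _ _ _)
  ev_comp _ _ _ := operators.evalMap_comp _ _ _
  bijective {x z _ _} he := (operators.evalMap_bijective he.hom).comp (i x.obj z.obj).bijective

/-- Stated for any model of the algebra of operators, since the one used is the algebra recovered
over `HC` from the pullback to `C`. -/
lemma Pairing.ofOperators_compatible {G : LaxMonoidalComonad k H} [G.toComonad.toFunctor.Additive]
    [G.toComonad.toFunctor.Linear k] {S : MulOne M} {ε : Aug M}
    (i : ∀ x y, M.at x y ≃ₗ[k] operators k G.monoidalCounit x y)
    (hi : ∀ {x x' y y' : H} (f : x ⟶ x') (g : y ⟶ y') (b : M.at x' y'),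
      i x y (M.act f g b) = operators.act f g (i x' y' b))
    (map_one : i (𝟙_ H) (𝟙_ H) S.one = operators.one k G.monoidalCounit)
    (map_mul : ∀ {x y x' y' : H} (b : M.at x y) (b' : M.at x' y'),
      i (x ⊗ x') (y' ⊗ y) (S.mul b b') = operators.mul (i x y b) (i x' y' b'))
    (map_φ : ∀ {x y : H} (b : M.at x y), operators.φ (i x y b) = ε.app x y b) :
    (Pairing.ofOperators (P := P) i hi).Compatible S.restrict ε.restrict where
  counit b _ := (operators.evalMap_counit _ _).trans (congrArg (contractLeft _) (map_φ b))
  one := (congrArg (operators.evalMap · _) map_one).trans operators.evalMap_one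
  mul b _ b' _ := (operators.evalMap_mul _ _ _ _).trans
    (congrArg (operators.evalMap · _) (map_mul b b').symm)

end OperatorPairing

/-! ### The bialgebroid of a comonad -/

section Reconstruction
variable {k : Type w} [Field k] {C : Type u} [Category.{w} C] [Preadditive C]
  [Linear k C] [MonoidalCategory C] [MonoidalPreadditive C] [MonoidalLinear k C]
  [IsLocallyPresentable.{w} C] [TensorCocontinuous C]
  {L : Center C} [MonObj L] [IsCommMonObj L]

/-- Every colimit-preserving lax monoidal comonad is given by a Harish-Chandra bialgebroid. -/
theorem exists_bialgebroid (hC : IsCpRigid k C) (h1 : compactProjective k (𝟙_ C))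
    (G : LaxMonoidalComonad k (HC L)) :
    ∃ B : HCBialgebroid k L, Nonempty (B.Realization k G) := by
  have hCol : HasColimitsOfSize.{w, w} C := by
    obtain ⟨κ, _, _⟩ := IsLocallyPresentable.exists_cardinal.{w} C
    infer_instance
  have := G.additive
  have := G.linear
  have := G.cocontinuous
  have : HasColimitsOfSize.{0, 0} (HC L) := hasColimitsOfSizeShrink.{0, 0, w, w} (HC L)
  obtain ⟨𝒢⟩ := nonempty_generating (L := L) hC h1
  have (x y : HC L) : Small.{w} (operators k G.monoidalCounit x y) := operators.small _ 𝒢 x y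
  let hM := opPsh_isLinear (k := k) (c := G.monoidalCounit)
  let hS := opMul_isMonoid (k := k) (c := G.monoidalCounit)
  let hε := opAug_isMul (k := k) (c := G.monoidalCounit)
  -- The functor on `HC` attached to the constructed algebra and moment map is again the functor of
  -- operators, so the pairing can be computed with operators.
  let i (x y : HC L) : (freeMoment hM hS).hcPsh.at x y ≃ₗ[k] operators k G.monoidalCounit x y :=
    (hcEquiv hM hS x y).symm ≪≫ₗ opEquiv k G.monoidalCounit x y
  have hi {x y : HC L} (b : (opPsh k G.monoidalCounit).at x y) :
      i x y (hcEquiv hM hS x y b) = opEquiv k G.monoidalCounit x y b :=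
    congrArg (opEquiv k G.monoidalCounit x y) ((hcEquiv hM hS x y).symm_apply_apply b)
  have surj {x y : HC L} := (hcEquiv hM hS x y).surjective
  have act {x x' y y' : HC L} (f : x ⟶ x') (g : y ⟶ y') (b : (freeMoment hM hS).hcPsh.at x' y') :
      i x y ((freeMoment hM hS).hcPsh.act f g b) = operators.act f g (i x' y' b) := by
    obtain ⟨b, rfl⟩ := surj b
    exact (congrArg (i x y) (hcEquiv_act hM hS f g b).symm).trans ((hi _).trans
      ((opEquiv_act f g b).trans (congrArg _ (hi b).symm)))
  have compat : (Pairing.ofOperators (P := generators k L) i act).Compatible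
      (freeMoment hM hS).hcMulOne.restrict (freeHeisenberg hM hS hε).hcAug.restrict := by
    refine Pairing.ofOperators_compatible i act ?_ (fun {x y x' y'} b b' => ?_) fun {x y} b => ?_
    · exact (congrArg (i _ _) (hcEquiv_one hM hS).symm).trans ((hi _).trans opEquiv_one)
    · obtain ⟨b, rfl⟩ := surj b
      obtain ⟨b', rfl⟩ := surj b'
      exact (congrArg (i _ _) (hcEquiv_mul hM hS b b').symm).trans ((hi _).trans
        ((opEquiv_mul b b').trans (congrArg₂ (fun t t' => operators.mul t t') (hi b).symm
          (hi b').symm)))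
    · obtain ⟨b, rfl⟩ := surj b
      exact (congrArg operators.φ (hi b)).trans (hcAug_hcEquiv hM hS hε b).symm
  -- Duals on both sides are needed: those of `w` to compute the coend in `θ_bijective`, those of
  -- `z` to define `Δ` and to test its axioms.
  obtain ⟨Δ, hΔ, hR⟩ := compat.exists_realization 𝒢 (freeMoment hM hS).hcPsh_isLinear.restrict
    (generators.exists_dual hC h1) (generators.exists_dual' hC h1)
  exact ⟨⟨freeBiAlgebra hM hS, freeMoment hM hS, freeHeisenberg hM hS hε, Δ, hΔ⟩, hR⟩

end Reconstruction
end HarishChandra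

theorem mainTheorem1 (k : Type w) [Field k] (C : Type u) [Category.{w} C] [Preadditive C]
    [Linear k C] [MonoidalCategory C] [MonoidalPreadditive C] [MonoidalLinear k C]
    [IsLocallyPresentable.{w} C] [HarishChandra.TensorCocontinuous C]
    (hC : HarishChandra.IsCpRigid k C) (h1 : HarishChandra.compactProjective k (𝟙_ C))
    (L : Center C) [MonObj L] [IsCommMonObj L] :
    (∀ B : HarishChandra.HCBialgebroid k L,
      ∃ G : HarishChandra.LaxMonoidalComonad k (HarishChandra.HC L),
        Nonempty (B.Realization k G)) ∧
    (∀ G : HarishChandra.LaxMonoidalComonad k (HarishChandra.HC L),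
      ∃ B : HarishChandra.HCBialgebroid k L, Nonempty (B.Realization k G)) := by
  exact ⟨fun B => B.exists_realization hC h1, HarishChandra.exists_bialgebroid hC h1⟩
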